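/- **Setting.** Manifolds, bundles, distributions and homotopies are smooth. Let $\pi\colon Q\to M$ be an oriented circle bundle over a non-empty closed oriented $3$-manifold $M$, let $\xi$ be an oriented contact structure on $M$, and let $n\neq 0$ be an integer. Write $e(Q), e(\xi)\in H^2(M;\mathbb Z)$ for the Euler classes of $Q$ and of the oriented plane bundle $\xi$. An *Engel structure* on $Q$ is a $2$-plane field $\mathcal D\subset TQ$ such that $\mathcal E=[\mathcal D,\mathcal D]$ has rank $3$ and $[\mathcal E,\mathcal E]=TQ$; its *characteristic line field* is $\mathcal L=\{v\in\mathcal E : [v,\mathcal E]\subseteq\mathcal E\}$. If $\mathcal L$ is tangent to the fibers, $\mathcal D$ *induces* the contact structure $d\pi(\mathcal E)$ on $M$. If $\mathcal D$ induces $\xi$, its *development map* is $\phi_{\mathcal D}\colon Q\to\mathbb P\xi$, $q\mapsto d\pi(\mathcal D_q)$, and its *twisting number* (defined if it is the same for all fibers, e.g. if $M$ is connected) is the degree of $\phi_{\mathcal D}$ from the fibers of $Q$ to those of $\mathbb P\xi$, the latter being oriented by the orientation of $\xi$. Two Engel structures with characteristic line field tangent to the fibers are *isotopic* if they are homotopic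 through such Engel structures that all induce the same contact structure on $M$. Let $\mathrm{Eng}^n_\xi(Q)$ be the set of isotopy classes of Engel structures on $Q$ with characteristic line field tangent to the fibers, induced contact structure $\xi$ (as a plane field) and twisting number $n$, and let $\mathrm{Eng}^n_{\xi;o}(Q)\subseteq \mathrm{Eng}^n_\xi(Q)$ be the subset of classes of Engel structures that are orientable as plane fields. **Theorem.** 1. $\mathrm{Eng}^n_\xi(Q)\neq\emptyset$ if and only if $n\cdot e(Q)=2\cdot e(\xi)$. 2. $\mathrm{Eng}^n_{\xi;o}(Q)\neq\emptyset$ if and only if $n$ is even and $\frac n2\cdot e(Q)=e(\xi)$. 3. If $\mathrm{Eng}^n_\xi(Q)\neq\emptyset$, there is a simply transitive action of $H^1(M;\mathbb Z)$ on $\mathrm{Eng}^n_\xi(Q)$, given by $f^*[\mathbb S^1]\cdot[\mathcal D]=[\mathcal D']$ whenever $f\colon M\to\mathbb S^1$ is continuous and $\phi_{\mathcal D'}=f\cdot\phi_{\mathcal D}$. Here $\mathbb S^1=\mathbb R/\mathbb Z$ acts on the fibers of $\mathbb P\xi$ after the choice of any complex structure $J$ on $\xi$ compatible with its orientation, $h\bmod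 1$ acting by the rotation $\exp(\pi hJ)$. If moreover $\mathrm{Eng}^n_{\xi;o}(Q)\neq\emptyset$, then the subgroup $2\cdot H^1(M;\mathbb Z)$ preserves $\mathrm{Eng}^n_{\xi;o}(Q)$ and acts on it simply transitively. -/

import Mathlib

open Set Filter Topology
open scoped Manifold ContDiff

noncomputable section

/-! ## Čech cohomology with integer coefficients

Open covers are indexed by the points of the space, `x ∈ U x`.  These are cofinal among all open
covers, and are directed by pointwise intersection, so the direct limit defining Čech cohomology
can be computed from them. -/

section Cech

variable {M : Type*} [TopologicalSpace M]

/-- An open cover indexed by the points of the space, with `x ∈ U x`. -/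
def IsPointedCover (U : M → Set M) : Prop := ∀ x, IsOpen (U x) ∧ x ∈ U x

theorem IsPointedCover.inter {U V : M → Set M} (hU : IsPointedCover U) (hV : IsPointedCover V) :
    IsPointedCover (fun x => U x ∩ V x) :=
  fun x => ⟨(hU x).1.inter (hV x).1, (hU x).2, (hV x).2⟩

theorem isPointedCover_univ : IsPointedCover (fun _ : M => (univ : Set M)) :=
  fun _ => ⟨isOpen_univ, mem_univ _⟩

/-- Čech `p`-cochains: `c i` is locally constant on `U (i 0) ∩ … ∩ U (i p)` for some cover `U`;
its values outside that set carry no information. -/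
def cechCochains (M : Type*) [TopologicalSpace M] (p : ℕ) :
    AddSubgroup ((Fin (p + 1) → M) → M → ℤ) where
  carrier := {c | ∃ U : M → Set M, IsPointedCover U ∧
    ∀ i, ∀ y ∈ ⋂ k, U (i k), ∀ᶠ z in 𝓝 y, c i z = c i y}
  zero_mem' := ⟨_, isPointedCover_univ, fun _ _ _ => Eventually.of_forall fun _ => rfl⟩
  add_mem' := by
    rintro c d ⟨U, hU, hc⟩ ⟨V, hV, hd⟩
    refine ⟨_, hU.inter hV, fun i y hy => ?_⟩
    rw [iInter_inter_distrib] at hy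
    filter_upwards [hc i y hy.1, hd i y hy.2] with z h1 h2
    simp [h1, h2]
  neg_mem' := by
    rintro c ⟨U, hU, hc⟩
    refine ⟨U, hU, fun i y hy => ?_⟩
    filter_upwards [hc i y hy] with z h1
    simp [h1]

/-- Cochains representing zero in the direct limit: they vanish on some cover. -/
def cechNull (M : Type*) [TopologicalSpace M] (p : ℕ) :
    AddSubgroup ((Fin (p + 1) → M) → M → ℤ) where
  carrier := {c | ∃ U : M → Set M, IsPointedCover U ∧ ∀ i, ∀ y ∈ ⋂ k, U (i k), c i y = 0}
  zero_mem' := ⟨_, isPointedCover_univ, fun _ _ _ => rfl⟩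
  add_mem' := by
    rintro c d ⟨U, hU, hc⟩ ⟨V, hV, hd⟩
    refine ⟨_, hU.inter hV, fun i y hy => ?_⟩
    rw [iInter_inter_distrib] at hy
    simp [hc i y hy.1, hd i y hy.2]
  neg_mem' := by
    rintro c ⟨U, hU, hc⟩
    exact ⟨U, hU, fun i y hy => by simp [hc i y hy]⟩

/-- The Čech differential. -/
def cechD (M : Type*) (p : ℕ) :
    ((Fin (p + 1) → M) → M → ℤ) →+ ((Fin (p + 2) → M) → M → ℤ) where
  toFun c i y := ∑ k : Fin (p + 2), (-1) ^ (k : ℕ) * c (i ∘ k.succAbove) y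
  map_zero' := by ext; simp
  map_add' c d := by ext; simp [mul_add, Finset.sum_add_distrib]

/-- Čech cocycles. -/
def cechCocycles (M : Type*) [TopologicalSpace M] (p : ℕ) :
    AddSubgroup ((Fin (p + 1) → M) → M → ℤ) :=
  cechCochains M p ⊓ (cechNull M (p + 1)).comap (cechD M p)

/-- Čech coboundaries. -/
def cechCoboundaries (M : Type*) [TopologicalSpace M] :
    (p : ℕ) → AddSubgroup ((Fin (p + 1) → M) → M → ℤ)
  | 0 => cechNull M 0
  | p + 1 => (cechCochains M p).map (cechD M p) ⊔ cechNull M (p + 1)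

/-- The Čech cohomology group `Hᵖ(M; ℤ)`. -/
abbrev CechH (M : Type*) [TopologicalSpace M] (p : ℕ) : Type _ :=
  cechCocycles M p ⧸ (cechCoboundaries M p).addSubgroupOf (cechCocycles M p)

/-- `α = f^*[S¹]` for `f : M → S¹ = ℝ/ℤ`: on the members of a cover choose continuous lifts
`h x : U x → ℝ` of `f`; the class is represented by the integers `h x' - h x`. -/
def IsCircleClass (f : C(M, UnitAddCircle)) (α : CechH M 1) : Prop :=
  ∃ c : cechCocycles M 1, (QuotientAddGroup.mk c : CechH M 1) = α ∧
    ∃ U : M → Set M, IsPointedCover U ∧ ∃ h : M → M → ℝ,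
      (∀ x, ContinuousOn (h x) (U x)) ∧
      (∀ x, ∀ y ∈ U x, (h x y : UnitAddCircle) = f y) ∧
      ∀ (i : Fin 2 → M), ∀ y ∈ ⋂ k, U (i k), (c.1 i y : ℝ) = h (i 1) y - h (i 0) y

/-- The class `f^*[S¹] ∈ H¹(M; ℤ)` (it exists and is unique). -/
def circleClass (f : C(M, UnitAddCircle)) : CechH M 1 := Classical.epsilon (IsCircleClass f)

/-- The cocycle of an oriented circle bundle.  Over `U x` the fibres are parametrized by
`E x y : ℝ → P y`, the universal cover of the fibre (points of the fibre being elements of `P y` up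
to the relation `R y`).  `G x x'` is a lift to `ℝ` of the change of parametrization, a section over
`U x ∩ U x'` of the universal cover of the group of circle homeomorphisms.  The cocycle is the
deviation of the `G x x'` from being multiplicative, a translation of `ℝ` by an integer. -/
def IsLiftingCocycle {P : M → Type*} (R : ∀ y, P y → P y → Prop) (U : M → Set M)
    (E : M → (y : M) → ℝ → P y) (c : (Fin 3 → M) → M → ℤ) : Prop :=
  ∃ G : M → M → M → ℝ → ℝ,
    (∀ x x', ContinuousOn (fun p : M × ℝ => G x x' p.1 p.2) ((U x ∩ U x') ×ˢ univ)) ∧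
    (∀ x x', ∀ y ∈ U x ∩ U x', ∀ t, R y (E x y t) (E x' y (G x x' y t))) ∧
    ∀ (i : Fin 3 → M), ∀ y ∈ ⋂ k, U (i k), ∀ t,
      G (i 1) (i 2) y (G (i 0) (i 1) y t) = G (i 0) (i 2) y t + c i y

end Cech

/-! ## Distributions on manifolds -/

section Distributions

variable {E : Type*} [NormedAddCommGroup E] [NormedSpace ℝ E]
  {H : Type*} [TopologicalSpace H] (I : ModelWithCorners ℝ E H)
  {X : Type*} [TopologicalSpace X] [ChartedSpace H X]

/-- A field of subspaces of the tangent spaces. -/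
abbrev TangentDistribution (I : ModelWithCorners ℝ E H) (X : Type*) [TopologicalSpace X]
    [ChartedSpace H X] : Type _ :=
  (q : X) → Submodule ℝ (TangentSpace I q)

/-- `V` is smooth on `U`, as a map to the tangent bundle. -/
def SmoothFieldOn [IsManifold I ∞ X] (V : (q : X) → TangentSpace I q) (U : Set X) : Prop :=
  ContMDiffOn I I.tangent ∞ (fun q => (⟨q, V q⟩ : TangentBundle I X)) U

/-- `V` is a smooth section of the distribution `D` over `U`. -/
def IsSectionOn [IsManifold I ∞ X] (D : TangentDistribution I X) (V : (q : X) → TangentSpace I q)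
    (U : Set X) : Prop :=
  SmoothFieldOn I V U ∧ ∀ q ∈ U, V q ∈ D q

/-- `D` is a smooth field of tangent planes: it is locally spanned by smooth frames. -/
def IsPlaneField [IsManifold I ∞ X] (D : TangentDistribution I X) : Prop :=
  ∀ q₀ : X, ∃ U : Set X, IsOpen U ∧ q₀ ∈ U ∧ ∃ V W : (q : X) → TangentSpace I q,
    SmoothFieldOn I V U ∧ SmoothFieldOn I W U ∧
    ∀ q ∈ U, LinearIndependent ℝ ![V q, W q] ∧ D q = Submodule.span ℝ {V q, W q}

/-- The derived distribution `[D, D]`, spanned by `D` and the brackets of local sections. -/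
def derivedDistribution [IsManifold I ∞ X] (D : TangentDistribution I X) : TangentDistribution I X :=
  fun q => D q ⊔ Submodule.span ℝ
    {v | ∃ (U : Set X) (V W : (q : X) → TangentSpace I q), IsOpen U ∧ q ∈ U ∧
      IsSectionOn I D V U ∧ IsSectionOn I D W U ∧ v = VectorField.mlieBracket I V W q}

/-- The pair `(v, w)` is a basis of the plane `S` which is positive for the orientation `o`. -/
def IsPositivePair {T : Type*} [AddCommGroup T] [Module ℝ T] {S : Submodule ℝ T}
    (o : Orientation ℝ S (Fin 2)) (v w : T) : Prop :=
  ∃ b : Module.Basis (Fin 2) ℝ S, b.orientation = o ∧ (b 0 : T) = v ∧ (b 1 : T) = w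

/-- A choice of orientations of the planes `D q` that is locally given by a smooth frame. -/
def IsOrientationOf [IsManifold I ∞ X] (D : TangentDistribution I X)
    (o : ∀ q, Orientation ℝ (D q) (Fin 2)) : Prop :=
  ∀ q₀ : X, ∃ U : Set X, IsOpen U ∧ q₀ ∈ U ∧ ∃ V W : (q : X) → TangentSpace I q,
    SmoothFieldOn I V U ∧ SmoothFieldOn I W U ∧ ∀ q ∈ U, IsPositivePair (o q) (V q) (W q)

/-- An Engel structure (on a manifold of dimension four): a plane field `D` such that `[D, D]` has
rank three and `[[D, D], [D, D]]` is the whole tangent bundle. -/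
structure IsEngel [IsManifold I ∞ X] (D : TangentDistribution I X) : Prop where
  plane : IsPlaneField I D
  rank_three : ∀ q, Module.finrank ℝ (derivedDistribution I D q) = 3
  full : ∀ q, derivedDistribution I (derivedDistribution I D) q = ⊤

/-- The characteristic line field of an Engel structure `D`: the vectors `v` of the even contact
structure `F = [D, D]` such that `[v, F] ⊆ F`. -/
def characteristicLine [IsManifold I ∞ X] (D : TangentDistribution I X) (q : X) :
    Set (TangentSpace I q) :=
  {v | v ∈ derivedDistribution I D q ∧
    ∀ (U : Set X) (V W : (q : X) → TangentSpace I q), IsOpen U → q ∈ U →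
      IsSectionOn I (derivedDistribution I D) V U → IsSectionOn I (derivedDistribution I D) W U →
      V q = v → VectorField.mlieBracket I V W q ∈ derivedDistribution I D q}

end Distributions

/-! ## Oriented contact structures on 3-manifolds -/

section Contact

variable {M : Type*} [TopologicalSpace M] [ChartedSpace (EuclideanSpace ℝ (Fin 3)) M]
  [IsManifold (𝓡 3) ∞ M]

/-- An oriented contact structure on a 3-manifold. -/
structure OrientedContactStructure (M : Type*) [TopologicalSpace M]
    [ChartedSpace (EuclideanSpace ℝ (Fin 3)) M] [IsManifold (𝓡 3) ∞ M] where
  /-- the contact planes -/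
  plane : TangentDistribution (𝓡 3) M
  isPlaneField : IsPlaneField (𝓡 3) plane
  nonintegrable : ∀ y, derivedDistribution (𝓡 3) plane y = ⊤
  /-- the orientations of the contact planes -/
  orient : ∀ y, Orientation ℝ (plane y) (Fin 2)
  isOrientation : IsOrientationOf (𝓡 3) plane orient

namespace OrientedContactStructure

/-- Euler class of an oriented contact structure: that of its oriented bundle of rays, parametrized
by `t ↦ cos (2πt) a + sin (2πt) b` for local positive frames `(a, b)`. -/
def IsEulerClass (ξ : OrientedContactStructure M) (e : CechH M 2) : Prop :=
  ∃ c : cechCocycles M 2, (QuotientAddGroup.mk c : CechH M 2) = e ∧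
    ∃ U : M → Set M, IsPointedCover U ∧ ∃ a b : M → (y : M) → TangentSpace (𝓡 3) y,
      (∀ x, SmoothFieldOn (𝓡 3) (a x) (U x) ∧ SmoothFieldOn (𝓡 3) (b x) (U x) ∧
        ∀ y ∈ U x, IsPositivePair (ξ.orient y) (a x y) (b x y)) ∧
      IsLiftingCocycle (P := fun y : M => TangentSpace (𝓡 3) y) (fun _ v w => SameRay ℝ v w) U
        (fun x y t => Real.cos (2 * Real.pi * t) • a x y + Real.sin (2 * Real.pi * t) • b x y) c.1

/-- The Euler class `e(ξ) ∈ H²(M; ℤ)` (it exists and is unique). -/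
def eulerClass (ξ : OrientedContactStructure M) : CechH M 2 :=
  Classical.epsilon ξ.IsEulerClass

/-- A smooth complex structure on the contact planes inducing their orientation; it turns the
contact planes into complex lines, on which the circle acts by rotations. -/
structure ComplexStructure (ξ : OrientedContactStructure M) where
  /-- rotation by a quarter turn -/
  J : ∀ y, ξ.plane y →ₗ[ℝ] ξ.plane y
  sq : ∀ (y : M) (v : ξ.plane y), J y (J y v) = -v
  positive : ∀ (y : M) (v : ξ.plane y), v ≠ 0 →
    IsPositivePair (ξ.orient y) (v : TangentSpace (𝓡 3) y) (J y v : TangentSpace (𝓡 3) y)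
  smooth : ∀ (U : Set M) (V W : (y : M) → TangentSpace (𝓡 3) y), IsOpen U →
    SmoothFieldOn (𝓡 3) V U → (∀ y ∈ U, ∃ h : V y ∈ ξ.plane y, W y = J y ⟨V y, h⟩) →
    SmoothFieldOn (𝓡 3) W U

end OrientedContactStructure

end Contact

/-! ## Oriented circle bundles and Engel structures on them -/

section CircleBundle

variable {M : Type*} [TopologicalSpace M] [ChartedSpace (EuclideanSpace ℝ (Fin 3)) M]
  {Q : Type*} [TopologicalSpace Q] [ChartedSpace (EuclideanSpace ℝ (Fin 4)) Q]

/-- An oriented local trivialization over `U` of `π : Q → M`, in the form of a map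
`E : U × ℝ → Q` which induces a diffeomorphism from `U × ℝ/ℤ` to `π⁻¹ U` over `U` and along which
the positive vertical directions `pos` are those of increasing `t`. -/
structure IsTrivialization (π : Q → M) (pos : (q : Q) → Set (TangentSpace (𝓡 4) q))
    (U : Set M) (E : M → ℝ → Q) : Prop where
  smooth : ContMDiffOn ((𝓡 3).prod 𝓘(ℝ, ℝ)) (𝓡 4) ∞ (fun p : M × ℝ => E p.1 p.2) (U ×ˢ univ)
  bijective_deriv : ∀ y ∈ U, ∀ t : ℝ, Function.Bijective
    (mfderiv ((𝓡 3).prod 𝓘(ℝ, ℝ)) (𝓡 4) (fun p : M × ℝ => E p.1 p.2) (y, t))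
  range_eq : ∀ y ∈ U, range (E y) = π ⁻¹' {y}
  eq_iff : ∀ y ∈ U, ∀ t t' : ℝ, E y t = E y t' ↔ ∃ k : ℤ, t' = t + k
  pos_eq : ∀ y ∈ U, ∀ t : ℝ, pos (E y t) =
    {v | ∃ r : ℝ, 0 < r ∧ v = mfderiv 𝓘(ℝ, ℝ) (𝓡 4) (E y) t r}

/-- An oriented circle bundle: a smooth locally trivial bundle with fibre `S¹` (no structure group
is assumed) whose fibres are coherently oriented. -/
structure OrientedCircleBundle (Q M : Type*) [TopologicalSpace M]
    [ChartedSpace (EuclideanSpace ℝ (Fin 3)) M] [TopologicalSpace Q]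
    [ChartedSpace (EuclideanSpace ℝ (Fin 4)) Q] where
  /-- the bundle projection -/
  proj : Q → M
  contMDiff_proj : ContMDiff (𝓡 4) (𝓡 3) ∞ proj
  /-- the positively oriented vertical tangent vectors -/
  pos : (q : Q) → Set (TangentSpace (𝓡 4) q)
  locallyTrivial : ∀ x : M, ∃ U : Set M, IsOpen U ∧ x ∈ U ∧
    ∃ E : M → ℝ → Q, IsTrivialization proj pos U E

namespace OrientedCircleBundle

/-- Euler class of an oriented circle bundle. -/
def IsEulerClass (B : OrientedCircleBundle Q M) (e : CechH M 2) : Prop :=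
  ∃ c : cechCocycles M 2, (QuotientAddGroup.mk c : CechH M 2) = e ∧
    ∃ U : M → Set M, IsPointedCover U ∧ ∃ E : M → M → ℝ → Q,
      (∀ x, IsTrivialization B.proj B.pos (U x) (E x)) ∧
      IsLiftingCocycle (P := fun _ : M => Q) (fun _ q q' => q = q') U E c.1

/-- The Euler class `e(Q) ∈ H²(M; ℤ)` (it exists and is unique). -/
def eulerClass (B : OrientedCircleBundle Q M) : CechH M 2 := Classical.epsilon B.IsEulerClass

/-- The image of `D q` in the tangent space of the base.  If `D` contains the vertical direction,
the map `q ↦ B.image D q` is the development map of `D`. -/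
def image (B : OrientedCircleBundle Q M) (D : TangentDistribution (𝓡 4) Q) (q : Q) :
    Submodule ℝ (TangentSpace (𝓡 3) (B.proj q)) :=
  (D q).map (mfderiv (𝓡 4) (𝓡 3) B.proj q).toLinearMap

variable [IsManifold (𝓡 3) ∞ M] [IsManifold (𝓡 4) ∞ Q]

/-- The Engel structures on `Q` with characteristic line field tangent to the fibres. -/
structure VerticalEngel (B : OrientedCircleBundle Q M) where
  /-- the Engel planes -/
  D : TangentDistribution (𝓡 4) Q
  isEngel : IsEngel (𝓡 4) D
  vertical : ∀ q, characteristicLine (𝓡 4) D q = {v | mfderiv (𝓡 4) (𝓡 3) B.proj q v = 0}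

variable {B : OrientedCircleBundle Q M}

/-- `ξ` is the contact structure induced on the base: the image of `[D, D]`. -/
def VerticalEngel.Induces (𝒟 : B.VerticalEngel) (ξ : OrientedContactStructure M) : Prop :=
  ∀ q, B.image (derivedDistribution (𝓡 4) 𝒟.D) q = ξ.plane (B.proj q)

/-- The twisting number, i.e. the degree along the fibres of the development map `Q → ℙξ`: in the
angular coordinate `θ ↦ ℝ (cos (πθ) a + sin (πθ) b)` on the projectivized contact planes, `θ`
increases by `n` when the fibre of `Q` is traversed once in the positive direction. -/
def VerticalEngel.HasTwisting (𝒟 : B.VerticalEngel) (ξ : OrientedContactStructure M) (n : ℤ) :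
    Prop :=
  ∀ a b : (y : M) → TangentSpace (𝓡 3) y, (∀ y, IsPositivePair (ξ.orient y) (a y) (b y)) →
    ∀ (U : Set M) (E : M → ℝ → Q), IsOpen U → IsTrivialization B.proj B.pos U E → ∀ y ∈ U,
      ∃ θ : ℝ → ℝ, Continuous θ ∧ (∀ t, θ (t + 1) = θ t + n) ∧
        ∀ t, B.image 𝒟.D (E y t) = Submodule.span ℝ
          {Real.cos (Real.pi * θ t) • a (B.proj (E y t)) +
            Real.sin (Real.pi * θ t) • b (B.proj (E y t))}

/-- `D` is an orientable plane field. -/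
def VerticalEngel.Orientable (𝒟 : B.VerticalEngel) : Prop :=
  ∃ o : ∀ q, Orientation ℝ (𝒟.D q) (Fin 2), IsOrientationOf (𝓡 4) 𝒟.D o

/-- Isotopy: a smooth homotopy through Engel structures with characteristic line field tangent to
the fibres, along which the induced contact structure on the base stays fixed. -/
def Isotopic (𝒟₀ 𝒟₁ : B.VerticalEngel) : Prop :=
  ∃ 𝒟 : ℝ → B.VerticalEngel, 𝒟 0 = 𝒟₀ ∧ 𝒟 1 = 𝒟₁ ∧
    (∀ t₀ ∈ Icc (0 : ℝ) 1, ∀ q₀ : Q, ∃ W : Set (ℝ × Q), IsOpen W ∧ (t₀, q₀) ∈ W ∧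
      ∃ X Y : ℝ → (q : Q) → TangentSpace (𝓡 4) q,
        ContMDiffOn (𝓘(ℝ, ℝ).prod (𝓡 4)) (𝓡 4).tangent ∞
          (fun p : ℝ × Q => (⟨p.2, X p.1 p.2⟩ : TangentBundle (𝓡 4) Q)) W ∧
        ContMDiffOn (𝓘(ℝ, ℝ).prod (𝓡 4)) (𝓡 4).tangent ∞
          (fun p : ℝ × Q => (⟨p.2, Y p.1 p.2⟩ : TangentBundle (𝓡 4) Q)) W ∧
        ∀ p ∈ W, p.1 ∈ Icc (0 : ℝ) 1 → LinearIndependent ℝ ![X p.1 p.2, Y p.1 p.2] ∧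
          (𝒟 p.1).D p.2 = Submodule.span ℝ {X p.1 p.2, Y p.1 p.2}) ∧
    ∀ t ∈ Icc (0 : ℝ) 1, ∀ q,
      B.image (derivedDistribution (𝓡 4) (𝒟 t).D) q =
        B.image (derivedDistribution (𝓡 4) 𝒟₀.D) q

variable (B)

/-- `Eng(Q)`: isotopy classes of Engel structures on `Q` with characteristic line field tangent to
the fibres. -/
def Eng : Type _ := Quot (Isotopic (B := B))

variable {B}

/-- The isotopy class of an Engel structure. -/
def VerticalEngel.isotopyClass (𝒟 : B.VerticalEngel) : B.Eng := Quot.mk _ 𝒟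

variable (B)

/-- `Eng^n_ξ(Q)`: the classes of Engel structures with twisting number `n` and induced contact
structure `ξ`. -/
def EngSet (ξ : OrientedContactStructure M) (n : ℤ) : Set B.Eng :=
  {c | ∃ 𝒟 : B.VerticalEngel, 𝒟.isotopyClass = c ∧ 𝒟.Induces ξ ∧ 𝒟.HasTwisting ξ n}

/-- `Eng^n_{ξ;o}(Q)`: the classes of orientable Engel structures with twisting number `n` and
induced contact structure `ξ`. -/
def EngOrSet (ξ : OrientedContactStructure M) (n : ℤ) : Set B.Eng :=
  {c | ∃ 𝒟 : B.VerticalEngel, 𝒟.isotopyClass = c ∧ 𝒟.Induces ξ ∧ 𝒟.HasTwisting ξ n ∧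
    𝒟.Orientable}

variable {B}

/-- `φ_{D'} = f · φ_D`: the development map of `D'` is that of `D` followed by the rotation by `f`
of the fibres `ℙξ_y`.  A full turn of `ℙξ_y` being half a turn of `ξ_y`, the element `h mod 1` of
`ℝ/ℤ` acts by `exp (π h J)`. -/
def VerticalEngel.IsRotationOf {ξ : OrientedContactStructure M} (J : ξ.ComplexStructure)
    (f : C(M, UnitAddCircle)) (𝒟 𝒟' : B.VerticalEngel) : Prop :=
  ∀ (q : Q) (h : ℝ), (h : UnitAddCircle) = f (B.proj q) → ∀ v : ξ.plane (B.proj q),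
    (v : TangentSpace (𝓡 3) (B.proj q)) ∈ B.image 𝒟.D q →
    ((Real.cos (Real.pi * h) • v + Real.sin (Real.pi * h) • J.J (B.proj q) v :
      ξ.plane (B.proj q)) : TangentSpace (𝓡 3) (B.proj q)) ∈ B.image 𝒟'.D q

end OrientedCircleBundle

end CircleBundle

end

/-! An Engel structure whose characteristic line field is tangent to the fibres contains the fibre
directions (`VerticalEngel.ker_le`: otherwise brackets of its sections would leave the preimage of
the contact planes), so it is the preimage of a field of lines in the contact planes, the
development map.  Computing brackets modulo the contact planes shows that the development map is
given by local smooth angles whose derivative along the fibres does not vanish (`deriv_angle_ne`)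
and that every such field of lines comes from an Engel structure (`VerticalEngel.ofTwisting`).  The
theorem thus becomes a statement about maps from `Q` to the projectivized contact planes that are
immersions on the fibres.

Angles are measured in units of `π` by means of a complex structure `J` on the contact planes:
`J.dir v w p` is the angle from `v` to `w` up to multiples of `p`, where `p = 1` is used for lines
and `p = 2` for rays.  Fields of rays matter because the fibres of `Q` are oriented, so that
orienting an Engel structure amounts to lifting its development map to rays
(`Orientable.exists_isDirectionField`, `orientable_of_isDirectionField`).

*Isotopy.*  If the angle between two development maps of equal twisting number `n ≠ 0` lifts to the
real numbers, interpolating the angles linearly gives an isotopy, since both angles move along the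
fibres in the direction given by the sign of `n` (`isotopic_of_angleLifts`).  Conversely the angle
lifts along an isotopy (`angleLifts_of_isotopic`).  Since the twisting numbers agree, the angle lifts
at least locally over the base, and the only obstruction to lifting it is a class in `H¹(M; ℤ)`, the
difference class (`IsDifferenceClass`).  It is additive, vanishes exactly on isotopic pairs, and
every class occurs, because a Čech 1-cocycle is the coboundary of a cochain of smooth functions, by
which a development map can be rotated (`exists_isDifferenceClass_eq`).  Hence the isotopy classes
form a torsor (`exists_addAction`).  Between fields of rays all angles are defined modulo `2`, so
that the difference class is even, and every even class occurs.

*Existence.*  Choose local trivializations of `Q` and local sections of the contact structure over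
the same cover (`EulerData`).  The lifted transition functions `G` and the angles `α` fail to be
cocycles by cocycles `c` and `d` representing the two Euler classes.  The angles of a development
map in the local trivializations compare through `G`, `α` and an integral 1-cochain `b`, whose
coboundary is `n * c - 2 * d`; for rays it is divisible by `2` (`isCobounding_of_isDirectionField`).
Conversely, given such a `b`, a partition of unity glues the angles that grow at constant speed `n`
in the trivializations; convex combinations preserve the sign of the speed, and the result is a
development map of twisting number `n` (`IsCobounding.exists_verticalEngel`). -/


set_option linter.unusedSectionVars false

noncomputable section

/-! ### Local inverses and vector fields in coordinates -/

section Foundations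

variable {E : Type*} [NormedAddCommGroup E] [NormedSpace ℝ E]
  {H : Type*} [TopologicalSpace H] {I : ModelWithCorners ℝ E H}
  {X : Type*} [TopologicalSpace X] [ChartedSpace H X]
  {G : Type*} [NormedAddCommGroup G] [NormedSpace ℝ G]

/-- The inverse function theorem for a map from a boundaryless manifold to a vector space: a smooth
map with bijective derivative at `q₀` has a smooth local inverse `Ψ`. -/
theorem exists_smooth_local_inverse [FiniteDimensional ℝ E] [FiniteDimensional ℝ G]
    [I.Boundaryless] [IsManifold I ∞ X]
    {F : X → G} {O : Set X} (hO : IsOpen O) (hF : ContMDiffOn I 𝓘(ℝ, G) ∞ F O) {q₀ : X}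
    (hq₀ : q₀ ∈ O) (hb : Function.Bijective (mvfderiv I F q₀)) :
    ∃ (Ψ : G → X) (S : Set G), IsOpen S ∧ F q₀ ∈ S ∧ ContMDiffOn 𝓘(ℝ, G) I ∞ Ψ S ∧
      Ψ (F q₀) = q₀ ∧ (∀ z ∈ S, F (Ψ z) = z ∧ Ψ z ∈ O) ∧ ∀ᶠ q in 𝓝 q₀, Ψ (F q) = q := by
  have : CompleteSpace E := FiniteDimensional.complete ℝ E
  have : CompleteSpace G := FiniteDimensional.complete ℝ G
  set κ := extChartAt I q₀ with hκ
  set f : E → G := F ∘ κ.symm with hf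
  set T : Set E := κ.target ∩ κ.symm ⁻¹' O with hT
  have hTo : IsOpen T := (continuousOn_extChartAt_symm q₀).isOpen_inter_preimage
    (isOpen_extChartAt_target q₀) hO
  have hfT : ContDiffOn ℝ ∞ f T := by
    rw [← contMDiffOn_iff_contDiffOn]
    exact hF.comp ((contMDiffOn_extChartAt_symm q₀).mono inter_subset_left)
      (fun x hx => hx.2)
  have hxT : κ q₀ ∈ T := ⟨mem_extChartAt_target q₀, by simpa [hκ] using hq₀⟩
  have hdf : DifferentiableAt ℝ f (κ q₀) :=
    ((hfT _ hxT).contDiffAt (hTo.mem_nhds hxT)).differentiableAt (by simp)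
  have hcomp : mvfderiv I F q₀ = (fderiv ℝ f (κ q₀)).comp (mvfderiv I κ q₀) := by
    have h1 : F =ᶠ[𝓝 q₀] f ∘ κ := by
      filter_upwards [extChartAt_source_mem_nhds (I := I) q₀] with q hq
      change F q = F (κ.symm (κ q))
      rw [κ.left_inv hq]
    have h2 : mfderiv I 𝓘(ℝ, G) F q₀ = mfderiv I 𝓘(ℝ, G) (f ∘ κ) q₀ := h1.mfderiv_eq
    have h3 : mfderiv I 𝓘(ℝ, G) (f ∘ κ) q₀ =
        (mfderiv 𝓘(ℝ, E) 𝓘(ℝ, G) f (κ q₀)).comp (mfderiv I 𝓘(ℝ, E) κ q₀) :=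
      mfderiv_comp q₀ hdf.mdifferentiableAt (mdifferentiableAt_extChartAt (mem_chart_source H q₀))
    rw [mfderiv_eq_fderiv] at h3
    exact h2.trans h3
  have hκb : Function.Bijective (mvfderiv I κ q₀) := by
    obtain ⟨A, hA⟩ := isInvertible_mfderiv_extChartAt (I := I) (mem_extChartAt_source (I := I) q₀)
    have : ⇑(mvfderiv I κ q₀) = ⇑A := by
      rw [show ⇑A = ⇑(A : TangentSpace I q₀ →L[ℝ] _) from rfl, hA]; rfl
    rw [this]; exact A.bijective
  have hfb : Function.Bijective (fderiv ℝ f (κ q₀)) := by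
    rw [hcomp, ContinuousLinearMap.coe_comp] at hb
    exact (Function.Bijective.of_comp_iff _ hκb).1 hb
  let A : E ≃L[ℝ] G :=
    (LinearEquiv.ofBijective (fderiv ℝ f (κ q₀)).toLinearMap hfb).toContinuousLinearEquiv
  have hA : (A : E →L[ℝ] G) = fderiv ℝ f (κ q₀) := by ext; rfl
  set T' : Set E := T ∩ fderiv ℝ f ⁻¹' range ((↑) : (E ≃L[ℝ] G) → (E →L[ℝ] G)) with hT'
  have hT'o : IsOpen T' := (hfT.continuousOn_fderiv_of_isOpen hTo (by simp)).isOpen_inter_preimage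
    hTo (ContinuousLinearEquiv.isOpen)
  have hxT' : κ q₀ ∈ T' := ⟨hxT, A, hA⟩
  have hf' : HasFDerivAt f (A : E →L[ℝ] G) (κ q₀) := by rw [hA]; exact hdf.hasFDerivAt
  have hfc : ContDiffAt ℝ ∞ f (κ q₀) := (hfT _ hxT).contDiffAt (hTo.mem_nhds hxT)
  set e := hfc.toOpenPartialHomeomorph f hf' (by simp) with he
  have hes : κ q₀ ∈ e.source := hfc.mem_toOpenPartialHomeomorph_source hf' (by simp)
  have hef : ∀ x, e x = f x := fun x => rfl
  set S : Set G := e.target ∩ e.symm ⁻¹' T' with hS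
  have hSo : IsOpen S := e.isOpen_inter_preimage_symm hT'o
  have hFq : F q₀ = e (κ q₀) := by simp [hef, hf, hκ]
  have hinv : e.symm (F q₀) = κ q₀ := by rw [hFq, e.left_inv hes]
  have hsm : ContDiffOn ℝ ∞ e.symm S := by
    intro z hz
    obtain ⟨B, hB⟩ := hz.2.2
    have hzT := hz.2.1
    have h1 : ContDiffAt ℝ ∞ f (e.symm z) := (hfT _ hzT).contDiffAt (hTo.mem_nhds hzT)
    refine (e.contDiffAt_symm (f₀' := B) hz.1 ?_ h1).contDiffWithinAt
    rw [hB]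
    exact (h1.differentiableAt (by simp)).hasFDerivAt
  refine ⟨κ.symm ∘ e.symm, S, hSo, ⟨hFq ▸ e.map_source hes, ?_⟩, ?_, ?_, ?_, ?_⟩
  · rw [mem_preimage, hinv]; exact hxT'
  · exact (contMDiffOn_extChartAt_symm q₀).comp hsm.contMDiffOn (fun z hz => hz.2.1.1)
  · simp [hinv, hκ]
  · intro z hz
    refine ⟨?_, hz.2.1.2⟩
    change f (e.symm z) = z
    rw [← hef, e.right_inv hz.1]
  · have hc : ContinuousAt κ q₀ := continuousAt_extChartAt q₀
    filter_upwards [extChartAt_source_mem_nhds (I := I) q₀,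
      hc.preimage_mem_nhds (e.open_source.mem_nhds hes)] with q hq hq2
    have : F q = e (κ q) := by
      change F q = F (κ.symm (κ q))
      rw [κ.left_inv hq]
    rw [Function.comp_apply, this, e.left_inv hq2]
    exact κ.left_inv hq

/-- The derivative of a smooth function along a smooth field of vectors is smooth. -/
theorem ContMDiffAt.mvfderiv_apply_field [IsManifold I ∞ X] {E' : Type*} [NormedAddCommGroup E']
    [NormedSpace ℝ E'] {H' : Type*} [TopologicalSpace H'] {I' : ModelWithCorners ℝ E' H'}
    {P : Type*} [TopologicalSpace P] [ChartedSpace H' P] {s : Set P}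
    {f : X → G} {O : Set X} (hO : IsOpen O) (hf : ContMDiffOn I 𝓘(ℝ, G) ∞ f O)
    {g : P → X} {v : (p : P) → TangentSpace I (g p)} {p₀ : P} (hg : g p₀ ∈ O)
    (hv : ContMDiffWithinAt I' I.tangent ∞ (fun p => (⟨g p, v p⟩ : TangentBundle I X)) s p₀) :
    ContMDiffWithinAt I' 𝓘(ℝ, G) ∞ (fun p => mvfderiv I f (g p) (v p)) s p₀ := by
  have h1 := hf.contMDiffOn_tangentMapWithin (m := ∞) (by simp) hO.uniqueMDiffOn
  have hO' : IsOpen ((Bundle.TotalSpace.proj : TangentBundle I X → X) ⁻¹' O) :=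
    hO.preimage (FiberBundle.continuous_proj E (TangentSpace I))
  have h2 : ContMDiffAt I.tangent 𝓘(ℝ, G).tangent ∞ (tangentMapWithin I 𝓘(ℝ, G) f O)
      (⟨g p₀, v p₀⟩ : TangentBundle I X) := (h1 _ hg).contMDiffAt (hO'.mem_nhds hg)
  have h3 := h2.comp_contMDiffWithinAt p₀ hv
  have h4 := ((contMDiff_snd_tangentBundle_modelSpace G 𝓘(ℝ, G)
    (n := ∞)).contMDiffAt).comp_contMDiffWithinAt p₀ h3
  have hgc : ContinuousWithinAt g s p₀ :=
    ((FiberBundle.continuous_proj E (TangentSpace I)).continuousAt).comp_continuousWithinAt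
      hv.continuousWithinAt
  refine h4.congr_of_eventuallyEq ?_ ?_
  · filter_upwards [hgc.preimage_mem_nhdsWithin (hO.mem_nhds hg)] with p hp
    simp only [Function.comp, tangentMapWithin]
    rw [mfderivWithin_of_isOpen hO hp]; rfl
  · simp only [Function.comp, tangentMapWithin]
    rw [mfderivWithin_of_isOpen hO hg]; rfl

/-- Vector fields can be prescribed by their components `v` in local coordinates `F`. -/
theorem exists_field_of_coordinates [FiniteDimensional ℝ E] [FiniteDimensional ℝ G]
    [I.Boundaryless] [IsManifold I ∞ X]
    {F : X → G} {O : Set X} (hO : IsOpen O) (hF : ContMDiffOn I 𝓘(ℝ, G) ∞ F O) {q₀ : X}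
    (hq₀ : q₀ ∈ O) (hb : Function.Bijective (mvfderiv I F q₀)) :
    ∃ (O' : Set X) (L : (q : X) → G →L[ℝ] TangentSpace I q), IsOpen O' ∧ q₀ ∈ O' ∧ O' ⊆ O ∧
      (∀ q ∈ O', ∀ v, mvfderiv I F q (L q v) = v) ∧
      ∀ {E' : Type} [NormedAddCommGroup E'] [NormedSpace ℝ E'] {H' : Type} [TopologicalSpace H']
        {I' : ModelWithCorners ℝ E' H'} {P : Type _} [TopologicalSpace P] [ChartedSpace H' P]
        {s : Set P} {g : P → X} {v : P → G} {p₀ : P}, g p₀ ∈ O' →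
        ContMDiffWithinAt I' I ∞ g s p₀ → ContMDiffWithinAt I' 𝓘(ℝ, G) ∞ v s p₀ →
        ContMDiffWithinAt I' I.tangent ∞
          (fun p => (⟨g p, L (g p) (v p)⟩ : TangentBundle I X)) s p₀ := by
  classical
  obtain ⟨Ψ, S, hS, hqS, hΨ, hΨq, hFΨ, hΨF⟩ := exists_smooth_local_inverse hO hF hq₀ hb
  obtain ⟨O₁, hO₁s, hO₁, hq₁⟩ := eventually_nhds_iff.1 hΨF
  have hFc : ContinuousOn F O := hF.continuousOn
  set O' := (O ∩ F ⁻¹' S) ∩ O₁ with hO'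
  have hO'o : IsOpen O' := (hFc.isOpen_inter_preimage hO hS).inter hO₁
  have hΨS := hΨ.contMDiffOn_tangentMapWithin (m := ∞) (by simp) hS.uniqueMDiffOn
  have key : ∀ q ∈ O', Ψ (F q) = q := fun q hq => hO₁s q hq.2
  refine ⟨O', fun q => if h : Ψ (F q) = q then h ▸ mfderiv 𝓘(ℝ, G) I Ψ (F q) else 0, hO'o,
    ⟨⟨hq₀, hqS⟩, hq₁⟩, fun q hq => hq.1.1, ?_, ?_⟩
  · intro q hq v
    have hk := key q hq
    have hd : HasMFDerivAt 𝓘(ℝ, G) I Ψ (F q) (mfderiv 𝓘(ℝ, G) I Ψ (F q)) :=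
      (((hΨ _ hq.1.2).contMDiffAt (hS.mem_nhds hq.1.2)).mdifferentiableAt (by simp)).hasMFDerivAt
    have hd2 : MDifferentiableAt I 𝓘(ℝ, G) F (Ψ (F q)) := by
      rw [hk]
      exact ((hF _ hq.1.1).contMDiffAt (hO.mem_nhds hq.1.1)).mdifferentiableAt (by simp)
    have hcomp := hd2.hasMFDerivAt.comp (F q) hd
    have hid : HasMFDerivAt 𝓘(ℝ, G) 𝓘(ℝ, G) (F ∘ Ψ) (F q)
        (ContinuousLinearMap.id ℝ (TangentSpace 𝓘(ℝ, G) (F q))) := by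
      refine (hasMFDerivAt_id (F q)).congr_of_eventuallyEq ?_
      filter_upwards [hS.mem_nhds hq.1.2] with z hz
      exact (hFΨ z hz).1
    have := hasMFDerivAt_unique hcomp hid
    have h5 := congrArg (fun A => A v) this
    simp only [dif_pos hk]
    have aux : ∀ (y : X) (h : Ψ (F q) = y), mvfderiv I F y
        ((h ▸ mfderiv 𝓘(ℝ, G) I Ψ (F q) : G →L[ℝ] TangentSpace I y) v) =
        mvfderiv I F (Ψ (F q)) (mfderiv 𝓘(ℝ, G) I Ψ (F q) v) := by
      intro y h; subst h; rfl
    rw [aux]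
    exact h5
  · intro E' _ _ H' _ I' P _ _ s g v p₀ hp hg hv
    have hFg : ContMDiffWithinAt I' 𝓘(ℝ, G) ∞ (fun p => F (g p)) s p₀ :=
      (((hF _ hp.1.1).contMDiffAt (hO.mem_nhds hp.1.1))).comp_contMDiffWithinAt p₀ hg
    have hpair : ContMDiffWithinAt I' 𝓘(ℝ, G).tangent ∞
        (fun p => (⟨F (g p), v p⟩ : TangentBundle 𝓘(ℝ, G) G)) s p₀ := by
      rw [Bundle.contMDiffWithinAt_totalSpace]
      refine ⟨hFg, ?_⟩
      simpa using hv
    have hOS : IsOpen ((Bundle.TotalSpace.proj : TangentBundle 𝓘(ℝ, G) G → G) ⁻¹' S) :=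
      hS.preimage (FiberBundle.continuous_proj G (TangentSpace 𝓘(ℝ, G)))
    have h2 := ((hΨS (⟨F (g p₀), v p₀⟩ : TangentBundle 𝓘(ℝ, G) G) hp.1.2).contMDiffAt
      (hOS.mem_nhds hp.1.2)).comp_contMDiffWithinAt p₀ hpair
    have hgc : ∀ᶠ p in 𝓝[s] p₀, g p ∈ O' :=
      hg.continuousWithinAt.preimage_mem_nhdsWithin (hO'o.mem_nhds hp)
    have aux : ∀ p, g p ∈ O' → (⟨g p, (if h : Ψ (F (g p)) = g p then
        h ▸ mfderiv 𝓘(ℝ, G) I Ψ (F (g p)) else 0 : G →L[ℝ] TangentSpace I (g p)) (v p)⟩ :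
        TangentBundle I X) = tangentMapWithin 𝓘(ℝ, G) I Ψ S ⟨F (g p), v p⟩ := by
      intro p hp
      have hk := key _ hp
      simp only [tangentMapWithin, dif_pos hk]
      rw [mfderivWithin_of_isOpen hS hp.1.2]
      have : ∀ (y : X) (h : Ψ (F (g p)) = y), (⟨y, (h ▸ mfderiv 𝓘(ℝ, G) I Ψ (F (g p)) :
          G →L[ℝ] TangentSpace I y) (v p)⟩ : TangentBundle I X) =
          ⟨Ψ (F (g p)), mfderiv 𝓘(ℝ, G) I Ψ (F (g p)) (v p)⟩ := by
        intro y h; subst h; rfl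
      exact this _ hk
    refine h2.congr_of_eventuallyEq ?_ (aux p₀ hp)
    filter_upwards [hgc] with p hp
    exact aux p hp

end Foundations

/-! ### Lie brackets as commutators of derivations -/

section Brackets

variable {E : Type*} [NormedAddCommGroup E] [NormedSpace ℝ E]
  {X : Type*} [TopologicalSpace X] [ChartedSpace E X]
  {G : Type*} [NormedAddCommGroup G] [NormedSpace ℝ G]

/-- The chain rule expressing a derivative through a chart. -/
theorem mvfderiv_eq_fderiv_extChartAt {f : X → G} {q₀ q : X}
    [IsManifold 𝓘(ℝ, E) 1 X]
    (hq : q ∈ (extChartAt 𝓘(ℝ, E) q₀).source) {F : E → G}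
    (hF : DifferentiableAt ℝ F (extChartAt 𝓘(ℝ, E) q₀ q))
    (h : f =ᶠ[𝓝 q] F ∘ extChartAt 𝓘(ℝ, E) q₀) (v : TangentSpace 𝓘(ℝ, E) q) :
    mvfderiv 𝓘(ℝ, E) f q v = fderiv ℝ F (extChartAt 𝓘(ℝ, E) q₀ q)
      (mfderiv 𝓘(ℝ, E) 𝓘(ℝ, E) (extChartAt 𝓘(ℝ, E) q₀) q v) := by
  have h2 : mfderiv 𝓘(ℝ, E) 𝓘(ℝ, G) f q =
      mfderiv 𝓘(ℝ, E) 𝓘(ℝ, G) (F ∘ extChartAt 𝓘(ℝ, E) q₀) q := h.mfderiv_eq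
  have h3 : mfderiv 𝓘(ℝ, E) 𝓘(ℝ, G) (F ∘ extChartAt 𝓘(ℝ, E) q₀) q =
      (mfderiv 𝓘(ℝ, E) 𝓘(ℝ, G) F (extChartAt 𝓘(ℝ, E) q₀ q)).comp
        (mfderiv 𝓘(ℝ, E) 𝓘(ℝ, E) (extChartAt 𝓘(ℝ, E) q₀) q) :=
    mfderiv_comp q hF.mdifferentiableAt
      (mdifferentiableAt_extChartAt (by simpa using hq))
  rw [mfderiv_eq_fderiv] at h3
  exact congrArg (fun A => A v) (h2.trans h3)

/-- The Lie bracket acts on functions as the commutator of derivations. -/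
theorem mvfderiv_mlieBracket [FiniteDimensional ℝ E] [IsManifold 𝓘(ℝ, E) ∞ X]
    {f : X → G} {O : Set X} (hO : IsOpen O) (hf : ContMDiffOn 𝓘(ℝ, E) 𝓘(ℝ, G) ∞ f O)
    {V W : (q : X) → TangentSpace 𝓘(ℝ, E) q} {q₀ : X} (hq₀ : q₀ ∈ O)
    (hV : MDifferentiableAt 𝓘(ℝ, E) 𝓘(ℝ, E).tangent (fun q => (⟨q, V q⟩ : TangentBundle 𝓘(ℝ, E) X)) q₀)
    (hW : MDifferentiableAt 𝓘(ℝ, E) 𝓘(ℝ, E).tangent (fun q => (⟨q, W q⟩ : TangentBundle 𝓘(ℝ, E) X)) q₀) :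
    mvfderiv 𝓘(ℝ, E) f q₀ (VectorField.mlieBracket 𝓘(ℝ, E) V W q₀) =
      mvfderiv 𝓘(ℝ, E) (fun q => mvfderiv 𝓘(ℝ, E) f q (W q)) q₀ (V q₀) -
      mvfderiv 𝓘(ℝ, E) (fun q => mvfderiv 𝓘(ℝ, E) f q (V q)) q₀ (W q₀) := by
  have : CompleteSpace E := FiniteDimensional.complete ℝ E
  have : IsManifold 𝓘(ℝ, E) 1 X := .of_le (n := ∞) (by simp)
  have : IsManifold 𝓘(ℝ, E) 2 X := .of_le (n := ∞) (by norm_cast)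
  set φ := extChartAt 𝓘(ℝ, E) q₀ with hφ
  set x₀ := φ q₀ with hx₀
  set fh : E → G := f ∘ φ.symm with hfh
  set T : Set E := φ.target ∩ φ.symm ⁻¹' O with hT
  have hTo : IsOpen T := (continuousOn_extChartAt_symm q₀).isOpen_inter_preimage
    (isOpen_extChartAt_target q₀) hO
  have hfT : ContDiffOn ℝ ∞ fh T := by
    rw [← contMDiffOn_iff_contDiffOn]
    exact hf.comp ((contMDiffOn_extChartAt_symm q₀).mono inter_subset_left) (fun x hx => hx.2)
  have hsymm : φ.symm x₀ = q₀ := extChartAt_to_inv q₀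
  have hxT : x₀ ∈ T := ⟨mem_extChartAt_target q₀, by rw [mem_preimage, hsymm]; exact hq₀⟩
  have hfc : ∀ x ∈ T, ContDiffAt ℝ ∞ fh x := fun x hx => (hfT x hx).contDiffAt (hTo.mem_nhds hx)
  set pull : ((q : X) → TangentSpace 𝓘(ℝ, E) q) → E → E := fun V x =>
    VectorField.mpullbackWithin 𝓘(ℝ, E) 𝓘(ℝ, E) φ.symm V (range 𝓘(ℝ, E)) x with hpull
  have hsrc : ∀ᶠ q in 𝓝 q₀, q ∈ φ.source ∧ q ∈ O :=
    Filter.Eventually.and (extChartAt_source_mem_nhds (I := 𝓘(ℝ, E)) q₀) (hO.mem_nhds hq₀)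
  have hφV : ∀ (V : (q : X) → TangentSpace 𝓘(ℝ, E) q), ∀ q ∈ φ.source,
      mfderiv 𝓘(ℝ, E) 𝓘(ℝ, E) φ q (V q) = pull V (φ q) := by
    intro V q hq
    have ht : φ q ∈ φ.target := φ.map_source hq
    have hi := isInvertible_mfderivWithin_extChartAt_symm (I := 𝓘(ℝ, E)) ht
    have hc := mfderiv_extChartAt_comp_mfderivWithin_extChartAt_symm (I := 𝓘(ℝ, E)) ht
    have hq' : φ.symm (φ q) = q := φ.left_inv hq
    simp only [hpull, VectorField.mpullbackWithin_apply]
    obtain ⟨A, hA⟩ := hi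
    rw [← hφ] at hc hA
    rw [← hA] at hc ⊢
    rw [ContinuousLinearMap.inverse_equiv]
    have h6 : ∀ (z : X) (h : φ.symm (φ q) = z),
        mfderiv 𝓘(ℝ, E) 𝓘(ℝ, E) φ z (V z) = A.symm (V (φ.symm (φ q))) := by
      intro z h
      subst h
      have := congrArg (fun B => B (A.symm (V (φ.symm (φ q))))) hc
      refine Eq.trans ?_ this
      change _ = mfderiv 𝓘(ℝ, E) 𝓘(ℝ, E) φ (φ.symm (φ q)) (A (A.symm (V (φ.symm (φ q)))))
      rw [A.apply_symm_apply]
    exact h6 q hq'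
  have hder : ∀ q ∈ φ.source, q ∈ O → ∀ v, mvfderiv 𝓘(ℝ, E) f q v =
      fderiv ℝ fh (φ q) (mfderiv 𝓘(ℝ, E) 𝓘(ℝ, E) φ q v) := by
    intro q hq hqO v
    have hqT : φ q ∈ T := ⟨φ.map_source hq, by rw [mem_preimage, φ.left_inv hq]; exact hqO⟩
    refine mvfderiv_eq_fderiv_extChartAt hq ((hfc _ hqT).differentiableAt (by simp)) ?_ v
    filter_upwards [extChartAt_source_mem_nhds' (I := 𝓘(ℝ, E)) hq] with z hz
    change f z = f (φ.symm (φ z))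
    rw [φ.left_inv hz]
  have hpd : ∀ {V : (q : X) → TangentSpace 𝓘(ℝ, E) q},
      MDifferentiableAt 𝓘(ℝ, E) 𝓘(ℝ, E).tangent (fun q => (⟨q, V q⟩ : TangentBundle 𝓘(ℝ, E) X)) q₀ →
      DifferentiableAt ℝ (pull V) x₀ := by
    intro V hV
    have := MDifferentiableWithinAt.differentiableWithinAt_mpullbackWithin_vectorField
      (s := univ) hV.mdifferentiableWithinAt
    rw [preimage_univ, univ_inter] at this
    exact this.differentiableAt (by simp)
  have hmain : ∀ {V W : (q : X) → TangentSpace 𝓘(ℝ, E) q},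
      MDifferentiableAt 𝓘(ℝ, E) 𝓘(ℝ, E).tangent (fun q => (⟨q, W q⟩ : TangentBundle 𝓘(ℝ, E) X)) q₀ →
      mvfderiv 𝓘(ℝ, E) (fun q => mvfderiv 𝓘(ℝ, E) f q (W q)) q₀ (V q₀) =
      fderiv ℝ (fderiv ℝ fh) x₀ (pull V x₀) (pull W x₀) +
        fderiv ℝ fh x₀ (fderiv ℝ (pull W) x₀ (pull V x₀)) := by
    intro V W hW
    have hd1 : DifferentiableAt ℝ (fderiv ℝ fh) x₀ :=
      ((hfc _ hxT).fderiv_right (m := ∞) (by simp)).differentiableAt (by simp)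
    have hd := hd1.hasFDerivAt.clm_apply (hpd hW).hasFDerivAt
    rw [mvfderiv_eq_fderiv_extChartAt (mem_extChartAt_source q₀)
      (F := fun x => fderiv ℝ fh x (pull W x)) hd.differentiableAt]
    · rw [← hφ, hφV V q₀ (mem_extChartAt_source q₀), ← hx₀, hd.fderiv]
      simp [add_comm]
    · filter_upwards [hsrc] with q hq
      rw [hder q hq.1 hq.2, hφV W q hq.1]
      rfl
  rw [hmain hW, hmain hV, hder q₀ (mem_extChartAt_source q₀) hq₀]
  have hbr : mfderiv 𝓘(ℝ, E) 𝓘(ℝ, E) φ q₀ (VectorField.mlieBracket 𝓘(ℝ, E) V W q₀) =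
      VectorField.lieBracket ℝ (pull V) (pull W) x₀ := by
    rw [← VectorField.mlieBracketWithin_univ, VectorField.mlieBracketWithin_apply]
    obtain ⟨A, hA⟩ := isInvertible_mfderiv_extChartAt (I := 𝓘(ℝ, E))
      (mem_extChartAt_source (I := 𝓘(ℝ, E)) q₀)
    rw [← hφ] at hA ⊢
    rw [← hA, ContinuousLinearMap.inverse_equiv, preimage_univ, univ_inter]
    refine (A.apply_symm_apply _).trans ?_
    have hr : range 𝓘(ℝ, E) = univ := ModelWithCorners.range_eq_univ _
    change VectorField.lieBracketWithin ℝ (pull V) (pull W) (range 𝓘(ℝ, E)) x₀ = _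
    rw [hr, VectorField.lieBracketWithin_univ]
  rw [hbr, VectorField.lieBracket]
  have hsym : IsSymmSndFDerivAt ℝ fh x₀ :=
    (hfc _ hxT).isSymmSndFDerivAt (by simp; norm_cast)
  rw [hsym (pull V x₀) (pull W x₀), map_sub, ← hx₀]
  abel

end Brackets

/-! ### Positive pairs -/

section PositivePairs

variable {T : Type*} [AddCommGroup T] [Module ℝ T] {S : Submodule ℝ T}

theorem IsPositivePair.mem_left {o : Orientation ℝ S (Fin 2)} {v w : T}
    (h : IsPositivePair o v w) : v ∈ S := by
  obtain ⟨b, -, rfl, -⟩ := h; exact (b 0).2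

theorem IsPositivePair.mem_right {o : Orientation ℝ S (Fin 2)} {v w : T}
    (h : IsPositivePair o v w) : w ∈ S := by
  obtain ⟨b, -, -, rfl⟩ := h; exact (b 1).2

theorem IsPositivePair.linearIndependent {o : Orientation ℝ S (Fin 2)} {v w : T}
    (h : IsPositivePair o v w) : LinearIndependent ℝ ![v, w] := by
  obtain ⟨b, -, rfl, rfl⟩ := h
  have h := b.linearIndependent.map' S.subtype (Submodule.ker_subtype S)
  have h2 : (S.subtype ∘ b : Fin 2 → T) = ![(b 0 : T), (b 1 : T)] := by
    ext i; fin_cases i <;> rfl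
  rwa [h2] at h

theorem IsPositivePair.exists_coeffs {o : Orientation ℝ S (Fin 2)} {v w : T}
    (h : IsPositivePair o v w) {u : T} (hu : u ∈ S) : ∃ p q : ℝ, u = p • v + q • w := by
  obtain ⟨b, -, rfl, rfl⟩ := h
  refine ⟨b.repr ⟨u, hu⟩ 0, b.repr ⟨u, hu⟩ 1, ?_⟩
  have h := b.sum_repr ⟨u, hu⟩
  rw [Fin.sum_univ_two] at h
  exact (congrArg Subtype.val h).symm

/-- Two linear independent vectors are determined by their coefficients. -/
theorem LinearIndependent.pair_coeffs {v w : T} (h : LinearIndependent ℝ ![v, w]) {p q p' q' : ℝ}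
    (he : p • v + q • w = p' • v + q' • w) : p = p' ∧ q = q' := by
  rw [LinearIndependent.pair_iff] at h
  have := h (p - p') (q - q') (by
    rw [sub_smul, sub_smul, ← sub_eq_zero.2 he]; abel)
  exact ⟨sub_eq_zero.1 this.1, sub_eq_zero.1 this.2⟩

/-- A pair with coefficients of positive determinant with respect to a positive pair is positive,
and conversely. -/
theorem IsPositivePair.iff_det_pos {o : Orientation ℝ S (Fin 2)} {v w : T}
    (h : IsPositivePair o v w) {p q r s : ℝ} :
    IsPositivePair o (p • v + q • w) (r • v + s • w) ↔ 0 < p * s - q * r := by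
  have hli := h.linearIndependent
  obtain ⟨b, hb, rfl, rfl⟩ := h
  constructor
  · rintro ⟨b', hb', h0, h1⟩
    have hd : 0 < b.det b' := (b.orientation_eq_iff_det_pos b').1 (hb.trans hb'.symm)
    have h0' : b' 0 = p • b 0 + q • b 1 := Subtype.ext h0
    have h1' : b' 1 = r • b 0 + s • b 1 := Subtype.ext h1
    rw [Module.Basis.det_apply, Matrix.det_fin_two] at hd
    simp only [Module.Basis.toMatrix_apply, h0', h1'] at hd
    simp at hd
    linarith
  · intro hd
    let M : Matrix (Fin 2) (Fin 2) ℝ := !![p, r; q, s]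
    have hdet : b.det ![p • b 0 + q • b 1, r • b 0 + s • b 1] = p * s - q * r := by
      rw [Module.Basis.det_apply, Matrix.det_fin_two]
      simp [Module.Basis.toMatrix_apply]
      ring
    have hu : IsUnit (b.det ![p • b 0 + q • b 1, r • b 0 + s • b 1]) := by
      rw [hdet]; exact hd.ne'.isUnit
    obtain ⟨hl, hs⟩ := (b.is_basis_iff_det).2 hu
    refine ⟨Module.Basis.mk hl hs.ge, ?_, by simp, by simp⟩
    rw [← hb, eq_comm, b.orientation_eq_iff_det_pos]
    rw [Module.Basis.coe_mk, hdet]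
    exact hd

end PositivePairs

/-! ### Unit complex numbers -/

/-- The unit complex number of argument `π s`. -/
def cisPi (s : ℝ) : ℂ := Complex.exp (Real.pi * s * Complex.I)

theorem cisPi_re (s : ℝ) : (cisPi s).re = Real.cos (Real.pi * s) := by
  rw [cisPi, ← Complex.ofReal_mul, Complex.exp_ofReal_mul_I_re]

theorem cisPi_im (s : ℝ) : (cisPi s).im = Real.sin (Real.pi * s) := by
  rw [cisPi, ← Complex.ofReal_mul, Complex.exp_ofReal_mul_I_im]

theorem cisPi_add (s t : ℝ) : cisPi (s + t) = cisPi s * cisPi t := by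
  rw [cisPi, cisPi, cisPi, ← Complex.exp_add]; congr 1; push_cast; ring

@[simp] theorem cisPi_zero : cisPi 0 = 1 := by simp [cisPi]

theorem cisPi_ne_zero (s : ℝ) : cisPi s ≠ 0 := Complex.exp_ne_zero _

theorem norm_cisPi (s : ℝ) : ‖cisPi s‖ = 1 := by
  rw [cisPi, ← Complex.ofReal_mul, Complex.norm_exp_ofReal_mul_I]

theorem contDiff_cisPi : ContDiff ℝ ∞ cisPi := by
  unfold cisPi
  exact ((contDiff_const.mul Complex.ofRealCLM.contDiff).mul contDiff_const).cexp

theorem continuous_cisPi : Continuous cisPi := contDiff_cisPi.continuous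

theorem exists_polar (z : ℂ) : ∃ s : ℝ, z = ‖z‖ * cisPi s := by
  refine ⟨z.arg / Real.pi, ?_⟩
  have : (Real.pi : ℂ) ≠ 0 := by exact_mod_cast Real.pi_ne_zero
  rw [cisPi]
  push_cast
  rw [mul_div_cancel₀ _ this, Complex.norm_mul_exp_arg_mul_I]

theorem cisPi_int (k : ℤ) : cisPi k = ((-1 : ℝ) ^ k : ℝ) := by
  refine Complex.ext ?_ ?_
  · rw [cisPi_re, mul_comm, Real.cos_int_mul_pi, Complex.ofReal_re]
  · rw [cisPi_im, mul_comm, Real.sin_int_mul_pi, Complex.ofReal_im]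

theorem cisPi_two_mul_int (k : ℤ) : cisPi (2 * k) = 1 := by
  have h := cisPi_int (2 * k)
  push_cast at h
  rw [h, zpow_mul]; norm_num

namespace OrientedContactStructure

variable {M : Type*} [TopologicalSpace M] [ChartedSpace (EuclideanSpace ℝ (Fin 3)) M]
  [IsManifold (𝓡 3) ∞ M] {ξ : OrientedContactStructure M}

namespace ComplexStructure

variable (J : ξ.ComplexStructure) (y : M)

/-- A linear extension of the complex structure from the contact plane to the tangent space. -/
def ext : TangentSpace (𝓡 3) y →ₗ[ℝ] TangentSpace (𝓡 3) y :=
  (LinearMap.exists_extend ((ξ.plane y).subtype ∘ₗ J.J y)).choose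

variable {y}

theorem ext_coe (v : ξ.plane y) : J.ext y v = J.J y v := by
  have := (LinearMap.exists_extend ((ξ.plane y).subtype ∘ₗ J.J y)).choose_spec
  exact congrArg (fun f => f v) this

theorem ext_mem {v : TangentSpace (𝓡 3) y} (hv : v ∈ ξ.plane y) : J.ext y v ∈ ξ.plane y := by
  have := J.ext_coe ⟨v, hv⟩
  rw [this]; exact Subtype.mem _

theorem ext_ext {v : TangentSpace (𝓡 3) y} (hv : v ∈ ξ.plane y) : J.ext y (J.ext y v) = -v := by
  have h := J.ext_coe ⟨v, hv⟩
  change J.ext y v = _ at h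
  rw [h, J.ext_coe, J.sq]; rfl

theorem isPositivePair {v : TangentSpace (𝓡 3) y} (hv : v ∈ ξ.plane y) (h0 : v ≠ 0) :
    IsPositivePair (ξ.orient y) v (J.ext y v) := by
  have := J.positive y ⟨v, hv⟩ (by simpa [Subtype.ext_iff] using h0)
  rwa [← J.ext_coe] at this

variable (y) in
/-- Multiplication of tangent vectors by complex numbers; it is an action on the contact plane. -/
def mul (z : ℂ) : TangentSpace (𝓡 3) y →ₗ[ℝ] TangentSpace (𝓡 3) y :=
  z.re • LinearMap.id + z.im • J.ext y

theorem mul_apply (z : ℂ) (v : TangentSpace (𝓡 3) y) :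
    J.mul y z v = z.re • v + z.im • J.ext y v := by
  simp [mul]

theorem mul_mem (z : ℂ) {v : TangentSpace (𝓡 3) y} (hv : v ∈ ξ.plane y) :
    J.mul y z v ∈ ξ.plane y := by
  rw [mul_apply]
  exact add_mem (Submodule.smul_mem _ _ hv) (Submodule.smul_mem _ _ (J.ext_mem hv))

theorem mul_mul (z w : ℂ) {v : TangentSpace (𝓡 3) y} (hv : v ∈ ξ.plane y) :
    J.mul y z (J.mul y w v) = J.mul y (z * w) v := by
  simp only [mul_apply, map_add, map_smul, J.ext_ext hv, Complex.mul_re, Complex.mul_im]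
  module

@[simp] theorem mul_one (v : TangentSpace (𝓡 3) y) : J.mul y 1 v = v := by
  simp [mul_apply]

theorem mul_real_mul (r : ℝ) (z : ℂ) (v : TangentSpace (𝓡 3) y) :
    J.mul y (r * z) v = r • J.mul y z v := by
  simp only [mul_apply, Complex.mul_re, Complex.mul_im, Complex.ofReal_re, Complex.ofReal_im]
  module

theorem mul_inj {v : TangentSpace (𝓡 3) y} (hv : v ∈ ξ.plane y) (h0 : v ≠ 0) {z w : ℂ}
    (h : J.mul y z v = J.mul y w v) : z = w := by
  rw [mul_apply, mul_apply] at h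
  have := (J.isPositivePair hv h0).linearIndependent.pair_coeffs h
  exact Complex.ext this.1 this.2

theorem mul_ne_zero {v : TangentSpace (𝓡 3) y} (hv : v ∈ ξ.plane y) (h0 : v ≠ 0) {z : ℂ}
    (hz : z ≠ 0) : J.mul y z v ≠ 0 := by
  intro h
  exact hz (J.mul_inj hv h0 (h.trans (by simp [mul_apply])))

theorem exists_mul {v w : TangentSpace (𝓡 3) y} (hv : v ∈ ξ.plane y) (h0 : v ≠ 0)
    (hw : w ∈ ξ.plane y) : ∃ z : ℂ, w = J.mul y z v := by
  obtain ⟨p, q, h⟩ := (J.isPositivePair hv h0).exists_coeffs hw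
  exact ⟨⟨p, q⟩, by rw [mul_apply]; exact h⟩

theorem plane_eq_span {v : TangentSpace (𝓡 3) y} (hv : v ∈ ξ.plane y) (h0 : v ≠ 0) :
    ξ.plane y = Submodule.span ℝ {v, J.ext y v} := by
  refine le_antisymm (fun w hw => ?_) ?_
  · obtain ⟨p, q, h⟩ := (J.isPositivePair hv h0).exists_coeffs hw
    exact Submodule.mem_span_pair.2 ⟨p, q, h.symm⟩
  · rw [Submodule.span_le]
    rintro w (rfl | rfl)
    · exact hv
    · exact J.ext_mem hv

variable (y) in
/-- Rotation by the angle `π s`. -/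
def rot (s : ℝ) : TangentSpace (𝓡 3) y →ₗ[ℝ] TangentSpace (𝓡 3) y := J.mul y (cisPi s)

theorem rot_apply (s : ℝ) (v : TangentSpace (𝓡 3) y) :
    J.rot y s v = Real.cos (Real.pi * s) • v + Real.sin (Real.pi * s) • J.ext y v := by
  rw [rot, mul_apply, cisPi_re, cisPi_im]

theorem rot_mem (s : ℝ) {v : TangentSpace (𝓡 3) y} (hv : v ∈ ξ.plane y) :
    J.rot y s v ∈ ξ.plane y := J.mul_mem _ hv

theorem rot_ne_zero (s : ℝ) {v : TangentSpace (𝓡 3) y} (hv : v ∈ ξ.plane y) (h0 : v ≠ 0) :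
    J.rot y s v ≠ 0 := J.mul_ne_zero hv h0 (cisPi_ne_zero s)

theorem rot_rot (s t : ℝ) {v : TangentSpace (𝓡 3) y} (hv : v ∈ ξ.plane y) :
    J.rot y s (J.rot y t v) = J.rot y (s + t) v := by
  rw [rot, rot, rot, J.mul_mul _ _ hv, cisPi_add]

@[simp] theorem rot_zero (v : TangentSpace (𝓡 3) y) : J.rot y 0 v = v := by simp [rot]

theorem rot_add_int (s : ℝ) (k : ℤ) (v : TangentSpace (𝓡 3) y) :
    J.rot y (s + k) v = ((-1 : ℝ) ^ k : ℝ) • J.rot y s v := by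
  rw [rot, rot, add_comm, cisPi_add, cisPi_int, J.mul_real_mul]

theorem rot_add_two_mul_int (s : ℝ) (k : ℤ) (v : TangentSpace (𝓡 3) y) :
    J.rot y (s + 2 * k) v = J.rot y s v := by
  rw [rot, rot, cisPi_add, cisPi_two_mul_int, _root_.mul_one]

theorem exists_rot {v w : TangentSpace (𝓡 3) y} (hv : v ∈ ξ.plane y) (h0 : v ≠ 0)
    (hw : w ∈ ξ.plane y) (hw0 : w ≠ 0) : ∃ (r s : ℝ), 0 < r ∧ w = r • J.rot y s v := by
  obtain ⟨z, rfl⟩ := J.exists_mul hv h0 hw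
  have hz : z ≠ 0 := by
    rintro rfl
    exact hw0 (by simp [mul_apply])
  obtain ⟨s, hs⟩ := exists_polar z
  refine ⟨‖z‖, s, norm_pos_iff.2 hz, ?_⟩
  rw [rot, ← J.mul_real_mul, ← hs]

theorem mem_span_rot_iff (s t : ℝ) {v : TangentSpace (𝓡 3) y} (hv : v ∈ ξ.plane y) (h0 : v ≠ 0) :
    J.rot y t v ∈ Submodule.span ℝ {J.rot y s v} ↔ ∃ k : ℤ, t = s + k := by
  constructor
  · intro h
    obtain ⟨c, hc⟩ := Submodule.mem_span_singleton.1 h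
    rw [rot, rot, ← J.mul_real_mul] at hc
    have h1 := J.mul_inj hv h0 hc
    have h2 : cisPi (t - s) = c := by
      have : cisPi (t - s) * cisPi s = c * cisPi s := by rw [← cisPi_add, sub_add_cancel, h1]
      exact mul_right_cancel₀ (cisPi_ne_zero s) this
    have h3 := congrArg Complex.im h2
    rw [cisPi_im, Complex.ofReal_im, Real.sin_eq_zero_iff] at h3
    obtain ⟨k, hk⟩ := h3
    refine ⟨k, ?_⟩
    have : (k : ℝ) = t - s := by
      have h4 : Real.pi * k = Real.pi * (t - s) := by rw [← hk]; ring
      exact mul_left_cancel₀ Real.pi_ne_zero h4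
    linarith
  · rintro ⟨k, rfl⟩
    rw [rot_add_int]
    exact Submodule.smul_mem _ _ (Submodule.mem_span_singleton_self _)

theorem span_rot_eq_iff (s t : ℝ) {v : TangentSpace (𝓡 3) y} (hv : v ∈ ξ.plane y) (h0 : v ≠ 0) :
    Submodule.span ℝ {J.rot y s v} = Submodule.span ℝ {J.rot y t v} ↔ ∃ k : ℤ, t = s + k := by
  rw [← J.mem_span_rot_iff s t hv h0]
  constructor
  · intro h; rw [h]; exact Submodule.mem_span_singleton_self _
  · intro h
    refine le_antisymm ?_ ?_
    · obtain ⟨k, hk⟩ := (J.mem_span_rot_iff s t hv h0).1 h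
      rw [Submodule.span_le, singleton_subset_iff, SetLike.mem_coe, J.mem_span_rot_iff t s hv h0]
      exact ⟨-k, by push_cast; linarith⟩
    · rwa [Submodule.span_le, singleton_subset_iff]

theorem sameRay_rot_iff (s t : ℝ) {v : TangentSpace (𝓡 3) y} (hv : v ∈ ξ.plane y) (h0 : v ≠ 0) :
    SameRay ℝ (J.rot y s v) (J.rot y t v) ↔ ∃ k : ℤ, t = s + 2 * k := by
  constructor
  · intro h
    obtain ⟨c, hc, hct⟩ := h.exists_pos_left (J.rot_ne_zero s hv h0) (J.rot_ne_zero t hv h0)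
    have hm : J.rot y t v ∈ Submodule.span ℝ {J.rot y s v} :=
      Submodule.mem_span_singleton.2 ⟨c, hct⟩
    obtain ⟨k, rfl⟩ := (J.mem_span_rot_iff s t hv h0).1 hm
    rw [rot_add_int] at hct
    have h1 : c = (-1 : ℝ) ^ k := by
      have h2 := sub_eq_zero.2 hct
      rw [← sub_smul] at h2
      exact sub_eq_zero.1 ((smul_eq_zero.1 h2).resolve_right (J.rot_ne_zero s hv h0))
    rcases Int.even_or_odd k with ⟨j, hj⟩ | hodd
    · exact ⟨j, by rw [hj]; push_cast; ring⟩
    · rw [hodd.neg_one_zpow] at h1; linarith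
  · rintro ⟨k, rfl⟩
    rw [rot_add_two_mul_int]

end ComplexStructure

end OrientedContactStructure

/-! ### Change of angular coordinate -/

/-- The angle with respect to a frame `(a, b)` of the vector which has angle `π * θ` with respect to the
frame `(a, p a + r b)`: the ray of `(cos πθ + p sin πθ, r sin πθ)` has angle `π * shear p r θ`. -/
def shear (p r θ : ℝ) : ℝ :=
  θ + (Complex.arg (cisPi (-θ) *
    ⟨Real.cos (Real.pi * θ) + p * Real.sin (Real.pi * θ), r * Real.sin (Real.pi * θ)⟩)) / Real.pi

section Shear

theorem shear_aux_mem (p : ℝ) {r : ℝ} (hr : 0 < r) (θ : ℝ) :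
    cisPi (-θ) * ⟨Real.cos (Real.pi * θ) + p * Real.sin (Real.pi * θ),
      r * Real.sin (Real.pi * θ)⟩ ∈ Complex.slitPlane := by
  rw [Complex.mem_slitPlane_iff_not_le_zero]
  intro hle
  set c := Real.cos (Real.pi * θ)
  set s := Real.sin (Real.pi * θ)
  have hcs : s ^ 2 + c ^ 2 = 1 := Real.sin_sq_add_cos_sq _
  have hre : (cisPi (-θ)).re = c := by rw [cisPi_re, mul_neg, Real.cos_neg]
  have him : (cisPi (-θ)).im = -s := by rw [cisPi_im, mul_neg, Real.sin_neg]
  rw [Complex.le_def] at hle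
  simp only [Complex.mul_re, Complex.mul_im, hre, him, Complex.zero_re, Complex.zero_im] at hle
  obtain ⟨h1, h2⟩ := hle
  -- multiplying by `cisPi θ` shows that the vector is a nonpositive multiple of `cisPi θ`
  have h3 : r * s = (c * (c + p * s) - -s * (r * s)) * s := by
    linear_combination (-r * s) * hcs + c * h2
  have h4 : c + p * s = (c * (c + p * s) - -s * (r * s)) * c := by
    linear_combination (-(c + p * s)) * hcs - s * h2
  by_cases hs : s = 0
  · rw [hs] at h4 hcs h1
    have : c ^ 2 = 1 := by nlinarith
    nlinarith
  · have : r = c * (c + p * s) - -s * (r * s) := mul_right_cancel₀ hs h3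
    linarith

theorem shear_polar (p : ℝ) {r : ℝ} (hr : 0 < r) (θ : ℝ) :
    ∃ ρ : ℝ, 0 < ρ ∧ (⟨Real.cos (Real.pi * θ) + p * Real.sin (Real.pi * θ),
      r * Real.sin (Real.pi * θ)⟩ : ℂ) = ρ * cisPi (shear p r θ) := by
  set w : ℂ := ⟨Real.cos (Real.pi * θ) + p * Real.sin (Real.pi * θ), r * Real.sin (Real.pi * θ)⟩
  have hmem := shear_aux_mem p hr θ
  have hne : cisPi (-θ) * w ≠ 0 := Complex.slitPlane_ne_zero hmem
  refine ⟨‖cisPi (-θ) * w‖, norm_pos_iff.2 hne, ?_⟩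
  have hpi : (Real.pi : ℂ) ≠ 0 := by exact_mod_cast Real.pi_ne_zero
  have h2 : cisPi (Complex.arg (cisPi (-θ) * w) / Real.pi) =
      Complex.exp (Complex.arg (cisPi (-θ) * w) * Complex.I) := by
    rw [cisPi]; push_cast; rw [mul_div_cancel₀ _ hpi]
  have h3 : cisPi (shear p r θ) = cisPi θ * Complex.exp (Complex.arg (cisPi (-θ) * w) * Complex.I) := by
    rw [shear, cisPi_add, h2]
  rw [h3, mul_left_comm, Complex.norm_mul_exp_arg_mul_I, ← mul_assoc, ← cisPi_add, add_neg_cancel,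
    cisPi_zero, one_mul]

@[simp] theorem shear_zero (p r : ℝ) : shear p r 0 = 0 := by
  have h : (⟨1, 0⟩ : ℂ) = 1 := rfl
  rw [shear, mul_zero, Real.cos_zero, Real.sin_zero, mul_zero, mul_zero, add_zero, h]
  simp

theorem shear_add_one (p r θ : ℝ) : shear p r (θ + 1) = shear p r θ + 1 := by
  have h1 : cisPi (-(θ + 1)) = - cisPi (-θ) := by
    rw [neg_add, cisPi_add]
    have := cisPi_int (-1)
    push_cast at this
    rw [this]; norm_num
  have h2 : (⟨Real.cos (Real.pi * (θ + 1)) + p * Real.sin (Real.pi * (θ + 1)),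
      r * Real.sin (Real.pi * (θ + 1))⟩ : ℂ) =
      -⟨Real.cos (Real.pi * θ) + p * Real.sin (Real.pi * θ), r * Real.sin (Real.pi * θ)⟩ := by
    rw [mul_add, _root_.mul_one, Real.cos_add_pi, Real.sin_add_pi]
    refine Complex.ext ?_ ?_
    · change _ = -(_ + _); ring
    · change _ = -(_ * _); ring
  rw [shear, shear, h1, h2, neg_mul_neg]
  ring

theorem shear_add_int (p r θ : ℝ) (k : ℤ) : shear p r (θ + k) = shear p r θ + k := by
  induction k using Int.induction_on generalizing θ with
  | zero => simp
  | succ i ih =>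
    push_cast at ih ⊢
    rw [← add_assoc, shear_add_one, ih]; ring
  | pred i ih =>
    push_cast at ih ⊢
    have := shear_add_one p r (θ + (-i - 1))
    rw [show θ + (-(i : ℝ) - 1) + 1 = θ + -i by ring, ih] at this
    linarith

theorem continuousWithinAt_shear {Z : Type*} [TopologicalSpace Z] {p r θ : Z → ℝ} {s : Set Z}
    {z : Z} (hp : ContinuousWithinAt p s z) (hr : ContinuousWithinAt r s z) (hr0 : 0 < r z)
    (hθ : ContinuousWithinAt θ s z) :
    ContinuousWithinAt (fun z => shear (p z) (r z) (θ z)) s z := by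
  unfold shear
  have hmk : Continuous fun q : ℝ × ℝ => (⟨q.1, q.2⟩ : ℂ) :=
    Complex.equivRealProdCLM.symm.continuous
  have hc : ContinuousWithinAt (fun z => Real.cos (Real.pi * θ z)) s z :=
    Real.continuous_cos.continuousAt.comp_continuousWithinAt (continuousWithinAt_const.mul hθ)
  have hs : ContinuousWithinAt (fun z => Real.sin (Real.pi * θ z)) s z :=
    Real.continuous_sin.continuousAt.comp_continuousWithinAt (continuousWithinAt_const.mul hθ)
  have hw : ContinuousWithinAt (fun z => (⟨Real.cos (Real.pi * θ z) + p z * Real.sin (Real.pi * θ z),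
      r z * Real.sin (Real.pi * θ z)⟩ : ℂ)) s z :=
    hmk.continuousAt.comp_continuousWithinAt (f := fun z => (Real.cos (Real.pi * θ z) +
      p z * Real.sin (Real.pi * θ z), r z * Real.sin (Real.pi * θ z)))
      ((hc.add (hp.mul hs)).prodMk (hr.mul hs))
  have hu : ContinuousWithinAt (fun z => cisPi (-θ z)) s z :=
    continuous_cisPi.continuousAt.comp_continuousWithinAt hθ.neg
  have hm : ContinuousWithinAt (fun z => cisPi (-θ z) * (⟨Real.cos (Real.pi * θ z) +
      p z * Real.sin (Real.pi * θ z), r z * Real.sin (Real.pi * θ z)⟩ : ℂ)) s z := hu.mul hw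
  exact hθ.add ((ContinuousAt.comp_continuousWithinAt (g := Complex.arg)
    (f := fun z => cisPi (-θ z) * (⟨Real.cos (Real.pi * θ z) +
      p z * Real.sin (Real.pi * θ z), r z * Real.sin (Real.pi * θ z)⟩ : ℂ))
    (Complex.continuousAt_arg (shear_aux_mem (p z) hr0 (θ z))) hm).div_const Real.pi)

end Shear

/-! ### Trivializations of circle bundles -/

section Trivializations

variable {M : Type*} [TopologicalSpace M] [ChartedSpace (EuclideanSpace ℝ (Fin 3)) M]
  {Q : Type*} [TopologicalSpace Q] [ChartedSpace (EuclideanSpace ℝ (Fin 4)) Q]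
  {π : Q → M} {pos : (q : Q) → Set (TangentSpace (𝓡 4) q)} {U : Set M} {E : M → ℝ → Q}

namespace IsTrivialization

theorem mono (h : IsTrivialization π pos U E) {V : Set M} (hV : V ⊆ U) :
    IsTrivialization π pos V E where
  smooth := h.smooth.mono (prod_mono hV subset_rfl)
  bijective_deriv y hy := h.bijective_deriv y (hV hy)
  range_eq y hy := h.range_eq y (hV hy)
  eq_iff y hy := h.eq_iff y (hV hy)
  pos_eq y hy := h.pos_eq y (hV hy)

theorem proj_apply (h : IsTrivialization π pos U E) {y : M} (hy : y ∈ U) (t : ℝ) : π (E y t) = y := by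
  have : E y t ∈ π ⁻¹' {y} := by rw [← h.range_eq y hy]; exact mem_range_self t
  exact this

theorem exists_eq (h : IsTrivialization π pos U E) {q : Q} (hq : π q ∈ U) : ∃ t, E (π q) t = q := by
  have : q ∈ range (E (π q)) := by rw [h.range_eq _ hq]; rfl
  exact this

theorem periodic (h : IsTrivialization π pos U E) {y : M} (hy : y ∈ U) (t : ℝ) (k : ℤ) :
    E y (t + k) = E y t := ((h.eq_iff y hy t (t + k)).2 ⟨k, rfl⟩).symm

theorem contMDiffAt (h : IsTrivialization π pos U E) (hU : IsOpen U) {y : M} (hy : y ∈ U) (t : ℝ) :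
    ContMDiffAt ((𝓡 3).prod 𝓘(ℝ, ℝ)) (𝓡 4) ∞ (fun p : M × ℝ => E p.1 p.2) (y, t) :=
  (h.smooth (y, t) ⟨hy, mem_univ t⟩).contMDiffAt ((hU.prod isOpen_univ).mem_nhds ⟨hy, mem_univ t⟩)

theorem continuousOn (h : IsTrivialization π pos U E) :
    ContinuousOn (fun p : M × ℝ => E p.1 p.2) (U ×ˢ univ) := h.smooth.continuousOn

theorem contMDiff_fiber (h : IsTrivialization π pos U E) {y : M} (hy : y ∈ U) :
    ContMDiff 𝓘(ℝ, ℝ) (𝓡 4) ∞ (E y) := by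
  rw [← contMDiffOn_univ]
  have h2 : ContMDiffOn 𝓘(ℝ, ℝ) ((𝓡 3).prod 𝓘(ℝ, ℝ)) ∞ (fun t : ℝ => (y, t)) univ :=
    (contMDiff_const.prodMk contMDiff_id).contMDiffOn
  exact h.smooth.comp h2 (fun t _ => ⟨hy, mem_univ t⟩)

/-- The positive unit vertical tangent vector of a trivialization. -/
theorem velocity_mem (h : IsTrivialization π pos U E) {y : M} (hy : y ∈ U) (t : ℝ) :
    (mfderiv 𝓘(ℝ, ℝ) (𝓡 4) (E y) t (1 : ℝ) : TangentSpace (𝓡 4) (E y t)) ∈ pos (E y t) := by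
  rw [h.pos_eq y hy t]
  exact ⟨1, one_pos, rfl⟩

theorem eq_smul_velocity (h : IsTrivialization π pos U E) {y : M} (hy : y ∈ U) {t : ℝ}
    {v : TangentSpace (𝓡 4) (E y t)} (hv : v ∈ pos (E y t)) :
    ∃ r : ℝ, 0 < r ∧ v = r • (mfderiv 𝓘(ℝ, ℝ) (𝓡 4) (E y) t (1 : ℝ) : TangentSpace (𝓡 4) (E y t)) := by
  rw [h.pos_eq y hy t] at hv
  obtain ⟨r, hr, rfl⟩ := hv
  refine ⟨r, hr, ?_⟩
  have h1 := (mfderiv 𝓘(ℝ, ℝ) (𝓡 4) (E y) t).map_smul r (1 : ℝ)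
  have h2 : (r • (1 : ℝ) : ℝ) = r := by simp
  rw [← h1]
  exact congrArg (mfderiv 𝓘(ℝ, ℝ) (𝓡 4) (E y) t) h2.symm

/-- The derivative of a function along the fibre. -/
theorem hasDerivAt_comp {G : Type*} [NormedAddCommGroup G] [NormedSpace ℝ G]
    (h : IsTrivialization π pos U E) {y : M} (hy : y ∈ U) {t : ℝ} {f : Q → G}
    (hf : MDifferentiableAt (𝓡 4) 𝓘(ℝ, G) f (E y t)) :
    HasDerivAt (fun s => f (E y s)) (mvfderiv (𝓡 4) f (E y t)
      (mfderiv 𝓘(ℝ, ℝ) (𝓡 4) (E y) t (1 : ℝ) : TangentSpace (𝓡 4) (E y t))) t := by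
  have h1 := (hf.hasMFDerivAt).comp t
    ((h.contMDiff_fiber hy).mdifferentiableAt (by simp)).hasMFDerivAt
  have h2 : HasFDerivAt (fun s => f (E y s)) ((mvfderiv (𝓡 4) f (E y t)).comp
      (mfderiv 𝓘(ℝ, ℝ) (𝓡 4) (E y) t) : ℝ →L[ℝ] G) t := hasMFDerivAt_iff_hasFDerivAt.1 h1
  exact h2.hasDerivAt

/-- Near each point of the total space, the fibre coordinate of a trivialization is a smooth
function `τ`, increasing in the positive direction. -/
theorem exists_coordinate [IsManifold (𝓡 3) ∞ M] [IsManifold (𝓡 4) ∞ Q]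
    (h : IsTrivialization π pos U E) (hU : IsOpen U) {y₀ : M}
    (hy₀ : y₀ ∈ U) (t₀ : ℝ) :
    ∃ (O : Set Q) (τ : Q → ℝ), IsOpen O ∧ E y₀ t₀ ∈ O ∧ O ⊆ π ⁻¹' U ∧
      ContMDiffOn (𝓡 4) 𝓘(ℝ, ℝ) ∞ τ O ∧ τ (E y₀ t₀) = t₀ ∧ (∀ q ∈ O, E (π q) (τ q) = q) ∧
      (∀ q ∈ O, ∀ v ∈ pos q, 0 < mvfderiv (𝓡 4) τ q v) := by
  set q₀ := E y₀ t₀ with hq₀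
  set φ := extChartAt (𝓡 4) q₀ with hφ
  set F : M × ℝ → EuclideanSpace ℝ (Fin 4) := fun p => φ (E p.1 p.2) with hF
  have hφo : IsOpen φ.source := isOpen_extChartAt_source q₀
  set P : Set (M × ℝ) := (U ×ˢ univ) ∩ (fun p : M × ℝ => E p.1 p.2) ⁻¹' φ.source with hP
  have hPo : IsOpen P := h.continuousOn.isOpen_inter_preimage (hU.prod isOpen_univ) hφo
  have hFP : ContMDiffOn ((𝓡 3).prod 𝓘(ℝ, ℝ)) 𝓘(ℝ, EuclideanSpace ℝ (Fin 4)) ∞ F P :=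
    (contMDiffOn_extChartAt (I := 𝓡 4) (x := q₀)).comp (h.smooth.mono inter_subset_left)
      (fun p hp => by simpa [hφ] using hp.2)
  have hp₀ : (y₀, t₀) ∈ P := ⟨⟨hy₀, mem_univ _⟩, mem_extChartAt_source q₀⟩
  have hb : Function.Bijective (mvfderiv ((𝓡 3).prod 𝓘(ℝ, ℝ)) F (y₀, t₀)) := by
    obtain ⟨A, hA⟩ := isInvertible_mfderiv_extChartAt (I := 𝓡 4) (mem_extChartAt_source (I := 𝓡 4) q₀)
    have hc : mfderiv ((𝓡 3).prod 𝓘(ℝ, ℝ)) 𝓘(ℝ, EuclideanSpace ℝ (Fin 4)) F (y₀, t₀) =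
      (mfderiv (𝓡 4) 𝓘(ℝ, EuclideanSpace ℝ (Fin 4)) φ q₀).comp
        (mfderiv ((𝓡 3).prod 𝓘(ℝ, ℝ)) (𝓡 4) (fun p : M × ℝ => E p.1 p.2) (y₀, t₀)) :=
      mfderiv_comp (y₀, t₀) (mdifferentiableAt_extChartAt (mem_chart_source _ q₀))
        ((h.contMDiffAt hU hy₀ t₀).mdifferentiableAt (by simp))
    rw [← hφ] at hA
    rw [← hA] at hc
    have hc2 : ⇑(mvfderiv ((𝓡 3).prod 𝓘(ℝ, ℝ)) F (y₀, t₀)) = ⇑A ∘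
        ⇑(mfderiv ((𝓡 3).prod 𝓘(ℝ, ℝ)) (𝓡 4) (fun p : M × ℝ => E p.1 p.2) (y₀, t₀)) := by
      funext v
      exact congrArg (fun B => B v) hc
    rw [hc2]
    exact A.bijective.comp (h.bijective_deriv y₀ hy₀ t₀)
  obtain ⟨Ψ, S, hS, hqS, hΨ, hΨq, hFΨ, hΨF⟩ := exists_smooth_local_inverse hPo hFP hp₀ hb
  obtain ⟨N, hN, hNo, hpN⟩ := eventually_nhds_iff.1 hΨF
  -- `O` is the set of points `q` over which `Ψ ∘ φ` inverts `E`
  set O₁ : Set Q := φ.source ∩ φ ⁻¹' S with hO₁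
  have hO₁o : IsOpen O₁ := (continuousOn_extChartAt q₀).isOpen_inter_preimage hφo hS
  have hsm : ContMDiffOn (𝓡 4) ((𝓡 3).prod 𝓘(ℝ, ℝ)) ∞ (fun q => Ψ (φ q)) O₁ :=
    hΨ.comp ((contMDiffOn_extChartAt (I := 𝓡 4) (x := q₀)).mono
      (fun q hq => by simpa [hφ] using hq.1)) (fun q hq => hq.2)
  set O : Set Q := O₁ ∩ (fun q => Ψ (φ q)) ⁻¹' N with hO
  have hOo : IsOpen O := hsm.continuousOn.isOpen_inter_preimage hO₁o hNo
  have hinv : ∀ q ∈ O, Ψ (φ q) ∈ P ∧ E (Ψ (φ q)).1 (Ψ (φ q)).2 = q := by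
    intro q hq
    obtain ⟨h1, h2⟩ := hFΨ _ hq.1.2
    exact ⟨h2, φ.injOn h2.2 hq.1.1 h1⟩
  have hfst : ∀ q ∈ O, (Ψ (φ q)).1 = π q := by
    intro q hq
    obtain ⟨h1, h2⟩ := hinv q hq
    have := h.proj_apply h1.1.1 (Ψ (φ q)).2
    rw [h2] at this; exact this.symm
  have hΨ₀ : Ψ (φ q₀) = (y₀, t₀) := hΨq
  have hqO : q₀ ∈ O := by
    refine ⟨⟨mem_extChartAt_source q₀, hqS⟩, ?_⟩
    rw [mem_preimage, hΨ₀]; exact hpN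
  have hτ : ContMDiffOn (𝓡 4) 𝓘(ℝ, ℝ) ∞ (fun q => (Ψ (φ q)).2) O :=
    fun q hq => (contMDiffAt_snd.comp_contMDiffWithinAt q ((hsm q hq.1).mono inter_subset_left))
  have hE : ∀ q ∈ O, E (π q) (Ψ (φ q)).2 = q := fun q hq => by
    rw [← hfst q hq]; exact (hinv q hq).2
  have hOU : O ⊆ π ⁻¹' U := fun q hq => by
    rw [mem_preimage, ← hfst q hq]; exact (hinv q hq).1.1.1
  refine ⟨O, fun q => (Ψ (φ q)).2, hOo, hqO, hOU, hτ, by simp [hΨ₀], hE, ?_⟩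
  intro q hq v hv
  have key : ∀ (t : ℝ), (Ψ (φ q)).2 = t → ∀ v ∈ pos (E (π q) t),
      0 < mvfderiv (𝓡 4) (fun q => (Ψ (φ q)).2) (E (π q) t) v := by
    intro t ht v hv
    have hy : π q ∈ U := hOU hq
    have hqE : E (π q) t = q := by rw [← ht]; exact hE q hq
    have hd := h.hasDerivAt_comp hy (t := t) (f := fun q => (Ψ (φ q)).2)
      (by rw [hqE]; exact ((hτ q hq).contMDiffAt (hOo.mem_nhds hq)).mdifferentiableAt (by simp))
    have hid : HasDerivAt (fun s => (Ψ (φ (E (π q) s))).2) 1 t := by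
      refine (hasDerivAt_id t).congr_of_eventuallyEq ?_
      have hpt : (π q, t) ∈ N := by
        have : Ψ (φ q) = (π q, t) := Prod.ext (hfst q hq) ht
        rw [← this]; exact hq.2
      have hcont : Continuous fun s : ℝ => (π q, s) := by fun_prop
      filter_upwards [hcont.continuousAt.preimage_mem_nhds (hNo.mem_nhds hpt)] with s hs
      have := hN _ hs
      simp only [hF] at this
      rw [this]; rfl
    obtain ⟨r, hr, rfl⟩ := h.eq_smul_velocity hy hv
    rw [map_smul, hd.unique hid]
    simpa using hr
  have := key _ rfl
  rw [hE q hq] at this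
  exact this v hv

/-- A lift of the identity of the fibre, expressed in two trivializations, has degree one. -/
theorem transition_add_one [IsManifold (𝓡 3) ∞ M] [IsManifold (𝓡 4) ∞ Q]
    {E' : M → ℝ → Q} {U' : Set M} (h : IsTrivialization π pos U E)
    (h' : IsTrivialization π pos U' E') (hU' : IsOpen U') {y : M} (hy : y ∈ U) (hy' : y ∈ U')
    {g : ℝ → ℝ} (hg : Continuous g) (hgE : ∀ t, E y t = E' y (g t)) (t : ℝ) :
    g (t + 1) = g t + 1 := by
  -- `g` is strictly increasing, since `E` and `E'` are both positively oriented
  have hmono : StrictMono g := by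
    have hder : ∀ t, ∃ d, HasDerivAt g d t ∧ 0 < d := by
      intro t
      obtain ⟨O, τ, hO, hqO, hOU, hτ, hτq, hEτ, hpos⟩ := h'.exists_coordinate hU' hy' (g t)
      rw [← hgE t] at hqO hτq
      have hd := h.hasDerivAt_comp hy (f := τ)
        (((hτ _ hqO).contMDiffAt (hO.mem_nhds hqO)).mdifferentiableAt (by simp))
      refine ⟨_, hd.congr_of_eventuallyEq ?_, hpos _ hqO _ (h.velocity_mem hy t)⟩
      have hcE : Continuous (E y) := (h.contMDiff_fiber hy).continuous
      have hev : ∀ᶠ s in 𝓝 t, E y s ∈ O := hcE.continuousAt.preimage_mem_nhds (hO.mem_nhds hqO)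
      have hτc : ContinuousAt (fun s => τ (E y s)) t := hd.continuousAt
      have hdiff : ∀ᶠ s in 𝓝 t, |τ (E y s) - g s| < 1 := by
        have : ContinuousAt (fun s => |τ (E y s) - g s|) t := (hτc.sub hg.continuousAt).abs
        refine this.eventually_lt continuousAt_const ?_
        simp [hτq]
      filter_upwards [hev, hdiff] with s hs1 hs2
      have h1 := hEτ _ hs1
      rw [h.proj_apply hy, hgE s] at h1
      obtain ⟨k, hk⟩ := (h'.eq_iff y hy' _ _).1 h1
      rw [← hgE] at hk
      rw [hk] at hs2
      have : k = 0 := by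
        have : |(k : ℝ)| < 1 := by rw [← abs_neg]; convert hs2 using 2; ring
        exact_mod_cast Int.abs_lt_one_iff.1 (by exact_mod_cast this)
      rw [hk, this]; simp
    choose d hd hpos using hder
    exact strictMono_of_deriv_pos (fun t => by rw [(hd t).deriv]; exact hpos t)
  have hint : ∃ k : ℤ, g (t + 1) = g t + k := by
    have h1 : E' y (g t) = E' y (g (t + 1)) := by
      rw [← hgE, ← hgE]
      have := h.periodic hy t 1
      simpa using this.symm
    exact (h'.eq_iff y hy' _ _).1 h1
  obtain ⟨k, hk⟩ := hint
  have hlt : g t < g (t + 1) := hmono (by linarith)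
  have hk1 : 1 ≤ k := by
    have : (0 : ℝ) < k := by linarith
    exact_mod_cast this
  rcases hk1.eq_or_lt with h1 | h1
  · rw [hk, ← h1]; simp
  · -- otherwise the fibre would be traversed more than once
    exfalso
    have hk2 : (2 : ℝ) ≤ k := by exact_mod_cast h1
    obtain ⟨s, hs, hgs⟩ := intermediate_value_Icc (by linarith : t ≤ t + 1) hg.continuousOn
      (show g t + 1 ∈ Icc (g t) (g (t + 1)) from ⟨by linarith, by linarith⟩)
    have h2 : E y t = E y s := by
      rw [hgE, hgE, hgs]
      have := h'.periodic hy' (g t) 1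
      simpa using this.symm
    obtain ⟨j, hj⟩ := (h.eq_iff y hy _ _).1 h2
    have hj0 : t < s := hmono.lt_iff_lt.1 (by linarith)
    have hj1 : s < t + 1 := hmono.lt_iff_lt.1 (by linarith)
    have h3 : (0 : ℝ) < j := by linarith
    have h4 : (j : ℝ) < 1 := by linarith
    have h5 : 0 < j := by exact_mod_cast h3
    have h6 : j < 1 := by exact_mod_cast h4
    omega

theorem transition_add_int [IsManifold (𝓡 3) ∞ M] [IsManifold (𝓡 4) ∞ Q]
    {E' : M → ℝ → Q} {U' : Set M} (h : IsTrivialization π pos U E)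
    (h' : IsTrivialization π pos U' E') (hU' : IsOpen U') {y : M} (hy : y ∈ U) (hy' : y ∈ U')
    {g : ℝ → ℝ} (hg : Continuous g) (hgE : ∀ t, E y t = E' y (g t)) (t : ℝ) (k : ℤ) :
    g (t + k) = g t + k := by
  have h1 := h.transition_add_one h' hU' hy hy' hg hgE
  induction k using Int.induction_on generalizing t with
  | zero => simp
  | succ i ih =>
    push_cast at ih ⊢
    rw [← add_assoc, h1, ih]; ring
  | pred i ih =>
    push_cast at ih ⊢
    have := h1 (t + (-i - 1))
    rw [show t + (-(i : ℝ) - 1) + 1 = t + -i by ring, ih] at this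
    linarith

/-- A function on the total space is continuous if it is so in a trivialization. -/
theorem continuousOn_of_comp [IsManifold (𝓡 3) ∞ M] [IsManifold (𝓡 4) ∞ Q] (hπ : Continuous π)
    {Y : Type*} [TopologicalSpace Y]
    (h : IsTrivialization π pos U E) (hU : IsOpen U) {f : Q → Y}
    (hf : ContinuousOn (fun p : M × ℝ => f (E p.1 p.2)) (U ×ˢ univ)) : ContinuousOn f (π ⁻¹' U) := by
  intro q hq
  obtain ⟨t, ht⟩ := h.exists_eq hq
  obtain ⟨O, τ, hO, hqO, hOU, hτ, hτq, hEτ, -⟩ := h.exists_coordinate hU hq t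
  rw [ht] at hqO hτq
  have h1 : ContinuousAt (fun q => (π q, τ q)) q :=
    hπ.continuousAt.prodMk (((hτ q hqO).continuousWithinAt).continuousAt (hO.mem_nhds hqO))
  have h2 : ContinuousAt (fun p : M × ℝ => f (E p.1 p.2)) (π q, τ q) :=
    (hf (π q, τ q) ⟨hq, mem_univ _⟩).continuousAt ((hU.prod isOpen_univ).mem_nhds
      (show (π q, τ q) ∈ U ×ˢ univ from ⟨hq, mem_univ _⟩))
  have h3 : ContinuousAt (fun q => f (E (π q) (τ q))) q := ContinuousAt.comp (f := fun q => (π q, τ q)) h2 h1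
  refine (h3.congr ?_).continuousWithinAt
  filter_upwards [hO.mem_nhds hqO] with z hz
  rw [hEτ z hz]

end IsTrivialization

end Trivializations

namespace OrientedCircleBundle

variable {M : Type*} [TopologicalSpace M] [ChartedSpace (EuclideanSpace ℝ (Fin 3)) M]
  {Q : Type*} [TopologicalSpace Q] [ChartedSpace (EuclideanSpace ℝ (Fin 4)) Q]
  (B : OrientedCircleBundle Q M)

theorem continuous_proj : Continuous B.proj := B.contMDiff_proj.continuous

theorem mdifferentiableAt_proj (q : Q) : MDifferentiableAt (𝓡 4) (𝓡 3) B.proj q :=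
  (B.contMDiff_proj q).mdifferentiableAt (by simp)

/-- The differential of the projection. -/
abbrev dproj (q : Q) : TangentSpace (𝓡 4) q →L[ℝ] TangentSpace (𝓡 3) (B.proj q) :=
  mfderiv (𝓡 4) (𝓡 3) B.proj q

theorem dproj_surjective (q : Q) : Function.Surjective (B.dproj q) := by
  obtain ⟨U, hU, hx, E, h⟩ := B.locallyTrivial (B.proj q)
  obtain ⟨t, ht⟩ := h.exists_eq hx
  have hE := (h.contMDiffAt hU hx t).mdifferentiableAt (by simp : (∞ : ℕ∞ω) ≠ 0)
  have hcomp := (B.mdifferentiableAt_proj (E (B.proj q) t)).hasMFDerivAt.comp (B.proj q, t)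
    hE.hasMFDerivAt
  have hfst : HasMFDerivAt ((𝓡 3).prod 𝓘(ℝ, ℝ)) (𝓡 3) (B.proj ∘ fun p : M × ℝ => E p.1 p.2)
      (B.proj q, t) (ContinuousLinearMap.fst ℝ (TangentSpace (𝓡 3) (B.proj q))
        (TangentSpace 𝓘(ℝ, ℝ) t)) := by
    refine (hasMFDerivAt_fst (x := (B.proj q, t))).congr_of_eventuallyEq ?_
    filter_upwards [(hU.prod isOpen_univ).mem_nhds
      (show (B.proj q, t) ∈ U ×ˢ univ from ⟨hx, mem_univ _⟩)] with p hp
    exact h.proj_apply hp.1 p.2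
  have heq := hasMFDerivAt_unique hcomp hfst
  have hs : Function.Surjective (B.dproj (E (B.proj q) t)) := by
    intro w
    have hw : (w : EuclideanSpace ℝ (Fin 3)) = (ContinuousLinearMap.fst ℝ (TangentSpace (𝓡 3) (B.proj q))
        (TangentSpace 𝓘(ℝ, ℝ) t)) ((w : EuclideanSpace ℝ (Fin 3)), (0 : ℝ)) := rfl
    refine ⟨mfderiv ((𝓡 3).prod 𝓘(ℝ, ℝ)) (𝓡 4) (fun p : M × ℝ => E p.1 p.2) (B.proj q, t)
      ((w : EuclideanSpace ℝ (Fin 3)), (0 : ℝ)), ?_⟩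
    exact (congrArg (fun A => A ((w : EuclideanSpace ℝ (Fin 3)), (0 : ℝ))) heq).trans hw.symm
  rw [ht] at hs
  exact hs

theorem finrank_ker_dproj (q : Q) :
    Module.finrank ℝ (LinearMap.ker (B.dproj q).toLinearMap) = 1 := by
  have : FiniteDimensional ℝ (TangentSpace (𝓡 4) q) :=
    inferInstanceAs (FiniteDimensional ℝ (EuclideanSpace ℝ (Fin 4)))
  have h := LinearMap.finrank_range_add_finrank_ker (B.dproj q).toLinearMap
  have hr : LinearMap.range (B.dproj q).toLinearMap = ⊤ :=
    LinearMap.range_eq_top.2 (B.dproj_surjective q)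
  rw [hr, finrank_top] at h
  have h3 : Module.finrank ℝ (TangentSpace (𝓡 3) (B.proj q)) = 3 := finrank_euclideanSpace_fin
  have h4 : Module.finrank ℝ (TangentSpace (𝓡 4) q) = 4 := finrank_euclideanSpace_fin
  omega

theorem dproj_of_mem_pos {q : Q} {v : TangentSpace (𝓡 4) q} (hv : v ∈ B.pos q) :
    B.dproj q v = 0 := by
  obtain ⟨U, hU, hx, E, h⟩ := B.locallyTrivial (B.proj q)
  obtain ⟨t, ht⟩ := h.exists_eq hx
  have key : ∀ v ∈ B.pos (E (B.proj q) t), B.dproj (E (B.proj q) t) v = 0 := by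
    intro v hv
    obtain ⟨r, -, rfl⟩ := h.eq_smul_velocity hx hv
    have hcomp := (B.mdifferentiableAt_proj (E (B.proj q) t)).hasMFDerivAt.comp t
      ((h.contMDiff_fiber hx).mdifferentiableAt (by simp)).hasMFDerivAt
    have hc : HasMFDerivAt 𝓘(ℝ, ℝ) (𝓡 3) (B.proj ∘ E (B.proj q)) t
        (0 : TangentSpace 𝓘(ℝ, ℝ) t →L[ℝ] TangentSpace (𝓡 3) (B.proj q)) := by
      refine (hasMFDerivAt_const (B.proj q) t).congr_of_eventuallyEq ?_
      filter_upwards with s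
      exact h.proj_apply hx s
    have := hasMFDerivAt_unique hcomp hc
    rw [map_smul]
    have h2 := congrArg (fun A => A (1 : ℝ)) this
    have h3 : B.dproj (E (B.proj q) t) (mfderiv 𝓘(ℝ, ℝ) (𝓡 4) (E (B.proj q)) t (1 : ℝ) :
      TangentSpace (𝓡 4) (E (B.proj q) t)) = 0 := h2
    rw [h3, smul_zero]
  rw [ht] at key
  exact key v hv

variable [IsManifold (𝓡 3) ∞ M] [IsManifold (𝓡 4) ∞ Q]

theorem ne_zero_of_mem_pos {q : Q} {v : TangentSpace (𝓡 4) q} (hv : v ∈ B.pos q) : v ≠ 0 := by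
  obtain ⟨U, hU, hx, E, h⟩ := B.locallyTrivial (B.proj q)
  obtain ⟨t, ht⟩ := h.exists_eq hx
  obtain ⟨O, τ, hO, hqO, -, -, -, -, hp⟩ := h.exists_coordinate hU hx t
  rw [ht] at hqO
  rintro rfl
  simpa using hp q hqO _ hv

omit [IsManifold (𝓡 3) ∞ M] [IsManifold (𝓡 4) ∞ Q] in
theorem pos_nonempty (q : Q) : (B.pos q).Nonempty := by
  obtain ⟨U, hU, hx, E, h⟩ := B.locallyTrivial (B.proj q)
  obtain ⟨t, ht⟩ := h.exists_eq hx
  have : (B.pos (E (B.proj q) t)).Nonempty := ⟨_, h.velocity_mem hx t⟩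
  rwa [ht] at this

/-- Vertical vectors are multiples of a positive one. -/
theorem exists_smul_of_vertical {q : Q} {v w : TangentSpace (𝓡 4) q} (hv : v ∈ B.pos q)
    (hw : B.dproj q w = 0) : ∃ c : ℝ, w = c • v := by
  obtain ⟨u, hu0, hu⟩ := finrank_eq_one_iff'.1 (B.finrank_ker_dproj q)
  obtain ⟨c, hc⟩ := hu ⟨v, B.dproj_of_mem_pos hv⟩
  obtain ⟨d, hd⟩ := hu ⟨w, hw⟩
  have hc' : c • (u : TangentSpace (𝓡 4) q) = v := congrArg Subtype.val hc
  have hd' : d • (u : TangentSpace (𝓡 4) q) = w := congrArg Subtype.val hd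
  have hc0 : c ≠ 0 := by
    rintro rfl
    exact B.ne_zero_of_mem_pos hv (by rw [← hc', zero_smul])
  refine ⟨d / c, ?_⟩
  rw [← hc', ← hd', smul_smul, div_mul_cancel₀ _ hc0]

theorem pos_iff {q : Q} {v w : TangentSpace (𝓡 4) q} (hv : v ∈ B.pos q) :
    w ∈ B.pos q ↔ ∃ c : ℝ, 0 < c ∧ w = c • v := by
  obtain ⟨U, hU, hx, E, h⟩ := B.locallyTrivial (B.proj q)
  obtain ⟨t, ht⟩ := h.exists_eq hx
  have key : ∀ v w, v ∈ B.pos (E (B.proj q) t) →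
      (w ∈ B.pos (E (B.proj q) t) ↔ ∃ c : ℝ, 0 < c ∧ w = c • v) := by
    intro v w hv
    obtain ⟨r, hr, rfl⟩ := h.eq_smul_velocity hx hv
    constructor
    · intro hw
      obtain ⟨s, hs, rfl⟩ := h.eq_smul_velocity hx hw
      exact ⟨s / r, div_pos hs hr, by rw [smul_smul, div_mul_cancel₀ _ hr.ne']⟩
    · rintro ⟨c, hc, rfl⟩
      rw [h.pos_eq _ hx]
      refine ⟨c * r, mul_pos hc hr, ?_⟩
      rw [smul_smul]
      have h1 := (mfderiv 𝓘(ℝ, ℝ) (𝓡 4) (E (B.proj q)) t).map_smul (c * r) (1 : ℝ)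
      have h2 : ((c * r) • (1 : ℝ) : ℝ) = c * r := by simp
      rw [← h1]
      exact congrArg (mfderiv 𝓘(ℝ, ℝ) (𝓡 4) (E (B.proj q)) t) h2
  rw [ht] at key
  exact key v w hv

end OrientedCircleBundle

/-! ### Smooth coefficients and smooth angles -/

section Coefficients

variable {G : Type*} [NormedAddCommGroup G] [InnerProductSpace ℝ G]

/-- The coefficient of `a` in a linear combination of `a` and `b`, by Cramer's rule for the Gram
matrix. -/
def frameCoeff (a b w : G) : ℝ :=
  (inner ℝ a w * inner ℝ b b - inner ℝ b w * inner ℝ a b) /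
    (inner ℝ a a * inner ℝ b b - inner ℝ a b * inner ℝ a b)

theorem gram_pos {a b : G} (h : LinearIndependent ℝ ![a, b]) :
    0 < inner ℝ a a * inner ℝ b b - inner ℝ a b * inner ℝ a b := by
  have hlt : |inner ℝ a b| < ‖a‖ * ‖b‖ := by
    refine lt_of_le_of_ne (abs_real_inner_le_norm a b) fun heq => ?_
    have ha : a ≠ 0 := h.ne_zero 0
    have hb : b ≠ 0 := h.ne_zero 1
    have h1 : |inner ℝ a b / (‖a‖ * ‖b‖)| = 1 := by
      rw [abs_div, heq, abs_of_nonneg (by positivity : 0 ≤ ‖a‖ * ‖b‖)]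
      exact div_self (by positivity)
    obtain ⟨-, r, -, hr⟩ := (abs_real_inner_div_norm_mul_norm_eq_one_iff a b).1 h1
    have := (LinearIndependent.pair_iff.1 h) r (-1) (by rw [hr]; simp)
    norm_num at this
  rw [real_inner_self_eq_norm_mul_norm, real_inner_self_eq_norm_mul_norm]
  have h2 : inner ℝ a b * inner ℝ a b < (‖a‖ * ‖b‖) * (‖a‖ * ‖b‖) := by
    rw [← abs_mul_abs_self (inner ℝ a b)]
    exact mul_self_lt_mul_self (abs_nonneg _) hlt
  nlinarith

theorem frameCoeff_left {a b : G} (h : LinearIndependent ℝ ![a, b]) (p q : ℝ) :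
    frameCoeff a b (p • a + q • b) = p := by
  have := (gram_pos h).ne'
  rw [frameCoeff, div_eq_iff this]
  simp only [inner_add_right, inner_smul_right, real_inner_comm a b]
  ring

theorem frameCoeff_right {a b : G} (h : LinearIndependent ℝ ![a, b]) (p q : ℝ) :
    frameCoeff b a (p • a + q • b) = q := by
  rw [add_comm]
  exact frameCoeff_left ((LinearIndependent.pair_symm_iff).1 h) q p

theorem contDiffAt_frameCoeff {a b w : G} (h : LinearIndependent ℝ ![a, b]) :
    ContDiffAt ℝ ∞ (fun x : G × G × G => frameCoeff x.1 x.2.1 x.2.2) (a, b, w) := by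
  unfold frameCoeff
  have h1 : ContDiffAt ℝ ∞ (fun x : G × G × G => x.1) (a, b, w) := contDiffAt_fst
  have h2 : ContDiffAt ℝ ∞ (fun x : G × G × G => x.2.1) (a, b, w) := contDiffAt_fst.snd'
  have h3 : ContDiffAt ℝ ∞ (fun x : G × G × G => x.2.2) (a, b, w) := contDiffAt_snd.snd'
  refine ContDiffAt.div (((h1.inner ℝ h3).mul (h2.inner ℝ h2)).sub
    ((h2.inner ℝ h3).mul (h1.inner ℝ h2))) (((h1.inner ℝ h1).mul (h2.inner ℝ h2)).sub
    ((h1.inner ℝ h2).mul (h1.inner ℝ h2))) (gram_pos h).ne'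

variable {E' : Type*} [NormedAddCommGroup E'] [NormedSpace ℝ E'] {H' : Type*} [TopologicalSpace H']
  {I' : ModelWithCorners ℝ E' H'} {P : Type*} [TopologicalSpace P] [ChartedSpace H' P]
  {s : Set P} {p₀ : P}

theorem ContMDiffWithinAt.frameCoeff {a b w : P → G}
    (ha : ContMDiffWithinAt I' 𝓘(ℝ, G) ∞ a s p₀) (hb : ContMDiffWithinAt I' 𝓘(ℝ, G) ∞ b s p₀)
    (hw : ContMDiffWithinAt I' 𝓘(ℝ, G) ∞ w s p₀) (h : LinearIndependent ℝ ![a p₀, b p₀]) :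
    ContMDiffWithinAt I' 𝓘(ℝ, ℝ) ∞ (fun p => frameCoeff (a p) (b p) (w p)) s p₀ :=
  ((contDiffAt_frameCoeff (w := w p₀) h).contMDiffAt).comp_contMDiffWithinAt
    (f := fun p => (a p, b p, w p)) p₀ (ha.prodMk_space (hb.prodMk_space hw))

/-- A determination of the angle (in units of `π`) of the complex number `u` close to `u₀`. -/
def angleNear (u₀ u : ℂ) : ℝ := (Complex.arg u₀ + Complex.arg (u / u₀)) / Real.pi

theorem eq_norm_mul_cisPi_angleNear {u₀ : ℂ} (h : u₀ ≠ 0) (u : ℂ) :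
    u = ‖u‖ * cisPi (angleNear u₀ u) := by
  have hpi : (Real.pi : ℂ) ≠ 0 := by exact_mod_cast Real.pi_ne_zero
  have h1 : cisPi (angleNear u₀ u) = Complex.exp (Complex.arg u₀ * Complex.I) *
      Complex.exp (Complex.arg (u / u₀) * Complex.I) := by
    rw [cisPi, angleNear, ← Complex.exp_add]
    push_cast
    rw [mul_div_cancel₀ _ hpi, add_mul]
  have h2 : u = u₀ * (u / u₀) := by field_simp
  have h3 : (‖u‖ : ℂ) = ‖u₀‖ * ‖u / u₀‖ := by
    rw [← Complex.ofReal_mul, ← norm_mul, ← h2]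
  calc u = u₀ * (u / u₀) := h2
    _ = (‖u₀‖ * Complex.exp (Complex.arg u₀ * Complex.I)) *
        (‖u / u₀‖ * Complex.exp (Complex.arg (u / u₀) * Complex.I)) := by
        rw [Complex.norm_mul_exp_arg_mul_I, Complex.norm_mul_exp_arg_mul_I]
    _ = _ := by rw [h1, h3]; ring

theorem contDiffAt_angleNear {u₀ u : ℂ} (h : u / u₀ ∈ Complex.slitPlane) :
    ContDiffAt ℝ ∞ (angleNear u₀) u := by
  unfold angleNear
  have h1 : ContDiffAt ℝ ∞ Complex.log (u / u₀) :=
    (Complex.contDiffAt_log h).restrict_scalars ℝ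
  have h2 : ContDiffAt ℝ ∞ (fun u : ℂ => u / u₀) u := contDiffAt_id.div_const u₀
  have h3 : ContDiffAt ℝ ∞ (fun u : ℂ => (Complex.log (u / u₀)).im) u :=
    (Complex.imCLM.contDiff.contDiffAt).comp u
      (ContDiffAt.comp (g := Complex.log) u h1 h2)
  simp only [Complex.log_im] at h3
  exact (contDiffAt_const.add h3).div_const _

/-- A continuous angle of a smooth complex number is smooth. -/
theorem ContMDiffWithinAt.of_angle {u : P → ℂ} {θ : P → ℝ}
    (hu : ContMDiffWithinAt I' 𝓘(ℝ, ℂ) ∞ u s p₀) (hu0 : u p₀ ≠ 0)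
    (hθ : ContinuousWithinAt θ s p₀) (hp₀ : p₀ ∈ s)
    (h : ∀ᶠ p in 𝓝[s] p₀, ∃ r : ℝ, 0 < r ∧ u p = r * cisPi (2 * θ p)) :
    ContMDiffWithinAt I' 𝓘(ℝ, ℝ) ∞ θ s p₀ := by
  -- near `p₀`, the angle `2 θ` agrees with `angleNear` up to a constant
  have hsm : ContMDiffWithinAt I' 𝓘(ℝ, ℝ) ∞ (fun p => angleNear (u p₀) (u p)) s p₀ :=
    ((contDiffAt_angleNear (u₀ := u p₀) (u := u p₀) (by rw [div_self hu0]; simp)).contMDiffAt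
      ).comp_contMDiffWithinAt p₀ hu
  set c := angleNear (u p₀) (u p₀) - 2 * θ p₀ with hc
  have hev : ∀ᶠ p in 𝓝[s] p₀, ∃ k : ℤ, angleNear (u p₀) (u p) - 2 * θ p = 2 * k := by
    filter_upwards [h] with p hp
    obtain ⟨r, hr, hrp⟩ := hp
    have h1 := eq_norm_mul_cisPi_angleNear hu0 (u p)
    have hn : ‖u p‖ = r := by
      rw [hrp, norm_mul, norm_cisPi, Complex.norm_real, Real.norm_of_nonneg hr.le, mul_one]
    rw [hn] at h1
    have h2 : cisPi (angleNear (u p₀) (u p)) = cisPi (2 * θ p) := by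
      have hr' : (r : ℂ) ≠ 0 := by exact_mod_cast hr.ne'
      exact mul_left_cancel₀ hr' (h1.symm.trans hrp)
    rw [cisPi, cisPi, Complex.exp_eq_exp_iff_exists_int] at h2
    obtain ⟨k, hk⟩ := h2
    refine ⟨k, ?_⟩
    have h3 := congrArg Complex.im hk
    simp at h3
    have h4 : Real.pi * (angleNear (u p₀) (u p)) = Real.pi * (2 * θ p + 2 * k) := by linarith
    have := mul_left_cancel₀ Real.pi_ne_zero h4
    linarith
  have hcont : ContinuousWithinAt (fun p => angleNear (u p₀) (u p) - 2 * θ p) s p₀ :=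
    hsm.continuousWithinAt.sub (continuousWithinAt_const.mul hθ)
  have hclose : ∀ᶠ p in 𝓝[s] p₀, |angleNear (u p₀) (u p) - 2 * θ p - c| < 1 := by
    have := (hcont.sub (continuousWithinAt_const (b := c))).abs
    refine this.eventually_lt continuousWithinAt_const ?_
    simp [hc]
  obtain ⟨k₀, hk₀⟩ := hev.self_of_nhdsWithin hp₀
  have heq : ∀ᶠ p in 𝓝[s] p₀, θ p = (angleNear (u p₀) (u p) - c) / 2 := by
    filter_upwards [hev, hclose] with p ⟨k, hk⟩ hp
    rw [hk, hc, hk₀] at hp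
    have h5 : |((2 * k - 2 * k₀ : ℤ) : ℝ)| < 1 := by push_cast; exact hp
    have h6 : (2 * k - 2 * k₀ : ℤ) = 0 := Int.abs_lt_one_iff.1 (by exact_mod_cast h5)
    have h7 : k = k₀ := by omega
    rw [hc, hk₀, ← h7, ← hk]; ring
  have hsm2 : ContMDiffWithinAt I' 𝓘(ℝ, ℝ) ∞ (fun p => (angleNear (u p₀) (u p) - c) / 2) s p₀ := by
    have : ContDiff ℝ ∞ (fun x : ℝ => (x - c) / 2) := by fun_prop
    exact (this.contMDiff.contMDiffAt).comp_contMDiffWithinAt p₀ hsm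
  exact hsm2.congr_of_eventuallyEq heq (heq.self_of_nhdsWithin hp₀)

end Coefficients

/-! ### Brackets of lifts of sections of a plane field -/

section LiftedBrackets

variable {M : Type*} [TopologicalSpace M] [ChartedSpace (EuclideanSpace ℝ (Fin 3)) M]
  [IsManifold (𝓡 3) ∞ M]
  {E : Type*} [NormedAddCommGroup E] [NormedSpace ℝ E] [FiniteDimensional ℝ E]
  {X : Type*} [TopologicalSpace X] [ChartedSpace E X] [IsManifold 𝓘(ℝ, E) ∞ X]
  {G : Type*} [NormedAddCommGroup G] [InnerProductSpace ℝ G] {e : M → G}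

/-- An immersion into a Euclidean space; it serves as a global system of coordinates. -/
structure IsImmersed (e : M → G) : Prop where
  smooth : ContMDiff (𝓡 3) 𝓘(ℝ, G) ∞ e
  injective : ∀ y, Function.Injective (mvfderiv (𝓡 3) e y)

theorem IsImmersed.linearIndependent (he : IsImmersed e) {y : M} {a b : TangentSpace (𝓡 3) y}
    (h : LinearIndependent ℝ ![a, b]) :
    LinearIndependent ℝ ![mvfderiv (𝓡 3) e y a, mvfderiv (𝓡 3) e y b] := by
  rw [LinearIndependent.pair_iff] at h ⊢
  intro s t hst
  apply h s t
  apply he.injective y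
  rw [map_add, map_smul, map_smul, hst, map_zero]

theorem IsImmersed.contMDiffWithinAt (he : IsImmersed e) {E' : Type*} [NormedAddCommGroup E']
    [NormedSpace ℝ E'] {H' : Type*} [TopologicalSpace H'] {I' : ModelWithCorners ℝ E' H'}
    {P : Type*} [TopologicalSpace P] [ChartedSpace H' P] {s : Set P}
    {g : P → M} {v : (p : P) → TangentSpace (𝓡 3) (g p)} {p₀ : P}
    (hv : ContMDiffWithinAt I' (𝓡 3).tangent ∞ (fun p => (⟨g p, v p⟩ : TangentBundle (𝓡 3) M)) s p₀) :
    ContMDiffWithinAt I' 𝓘(ℝ, G) ∞ (fun p => mvfderiv (𝓡 3) e (g p) (v p)) s p₀ :=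
  ContMDiffAt.mvfderiv_apply_field isOpen_univ he.smooth.contMDiffOn (mem_univ _) hv

theorem SmoothFieldOn.mdifferentiableAt {H : Type*} [TopologicalSpace H]
    {I : ModelWithCorners ℝ E H} {X : Type*} [TopologicalSpace X] [ChartedSpace H X]
    [IsManifold I ∞ X] {V : (q : X) → TangentSpace I q} {O : Set X}
    (hV : SmoothFieldOn I V O) (hO : IsOpen O) {q : X} (hq : q ∈ O) :
    MDifferentiableAt I I.tangent (fun q => (⟨q, V q⟩ : TangentBundle I X)) q :=
  ((hV q hq).contMDiffAt (hO.mem_nhds hq)).mdifferentiableAt (by simp)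

theorem mvfderiv_immersion_comp (he : IsImmersed e) {π : X → M} (hπ : ContMDiff 𝓘(ℝ, E) (𝓡 3) ∞ π)
    (q : X) (v : TangentSpace 𝓘(ℝ, E) q) :
    mvfderiv 𝓘(ℝ, E) (e ∘ π) q v = mvfderiv (𝓡 3) e (π q) (mfderiv 𝓘(ℝ, E) (𝓡 3) π q v) := by
  have := mfderiv_comp q ((he.smooth (π q)).mdifferentiableAt (by simp))
    ((hπ q).mdifferentiableAt (by simp))
  exact congrArg (fun A => A v) this

theorem mvfderiv_comp_proj {f : M → G} {π : X → M} {q : X}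
    (hf : MDifferentiableAt (𝓡 3) 𝓘(ℝ, G) f (π q)) (hπ : ContMDiff 𝓘(ℝ, E) (𝓡 3) ∞ π)
    (v : TangentSpace 𝓘(ℝ, E) q) :
    mvfderiv 𝓘(ℝ, E) (fun q => f (π q)) q v =
      mvfderiv (𝓡 3) f (π q) (mfderiv 𝓘(ℝ, E) (𝓡 3) π q v) := by
  have := mfderiv_comp q hf ((hπ q).mdifferentiableAt (by simp))
  exact congrArg (fun A => A v) this

theorem mvfderiv_smul_apply {f : X → ℝ} {g : X → G} {q : X}
    (hf : MDifferentiableAt 𝓘(ℝ, E) 𝓘(ℝ, ℝ) f q) (hg : MDifferentiableAt 𝓘(ℝ, E) 𝓘(ℝ, G) g q)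
    (v : TangentSpace 𝓘(ℝ, E) q) :
    mvfderiv 𝓘(ℝ, E) (fun q => f q • g q) q v =
      f q • mvfderiv 𝓘(ℝ, E) g q v + (mvfderiv 𝓘(ℝ, E) f q v) • g q := by
  rw [mvfderiv_fun_smul hf hg]; rfl

theorem mvfderiv_congr {f g : X → G} {q : X} (h : f =ᶠ[𝓝 q] g) :
    mvfderiv 𝓘(ℝ, E) f q = mvfderiv 𝓘(ℝ, E) g q := by
  ext v
  have : mfderiv 𝓘(ℝ, E) 𝓘(ℝ, G) f q = mfderiv 𝓘(ℝ, E) 𝓘(ℝ, G) g q := h.mfderiv_eq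
  exact congrArg (fun A => A v) this

/-- Modulo the plane field spanned by `a` and `b`, the bracket of two lifts of sections is the
determinant of their coefficients times `[a, b]`. -/
theorem dproj_mlieBracket_eq (he : IsImmersed e) {π : X → M} (hπ : ContMDiff 𝓘(ℝ, E) (𝓡 3) ∞ π)
    {U : Set M} (hU : IsOpen U) {a b : (y : M) → TangentSpace (𝓡 3) y}
    (ha : SmoothFieldOn (𝓡 3) a U) (hb : SmoothFieldOn (𝓡 3) b U)
    (hab : ∀ y ∈ U, LinearIndependent ℝ ![a y, b y])
    {O : Set X} (hO : IsOpen O) {V W : (q : X) → TangentSpace 𝓘(ℝ, E) q}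
    (hV : SmoothFieldOn 𝓘(ℝ, E) V O) (hW : SmoothFieldOn 𝓘(ℝ, E) W O)
    (hVm : ∀ q ∈ O, mfderiv 𝓘(ℝ, E) (𝓡 3) π q (V q) ∈ Submodule.span ℝ {a (π q), b (π q)})
    (hWm : ∀ q ∈ O, mfderiv 𝓘(ℝ, E) (𝓡 3) π q (W q) ∈ Submodule.span ℝ {a (π q), b (π q)})
    {q₀ : X} (hq₀ : q₀ ∈ O) (hq₀U : π q₀ ∈ U) {f₁ f₂ g₁ g₂ : ℝ}
    (hf : mfderiv 𝓘(ℝ, E) (𝓡 3) π q₀ (V q₀) = f₁ • a (π q₀) + f₂ • b (π q₀))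
    (hg : mfderiv 𝓘(ℝ, E) (𝓡 3) π q₀ (W q₀) = g₁ • a (π q₀) + g₂ • b (π q₀)) :
    ∃ c d : ℝ, mfderiv 𝓘(ℝ, E) (𝓡 3) π q₀ (VectorField.mlieBracket 𝓘(ℝ, E) V W q₀) =
      c • a (π q₀) + d • b (π q₀) +
        (f₁ * g₂ - f₂ * g₁) • VectorField.mlieBracket (𝓡 3) a b (π q₀) := by
  set p : X → G := e ∘ π with hp
  set α : M → G := fun y => mvfderiv (𝓡 3) e y (a y) with hα
  set β : M → G := fun y => mvfderiv (𝓡 3) e y (b y) with hβ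
  have hps : ContMDiff 𝓘(ℝ, E) 𝓘(ℝ, G) ∞ p := he.smooth.comp hπ
  have hαs : ∀ y ∈ U, ContMDiffAt (𝓡 3) 𝓘(ℝ, G) ∞ α y := fun y hy =>
    (he.contMDiffWithinAt (ha y hy)).contMDiffAt (hU.mem_nhds hy)
  have hβs : ∀ y ∈ U, ContMDiffAt (𝓡 3) 𝓘(ℝ, G) ∞ β y := fun y hy =>
    (he.contMDiffWithinAt (hb y hy)).contMDiffAt (hU.mem_nhds hy)
  have hαd : MDifferentiableAt (𝓡 3) 𝓘(ℝ, G) α (π q₀) := (hαs _ hq₀U).mdifferentiableAt (by simp)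
  have hβd : MDifferentiableAt (𝓡 3) 𝓘(ℝ, G) β (π q₀) := (hβs _ hq₀U).mdifferentiableAt (by simp)
  have hαπ : ContMDiffAt 𝓘(ℝ, E) 𝓘(ℝ, G) ∞ (fun q => α (π q)) q₀ :=
    ContMDiffAt.comp q₀ (hαs _ hq₀U) (hπ q₀)
  have hβπ : ContMDiffAt 𝓘(ℝ, E) 𝓘(ℝ, G) ∞ (fun q => β (π q)) q₀ :=
    ContMDiffAt.comp q₀ (hβs _ hq₀U) (hπ q₀)
  have hli : ∀ y ∈ U, LinearIndependent ℝ ![α y, β y] := fun y hy =>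
    he.linearIndependent (hab y hy)
  set N : Set X := O ∩ π ⁻¹' U with hN
  have hNo : N ∈ 𝓝 q₀ := (hO.inter (hU.preimage hπ.continuous)).mem_nhds ⟨hq₀, hq₀U⟩
  -- the coefficients of a lift are smooth functions
  have main : ∀ {V : (q : X) → TangentSpace 𝓘(ℝ, E) q}, SmoothFieldOn 𝓘(ℝ, E) V O →
      (∀ q ∈ O, mfderiv 𝓘(ℝ, E) (𝓡 3) π q (V q) ∈ Submodule.span ℝ {a (π q), b (π q)}) →
      ∀ {f₁ f₂ : ℝ}, mfderiv 𝓘(ℝ, E) (𝓡 3) π q₀ (V q₀) = f₁ • a (π q₀) + f₂ • b (π q₀) →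
      ∃ c d : TangentSpace 𝓘(ℝ, E) q₀ → ℝ, ∀ w : TangentSpace 𝓘(ℝ, E) q₀,
        mvfderiv 𝓘(ℝ, E) (fun q => mvfderiv 𝓘(ℝ, E) p q (V q)) q₀ w =
        c w • α (π q₀) + d w • β (π q₀) +
        (f₁ • mvfderiv (𝓡 3) α (π q₀) (mfderiv 𝓘(ℝ, E) (𝓡 3) π q₀ w) +
        f₂ • mvfderiv (𝓡 3) β (π q₀) (mfderiv 𝓘(ℝ, E) (𝓡 3) π q₀ w)) := by
    intro V hV hVm f₁ f₂ hf
    set φ₁ : X → ℝ := fun q => frameCoeff (α (π q)) (β (π q)) (mvfderiv 𝓘(ℝ, E) p q (V q)) with hφ₁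
    set φ₂ : X → ℝ := fun q => frameCoeff (β (π q)) (α (π q)) (mvfderiv 𝓘(ℝ, E) p q (V q)) with hφ₂
    have hpV : ContMDiffAt 𝓘(ℝ, E) 𝓘(ℝ, G) ∞ (fun q => mvfderiv 𝓘(ℝ, E) p q (V q)) q₀ :=
      (ContMDiffAt.mvfderiv_apply_field isOpen_univ hps.contMDiffOn (mem_univ _)
        (hV q₀ hq₀)).contMDiffAt (hO.mem_nhds hq₀)
    have h1 : MDifferentiableAt 𝓘(ℝ, E) 𝓘(ℝ, ℝ) φ₁ q₀ := by
      rw [← mdifferentiableWithinAt_univ]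
      exact (ContMDiffWithinAt.frameCoeff hαπ.contMDiffWithinAt hβπ.contMDiffWithinAt
        hpV.contMDiffWithinAt (hli _ hq₀U)).mdifferentiableWithinAt (by simp)
    have h2 : MDifferentiableAt 𝓘(ℝ, E) 𝓘(ℝ, ℝ) φ₂ q₀ := by
      rw [← mdifferentiableWithinAt_univ]
      exact (ContMDiffWithinAt.frameCoeff hβπ.contMDiffWithinAt hαπ.contMDiffWithinAt
        hpV.contMDiffWithinAt ((LinearIndependent.pair_symm_iff).1
          (hli _ hq₀U))).mdifferentiableWithinAt (by simp)
    have hco : ∀ q ∈ N, ∀ s t : ℝ, mfderiv 𝓘(ℝ, E) (𝓡 3) π q (V q) = s • a (π q) + t • b (π q) →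
        mvfderiv 𝓘(ℝ, E) p q (V q) = s • α (π q) + t • β (π q) ∧ φ₁ q = s ∧ φ₂ q = t := by
      intro q hq s t hst
      have h3 : mvfderiv 𝓘(ℝ, E) p q (V q) = s • α (π q) + t • β (π q) := by
        rw [hp, mvfderiv_immersion_comp he hπ, hst, map_add, map_smul, map_smul]
      refine ⟨h3, ?_, ?_⟩
      · simp only [hφ₁]; rw [h3, frameCoeff_left (hli _ hq.2)]
      · simp only [hφ₂]; rw [h3, frameCoeff_right (hli _ hq.2)]
    have hev : (fun q => mvfderiv 𝓘(ℝ, E) p q (V q)) =ᶠ[𝓝 q₀]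
        fun q => φ₁ q • α (π q) + φ₂ q • β (π q) := by
      filter_upwards [hNo] with q hq
      obtain ⟨s, t, hst⟩ := Submodule.mem_span_pair.1 (hVm q hq.1)
      obtain ⟨h3, h4, h5⟩ := hco q hq s t hst.symm
      rw [h3, h4, h5]
    obtain ⟨-, h4, h5⟩ := hco q₀ ⟨hq₀, hq₀U⟩ f₁ f₂ hf
    refine ⟨fun w => mvfderiv 𝓘(ℝ, E) φ₁ q₀ w, fun w => mvfderiv 𝓘(ℝ, E) φ₂ q₀ w, fun w => ?_⟩
    have hαm : MDifferentiableAt 𝓘(ℝ, E) 𝓘(ℝ, G) (fun q => α (π q)) q₀ :=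
      hαπ.mdifferentiableAt (by simp)
    have hβm : MDifferentiableAt 𝓘(ℝ, E) 𝓘(ℝ, G) (fun q => β (π q)) q₀ :=
      hβπ.mdifferentiableAt (by simp)
    have hadd : mvfderiv 𝓘(ℝ, E) (fun q => φ₁ q • α (π q) + φ₂ q • β (π q)) q₀ =
        mvfderiv 𝓘(ℝ, E) (fun q => φ₁ q • α (π q)) q₀ +
          mvfderiv 𝓘(ℝ, E) (fun q => φ₂ q • β (π q)) q₀ :=
      mvfderiv_fun_add (h1.smul hαm) (h2.smul hβm)
    rw [mvfderiv_congr hev, hadd,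
      add_apply, mvfderiv_smul_apply h1 hαm, mvfderiv_smul_apply h2 hβm,
      mvfderiv_comp_proj hαd hπ, mvfderiv_comp_proj hβd hπ, h4, h5]
    module
  obtain ⟨c₁, d₁, h1⟩ := main hV hVm hf
  obtain ⟨c₂, d₂, h2⟩ := main hW hWm hg
  refine ⟨c₂ (V q₀) - c₁ (W q₀), d₂ (V q₀) - d₁ (W q₀), ?_⟩
  apply he.injective (π q₀)
  have hbr := mvfderiv_mlieBracket isOpen_univ hps.contMDiffOn (mem_univ q₀)
    (hV.mdifferentiableAt hO hq₀) (hW.mdifferentiableAt hO hq₀)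
  have hbr2 := mvfderiv_mlieBracket isOpen_univ he.smooth.contMDiffOn (mem_univ (π q₀))
    (ha.mdifferentiableAt hU hq₀U) (hb.mdifferentiableAt hU hq₀U)
  rw [← mvfderiv_immersion_comp he hπ, ← hp, hbr, h1, h2, hf, hg]
  simp only [map_add, map_smul]
  rw [hbr2]
  simp only [← hα, ← hβ]
  have e1 : mvfderiv (𝓡 3) e (π q₀) (a (π q₀)) = α (π q₀) := rfl
  have e2 : mvfderiv (𝓡 3) e (π q₀) (b (π q₀)) = β (π q₀) := rfl
  rw [e1, e2]
  module

/-- If two fields project to multiples of `w`, then modulo `w` their bracket projects to the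
derivative of `w` in a vertical direction. -/
theorem mvfderiv_mlieBracket_eq_of_smul {p : X → G} (hps : ContMDiff 𝓘(ℝ, E) 𝓘(ℝ, G) ∞ p)
    {O : Set X} (hO : IsOpen O) {V W : (q : X) → TangentSpace 𝓘(ℝ, E) q}
    (hV : SmoothFieldOn 𝓘(ℝ, E) V O) (hW : SmoothFieldOn 𝓘(ℝ, E) W O) {w : X → G} {q₀ : X}
    (hq₀ : q₀ ∈ O) (hw : ContMDiffAt 𝓘(ℝ, E) 𝓘(ℝ, G) ∞ w q₀) (hw0 : w q₀ ≠ 0)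
    (hVw : ∀ᶠ q in 𝓝 q₀, w q ≠ 0 ∧ ∃ f : ℝ, mvfderiv 𝓘(ℝ, E) p q (V q) = f • w q)
    (hWw : ∀ᶠ q in 𝓝 q₀, ∃ g : ℝ, mvfderiv 𝓘(ℝ, E) p q (W q) = g • w q) {f g : ℝ}
    (hf : mvfderiv 𝓘(ℝ, E) p q₀ (V q₀) = f • w q₀) (hg : mvfderiv 𝓘(ℝ, E) p q₀ (W q₀) = g • w q₀) :
    ∃ c : ℝ, mvfderiv 𝓘(ℝ, E) p q₀ (VectorField.mlieBracket 𝓘(ℝ, E) V W q₀) =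
      c • w q₀ + mvfderiv 𝓘(ℝ, E) w q₀ (g • V q₀ - f • W q₀) := by
  have main : ∀ {V : (q : X) → TangentSpace 𝓘(ℝ, E) q}, SmoothFieldOn 𝓘(ℝ, E) V O →
      (∀ᶠ q in 𝓝 q₀, w q ≠ 0 ∧ ∃ f : ℝ, mvfderiv 𝓘(ℝ, E) p q (V q) = f • w q) →
      ∀ {f : ℝ}, mvfderiv 𝓘(ℝ, E) p q₀ (V q₀) = f • w q₀ →
      ∃ c : TangentSpace 𝓘(ℝ, E) q₀ → ℝ, ∀ v,
        mvfderiv 𝓘(ℝ, E) (fun q => mvfderiv 𝓘(ℝ, E) p q (V q)) q₀ v =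
        c v • w q₀ + f • mvfderiv 𝓘(ℝ, E) w q₀ v := by
    intro V hV hVw f hf
    have hpV : ContMDiffAt 𝓘(ℝ, E) 𝓘(ℝ, G) ∞ (fun q => mvfderiv 𝓘(ℝ, E) p q (V q)) q₀ :=
      (ContMDiffAt.mvfderiv_apply_field isOpen_univ hps.contMDiffOn (mem_univ _)
        (hV q₀ hq₀)).contMDiffAt (hO.mem_nhds hq₀)
    set φ : X → ℝ := fun q => inner ℝ (w q) (mvfderiv 𝓘(ℝ, E) p q (V q)) / inner ℝ (w q) (w q) with hφ
    have hφd : MDifferentiableAt 𝓘(ℝ, E) 𝓘(ℝ, ℝ) φ q₀ := by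
      have h1 : ContDiffAt ℝ ∞ (fun x : G × G => inner ℝ x.1 x.2 / inner ℝ x.1 x.1)
          (w q₀, mvfderiv 𝓘(ℝ, E) p q₀ (V q₀)) :=
        (contDiffAt_fst.inner ℝ contDiffAt_snd).div (contDiffAt_fst.inner ℝ contDiffAt_fst)
          (inner_self_ne_zero.2 hw0)
      exact (ContMDiffAt.comp (f := fun q => (w q, mvfderiv 𝓘(ℝ, E) p q (V q))) q₀ h1.contMDiffAt
        (hw.prodMk_space hpV)).mdifferentiableAt (by simp)
    have hco : ∀ q, w q ≠ 0 → ∀ s : ℝ, mvfderiv 𝓘(ℝ, E) p q (V q) = s • w q → φ q = s := by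
      intro q hq s hs
      simp only [hφ]
      rw [hs, inner_smul_right, mul_div_cancel_right₀ _ (inner_self_ne_zero.2 hq)]
    have hev : (fun q => mvfderiv 𝓘(ℝ, E) p q (V q)) =ᶠ[𝓝 q₀] fun q => φ q • w q := by
      filter_upwards [hVw] with q ⟨hq, s, hs⟩
      rw [hco q hq s hs, hs]
    refine ⟨fun v => mvfderiv 𝓘(ℝ, E) φ q₀ v, fun v => ?_⟩
    rw [mvfderiv_congr hev, mvfderiv_smul_apply hφd (hw.mdifferentiableAt (by simp)),
      hco q₀ hw0 f hf]
    abel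
  obtain ⟨c₁, h1⟩ := main hV hVw hf
  obtain ⟨c₂, h2⟩ := main hW ((hVw.mono fun q h => h.1).and hWw) hg
  refine ⟨c₂ (V q₀) - c₁ (W q₀), ?_⟩
  rw [mvfderiv_mlieBracket isOpen_univ hps.contMDiffOn (mem_univ q₀)
    (hV.mdifferentiableAt hO hq₀) (hW.mdifferentiableAt hO hq₀), h1, h2, map_sub, map_smul, map_smul]
  module

end LiftedBrackets

/-! ### Frames of contact structures and compatible complex structures -/

section Immersions

variable {M : Type*} [TopologicalSpace M] [ChartedSpace (EuclideanSpace ℝ (Fin 3)) M]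
  [IsManifold (𝓡 3) ∞ M]

theorem exists_isImmersed (M : Type*) [TopologicalSpace M]
    [ChartedSpace (EuclideanSpace ℝ (Fin 3)) M] [IsManifold (𝓡 3) ∞ M] [T2Space M]
    [CompactSpace M] :
    ∃ (n : ℕ) (e : M → EuclideanSpace ℝ (Fin n)), IsImmersed e := by
  obtain ⟨n, e, h1, -, h2⟩ := exists_embedding_euclidean_of_compact (I := 𝓡 3) (M := M)
  exact ⟨n, e, h1, fun y => h2 y⟩

end Immersions

section QuarterTurn

variable {T : Type*} [AddCommGroup T] [Module ℝ T]
  {G : Type*} [NormedAddCommGroup G] [InnerProductSpace ℝ G]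

/-- Rotation by a quarter turn in the plane spanned by `a` and `b`, oriented by `(a, b)`, for the
metric induced by an injective linear map `d` to a Euclidean space. -/
def quarterTurn (d : T →ₗ[ℝ] G) (a b : T) : T →ₗ[ℝ] T :=
  (√(inner ℝ (d a) (d a) * inner ℝ (d b) (d b) - inner ℝ (d a) (d b) * inner ℝ (d a) (d b)))⁻¹ •
    (((innerₛₗ ℝ (d a)).comp d).smulRight b - ((innerₛₗ ℝ (d b)).comp d).smulRight a)

theorem quarterTurn_apply (d : T →ₗ[ℝ] G) (a b v : T) :
    quarterTurn d a b v = (√(inner ℝ (d a) (d a) * inner ℝ (d b) (d b) -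
      inner ℝ (d a) (d b) * inner ℝ (d a) (d b)))⁻¹ •
        ((inner ℝ (d a) (d v) : ℝ) • b - (inner ℝ (d b) (d v) : ℝ) • a) := by
  simp [quarterTurn]

theorem quarterTurn_congr (d : T →ₗ[ℝ] G) (a b : T) {p q r s : ℝ} (h : 0 < p * s - q * r) (v : T) :
    quarterTurn d (p • a + q • b) (r • a + s • b) v = quarterTurn d a b v := by
  rw [quarterTurn_apply, quarterTurn_apply]
  have hg : inner ℝ (d (p • a + q • b)) (d (p • a + q • b)) *
      inner ℝ (d (r • a + s • b)) (d (r • a + s • b)) -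
      inner ℝ (d (p • a + q • b)) (d (r • a + s • b)) *
        inner ℝ (d (p • a + q • b)) (d (r • a + s • b)) =
      (p * s - q * r) ^ 2 * (inner ℝ (d a) (d a) * inner ℝ (d b) (d b) -
        inner ℝ (d a) (d b) * inner ℝ (d a) (d b)) := by
    simp only [map_add, map_smul, inner_add_left, inner_add_right, inner_smul_left,
      inner_smul_right, real_inner_comm (d a) (d b), RCLike.conj_to_real]
    ring
  have hv : (inner ℝ (d (p • a + q • b)) (d v) : ℝ) • (r • a + s • b) -
      (inner ℝ (d (r • a + s • b)) (d v) : ℝ) • (p • a + q • b) =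
      (p * s - q * r) • ((inner ℝ (d a) (d v) : ℝ) • b - (inner ℝ (d b) (d v) : ℝ) • a) := by
    simp only [map_add, map_smul, inner_add_left, inner_smul_left, RCLike.conj_to_real]
    module
  rw [hg, hv, Real.sqrt_mul (sq_nonneg _), Real.sqrt_sq h.le, smul_smul, mul_inv]
  congr 1
  field_simp

theorem quarterTurn_apply_add (d : T →ₗ[ℝ] G) (a b : T) (x y : ℝ) :
    quarterTurn d a b (x • a + y • b) = (√(inner ℝ (d a) (d a) * inner ℝ (d b) (d b) -
      inner ℝ (d a) (d b) * inner ℝ (d a) (d b)))⁻¹ •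
      ((-(x * inner ℝ (d a) (d b) + y * inner ℝ (d b) (d b))) • a +
        (x * inner ℝ (d a) (d a) + y * inner ℝ (d a) (d b)) • b) := by
  rw [quarterTurn_apply]
  congr 1
  simp only [map_add, map_smul, inner_add_right, inner_smul_right, real_inner_comm (d a) (d b)]
  module

end QuarterTurn

namespace OrientedContactStructure

variable {M : Type*} [TopologicalSpace M] [ChartedSpace (EuclideanSpace ℝ (Fin 3)) M]
  [IsManifold (𝓡 3) ∞ M] {ξ : OrientedContactStructure M}

/-- A nowhere vanishing smooth section of the contact planes over an open set. -/
structure IsSectionOver (ξ : OrientedContactStructure M) (a : (y : M) → TangentSpace (𝓡 3) y)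
    (U : Set M) : Prop where
  isOpen : IsOpen U
  smooth : SmoothFieldOn (𝓡 3) a U
  mem : ∀ y ∈ U, a y ∈ ξ.plane y
  ne_zero : ∀ y ∈ U, a y ≠ 0

theorem IsSectionOver.mono {a : (y : M) → TangentSpace (𝓡 3) y} {U V : Set M}
    (h : ξ.IsSectionOver a U) (hV : IsOpen V) (hVU : V ⊆ U) : ξ.IsSectionOver a V :=
  ⟨hV, h.smooth.mono hVU, fun y hy => h.mem y (hVU hy), fun y hy => h.ne_zero y (hVU hy)⟩

theorem exists_isSectionOver (ξ : OrientedContactStructure M) (x : M) :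
    ∃ (U : Set M) (a : (y : M) → TangentSpace (𝓡 3) y), x ∈ U ∧ ξ.IsSectionOver a U := by
  obtain ⟨U, hU, hx, V, W, hV, hW, h⟩ := ξ.isPlaneField x
  refine ⟨U, V, hx, hU, hV, fun y hy => ?_, fun y hy => (h y hy).1.ne_zero 0⟩
  rw [(h y hy).2]
  exact Submodule.subset_span (by simp)

theorem finrank_plane (ξ : OrientedContactStructure M) (y : M) :
    Module.finrank ℝ (ξ.plane y) = 2 := by
  obtain ⟨U, hU, hx, V, W, hV, hW, h⟩ := ξ.isPlaneField y
  obtain ⟨h1, h2⟩ := h y hx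
  rw [h2]
  have := finrank_span_eq_card h1
  rw [Matrix.range_cons_cons_empty] at this
  simpa using this

/-- The brackets of a local frame of a contact structure are transverse to the contact planes. -/
theorem mlieBracket_notMem [T2Space M] [CompactSpace M] {U : Set M} (hU : IsOpen U)
    {a b : (y : M) → TangentSpace (𝓡 3) y}
    (ha : SmoothFieldOn (𝓡 3) a U) (hb : SmoothFieldOn (𝓡 3) b U)
    (hab : ∀ y ∈ U, LinearIndependent ℝ ![a y, b y])
    (hsp : ∀ y ∈ U, ξ.plane y = Submodule.span ℝ {a y, b y}) {y : M} (hy : y ∈ U) :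
    VectorField.mlieBracket (𝓡 3) a b y ∉ ξ.plane y := by
  obtain ⟨n, e, he⟩ := exists_isImmersed M
  intro hmem
  have hle : derivedDistribution (𝓡 3) ξ.plane y ≤ ξ.plane y := by
    refine sup_le le_rfl (Submodule.span_le.2 ?_)
    rintro v ⟨O, V, W, hO, hyO, hV, hW, rfl⟩
    have hid : ContMDiff (𝓡 3) (𝓡 3) ∞ (id : M → M) := contMDiff_id
    have hd : ∀ q : M, ∀ v : TangentSpace (𝓡 3) q, mfderiv (𝓡 3) (𝓡 3) (id : M → M) q v = v := by
      intro q v; rw [mfderiv_id]; rfl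
    have hVm : ∀ q ∈ O ∩ U, V q ∈ Submodule.span ℝ {a q, b q} := fun q hq => by
      rw [← hsp q hq.2]; exact hV.2 q hq.1
    have hWm : ∀ q ∈ O ∩ U, W q ∈ Submodule.span ℝ {a q, b q} := fun q hq => by
      rw [← hsp q hq.2]; exact hW.2 q hq.1
    obtain ⟨f₁, f₂, hf⟩ := Submodule.mem_span_pair.1 (hVm y ⟨hyO, hy⟩)
    obtain ⟨g₁, g₂, hg⟩ := Submodule.mem_span_pair.1 (hWm y ⟨hyO, hy⟩)
    obtain ⟨c, d, h⟩ := dproj_mlieBracket_eq he hid hU ha hb hab (hO.inter hU)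
      (V := V) (W := W) (hV.1.mono inter_subset_left) (hW.1.mono inter_subset_left)
      (fun q hq => by rw [hd]; exact hVm q hq) (fun q hq => by rw [hd]; exact hWm q hq)
      (q₀ := y) ⟨hyO, hy⟩ hy (f₁ := f₁) (f₂ := f₂) (g₁ := g₁) (g₂ := g₂)
      (by rw [hd]; exact hf.symm) (by rw [hd]; exact hg.symm)
    rw [hd] at h
    rw [h]
    have h1 : a y ∈ ξ.plane y := by rw [hsp y hy]; exact Submodule.subset_span (by simp)
    have h2 : b y ∈ ξ.plane y := by rw [hsp y hy]; exact Submodule.subset_span (by simp)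
    exact add_mem (add_mem (Submodule.smul_mem _ _ h1) (Submodule.smul_mem _ _ h2))
      (Submodule.smul_mem _ _ hmem)
  rw [ξ.nonintegrable, top_le_iff] at hle
  have h2 := ξ.finrank_plane y
  rw [hle, finrank_top] at h2
  have h3 : Module.finrank ℝ (EuclideanSpace ℝ (Fin 3)) = 2 := h2
  simp at h3

theorem exists_positivePair (ξ : OrientedContactStructure M) (y : M) :
    ∃ v w : TangentSpace (𝓡 3) y, IsPositivePair (ξ.orient y) v w := by
  obtain ⟨U, -, hx, V, W, -, -, h⟩ := ξ.isOrientation y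
  exact ⟨V y, W y, h y hx⟩

/-- Contact structures on closed manifolds admit compatible complex structures. -/
theorem nonempty_complexStructure [T2Space M] [CompactSpace M] (ξ : OrientedContactStructure M) :
    Nonempty ξ.ComplexStructure := by
  obtain ⟨n, e, he⟩ := exists_isImmersed M
  choose A B hAB using ξ.exists_positivePair
  set d : (y : M) → TangentSpace (𝓡 3) y →ₗ[ℝ] EuclideanSpace ℝ (Fin n) :=
    fun y => (mvfderiv (𝓡 3) e y).toLinearMap with hd
  set K : (y : M) → TangentSpace (𝓡 3) y →ₗ[ℝ] TangentSpace (𝓡 3) y :=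
    fun y => quarterTurn (d y) (A y) (B y) with hK
  have hKm : ∀ y, ∀ v ∈ ξ.plane y, K y v ∈ ξ.plane y := by
    intro y v hv
    simp only [hK]
    rw [quarterTurn_apply]
    exact Submodule.smul_mem _ _ (sub_mem (Submodule.smul_mem _ _ (hAB y).mem_right)
      (Submodule.smul_mem _ _ (hAB y).mem_left))
  have hgram : ∀ y, 0 < inner ℝ (d y (A y)) (d y (A y)) * inner ℝ (d y (B y)) (d y (B y)) -
      inner ℝ (d y (A y)) (d y (B y)) * inner ℝ (d y (A y)) (d y (B y)) := fun y =>
    gram_pos (he.linearIndependent (hAB y).linearIndependent)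
  refine ⟨⟨fun y => (K y).restrict (hKm y), fun y v => ?_, fun y v hv => ?_, ?_⟩⟩
  · ext1
    obtain ⟨x, z, hv⟩ := (hAB y).exists_coeffs v.2
    change K y (K y v) = -(v : TangentSpace (𝓡 3) y)
    rw [hv]
    simp only [hK]
    rw [quarterTurn_apply_add, map_smul, quarterTurn_apply_add, smul_smul, ← mul_inv,
      Real.mul_self_sqrt (hgram y).le, inv_smul_eq_iff₀ (hgram y).ne']
    module
  · obtain ⟨x, z, hxz⟩ := (hAB y).exists_coeffs v.2
    change IsPositivePair _ (v : TangentSpace (𝓡 3) y) (K y v)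
    have hne : (v : TangentSpace (𝓡 3) y) ≠ 0 := by simpa using hv
    have hn : 0 < inner ℝ (d y v) (d y v) := by
      refine real_inner_self_pos.2 fun h0 => hne (he.injective y ?_)
      rw [map_zero]; exact h0
    rw [hxz] at hn ⊢
    simp only [hK]
    rw [quarterTurn_apply_add, smul_add, smul_smul, smul_smul, (hAB y).iff_det_pos]
    have hs := inv_pos.2 (Real.sqrt_pos.2 (hgram y))
    have : x * inner ℝ (d y (A y)) (d y (A y)) * x + 2 * (x * z * inner ℝ (d y (A y)) (d y (B y))) +
        z * z * inner ℝ (d y (B y)) (d y (B y)) =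
        inner ℝ (d y (x • A y + z • B y)) (d y (x • A y + z • B y)) := by
      simp only [map_add, map_smul, inner_add_left, inner_add_right, inner_smul_left,
        inner_smul_right, real_inner_comm (d y (A y)) (d y (B y)), RCLike.conj_to_real]
      ring
    rw [← this] at hn
    have := mul_pos hs hn
    linarith
  · intro U V W hU hV hW y₀ hy₀
    obtain ⟨O, hO, hyO, a, b, ha, hb, hab⟩ := ξ.isOrientation y₀
    have key : ∀ y ∈ O, ∀ v, K y v = quarterTurn (d y) (a y) (b y) v := by
      intro y hy v
      obtain ⟨p, q, hA⟩ := (hab y hy).exists_coeffs (hAB y).mem_left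
      obtain ⟨r, s, hB⟩ := (hab y hy).exists_coeffs (hAB y).mem_right
      have := hAB y
      rw [hA, hB, (hab y hy).iff_det_pos] at this
      simp only [hK]
      rw [hA, hB, quarterTurn_congr _ _ _ this]
    have hVs := he.contMDiffWithinAt (hV y₀ hy₀)
    have haU : ContMDiffWithinAt (𝓡 3) (𝓡 3).tangent ∞
        (fun q => (⟨q, a q⟩ : TangentBundle (𝓡 3) M)) U y₀ :=
      ((ha y₀ hyO).contMDiffAt (hO.mem_nhds hyO)).contMDiffWithinAt
    have hbU : ContMDiffWithinAt (𝓡 3) (𝓡 3).tangent ∞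
        (fun q => (⟨q, b q⟩ : TangentBundle (𝓡 3) M)) U y₀ :=
      ((hb y₀ hyO).contMDiffAt (hO.mem_nhds hyO)).contMDiffWithinAt
    have has := he.contMDiffWithinAt haU
    have hbs := he.contMDiffWithinAt hbU
    have hc : ∀ {a b : EuclideanSpace ℝ (Fin n)} (v : EuclideanSpace ℝ (Fin n)),
        LinearIndependent ℝ ![a, b] → ContDiffAt ℝ ∞ (fun x : EuclideanSpace ℝ (Fin n) ×
        EuclideanSpace ℝ (Fin n) × EuclideanSpace ℝ (Fin n) =>
        (√(inner ℝ x.1 x.1 * inner ℝ x.2.1 x.2.1 - inner ℝ x.1 x.2.1 * inner ℝ x.1 x.2.1))⁻¹ *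
          inner ℝ x.1 x.2.2) (a, b, v) ∧ ContDiffAt ℝ ∞ (fun x : EuclideanSpace ℝ (Fin n) ×
        EuclideanSpace ℝ (Fin n) × EuclideanSpace ℝ (Fin n) =>
        -((√(inner ℝ x.1 x.1 * inner ℝ x.2.1 x.2.1 - inner ℝ x.1 x.2.1 * inner ℝ x.1 x.2.1))⁻¹ *
          inner ℝ x.2.1 x.2.2)) (a, b, v) := by
      intro a b v h
      have h1 : ContDiffAt ℝ ∞ (fun x : EuclideanSpace ℝ (Fin n) ×
        EuclideanSpace ℝ (Fin n) × EuclideanSpace ℝ (Fin n) => x.1) (a, b, v) := contDiffAt_fst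
      have h2 : ContDiffAt ℝ ∞ (fun x : EuclideanSpace ℝ (Fin n) ×
        EuclideanSpace ℝ (Fin n) × EuclideanSpace ℝ (Fin n) => x.2.1) (a, b, v) :=
        contDiffAt_fst.snd'
      have h3 : ContDiffAt ℝ ∞ (fun x : EuclideanSpace ℝ (Fin n) ×
        EuclideanSpace ℝ (Fin n) × EuclideanSpace ℝ (Fin n) => x.2.2) (a, b, v) :=
        contDiffAt_snd.snd'
      have h4 := ((((h1.inner ℝ h1).mul (h2.inner ℝ h2)).sub
        ((h1.inner ℝ h2).mul (h1.inner ℝ h2))).sqrt (gram_pos h).ne').inv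
        (Real.sqrt_pos.2 (gram_pos h)).ne'
      exact ⟨h4.mul (h1.inner ℝ h3), (h4.mul (h2.inner ℝ h3)).neg⟩
    obtain ⟨hc1, hc2⟩ := hc (mvfderiv (𝓡 3) e y₀ (V y₀))
      (he.linearIndependent (hab y₀ hyO).linearIndependent)
    have hp := has.prodMk_space (hbs.prodMk_space hVs)
    have s1 := (hc1.contMDiffAt.comp_contMDiffWithinAt y₀ hp).smul_section hbU
    have s2 := (hc2.contMDiffAt.comp_contMDiffWithinAt y₀ hp).smul_section haU
    have heq : ∀ y ∈ U ∩ O, W y = quarterTurn (d y) (a y) (b y) (V y) := by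
      rintro y ⟨hyU, hyO⟩
      obtain ⟨h, hWy⟩ := hW y hyU
      rw [hWy, ← key y hyO]
      rfl
    have hev : ∀ᶠ y in 𝓝[U] y₀, y ∈ U ∩ O :=
      inter_mem self_mem_nhdsWithin (mem_nhdsWithin_of_mem_nhds (hO.mem_nhds hyO))
    have hfin : ∀ y ∈ U ∩ O, (⟨y, W y⟩ : TangentBundle (𝓡 3) M) = ⟨y,
        ((√(inner ℝ (d y (a y)) (d y (a y)) * inner ℝ (d y (b y)) (d y (b y)) -
          inner ℝ (d y (a y)) (d y (b y)) * inner ℝ (d y (a y)) (d y (b y))))⁻¹ *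
          inner ℝ (d y (a y)) (d y (V y))) • b y +
        (-((√(inner ℝ (d y (a y)) (d y (a y)) * inner ℝ (d y (b y)) (d y (b y)) -
          inner ℝ (d y (a y)) (d y (b y)) * inner ℝ (d y (a y)) (d y (b y))))⁻¹ *
          inner ℝ (d y (b y)) (d y (V y)))) • a y⟩ := by
      intro y hy
      rw [heq y hy, quarterTurn_apply]
      congr 1
      module
    exact (s1.add_section s2).congr_of_eventuallyEq (hev.mono hfin) (hfin y₀ ⟨hy₀, hyO⟩)

namespace ComplexStructure

variable (J : ξ.ComplexStructure) {a : (y : M) → TangentSpace (𝓡 3) y} {U : Set M}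

theorem smooth_ext (ha : ξ.IsSectionOver a U) :
    SmoothFieldOn (𝓡 3) (fun y => J.ext y (a y)) U :=
  J.smooth U a _ ha.isOpen ha.smooth fun y hy => ⟨ha.mem y hy, J.ext_coe ⟨a y, ha.mem y hy⟩⟩

theorem frame_linearIndependent (ha : ξ.IsSectionOver a U) {y : M} (hy : y ∈ U) :
    LinearIndependent ℝ ![a y, J.ext y (a y)] :=
  (J.isPositivePair (ha.mem y hy) (ha.ne_zero y hy)).linearIndependent

theorem frame_mlieBracket_notMem [T2Space M] [CompactSpace M] (ha : ξ.IsSectionOver a U) {y : M}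
    (hy : y ∈ U) : VectorField.mlieBracket (𝓡 3) a (fun y => J.ext y (a y)) y ∉ ξ.plane y :=
  mlieBracket_notMem ha.isOpen ha.smooth (J.smooth_ext ha)
    (fun _ hy => J.frame_linearIndependent ha hy)
    (fun y hy => J.plane_eq_span (ha.mem y hy) (ha.ne_zero y hy)) hy

end ComplexStructure

end OrientedContactStructure

/-! ### Engel structures and their development maps -/

instance finiteDimensional_tangentSpace {E : Type*} [NormedAddCommGroup E] [NormedSpace ℝ E]
    [h : FiniteDimensional ℝ E] {H : Type*} [TopologicalSpace H] (I : ModelWithCorners ℝ E H)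
    {X : Type*} [TopologicalSpace X] [ChartedSpace H X] (q : X) :
    FiniteDimensional ℝ (TangentSpace I q) := h

namespace OrientedCircleBundle

variable {M : Type*} [TopologicalSpace M] [ChartedSpace (EuclideanSpace ℝ (Fin 3)) M]
  {Q : Type*} [TopologicalSpace Q] [ChartedSpace (EuclideanSpace ℝ (Fin 4)) Q]
  [IsManifold (𝓡 3) ∞ M] [IsManifold (𝓡 4) ∞ Q]
  {B : OrientedCircleBundle Q M} {ξ : OrientedContactStructure M} (J : ξ.ComplexStructure)
  {G : Type*} [NormedAddCommGroup G] [InnerProductSpace ℝ G] {e : M → G}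

/-- `θ` is a smooth angle (in units of `π`, relative to the frame `(a, J a)`) over `O` for the field
`ℓ` of lines in the contact planes, and it is monotone along the fibres. -/
structure IsTwistAngle (B : OrientedCircleBundle Q M) (J : ξ.ComplexStructure)
    (ℓ : (q : Q) → Submodule ℝ (TangentSpace (𝓡 3) (B.proj q)))
    (a : (y : M) → TangentSpace (𝓡 3) y) (O : Set Q) (θ : Q → ℝ) : Prop where
  isOpen : IsOpen O
  smooth : ContMDiffOn (𝓡 4) 𝓘(ℝ, ℝ) ∞ θ O
  eq_span : ∀ q ∈ O, ℓ q = Submodule.span ℝ {J.rot (B.proj q) (θ q) (a (B.proj q))}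
  deriv_ne : ∀ q ∈ O, ∀ v ∈ B.pos q, mvfderiv (𝓡 4) θ q v ≠ 0

/-- A field of lines in the contact planes, parametrized by the total space of the circle bundle,
which rotates along the fibres without stopping. -/
def IsTwisting (B : OrientedCircleBundle Q M) (J : ξ.ComplexStructure)
    (ℓ : (q : Q) → Submodule ℝ (TangentSpace (𝓡 3) (B.proj q))) : Prop :=
  ∀ q₀ : Q, ∃ (U : Set M) (a : (y : M) → TangentSpace (𝓡 3) y) (O : Set Q) (θ : Q → ℝ),
    ξ.IsSectionOver a U ∧ q₀ ∈ O ∧ O ⊆ B.proj ⁻¹' U ∧ B.IsTwistAngle J ℓ a O θ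

theorem mvfderiv_clm_comp {G₁ G₂ : Type*} [NormedAddCommGroup G₁] [NormedSpace ℝ G₁]
    [NormedAddCommGroup G₂] [NormedSpace ℝ G₂] (L : G₁ →L[ℝ] G₂) {f : Q → G₁} {q : Q}
    (hf : MDifferentiableAt (𝓡 4) 𝓘(ℝ, G₁) f q) (v : TangentSpace (𝓡 4) q) :
    mvfderiv (𝓡 4) (fun q => L (f q)) q v = L (mvfderiv (𝓡 4) f q v) := by
  have h5 := mfderiv_comp q (I' := 𝓘(ℝ, G₁)) (g := L) (L.differentiableAt.mdifferentiableAt) hf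
  refine (congrArg (fun A => A v) h5).trans ?_
  change mfderiv 𝓘(ℝ, G₁) 𝓘(ℝ, G₂) L (f q) (mvfderiv (𝓡 4) f q v) = _
  rw [mfderiv_eq_fderiv]
  exact congrArg (fun A : G₁ →L[ℝ] G₂ => A (mvfderiv (𝓡 4) f q v)) L.fderiv

theorem mvfderiv_real_comp {θ : Q → ℝ} {q : Q} (hθ : MDifferentiableAt (𝓡 4) 𝓘(ℝ, ℝ) θ q)
    {φ : ℝ → ℝ} {φ' : ℝ} (hφ : HasDerivAt φ φ' (θ q)) (v : TangentSpace (𝓡 4) q) :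
    mvfderiv (𝓡 4) (fun q => φ (θ q)) q v = mvfderiv (𝓡 4) θ q v * φ' := by
  have := mfderiv_comp q (I' := 𝓘(ℝ, ℝ)) (g := φ) hφ.differentiableAt.mdifferentiableAt hθ
  have h2 := congrArg (fun A => A v) this
  refine h2.trans ?_
  change mfderiv 𝓘(ℝ, ℝ) 𝓘(ℝ, ℝ) φ (θ q) (mvfderiv (𝓡 4) θ q v) = _
  rw [mfderiv_eq_fderiv]
  have h3 : fderiv ℝ φ (θ q) (mvfderiv (𝓡 4) θ q v) = _ :=
    congrArg (fun A : ℝ →L[ℝ] ℝ => A (mvfderiv (𝓡 4) θ q v)) hφ.hasFDerivAt.fderiv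
  refine h3.trans ?_
  rw [ContinuousLinearMap.toSpanSingleton_apply, smul_eq_mul]

/-- The section `a` rotated by the angle `θ`, as a map to the ambient Euclidean space. -/
abbrev rotated (B : OrientedCircleBundle Q M) (J : ξ.ComplexStructure) (e : M → G)
    (a : (y : M) → TangentSpace (𝓡 3) y) (θ : Q → ℝ) (q : Q) : G :=
  mvfderiv (𝓡 3) e (B.proj q) (J.rot (B.proj q) (θ q) (a (B.proj q)))

variable {J} {U : Set M} {a : (y : M) → TangentSpace (𝓡 3) y}

theorem rotated_eq (θ : Q → ℝ) (q : Q) : B.rotated J e a θ q =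
    Real.cos (Real.pi * θ q) • mvfderiv (𝓡 3) e (B.proj q) (a (B.proj q)) +
      Real.sin (Real.pi * θ q) • mvfderiv (𝓡 3) e (B.proj q) (J.ext (B.proj q) (a (B.proj q))) := by
  rw [rotated, J.rot_apply, map_add, map_smul, map_smul]

theorem contMDiffAt_immersed (he : IsImmersed e) (hU : IsOpen U) (ha : SmoothFieldOn (𝓡 3) a U)
    {y : M} (hy : y ∈ U) :
    ContMDiffAt (𝓡 3) 𝓘(ℝ, G) ∞ (fun y => mvfderiv (𝓡 3) e y (a y)) y :=
  (he.contMDiffWithinAt (ha y hy)).contMDiffAt (hU.mem_nhds hy)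

theorem contMDiffWithinAt_rotated (he : IsImmersed e) (ha : ξ.IsSectionOver a U)
    {E' : Type*} [NormedAddCommGroup E'] [NormedSpace ℝ E'] {H' : Type*} [TopologicalSpace H']
    {I' : ModelWithCorners ℝ E' H'} {P : Type*} [TopologicalSpace P] [ChartedSpace H' P]
    {s : Set P} {p₀ : P} {g : P → Q} (hg : ContMDiffWithinAt I' (𝓡 4) ∞ g s p₀)
    (hp : B.proj (g p₀) ∈ U) {θ : P → ℝ} (hθ : ContMDiffWithinAt I' 𝓘(ℝ, ℝ) ∞ θ s p₀) :
    ContMDiffWithinAt I' 𝓘(ℝ, G) ∞ (fun p => mvfderiv (𝓡 3) e (B.proj (g p))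
      (J.rot (B.proj (g p)) (θ p) (a (B.proj (g p))))) s p₀ := by
  have hπ : ContMDiffWithinAt I' (𝓡 3) ∞ (fun p => B.proj (g p)) s p₀ :=
    (B.contMDiff_proj (g p₀)).comp_contMDiffWithinAt p₀ hg
  have h1 := (contMDiffAt_immersed he ha.isOpen ha.smooth hp).comp_contMDiffWithinAt p₀ hπ
  have h2 := (contMDiffAt_immersed he ha.isOpen (J.smooth_ext ha) hp).comp_contMDiffWithinAt p₀ hπ
  have hc : ContDiff ℝ ∞ (fun x : ℝ => Real.cos (Real.pi * x)) := by fun_prop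
  have hs : ContDiff ℝ ∞ (fun x : ℝ => Real.sin (Real.pi * x)) := by fun_prop
  have h3 := (hc.contMDiff (θ p₀)).comp_contMDiffWithinAt p₀ hθ
  have h4 := (hs.contMDiff (θ p₀)).comp_contMDiffWithinAt p₀ hθ
  have h5 := (h3.smul h1).add (h4.smul h2)
  have h6 : ∀ p, mvfderiv (𝓡 3) e (B.proj (g p))
      (J.rot (B.proj (g p)) (θ p) (a (B.proj (g p)))) = _ := fun p => by
    rw [J.rot_apply, map_add, map_smul, map_smul]
  exact h5.congr_of_eventuallyEq (Eventually.of_forall h6) (h6 p₀)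

theorem mvfderiv_rotated (he : IsImmersed e) (ha : ξ.IsSectionOver a U) {q : Q}
    (hq : B.proj q ∈ U) {θ : Q → ℝ} (hθ : MDifferentiableAt (𝓡 4) 𝓘(ℝ, ℝ) θ q)
    {v : TangentSpace (𝓡 4) q} (hv : B.dproj q v = 0) :
    mvfderiv (𝓡 4) (B.rotated J e a θ) q v = mvfderiv (𝓡 3) e (B.proj q)
      ((mvfderiv (𝓡 4) θ q v * Real.pi) •
        J.ext (B.proj q) (J.rot (B.proj q) (θ q) (a (B.proj q)))) := by
  have hα := (contMDiffAt_immersed he ha.isOpen ha.smooth hq).mdifferentiableAt (by simp)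
  have hβ := (contMDiffAt_immersed he ha.isOpen (J.smooth_ext ha) hq).mdifferentiableAt (by simp)
  have hα' : MDifferentiableAt (𝓡 4) 𝓘(ℝ, G)
      (fun q => mvfderiv (𝓡 3) e (B.proj q) (a (B.proj q))) q :=
    MDifferentiableAt.comp q hα (B.mdifferentiableAt_proj q)
  have hβ' : MDifferentiableAt (𝓡 4) 𝓘(ℝ, G)
      (fun q => mvfderiv (𝓡 3) e (B.proj q) (J.ext (B.proj q) (a (B.proj q)))) q :=
    MDifferentiableAt.comp q hβ (B.mdifferentiableAt_proj q)
  have hc : HasDerivAt (fun x : ℝ => Real.cos (Real.pi * x))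
      (-Real.sin (Real.pi * θ q) * Real.pi) (θ q) := by
    simpa using ((hasDerivAt_id (θ q)).const_mul Real.pi).cos
  have hs : HasDerivAt (fun x : ℝ => Real.sin (Real.pi * x))
      (Real.cos (Real.pi * θ q) * Real.pi) (θ q) := by
    simpa using ((hasDerivAt_id (θ q)).const_mul Real.pi).sin
  have hc' : MDifferentiableAt (𝓡 4) 𝓘(ℝ, ℝ) (fun q => Real.cos (Real.pi * θ q)) q :=
    MDifferentiableAt.comp q (I' := 𝓘(ℝ, ℝ)) (g := fun x : ℝ => Real.cos (Real.pi * x))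
      hc.differentiableAt.mdifferentiableAt hθ
  have hs' : MDifferentiableAt (𝓡 4) 𝓘(ℝ, ℝ) (fun q => Real.sin (Real.pi * θ q)) q :=
    MDifferentiableAt.comp q (I' := 𝓘(ℝ, ℝ)) (g := fun x : ℝ => Real.sin (Real.pi * x))
      hs.differentiableAt.mdifferentiableAt hθ
  have hadd := mvfderiv_fun_add (hc'.smul hα') (hs'.smul hβ')
  have hfun : B.rotated J e a θ = fun q => (fun q => Real.cos (Real.pi * θ q)) q •
      (fun q => mvfderiv (𝓡 3) e (B.proj q) (a (B.proj q))) q +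
      (fun q => Real.sin (Real.pi * θ q)) q •
      (fun q => mvfderiv (𝓡 3) e (B.proj q) (J.ext (B.proj q) (a (B.proj q)))) q :=
    funext fun q => rotated_eq θ q
  rw [hfun]
  refine (congrArg (fun A => A v) hadd).trans ?_
  change mvfderiv (𝓡 4) (fun q => Real.cos (Real.pi * θ q) •
      mvfderiv (𝓡 3) e (B.proj q) (a (B.proj q))) q v + mvfderiv (𝓡 4)
      (fun q => Real.sin (Real.pi * θ q) •
      mvfderiv (𝓡 3) e (B.proj q) (J.ext (B.proj q) (a (B.proj q)))) q v = _
  rw [mvfderiv_smul_apply hc' hα', mvfderiv_smul_apply hs' hβ', mvfderiv_real_comp hθ hc,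
    mvfderiv_real_comp hθ hs, mvfderiv_comp_proj hα B.contMDiff_proj,
    mvfderiv_comp_proj hβ B.contMDiff_proj]
  change Real.cos _ • mvfderiv (𝓡 3) _ _ (B.dproj q v) + _ +
    (Real.sin _ • mvfderiv (𝓡 3) _ _ (B.dproj q v) + _) = _
  rw [hv, map_zero, map_zero]
  have hJ : J.ext (B.proj q) (J.rot (B.proj q) (θ q) (a (B.proj q))) =
      Real.cos (Real.pi * θ q) • J.ext (B.proj q) (a (B.proj q)) -
        Real.sin (Real.pi * θ q) • a (B.proj q) := by
    rw [J.rot_apply, map_add, map_smul, map_smul, J.ext_ext (ha.mem _ hq), smul_neg, sub_eq_add_neg]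
  rw [hJ, map_smul, map_sub, map_smul, map_smul]
  module

section Linear

theorem finrank_comap_dproj (q : Q) (S : Submodule ℝ (TangentSpace (𝓡 3) (B.proj q))) :
    Module.finrank ℝ (S.comap (B.dproj q).toLinearMap) = Module.finrank ℝ S + 1 := by
  set f := (B.dproj q).toLinearMap with hf
  have h1 := ((f.domRestrict (S.comap f))).finrank_range_add_finrank_ker
  have h2 : LinearMap.range (f.domRestrict (S.comap f)) = S := by
    rw [LinearMap.range_domRestrict,
      Submodule.map_comap_eq_of_surjective (B.dproj_surjective q)]
  have h3 : LinearMap.ker (f.domRestrict (S.comap f)) =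
      (LinearMap.ker f).comap (S.comap f).subtype := by
    ext x; simp
  rw [h2, h3, (Submodule.comapSubtypeEquivOfLe (LinearMap.ker_le_comap f)).finrank_eq,
    B.finrank_ker_dproj] at h1
  exact h1.symm

theorem image_comap (q : Q) (S : Submodule ℝ (TangentSpace (𝓡 3) (B.proj q)))
    (D : TangentDistribution (𝓡 4) Q) (h : D q = S.comap (B.dproj q).toLinearMap) :
    B.image D q = S := by
  rw [image, h]
  exact Submodule.map_comap_eq_of_surjective (B.dproj_surjective q) S

theorem eq_comap_image (q : Q) (D : TangentDistribution (𝓡 4) Q)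
    (h : LinearMap.ker (B.dproj q).toLinearMap ≤ D q) :
    D q = (B.image D q).comap (B.dproj q).toLinearMap := by
  rw [image, Submodule.comap_map_eq, sup_eq_left.2 h]

end Linear

/-- A local smooth horizontal lift: `lift q u s` has the projection whose image in the ambient
Euclidean space is `u`, and vertical component `s`. -/
theorem exists_lift [FiniteDimensional ℝ G] (he : IsImmersed e) (q₀ : Q) :
    ∃ (O : Set Q) (lift : (q : Q) → G → ℝ → TangentSpace (𝓡 4) q), IsOpen O ∧ q₀ ∈ O ∧
      (∀ q ∈ O, ∀ (w : TangentSpace (𝓡 3) (B.proj q)) (s : ℝ),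
        B.dproj q (lift q (mvfderiv (𝓡 3) e (B.proj q) w) s) = w) ∧
      (∀ q ∈ O, lift q 0 1 ∈ B.pos q) ∧
      (∀ q u s, lift q u s = lift q u 0 + s • lift q 0 1) ∧
      ∀ {E' : Type} [NormedAddCommGroup E'] [NormedSpace ℝ E'] {H' : Type} [TopologicalSpace H']
        {I' : ModelWithCorners ℝ E' H'} {P : Type _} [TopologicalSpace P] [ChartedSpace H' P]
        {S : Set P} {g : P → Q} {u : P → G} {s : P → ℝ} {p₀ : P}, g p₀ ∈ O →
        ContMDiffWithinAt I' (𝓡 4) ∞ g S p₀ → ContMDiffWithinAt I' 𝓘(ℝ, G) ∞ u S p₀ →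
        ContMDiffWithinAt I' 𝓘(ℝ, ℝ) ∞ s S p₀ →
        ContMDiffWithinAt I' (𝓡 4).tangent ∞
          (fun p => (⟨g p, lift (g p) (u p) (s p)⟩ : TangentBundle (𝓡 4) Q)) S p₀ := by
  set y₀ := B.proj q₀
  obtain ⟨U, hU, hy₀, E, hE⟩ := B.locallyTrivial y₀
  obtain ⟨t₀, ht₀⟩ := hE.exists_eq (q := q₀) hy₀
  obtain ⟨O₁, τ, hO₁, hq₁, -, hτ, -, -, hpos⟩ := hE.exists_coordinate hU hy₀ t₀
  change E y₀ t₀ = q₀ at ht₀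
  rw [ht₀] at hq₁
  -- a linear left inverse of the derivative of the immersion at the base point
  obtain ⟨A, hA⟩ : ∃ A : G →ₗ[ℝ] EuclideanSpace ℝ (Fin 3),
      A ∘ₗ (mvfderiv (𝓡 3) e y₀).toLinearMap = LinearMap.id :=
    LinearMap.exists_leftInverse_of_injective _ (LinearMap.ker_eq_bot.2 (he.injective y₀))
  set A' : G →L[ℝ] EuclideanSpace ℝ (Fin 3) := A.toContinuousLinearMap
  set F : Q → EuclideanSpace ℝ (Fin 3) × ℝ := fun q => (A' (e (B.proj q)), τ q) with hF
  have hF1 : ContMDiff (𝓡 4) 𝓘(ℝ, EuclideanSpace ℝ (Fin 3)) ∞ (fun q => A' (e (B.proj q))) :=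
    A'.contDiff.contMDiff.comp (he.smooth.comp B.contMDiff_proj)
  have hFs : ContMDiffOn (𝓡 4) 𝓘(ℝ, EuclideanSpace ℝ (Fin 3) × ℝ) ∞ F O₁ :=
    hF1.contMDiffOn.prodMk_space hτ
  have hd : ∀ q ∈ O₁, ∀ v : TangentSpace (𝓡 4) q, mvfderiv (𝓡 4) F q v =
      (A' (mvfderiv (𝓡 3) e (B.proj q) (B.dproj q v)), mvfderiv (𝓡 4) τ q v) := by
    intro q hq v
    have hFd : MDifferentiableAt (𝓡 4) 𝓘(ℝ, EuclideanSpace ℝ (Fin 3) × ℝ) F q :=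
      ((hFs q hq).contMDiffAt (hO₁.mem_nhds hq)).mdifferentiableAt (by simp)
    have h4 : MDifferentiableAt (𝓡 4) 𝓘(ℝ, G) (e ∘ B.proj) q :=
      ((he.smooth.comp B.contMDiff_proj) q).mdifferentiableAt (by simp)
    refine Prod.ext ?_ ?_
    · refine (mvfderiv_clm_comp (ContinuousLinearMap.fst ℝ _ _) hFd v).symm.trans ?_
      refine (mvfderiv_clm_comp A' h4 v).trans ?_
      exact congrArg A' (mvfderiv_immersion_comp he B.contMDiff_proj q v)
    · exact (mvfderiv_clm_comp (ContinuousLinearMap.snd ℝ _ _) hFd v).symm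
  have hbij : Function.Bijective (mvfderiv (𝓡 4) F q₀) := by
    have hinj : Function.Injective (mvfderiv (𝓡 4) F q₀).toLinearMap := by
      rw [← LinearMap.ker_eq_bot, LinearMap.ker_eq_bot']
      intro v hv
      have hv' : mvfderiv (𝓡 4) F q₀ v = 0 := hv
      rw [hd q₀ hq₁] at hv'
      have h1 : A' (mvfderiv (𝓡 3) e y₀ (B.dproj q₀ v)) = B.dproj q₀ v :=
        congrArg (fun L => L (B.dproj q₀ v)) hA
      have h2 : A' (mvfderiv (𝓡 3) e y₀ (B.dproj q₀ v)) = 0 := congrArg Prod.fst hv'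
      have h3 : mvfderiv (𝓡 4) τ q₀ v = 0 := congrArg Prod.snd hv'
      obtain ⟨T, hT⟩ := B.pos_nonempty q₀
      obtain ⟨c, rfl⟩ := B.exists_smul_of_vertical hT (h1.symm.trans h2)
      rw [map_smul, smul_eq_zero] at h3
      rcases h3 with h3 | h3
      · rw [h3, zero_smul]
      · exact absurd h3 (hpos q₀ hq₁ T hT).ne'
    refine ⟨hinj, ?_⟩
    refine (LinearMap.injective_iff_surjective_of_finrank_eq_finrank ?_).1 hinj
    change Module.finrank ℝ (EuclideanSpace ℝ (Fin 4)) = Module.finrank ℝ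
      (EuclideanSpace ℝ (Fin 3) × ℝ)
    simp
  obtain ⟨O, L, hO, hq₀, hOO, hL, hLs⟩ := exists_field_of_coordinates hO₁ hFs hq₁ hbij
  have hAinj : ∀ q ∈ O, Function.Injective
      (A' ∘ mvfderiv (𝓡 3) e (B.proj q) : EuclideanSpace ℝ (Fin 3) → EuclideanSpace ℝ (Fin 3)) := by
    intro q hq
    refine (LinearMap.injective_iff_surjective (f := ((A'.comp (mvfderiv (𝓡 3) e (B.proj q)) :
      EuclideanSpace ℝ (Fin 3) →L[ℝ] EuclideanSpace ℝ (Fin 3))).toLinearMap)).2 fun x => ?_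
    refine ⟨B.dproj q (L q (x, 0)), ?_⟩
    have := hL q hq (x, 0)
    rw [hd q (hOO hq)] at this
    exact congrArg Prod.fst this
  refine ⟨O, fun q u s => L q (A' u, s), hO, hq₀, fun q hq w s => ?_, fun q hq => ?_,
    fun q u s => ?_, ?_⟩
  · have := hL q hq (A' (mvfderiv (𝓡 3) e (B.proj q) w), s)
    rw [hd q (hOO hq)] at this
    exact hAinj q hq (congrArg Prod.fst this)
  · have := hL q hq (A' 0, 1)
    rw [hd q (hOO hq)] at this
    have h1 := congrArg Prod.fst this
    have h2 : mvfderiv (𝓡 4) τ q (L q (A' 0, 1)) = 1 := congrArg Prod.snd this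
    have h3 : B.dproj q (L q (A' 0, 1)) = 0 := by
      refine hAinj q hq (h1.trans ?_)
      change A' 0 = A' (mvfderiv (𝓡 3) e (B.proj q) 0)
      rw [map_zero (mvfderiv (𝓡 3) e (B.proj q))]
    obtain ⟨T, hT⟩ := B.pos_nonempty q
    obtain ⟨c, hc⟩ := B.exists_smul_of_vertical hT h3
    rw [hc, map_smul, smul_eq_mul] at h2
    refine (B.pos_iff hT).2 ⟨c, ?_, hc⟩
    have := hpos q (hOO hq) T hT
    by_contra! hneg
    nlinarith
  · rw [← map_smul, ← map_add]
    simp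
  · intro E' _ _ H' _ I' P _ _ S g u s p₀ hp hg hu hs
    exact hLs hp hg ((A'.contDiff.contMDiff.contMDiffAt.comp_contMDiffWithinAt p₀ hu).prodMk_space hs)

end OrientedCircleBundle

namespace OrientedCircleBundle

variable {M : Type*} [TopologicalSpace M] [ChartedSpace (EuclideanSpace ℝ (Fin 3)) M]
  {Q : Type*} [TopologicalSpace Q] [ChartedSpace (EuclideanSpace ℝ (Fin 4)) Q]
  [IsManifold (𝓡 3) ∞ M] [IsManifold (𝓡 4) ∞ Q] [T2Space M] [CompactSpace M]
  {B : OrientedCircleBundle Q M} {ξ : OrientedContactStructure M} {J : ξ.ComplexStructure}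
  {U : Set M} {a : (y : M) → TangentSpace (𝓡 3) y}

theorem ker_dproj_le {q : Q} {S : Submodule ℝ (TangentSpace (𝓡 4) q)} {T : TangentSpace (𝓡 4) q}
    (hT : T ≠ 0) (hT0 : B.dproj q T = 0) (hTS : T ∈ S) :
    LinearMap.ker (B.dproj q).toLinearMap ≤ S := by
  obtain ⟨P, hP⟩ := B.pos_nonempty q
  obtain ⟨c, rfl⟩ := B.exists_smul_of_vertical hP hT0
  have hc : c ≠ 0 := by rintro rfl; simp at hT
  intro v hv
  obtain ⟨d, rfl⟩ := B.exists_smul_of_vertical hP hv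
  have := S.smul_mem (d / c) hTS
  rwa [smul_smul, div_mul_cancel₀ _ hc] at this

namespace VerticalEngel

variable {𝒟 : B.VerticalEngel}

theorem derived_eq (h : 𝒟.Induces ξ) (q : Q) : derivedDistribution (𝓡 4) 𝒟.D q =
    (ξ.plane (B.proj q)).comap (B.dproj q).toLinearMap := by
  rw [← h q]
  refine eq_comap_image q _ fun v hv => ?_
  have h1 : v ∈ characteristicLine (𝓡 4) 𝒟.D q := by rw [𝒟.vertical]; exact hv
  exact h1.1

theorem mem_derived (h : 𝒟.Induces ξ) {q : Q} {v : TangentSpace (𝓡 4) q}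
    (hv : v ∈ derivedDistribution (𝓡 4) 𝒟.D q) : B.dproj q v ∈ ξ.plane (B.proj q) := by
  rw [derived_eq h] at hv; exact hv

theorem dproj_mem (h : 𝒟.Induces ξ) {q : Q} {v : TangentSpace (𝓡 4) q} (hv : v ∈ 𝒟.D q) :
    B.dproj q v ∈ ξ.plane (B.proj q) :=
  mem_derived h ((le_sup_left : 𝒟.D q ≤ derivedDistribution (𝓡 4) 𝒟.D q) hv)

theorem image_le (h : 𝒟.Induces ξ) (q : Q) : B.image 𝒟.D q ≤ ξ.plane (B.proj q) := by
  rintro w ⟨v, hv, rfl⟩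
  exact dproj_mem h hv

theorem mlieBracket_mem_derived {D : TangentDistribution (𝓡 4) Q} {O : Set Q} (hO : IsOpen O)
    {V W : (q : Q) → TangentSpace (𝓡 4) q} (hV : IsSectionOn (𝓡 4) D V O)
    (hW : IsSectionOn (𝓡 4) D W O) {q : Q} (hq : q ∈ O) :
    VectorField.mlieBracket (𝓡 4) V W q ∈ derivedDistribution (𝓡 4) D q :=
  (le_sup_right : _ ≤ derivedDistribution (𝓡 4) D q)
    (Submodule.subset_span ⟨O, V, W, hO, hq, hV, hW, rfl⟩)

theorem finrank_D (𝒟 : B.VerticalEngel) (q : Q) : Module.finrank ℝ (𝒟.D q) = 2 := by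
  obtain ⟨U, hU, hx, V, W, hV, hW, h⟩ := 𝒟.isEngel.plane q
  obtain ⟨h1, h2⟩ := h q hx
  rw [h2]
  have := finrank_span_eq_card h1
  rw [Matrix.range_cons_cons_empty] at this
  simpa using this

/-- The Engel planes contain the fibre directions: otherwise the brackets of sections of the Engel
planes would leave the preimages of the contact planes. -/
theorem ker_le (h : 𝒟.Induces ξ) (q₀ : Q) : LinearMap.ker (B.dproj q₀).toLinearMap ≤ 𝒟.D q₀ := by
  by_contra hne
  obtain ⟨J⟩ := ξ.nonempty_complexStructure
  obtain ⟨n, e, he⟩ := exists_isImmersed M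
  obtain ⟨U, a, hU, ha⟩ := ξ.exists_isSectionOver (B.proj q₀)
  have hinj : ∀ v ∈ 𝒟.D q₀, B.dproj q₀ v = 0 → v = 0 := fun v hv hv0 => by
    by_contra hv1
    exact hne (ker_dproj_le hv1 hv0 hv)
  obtain ⟨O, hO, hq₀, V, W, hV, hW, hVW⟩ := 𝒟.isEngel.plane q₀
  have hVD : IsSectionOn (𝓡 4) 𝒟.D V O := ⟨hV, fun q hq => by
    rw [(hVW q hq).2]; exact Submodule.subset_span (by simp)⟩
  have hWD : IsSectionOn (𝓡 4) 𝒟.D W O := ⟨hW, fun q hq => by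
    rw [(hVW q hq).2]; exact Submodule.subset_span (by simp)⟩
  have hsp : ∀ y ∈ U, ξ.plane y = Submodule.span ℝ {a y, J.ext y (a y)} := fun y hy =>
    J.plane_eq_span (ha.mem y hy) (ha.ne_zero y hy)
  have hO' : IsOpen (O ∩ B.proj ⁻¹' U) := hO.inter (ha.isOpen.preimage B.continuous_proj)
  have hVm : ∀ q ∈ O ∩ B.proj ⁻¹' U, mfderiv (𝓡 4) (𝓡 3) B.proj q (V q) ∈
      Submodule.span ℝ {a (B.proj q), J.ext (B.proj q) (a (B.proj q))} := fun q hq => by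
    rw [← hsp _ hq.2]; exact dproj_mem h (hVD.2 q hq.1)
  have hWm : ∀ q ∈ O ∩ B.proj ⁻¹' U, mfderiv (𝓡 4) (𝓡 3) B.proj q (W q) ∈
      Submodule.span ℝ {a (B.proj q), J.ext (B.proj q) (a (B.proj q))} := fun q hq => by
    rw [← hsp _ hq.2]; exact dproj_mem h (hWD.2 q hq.1)
  obtain ⟨f₁, f₂, hf⟩ := Submodule.mem_span_pair.1 (hVm q₀ ⟨hq₀, hU⟩)
  obtain ⟨g₁, g₂, hg⟩ := Submodule.mem_span_pair.1 (hWm q₀ ⟨hq₀, hU⟩)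
  obtain ⟨c, d, hbr⟩ := dproj_mlieBracket_eq he B.contMDiff_proj ha.isOpen ha.smooth
    (J.smooth_ext ha) (fun y hy => J.frame_linearIndependent ha hy) hO'
    (hV.mono inter_subset_left) (hW.mono inter_subset_left) hVm hWm ⟨hq₀, hU⟩ hU hf.symm hg.symm
  have hmem := mem_derived h (mlieBracket_mem_derived hO hVD hWD hq₀)
  have h1 : a (B.proj q₀) ∈ ξ.plane (B.proj q₀) := ha.mem _ hU
  have h2 := J.ext_mem h1
  -- the projection is injective on the Engel plane, so that the projections of `V` and `W` form a
  -- frame of the contact plane, and the transverse part of their bracket is nonzero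
  have hdet : f₁ * g₂ - f₂ * g₁ ≠ 0 := by
    intro hdet
    have hli := LinearIndependent.pair_iff.1 (hVW q₀ hq₀).1
    have key : ∀ s t : ℝ, s * f₁ + t * g₁ = 0 → s * f₂ + t * g₂ = 0 → s = 0 ∧ t = 0 := by
      intro s t h3 h4
      refine hli s t (hinj _ (add_mem (Submodule.smul_mem _ _ (hVD.2 _ hq₀))
        (Submodule.smul_mem _ _ (hWD.2 _ hq₀))) ?_)
      rw [map_add, map_smul, map_smul]
      change s • mfderiv (𝓡 4) (𝓡 3) B.proj q₀ (V q₀) + t • mfderiv (𝓡 4) (𝓡 3) B.proj q₀ (W q₀) = 0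
      rw [← hf, ← hg]
      calc _ = (s * f₁ + t * g₁) • a (B.proj q₀) +
            (s * f₂ + t * g₂) • J.ext (B.proj q₀) (a (B.proj q₀)) := by module
        _ = 0 := by rw [h3, h4, zero_smul, zero_smul, add_zero]
    have h5 := key g₁ (-f₁) (by ring) (by linarith)
    have h6 := key g₂ (-f₂) (by linarith) (by ring)
    have h7 := key 1 0 (by linarith [h5.2]) (by linarith [h6.2])
    exact one_ne_zero h7.1
  refine J.frame_mlieBracket_notMem ha hU ?_
  change mfderiv (𝓡 4) (𝓡 3) B.proj q₀ _ ∈ _ at hmem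
  rw [hbr] at hmem
  have h3 := sub_mem hmem (add_mem (Submodule.smul_mem _ c h1) (Submodule.smul_mem _ d h2))
  rw [add_sub_cancel_left] at h3
  have h4 := Submodule.smul_mem _ (f₁ * g₂ - f₂ * g₁)⁻¹ h3
  rwa [smul_smul, inv_mul_cancel₀ hdet, one_smul] at h4

theorem eq_comap (h : 𝒟.Induces ξ) (q : Q) :
    𝒟.D q = (B.image 𝒟.D q).comap (B.dproj q).toLinearMap :=
  eq_comap_image q _ (ker_le h q)

theorem finrank_image (h : 𝒟.Induces ξ) (q : Q) : Module.finrank ℝ (B.image 𝒟.D q) = 1 := by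
  have h1 := finrank_comap_dproj q (B.image 𝒟.D q)
  rw [← eq_comap h, finrank_D] at h1
  omega

theorem exists_section_generating (h : 𝒟.Induces ξ) (q₀ : Q) :
    ∃ (O : Set Q) (X : (q : Q) → TangentSpace (𝓡 4) q), IsOpen O ∧ q₀ ∈ O ∧
      IsSectionOn (𝓡 4) 𝒟.D X O ∧ ∀ q ∈ O, B.dproj q (X q) ≠ 0 ∧
        B.image 𝒟.D q = Submodule.span ℝ {B.dproj q (X q)} := by
  obtain ⟨n, e, he⟩ := exists_isImmersed M
  obtain ⟨O, hO, hq₀, V, W, hV, hW, hVW⟩ := 𝒟.isEngel.plane q₀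
  have hVD : IsSectionOn (𝓡 4) 𝒟.D V O := ⟨hV, fun q hq => by
    rw [(hVW q hq).2]; exact Submodule.subset_span (by simp)⟩
  have hWD : IsSectionOn (𝓡 4) 𝒟.D W O := ⟨hW, fun q hq => by
    rw [(hVW q hq).2]; exact Submodule.subset_span (by simp)⟩
  obtain ⟨X, hX, hX0⟩ : ∃ X : (q : Q) → TangentSpace (𝓡 4) q, IsSectionOn (𝓡 4) 𝒟.D X O ∧
      B.dproj q₀ (X q₀) ≠ 0 := by
    by_contra! hcon
    have h1 : B.image 𝒟.D q₀ = ⊥ := by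
      rw [image, (hVW q₀ hq₀).2, Submodule.map_span, Submodule.span_eq_bot]
      rintro x ⟨v, rfl | rfl, rfl⟩
      · exact hcon V hVD
      · exact hcon W hWD
    have h2 := finrank_image h q₀
    rw [h1, finrank_bot] at h2
    exact zero_ne_one h2
  have hcont : ContinuousOn (fun q => mvfderiv (𝓡 3) e (B.proj q) (B.dproj q (X q))) O := by
    have h1 : ∀ q, mvfderiv (𝓡 3) e (B.proj q) (B.dproj q (X q)) =
        mvfderiv (𝓡 4) (e ∘ B.proj) q (X q) := fun q =>
      (mvfderiv_immersion_comp he B.contMDiff_proj q (X q)).symm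
    simp only [h1]
    intro q hq
    exact (ContMDiffAt.mvfderiv_apply_field isOpen_univ
      (he.smooth.comp B.contMDiff_proj).contMDiffOn (mem_univ _) (hX.1 q hq)).continuousWithinAt
  have hne : ∀ q, mvfderiv (𝓡 3) e (B.proj q) (B.dproj q (X q)) ≠ 0 ↔ B.dproj q (X q) ≠ 0 :=
    fun q => (map_ne_zero_iff (mvfderiv (𝓡 3) e (B.proj q)) (he.injective _))
  have hO' := hcont.isOpen_inter_preimage hO (isOpen_compl_singleton (x := 0))
  refine ⟨_, X, hO', ⟨hq₀, (hne q₀).2 hX0⟩, ⟨hX.1.mono inter_subset_left,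
    fun q hq => hX.2 q hq.1⟩, fun q hq => ?_⟩
  have h0 : B.dproj q (X q) ≠ 0 := (hne q).1 hq.2
  refine ⟨h0, (Submodule.eq_of_le_of_finrank_eq ?_ ?_).symm⟩
  · rw [Submodule.span_singleton_le_iff_mem]
    exact Submodule.mem_map_of_mem (hX.2 q hq.1)
  · rw [finrank_image h, finrank_span_singleton h0]

/-- A smooth angle of the development map of an Engel structure is monotone along the fibres, for
otherwise the Engel plane would be closed under brackets to first order at some point. -/
theorem deriv_angle_ne (h : 𝒟.Induces ξ) (ha : ξ.IsSectionOver a U) {O : Set Q} (hO : IsOpen O)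
    (hOU : O ⊆ B.proj ⁻¹' U) {θ : Q → ℝ} (hθ : ContMDiffOn (𝓡 4) 𝓘(ℝ, ℝ) ∞ θ O)
    (hs : ∀ q ∈ O, B.image 𝒟.D q = Submodule.span ℝ {J.rot (B.proj q) (θ q) (a (B.proj q))})
    {q₀ : Q} (hq₀ : q₀ ∈ O) {T : TangentSpace (𝓡 4) q₀} (hT : T ∈ B.pos q₀) :
    mvfderiv (𝓡 4) θ q₀ T ≠ 0 := by
  intro h0
  obtain ⟨n, e, he⟩ := exists_isImmersed M
  have hle : derivedDistribution (𝓡 4) 𝒟.D q₀ ≤ 𝒟.D q₀ := by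
    refine sup_le le_rfl (Submodule.span_le.2 ?_)
    rintro v ⟨O', V, W, hO', hq₀', hV, hW, rfl⟩
    have hmem : ∀ q ∈ O, ∀ v ∈ 𝒟.D q, ∃ f : ℝ,
        B.dproj q v = f • J.rot (B.proj q) (θ q) (a (B.proj q)) := by
      intro q hq v hv
      have h1 : B.dproj q v ∈ B.image 𝒟.D q := Submodule.mem_map_of_mem hv
      rw [hs q hq] at h1
      obtain ⟨f, hf⟩ := Submodule.mem_span_singleton.1 h1
      exact ⟨f, hf.symm⟩
    have hmem2 : ∀ q ∈ O, ∀ v : TangentSpace (𝓡 4) q, ∀ f : ℝ,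
        B.dproj q v = f • J.rot (B.proj q) (θ q) (a (B.proj q)) →
        mvfderiv (𝓡 4) (e ∘ B.proj) q v = f • B.rotated J e a θ q := by
      intro q hq v f hf
      refine (mvfderiv_immersion_comp he B.contMDiff_proj q v).trans ?_
      change mvfderiv (𝓡 3) e (B.proj q) (B.dproj q v) = _
      rw [hf, map_smul]
    obtain ⟨f, hf⟩ := hmem q₀ hq₀ _ (hV.2 _ hq₀')
    obtain ⟨g, hg⟩ := hmem q₀ hq₀ _ (hW.2 _ hq₀')
    have hnhds : ∀ᶠ q in 𝓝 q₀, q ∈ O ∩ O' := (hO.inter hO').mem_nhds ⟨hq₀, hq₀'⟩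
    have hws : ContMDiffAt (𝓡 4) 𝓘(ℝ, EuclideanSpace ℝ (Fin n)) ∞ (B.rotated J e a θ) q₀ := by
      have := contMDiffWithinAt_rotated (J := J) he ha (contMDiffWithinAt_id (x := q₀) (s := O))
        (hOU hq₀) (hθ q₀ hq₀)
      exact this.contMDiffAt (hO.mem_nhds hq₀)
    have hw0 : ∀ q ∈ O, B.rotated J e a θ q ≠ 0 := fun q hq =>
      (map_ne_zero_iff (mvfderiv (𝓡 3) e (B.proj q)) (he.injective _)).2
        (J.rot_ne_zero _ (ha.mem _ (hOU hq)) (ha.ne_zero _ (hOU hq)))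
    obtain ⟨c, hc⟩ := mvfderiv_mlieBracket_eq_of_smul (he.smooth.comp B.contMDiff_proj) hO'
      (V := V) (W := W) hV.1 hW.1 hq₀' hws (hw0 q₀ hq₀)
      (hnhds.mono fun q hq => ⟨hw0 q hq.1, (hmem q hq.1 _ (hV.2 q hq.2)).imp
        fun f hf => hmem2 q hq.1 _ f hf⟩)
      (hnhds.mono fun q hq => (hmem q hq.1 _ (hW.2 q hq.2)).imp
        fun f hf => hmem2 q hq.1 _ f hf) (hmem2 q₀ hq₀ _ f hf) (hmem2 q₀ hq₀ _ g hg)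
    have hvert : B.dproj q₀ (g • V q₀ - f • W q₀) = 0 := by
      rw [map_sub, map_smul, map_smul, hf, hg]
      module
    obtain ⟨k, hk⟩ := B.exists_smul_of_vertical hT hvert
    rw [mvfderiv_rotated he ha (hOU hq₀) ((hθ.contMDiffAt
      (hO.mem_nhds hq₀)).mdifferentiableAt (by simp)) hvert, hk, map_smul (mvfderiv (𝓡 4) θ q₀), h0,
      smul_zero, zero_mul, zero_smul, map_zero, add_zero] at hc
    have hc2 := (mvfderiv_immersion_comp he B.contMDiff_proj q₀
      (VectorField.mlieBracket (𝓡 4) V W q₀)).symm.trans hc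
    rw [rotated, ← map_smul] at hc2
    have hc3 := he.injective _ hc2
    rw [eq_comap h q₀, hs q₀ hq₀]
    exact Submodule.mem_span_singleton.2 ⟨c, hc3.symm⟩
  have h3 := Submodule.finrank_mono hle
  rw [𝒟.isEngel.rank_three, finrank_D] at h3
  omega

/-- The development map of an Engel structure has local smooth angles. -/
theorem exists_twistAngle (h : 𝒟.Induces ξ) (J : ξ.ComplexStructure) (ha : ξ.IsSectionOver a U)
    {q₀ : Q} (hq₀ : B.proj q₀ ∈ U) : ∃ (O : Set Q) (θ : Q → ℝ), q₀ ∈ O ∧ O ⊆ B.proj ⁻¹' U ∧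
      B.IsTwistAngle J (B.image 𝒟.D) a O θ := by
  obtain ⟨n, e, he⟩ := exists_isImmersed M
  obtain ⟨O, X, hO, hq₀O, hX, hXs⟩ := exists_section_generating h q₀
  have hO' : IsOpen (O ∩ B.proj ⁻¹' U) := hO.inter (ha.isOpen.preimage B.continuous_proj)
  set α : Q → EuclideanSpace ℝ (Fin n) := fun q =>
    mvfderiv (𝓡 3) e (B.proj q) (a (B.proj q)) with hα
  set β : Q → EuclideanSpace ℝ (Fin n) := fun q =>
    mvfderiv (𝓡 3) e (B.proj q) (J.ext (B.proj q) (a (B.proj q))) with hβ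
  set w : Q → EuclideanSpace ℝ (Fin n) := fun q => mvfderiv (𝓡 4) (e ∘ B.proj) q (X q) with hw
  have hwe : ∀ q, w q = mvfderiv (𝓡 3) e (B.proj q) (B.dproj q (X q)) := fun q =>
    mvfderiv_immersion_comp he B.contMDiff_proj q (X q)
  set u : Q → ℂ := fun q => (frameCoeff (α q) (β q) (w q) : ℂ) +
    (frameCoeff (β q) (α q) (w q) : ℂ) * Complex.I with hu
  have hli : ∀ q, B.proj q ∈ U → LinearIndependent ℝ ![α q, β q] := fun q hq =>
    he.linearIndependent (J.frame_linearIndependent ha hq)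
  have hus : ContMDiffOn (𝓡 4) 𝓘(ℝ, ℂ) ∞ u (O ∩ B.proj ⁻¹' U) := by
    intro q hq
    have hαs : ContMDiffWithinAt (𝓡 4) 𝓘(ℝ, EuclideanSpace ℝ (Fin n)) ∞ α
        (O ∩ B.proj ⁻¹' U) q := (contMDiffAt_immersed he ha.isOpen ha.smooth hq.2
      ).comp_contMDiffWithinAt q B.contMDiff_proj.contMDiffAt.contMDiffWithinAt
    have hβs : ContMDiffWithinAt (𝓡 4) 𝓘(ℝ, EuclideanSpace ℝ (Fin n)) ∞ β
        (O ∩ B.proj ⁻¹' U) q := (contMDiffAt_immersed he ha.isOpen (J.smooth_ext ha) hq.2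
      ).comp_contMDiffWithinAt q B.contMDiff_proj.contMDiffAt.contMDiffWithinAt
    have hws : ContMDiffWithinAt (𝓡 4) 𝓘(ℝ, EuclideanSpace ℝ (Fin n)) ∞ w
        (O ∩ B.proj ⁻¹' U) q := (ContMDiffAt.mvfderiv_apply_field isOpen_univ
      (he.smooth.comp B.contMDiff_proj).contMDiffOn (mem_univ _) (hX.1 q hq.1)).mono
        inter_subset_left
    have h1 := ContMDiffWithinAt.frameCoeff hαs hβs hws (hli q hq.2)
    have h2 := ContMDiffWithinAt.frameCoeff hβs hαs hws
      ((LinearIndependent.pair_symm_iff).1 (hli q hq.2))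
    have h3 : ContDiff ℝ ∞ (fun x : ℝ × ℝ => (x.1 : ℂ) + (x.2 : ℂ) * Complex.I) :=
      (Complex.ofRealCLM.contDiff.comp contDiff_fst).add
        ((Complex.ofRealCLM.contDiff.comp contDiff_snd).mul contDiff_const)
    exact h3.contMDiff.contMDiffAt.comp_contMDiffWithinAt q (h1.prodMk_space h2)
  -- `u q` is the complex coordinate of the projection of `X q`
  have hum : ∀ q ∈ O ∩ B.proj ⁻¹' U, B.dproj q (X q) = J.mul (B.proj q) (u q) (a (B.proj q)) := by
    intro q hq
    have h1 : B.dproj q (X q) ∈ ξ.plane (B.proj q) := dproj_mem h (hX.2 q hq.1)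
    obtain ⟨z, hz⟩ := J.exists_mul (ha.mem _ hq.2) (ha.ne_zero _ hq.2) h1
    have h2 : w q = z.re • α q + z.im • β q := by
      rw [hwe, hz, J.mul_apply, map_add, map_smul, map_smul]
    have h3 : u q = z := by
      simp only [hu]
      rw [h2, frameCoeff_left (hli q hq.2), frameCoeff_right (hli q hq.2), Complex.re_add_im]
    rw [h3, hz]
  have hu0 : ∀ q ∈ O ∩ B.proj ⁻¹' U, u q ≠ 0 := fun q hq h0 => by
    have := hum q hq
    rw [h0, J.mul_apply, Complex.zero_re, Complex.zero_im, zero_smul, zero_smul, add_zero] at this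
    exact (hXs q hq.1).1 this
  have hq₀' : q₀ ∈ O ∩ B.proj ⁻¹' U := ⟨hq₀O, hq₀⟩
  have hO2 : IsOpen ((O ∩ B.proj ⁻¹' U) ∩ (fun q => u q / u q₀) ⁻¹' Complex.slitPlane) :=
    (hus.continuousOn.div_const _).isOpen_inter_preimage hO' Complex.isOpen_slitPlane
  have hθs : ContMDiffOn (𝓡 4) 𝓘(ℝ, ℝ) ∞ (fun q => angleNear (u q₀) (u q))
      ((O ∩ B.proj ⁻¹' U) ∩ (fun q => u q / u q₀) ⁻¹' Complex.slitPlane) := fun q hq =>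
    (contDiffAt_angleNear (u₀ := u q₀) (u := u q) hq.2).contMDiffAt.comp_contMDiffWithinAt q
      ((hus q hq.1).mono inter_subset_left)
  have hspan : ∀ q ∈ (O ∩ B.proj ⁻¹' U) ∩ (fun q => u q / u q₀) ⁻¹' Complex.slitPlane,
      B.image 𝒟.D q = Submodule.span ℝ
        {J.rot (B.proj q) (angleNear (u q₀) (u q)) (a (B.proj q))} := by
    intro q hq
    have h1 := eq_norm_mul_cisPi_angleNear (hu0 q₀ hq₀') (u q)
    have h2 : B.dproj q (X q) = ‖u q‖ •
        J.rot (B.proj q) (angleNear (u q₀) (u q)) (a (B.proj q)) := by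
      rw [hum q hq.1, OrientedContactStructure.ComplexStructure.rot, ← J.mul_real_mul, ← h1]
    rw [(hXs q hq.1.1).2, h2]
    exact Submodule.span_singleton_smul_eq (IsUnit.mk0 _ (norm_ne_zero_iff.2 (hu0 q hq.1))) _
  refine ⟨(O ∩ B.proj ⁻¹' U) ∩ (fun q => u q / u q₀) ⁻¹' Complex.slitPlane,
    fun q => angleNear (u q₀) (u q), ⟨hq₀', ?_⟩, fun q hq => hq.1.2,
    hO2, hθs, hspan, fun q hq v hv =>
      deriv_angle_ne h ha hO2 (fun q hq => hq.1.2) hθs hspan hq hv⟩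
  change u q₀ / u q₀ ∈ Complex.slitPlane
  rw [div_self (hu0 q₀ hq₀')]
  exact Complex.one_mem_slitPlane

end VerticalEngel

end OrientedCircleBundle

namespace OrientedCircleBundle

variable {M : Type*} [TopologicalSpace M] [ChartedSpace (EuclideanSpace ℝ (Fin 3)) M]
  {Q : Type*} [TopologicalSpace Q] [ChartedSpace (EuclideanSpace ℝ (Fin 4)) Q]
  [IsManifold (𝓡 3) ∞ M] [IsManifold (𝓡 4) ∞ Q] [T2Space M] [CompactSpace M]
  {B : OrientedCircleBundle Q M} {ξ : OrientedContactStructure M} {J : ξ.ComplexStructure}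
  {U : Set M} {a : (y : M) → TangentSpace (𝓡 3) y}
  {ℓ : (q : Q) → Submodule ℝ (TangentSpace (𝓡 3) (B.proj q))}

/-- The preimage under the projection of a field of subspaces of the tangent spaces of the base. -/
def liftField (ℓ : (q : Q) → Submodule ℝ (TangentSpace (𝓡 3) (B.proj q))) :
    TangentDistribution (𝓡 4) Q :=
  fun q => (ℓ q).comap (B.dproj q).toLinearMap

theorem mem_liftField {q : Q} {v : TangentSpace (𝓡 4) q} :
    v ∈ liftField ℓ q ↔ B.dproj q v ∈ ℓ q := Iff.rfl

theorem IsTwisting.le (h : B.IsTwisting J ℓ) (q : Q) : ℓ q ≤ ξ.plane (B.proj q) := by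
  obtain ⟨U, a, O, θ, ha, hq, hOU, hθ⟩ := h q
  rw [hθ.eq_span q hq, Submodule.span_singleton_le_iff_mem]
  exact J.rot_mem _ (ha.mem _ (hOU hq))

/-- The bracket of fields projecting to the contact planes, modulo the contact planes. -/
theorem exists_dproj_mlieBracket (J : ξ.ComplexStructure) {O : Set Q} (hO : IsOpen O)
    {V W : (q : Q) → TangentSpace (𝓡 4) q} (hV : SmoothFieldOn (𝓡 4) V O)
    (hW : SmoothFieldOn (𝓡 4) W O) (hVm : ∀ q ∈ O, B.dproj q (V q) ∈ ξ.plane (B.proj q))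
    (hWm : ∀ q ∈ O, B.dproj q (W q) ∈ ξ.plane (B.proj q)) (ha : ξ.IsSectionOver a U)
    {q₀ : Q} (hq₀ : q₀ ∈ O) (hU : B.proj q₀ ∈ U) {z w : ℂ}
    (hz : B.dproj q₀ (V q₀) = J.mul (B.proj q₀) z (a (B.proj q₀)))
    (hw : B.dproj q₀ (W q₀) = J.mul (B.proj q₀) w (a (B.proj q₀))) :
    ∃ v ∈ ξ.plane (B.proj q₀), B.dproj q₀ (VectorField.mlieBracket (𝓡 4) V W q₀) =
      v + (z.re * w.im - z.im * w.re) •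
        VectorField.mlieBracket (𝓡 3) a (fun y => J.ext y (a y)) (B.proj q₀) := by
  obtain ⟨n, e, he⟩ := exists_isImmersed M
  have hsp : ∀ y ∈ U, ξ.plane y = Submodule.span ℝ {a y, J.ext y (a y)} := fun y hy =>
    J.plane_eq_span (ha.mem y hy) (ha.ne_zero y hy)
  have hO' : IsOpen (O ∩ B.proj ⁻¹' U) := hO.inter (ha.isOpen.preimage B.continuous_proj)
  obtain ⟨c, d, hbr⟩ := dproj_mlieBracket_eq he B.contMDiff_proj ha.isOpen ha.smooth
    (J.smooth_ext ha) (fun y hy => J.frame_linearIndependent ha hy) hO'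
    (hV.mono inter_subset_left) (hW.mono inter_subset_left)
    (fun q hq => by rw [← hsp _ hq.2]; exact hVm q hq.1)
    (fun q hq => by rw [← hsp _ hq.2]; exact hWm q hq.1) ⟨hq₀, hU⟩ hU
    (hz.trans (J.mul_apply _ _)) (hw.trans (J.mul_apply _ _))
  exact ⟨_, add_mem (Submodule.smul_mem _ c (ha.mem _ hU))
    (Submodule.smul_mem _ d (J.ext_mem (ha.mem _ hU))), hbr⟩

/-- If the projections of two sections are proportional, so that no transverse term arises, their
bracket projects to the contact plane. -/
theorem dproj_mlieBracket_mem (J : ξ.ComplexStructure) {O : Set Q} (hO : IsOpen O)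
    {V W : (q : Q) → TangentSpace (𝓡 4) q} (hV : SmoothFieldOn (𝓡 4) V O)
    (hW : SmoothFieldOn (𝓡 4) W O) (hVm : ∀ q ∈ O, B.dproj q (V q) ∈ ξ.plane (B.proj q))
    (hWm : ∀ q ∈ O, B.dproj q (W q) ∈ ξ.plane (B.proj q))
    {q₀ : Q} (hq₀ : q₀ ∈ O) {w : TangentSpace (𝓡 3) (B.proj q₀)} {f g : ℝ}
    (hf : B.dproj q₀ (V q₀) = f • w) (hg : B.dproj q₀ (W q₀) = g • w)
    (hw : w ∈ ξ.plane (B.proj q₀)) :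
    B.dproj q₀ (VectorField.mlieBracket (𝓡 4) V W q₀) ∈ ξ.plane (B.proj q₀) := by
  obtain ⟨U, a, hU, ha⟩ := ξ.exists_isSectionOver (B.proj q₀)
  obtain ⟨z, rfl⟩ := J.exists_mul (ha.mem _ hU) (ha.ne_zero _ hU) hw
  rw [← J.mul_real_mul] at hf hg
  obtain ⟨v, hv, h⟩ := exists_dproj_mlieBracket J hO hV hW hVm hWm ha hq₀ hU hf hg
  rw [h]
  have : ((f : ℂ) * z).re * ((g : ℂ) * z).im - ((f : ℂ) * z).im * ((g : ℂ) * z).re = 0 := by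
    simp; ring
  rw [this, zero_smul, add_zero]
  exact hv

theorem derivedDistribution_liftField (h : B.IsTwisting J ℓ) :
    derivedDistribution (𝓡 4) (liftField ℓ) = liftField (fun q => ξ.plane (B.proj q)) := by
  funext q₀
  obtain ⟨n, e, he⟩ := exists_isImmersed M
  obtain ⟨U, a, O, θ, ha, hq₀, hOU, hθ⟩ := h q₀
  have hw : J.rot (B.proj q₀) (θ q₀) (a (B.proj q₀)) ∈ ξ.plane (B.proj q₀) :=
    J.rot_mem _ (ha.mem _ (hOU hq₀))
  refine le_antisymm (sup_le (fun v hv => h.le q₀ hv) (Submodule.span_le.2 ?_)) ?_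
  · rintro v ⟨O', V, W, hO', hq₀', hV, hW, rfl⟩
    have hVq := hV.2 q₀ hq₀'
    have hWq := hW.2 q₀ hq₀'
    rw [mem_liftField, hθ.eq_span q₀ hq₀] at hVq hWq
    obtain ⟨f, hf⟩ := Submodule.mem_span_singleton.1 hVq
    obtain ⟨g, hg⟩ := Submodule.mem_span_singleton.1 hWq
    exact dproj_mlieBracket_mem J hO' hV.1 hW.1 (fun q hq => h.le q (hV.2 q hq))
      (fun q hq => h.le q (hW.2 q hq)) hq₀' hf.symm hg.symm hw
  · obtain ⟨O₁, lift, hO₁, hq₁, hl1, hl2, hl3, hl4⟩ := exists_lift (B := B) he q₀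
    have hOO : IsOpen (O ∩ O₁) := hθ.isOpen.inter hO₁
    set T : (q : Q) → TangentSpace (𝓡 4) q := fun q => lift q 0 1 with hT
    set W : (q : Q) → TangentSpace (𝓡 4) q := fun q => lift q (B.rotated J e a θ q) 0 with hW
    have hTs : SmoothFieldOn (𝓡 4) T (O ∩ O₁) := fun q hq =>
      hl4 (u := fun _ => 0) (s := fun _ => 1) hq.2 contMDiffWithinAt_id contMDiffWithinAt_const
        contMDiffWithinAt_const
    have hWs : SmoothFieldOn (𝓡 4) W (O ∩ O₁) := fun q hq =>
      hl4 (s := fun _ => 0) hq.2 contMDiffWithinAt_id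
        (contMDiffWithinAt_rotated he ha contMDiffWithinAt_id (hOU hq.1)
          ((hθ.smooth q hq.1).mono inter_subset_left)) contMDiffWithinAt_const
    have hTd : ∀ q ∈ O ∩ O₁, B.dproj q (T q) = 0 := fun q hq =>
      B.dproj_of_mem_pos (hl2 q hq.2)
    have hWd : ∀ q ∈ O ∩ O₁, B.dproj q (W q) = J.rot (B.proj q) (θ q) (a (B.proj q)) :=
      fun q hq => hl1 q hq.2 _ 0
    have hTD : IsSectionOn (𝓡 4) (liftField ℓ) T (O ∩ O₁) := ⟨hTs, fun q hq => by
      rw [mem_liftField, hTd q hq]; exact zero_mem _⟩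
    have hWD : IsSectionOn (𝓡 4) (liftField ℓ) W (O ∩ O₁) := ⟨hWs, fun q hq => by
      rw [mem_liftField, hWd q hq, hθ.eq_span q hq.1]; exact Submodule.mem_span_singleton_self _⟩
    have hq : q₀ ∈ O ∩ O₁ := ⟨hq₀, hq₁⟩
    have hbr := VerticalEngel.mlieBracket_mem_derived hOO hTD hWD hq
    have hnhds : ∀ᶠ q in 𝓝 q₀, q ∈ O ∩ O₁ := hOO.mem_nhds hq
    have hws : ContMDiffAt (𝓡 4) 𝓘(ℝ, EuclideanSpace ℝ (Fin n)) ∞ (B.rotated J e a θ) q₀ :=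
      (contMDiffWithinAt_rotated (J := J) he ha (contMDiffWithinAt_id (x := q₀) (s := O))
        (hOU hq₀) (hθ.smooth q₀ hq₀)).contMDiffAt (hθ.isOpen.mem_nhds hq₀)
    have hw0 : ∀ q ∈ O, B.rotated J e a θ q ≠ 0 := fun q hq =>
      (map_ne_zero_iff (mvfderiv (𝓡 3) e (B.proj q)) (he.injective _)).2
        (J.rot_ne_zero _ (ha.mem _ (hOU hq)) (ha.ne_zero _ (hOU hq)))
    have hTp : ∀ q ∈ O ∩ O₁, mvfderiv (𝓡 4) (e ∘ B.proj) q (T q) =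
        (0 : ℝ) • B.rotated J e a θ q := by
      intro q hq
      refine (mvfderiv_immersion_comp he B.contMDiff_proj q (T q)).trans ?_
      change mvfderiv (𝓡 3) e (B.proj q) (B.dproj q (T q)) = _
      rw [hTd q hq, map_zero, zero_smul]
    have hWp : ∀ q ∈ O ∩ O₁, mvfderiv (𝓡 4) (e ∘ B.proj) q (W q) =
        (1 : ℝ) • B.rotated J e a θ q := by
      intro q hq
      refine (mvfderiv_immersion_comp he B.contMDiff_proj q (W q)).trans ?_
      change mvfderiv (𝓡 3) e (B.proj q) (B.dproj q (W q)) = _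
      rw [hWd q hq, one_smul]
    obtain ⟨c, hc⟩ := mvfderiv_mlieBracket_eq_of_smul (he.smooth.comp B.contMDiff_proj) hOO
      (V := T) (W := W) hTs hWs hq hws (hw0 q₀ hq₀)
      (hnhds.mono fun q hq => ⟨hw0 q hq.1, 0, hTp q hq⟩) (hnhds.mono fun q hq => ⟨1, hWp q hq⟩)
      (hTp q₀ hq) (hWp q₀ hq)
    rw [one_smul, zero_smul, sub_zero, mvfderiv_rotated he ha (hOU hq₀) ((hθ.smooth.contMDiffAt
      (hθ.isOpen.mem_nhds hq₀)).mdifferentiableAt (by simp)) (hTd q₀ hq), rotated, ← map_smul,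
      ← map_add] at hc
    have hc2 := he.injective _ ((mvfderiv_immersion_comp he B.contMDiff_proj q₀
      (VectorField.mlieBracket (𝓡 4) T W q₀)).symm.trans hc)
    -- the projection of the derived distribution contains `w` and `J w`, hence the contact plane
    set S := derivedDistribution (𝓡 4) (liftField ℓ) q₀ with hS
    have hle : liftField ℓ q₀ ≤ S := le_sup_left
    have hker : LinearMap.ker (B.dproj q₀).toLinearMap ≤ S :=
      ker_dproj_le (B.ne_zero_of_mem_pos (hl2 q₀ hq₁)) (hTd q₀ hq) (hle (hTD.2 q₀ hq))
    have hS2 : S = (S.map (B.dproj q₀).toLinearMap).comap (B.dproj q₀).toLinearMap := by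
      rw [Submodule.comap_map_eq, sup_eq_left.2 hker]
    have hwS : J.rot (B.proj q₀) (θ q₀) (a (B.proj q₀)) ∈ S.map (B.dproj q₀).toLinearMap :=
      ⟨W q₀, hle (hWD.2 q₀ hq), hWd q₀ hq⟩
    have hbS : B.dproj q₀ (VectorField.mlieBracket (𝓡 4) T W q₀) ∈
        S.map (B.dproj q₀).toLinearMap := ⟨_, hbr, rfl⟩
    have hne : mvfderiv (𝓡 4) θ q₀ (T q₀) * Real.pi ≠ 0 :=
      mul_ne_zero (hθ.deriv_ne q₀ hq₀ _ (hl2 q₀ hq₁)) Real.pi_ne_zero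
    have hJS : J.ext (B.proj q₀) (J.rot (B.proj q₀) (θ q₀) (a (B.proj q₀))) ∈
        S.map (B.dproj q₀).toLinearMap := by
      change mfderiv (𝓡 4) (𝓡 3) B.proj q₀ _ ∈ _ at hbS
      rw [hc2] at hbS
      have h3 := sub_mem hbS (Submodule.smul_mem _ c hwS)
      rw [add_sub_cancel_left] at h3
      have h4 := Submodule.smul_mem _ (mvfderiv (𝓡 4) θ q₀ (T q₀) * Real.pi)⁻¹ h3
      rwa [smul_smul, inv_mul_cancel₀ hne, one_smul] at h4
    rw [hS2]
    refine Submodule.comap_mono ?_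
    change ξ.plane (B.proj q₀) ≤ _
    rw [J.plane_eq_span hw (J.rot_ne_zero _ (ha.mem _ (hOU hq₀)) (ha.ne_zero _ (hOU hq₀))),
      Submodule.span_le]
    rintro x (rfl | rfl)
    · exact hwS
    · exact hJS

theorem linearIndependent_of_mem_pos {q : Q} {T Y : TangentSpace (𝓡 4) q} (hT : T ∈ B.pos q)
    (hY : B.dproj q Y ≠ 0) : LinearIndependent ℝ ![T, Y] := by
  rw [LinearIndependent.pair_iff]
  intro s t hst
  have h1 := congrArg (B.dproj q) hst
  rw [map_add, map_smul, map_smul, B.dproj_of_mem_pos hT, smul_zero, zero_add, map_zero,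
    smul_eq_zero] at h1
  have ht := h1.resolve_right hY
  rw [ht, zero_smul, add_zero, smul_eq_zero] at hst
  exact ⟨hst.resolve_right (B.ne_zero_of_mem_pos hT), ht⟩

theorem liftField_eq_span {q : Q} {T Y : TangentSpace (𝓡 4) q} (hT : T ∈ B.pos q)
    (hY : B.dproj q Y ≠ 0) (hℓ : ℓ q = Submodule.span ℝ {B.dproj q Y}) :
    LinearIndependent ℝ ![T, Y] ∧ liftField ℓ q = Submodule.span ℝ {T, Y} := by
  have hT0 := B.dproj_of_mem_pos hT
  have hli := linearIndependent_of_mem_pos hT hY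
  refine ⟨hli, (Submodule.eq_of_le_of_finrank_eq (Submodule.span_le.2 ?_) ?_).symm⟩
  · rintro x (rfl | rfl)
    · change B.dproj q _ ∈ ℓ q
      rw [hT0]; exact zero_mem _
    · change B.dproj q _ ∈ ℓ q
      rw [hℓ]; exact Submodule.mem_span_singleton_self _
  · have h2 := finrank_span_eq_card hli
    rw [Matrix.range_cons_cons_empty] at h2
    rw [h2, liftField, finrank_comap_dproj, hℓ, finrank_span_singleton hY]
    simp

theorem isPlaneField_liftField (h : B.IsTwisting J ℓ) : IsPlaneField (𝓡 4) (liftField ℓ) := by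
  intro q₀
  obtain ⟨n, e, he⟩ := exists_isImmersed M
  obtain ⟨U, a, O, θ, ha, hq₀, hOU, hθ⟩ := h q₀
  obtain ⟨O₁, lift, hO₁, hq₁, hl1, hl2, hl3, hl4⟩ := exists_lift (B := B) he q₀
  refine ⟨O ∩ O₁, hθ.isOpen.inter hO₁, ⟨hq₀, hq₁⟩, fun q => lift q 0 1,
    fun q => lift q (B.rotated J e a θ q) 0, fun q hq =>
      hl4 (u := fun _ => 0) (s := fun _ => 1) hq.2 contMDiffWithinAt_id contMDiffWithinAt_const
        contMDiffWithinAt_const, fun q hq => hl4 (s := fun _ => 0) hq.2 contMDiffWithinAt_id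
        (contMDiffWithinAt_rotated he ha contMDiffWithinAt_id (hOU hq.1)
          ((hθ.smooth q hq.1).mono inter_subset_left)) contMDiffWithinAt_const, fun q hq => ?_⟩
  have hW := hl1 q hq.2 (J.rot (B.proj q) (θ q) (a (B.proj q))) 0
  refine liftField_eq_span (hl2 q hq.2) ?_ ?_
  · rw [hW]
    exact J.rot_ne_zero (θ q) (ha.mem _ (hOU hq.1)) (ha.ne_zero _ (hOU hq.1))
  · rw [hW, hθ.eq_span q hq.1]

/-- Sections of the preimage of the contact planes with prescribed constant coefficients. -/
theorem exists_section_of_coeff (ha : ξ.IsSectionOver a U) {q₀ : Q} (hU : B.proj q₀ ∈ U)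
    (J : ξ.ComplexStructure) : ∃ (O : Set Q) (X : ℂ → ℝ → (q : Q) → TangentSpace (𝓡 4) q),
      IsOpen O ∧ q₀ ∈ O ∧ (∀ z s, IsSectionOn (𝓡 4) (liftField fun q => ξ.plane (B.proj q)) (X z s) O)
      ∧ (∀ z s, B.dproj q₀ (X z s q₀) = J.mul (B.proj q₀) z (a (B.proj q₀))) ∧
      ∀ z v, B.dproj q₀ v = J.mul (B.proj q₀) z (a (B.proj q₀)) → ∃ s, X z s q₀ = v := by
  obtain ⟨n, e, he⟩ := exists_isImmersed M
  obtain ⟨O₁, lift, hO₁, hq₁, hl1, hl2, hl3, hl4⟩ := exists_lift (B := B) he q₀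
  have hX : ∀ z s, ∀ q ∈ O₁, B.dproj q (lift q (mvfderiv (𝓡 3) e (B.proj q)
      (J.mul (B.proj q) z (a (B.proj q)))) s) = J.mul (B.proj q) z (a (B.proj q)) :=
    fun z s q hq => hl1 q hq _ s
  refine ⟨O₁ ∩ B.proj ⁻¹' U, fun z s q => lift q (mvfderiv (𝓡 3) e (B.proj q)
    (J.mul (B.proj q) z (a (B.proj q)))) s, hO₁.inter (ha.isOpen.preimage B.continuous_proj),
    ⟨hq₁, hU⟩, fun z s => ⟨fun q hq => ?_, fun q hq => ?_⟩, fun z s => hX z s q₀ hq₁,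
    fun z v hv => ?_⟩
  · refine hl4 (s := fun _ => s) hq.1 contMDiffWithinAt_id ?_ contMDiffWithinAt_const
    have hπ : ContMDiffWithinAt (𝓡 4) (𝓡 3) ∞ B.proj (O₁ ∩ B.proj ⁻¹' U) q :=
      (B.contMDiff_proj q).contMDiffWithinAt
    have h1 := (contMDiffAt_immersed he ha.isOpen ha.smooth hq.2).comp_contMDiffWithinAt q hπ
    have h2 := (contMDiffAt_immersed he ha.isOpen (J.smooth_ext ha) hq.2).comp_contMDiffWithinAt q hπ
    have h3 : ∀ c : ℝ, ContMDiffWithinAt (𝓡 4) 𝓘(ℝ, ℝ) ∞ (fun _ : Q => c)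
        (O₁ ∩ B.proj ⁻¹' U) q := fun c => contMDiffWithinAt_const
    have h5 := ((h3 z.re).smul h1).add ((h3 z.im).smul h2)
    have h6 : ∀ q, mvfderiv (𝓡 3) e (B.proj q) (J.mul (B.proj q) z (a (B.proj q))) = _ :=
      fun q => by rw [J.mul_apply, map_add, map_smul, map_smul]
    exact h5.congr_of_eventuallyEq (Eventually.of_forall h6) (h6 q)
  · rw [mem_liftField, hX z s q hq.1]
    exact J.mul_mem _ (ha.mem _ hq.2)
  · have h1 : B.dproj q₀ (v - lift q₀ (mvfderiv (𝓡 3) e (B.proj q₀)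
        (J.mul (B.proj q₀) z (a (B.proj q₀)))) 0) = 0 := by
      rw [map_sub, hv, hX z 0 q₀ hq₁, sub_self]
    obtain ⟨s, hs⟩ := B.exists_smul_of_vertical (hl2 q₀ hq₁) h1
    refine ⟨s, ?_⟩
    change lift q₀ _ s = v
    rw [hl3, ← hs]
    abel

theorem derivedDistribution_liftField_plane (J : ξ.ComplexStructure) (q₀ : Q) :
    derivedDistribution (𝓡 4) (liftField fun q => ξ.plane (B.proj q)) q₀ = ⊤ := by
  obtain ⟨U, a, hU, ha⟩ := ξ.exists_isSectionOver (B.proj q₀)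
  obtain ⟨O, X, hO, hq₀, hX, hXz, hXs⟩ := exists_section_of_coeff (B := B) ha hU J
  have hbr := VerticalEngel.mlieBracket_mem_derived hO (hX 1 0) (hX Complex.I 0) hq₀
  obtain ⟨v, hv, h⟩ := exists_dproj_mlieBracket J hO (hX 1 0).1 (hX Complex.I 0).1
    (hX 1 0).2 (hX Complex.I 0).2 ha hq₀ hU (hXz 1 0) (hXz Complex.I 0)
  simp only [Complex.one_re, Complex.one_im, Complex.I_re, Complex.I_im, mul_one, mul_zero,
    sub_zero, one_smul] at h
  have hlt : liftField (fun q => ξ.plane (B.proj q)) q₀ <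
      derivedDistribution (𝓡 4) (liftField fun q => ξ.plane (B.proj q)) q₀ := by
    refine lt_of_le_of_ne le_sup_left fun heq => ?_
    rw [← heq, mem_liftField, h] at hbr
    have := sub_mem hbr hv
    rw [add_sub_cancel_left] at this
    exact J.frame_mlieBracket_notMem ha hU this
  have h1 := Submodule.finrank_lt_finrank_of_lt hlt
  rw [liftField, finrank_comap_dproj, ξ.finrank_plane] at h1
  have h4 : Module.finrank ℝ (TangentSpace (𝓡 4) q₀) = 4 := by
    change Module.finrank ℝ (EuclideanSpace ℝ (Fin 4)) = 4
    simp
  refine Submodule.eq_top_of_finrank_eq (le_antisymm (Submodule.finrank_le _) ?_)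
  rw [h4]
  exact h1

/-- The Engel structure whose development map is a given twisting line field. -/
def VerticalEngel.ofTwisting (h : B.IsTwisting J ℓ) : B.VerticalEngel where
  D := liftField ℓ
  isEngel :=
    { plane := isPlaneField_liftField h
      rank_three := fun q => by
        rw [derivedDistribution_liftField h, liftField, finrank_comap_dproj, ξ.finrank_plane]
      full := fun q => by
        rw [derivedDistribution_liftField h, derivedDistribution_liftField_plane J] }
  vertical := fun q₀ => by
    rw [characteristicLine, derivedDistribution_liftField h]
    obtain ⟨U, a, hU, ha⟩ := ξ.exists_isSectionOver (B.proj q₀)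
    ext v
    constructor
    · rintro ⟨hv, hbr⟩
      obtain ⟨z, hz⟩ := J.exists_mul (ha.mem _ hU) (ha.ne_zero _ hU) hv
      obtain ⟨O, X, hO, hq₀, hX, hXz, hXs⟩ := exists_section_of_coeff (B := B) ha hU J
      obtain ⟨s, hs⟩ := hXs z v hz
      have hmem := hbr O _ _ hO hq₀ (hX z s) (hX (Complex.I * z) 0) hs
      obtain ⟨w, hw, h'⟩ := exists_dproj_mlieBracket J hO (hX z s).1 (hX (Complex.I * z) 0).1
        (hX z s).2 (hX (Complex.I * z) 0).2 ha hq₀ hU (hXz z s) (hXz (Complex.I * z) 0)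
      rw [mem_liftField, h'] at hmem
      have h3 := sub_mem hmem hw
      rw [add_sub_cancel_left] at h3
      have hn : z.re * (Complex.I * z).im - z.im * (Complex.I * z).re = Complex.normSq z := by
        rw [Complex.normSq_apply]; simp
      rw [hn] at h3
      have hz0 : z = 0 := by
        by_contra hz0
        have h4 := Submodule.smul_mem _ (Complex.normSq z)⁻¹ h3
        rw [smul_smul, inv_mul_cancel₀ (by simpa using hz0), one_smul] at h4
        exact J.frame_mlieBracket_notMem ha hU h4
      change B.dproj q₀ v = 0
      refine (show B.dproj q₀ v = _ from hz).trans ?_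
      rw [hz0, J.mul_apply]
      simp
    · intro hv
      change B.dproj q₀ v = 0 at hv
      refine ⟨?_, fun O V W hO hq hV hW hVv => ?_⟩
      · rw [mem_liftField, hv]; exact zero_mem _
      · rw [mem_liftField]
        refine dproj_mlieBracket_mem J hO hV.1 hW.1 hV.2 hW.2 hq
          (w := B.dproj q₀ (W q₀)) (f := 0) (g := 1) ?_ (one_smul _ _).symm (hW.2 q₀ hq)
        rw [hVv, hv, zero_smul]

theorem VerticalEngel.image_ofTwisting (h : B.IsTwisting J ℓ) :
    B.image (VerticalEngel.ofTwisting h).D = ℓ :=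
  funext fun q => image_comap q _ _ rfl

theorem VerticalEngel.induces_ofTwisting (h : B.IsTwisting J ℓ) :
    (VerticalEngel.ofTwisting h).Induces ξ := fun q => by
  refine image_comap q _ _ ?_
  exact congrFun (derivedDistribution_liftField h) q

theorem VerticalEngel.ext_image {𝒟 𝒟' : B.VerticalEngel} (h : 𝒟.Induces ξ) (h' : 𝒟'.Induces ξ)
    (heq : B.image 𝒟.D = B.image 𝒟'.D) : 𝒟 = 𝒟' := by
  have : 𝒟.D = 𝒟'.D := funext fun q => by rw [eq_comap h, eq_comap h', heq]
  cases 𝒟; cases 𝒟'; congr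

end OrientedCircleBundle

/-! ### Angles between directions in the contact planes -/

theorem AddCircle.coe_eq_coe_iff_exists {p x y : ℝ} :
    (x : AddCircle p) = (y : AddCircle p) ↔ ∃ k : ℤ, y = x + k * p := by
  rw [eq_comm, QuotientAddGroup.eq_iff_sub_mem, AddSubgroup.mem_zmultiples_iff]
  refine exists_congr fun k => ?_
  rw [zsmul_eq_mul, eq_comm, sub_eq_iff_eq_add']

namespace OrientedContactStructure

variable {M : Type*} [TopologicalSpace M] [ChartedSpace (EuclideanSpace ℝ (Fin 3)) M]
  [IsManifold (𝓡 3) ∞ M] {ξ : OrientedContactStructure M}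

namespace ComplexStructure

variable (J : ξ.ComplexStructure) {y : M} {u v w w' : TangentSpace (𝓡 3) y}

variable (v w) in
/-- The angle (in units of `π`) from `v` to `w`, up to multiples of `p`.  For `p = 1` it depends
only on the lines spanned by `v` and `w`, for `p = 2` on the rays. -/
def dir (p : ℝ) : AddCircle p :=
  (Classical.epsilon fun s : ℝ => ∃ r : ℝ, 0 < r ∧ w = r • J.rot y s v : ℝ)

theorem rot_unique (hv : v ∈ ξ.plane y) (h0 : v ≠ 0) {r r' s s' : ℝ} (hr : 0 < r) (hr' : 0 < r')
    (h : r • J.rot y s v = r' • J.rot y s' v) : ∃ k : ℤ, s' = s + 2 * k := by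
  rw [← J.sameRay_rot_iff s s' hv h0]
  exact Or.inr (Or.inr ⟨r, r', hr, hr', h⟩)

variable {p : ℝ}

theorem dir_eq (hp : ∃ j : ℤ, (2 : ℝ) = j * p) (hv : v ∈ ξ.plane y) (h0 : v ≠ 0) {r s : ℝ}
    (hr : 0 < r) (h : w = r • J.rot y s v) : J.dir v w p = (s : AddCircle p) := by
  obtain ⟨r', hr', h'⟩ := Classical.epsilon_spec (p := fun s : ℝ => ∃ r : ℝ, 0 < r ∧
    w = r • J.rot y s v) ⟨s, r, hr, h⟩
  obtain ⟨k, hk⟩ := J.rot_unique hv h0 hr' hr (h'.symm.trans h)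
  obtain ⟨j, hj⟩ := hp
  rw [dir, AddCircle.coe_eq_coe_iff_exists]
  refine ⟨k * j, ?_⟩
  rw [hk]; push_cast; rw [mul_assoc, ← hj]; ring

theorem dir_eq_iff (hp : ∃ j : ℤ, (2 : ℝ) = j * p) (hv : v ∈ ξ.plane y) (h0 : v ≠ 0)
    (hw : w ∈ ξ.plane y) (hw0 : w ≠ 0) {s : ℝ} : J.dir v w p = (s : AddCircle p) ↔
      ∃ (r : ℝ) (k : ℤ), 0 < r ∧ w = r • J.rot y (s + k * p) v := by
  constructor
  · intro h
    obtain ⟨r, t, hr, ht⟩ := J.exists_rot hv h0 hw hw0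
    rw [J.dir_eq hp hv h0 hr ht, eq_comm, AddCircle.coe_eq_coe_iff_exists] at h
    obtain ⟨k, hk⟩ := h
    exact ⟨r, k, hr, by rw [← hk]; exact ht⟩
  · rintro ⟨r, k, hr, h⟩
    rw [J.dir_eq hp hv h0 hr h, eq_comm, AddCircle.coe_eq_coe_iff_exists]
    exact ⟨k, rfl⟩

theorem dir_add (hp : ∃ j : ℤ, (2 : ℝ) = j * p) (hu : u ∈ ξ.plane y) (hu0 : u ≠ 0)
    (hv : v ∈ ξ.plane y) (hv0 : v ≠ 0) (hw : w ∈ ξ.plane y) (hw0 : w ≠ 0) :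
    J.dir u v p + J.dir v w p = J.dir u w p := by
  obtain ⟨r, s, hr, hs⟩ := J.exists_rot hu hu0 hv hv0
  obtain ⟨r', s', hr', hs'⟩ := J.exists_rot hv hv0 hw hw0
  rw [J.dir_eq hp hu hu0 hr hs, J.dir_eq hp hv hv0 hr' hs',
    J.dir_eq hp hu hu0 (mul_pos hr' hr) (s := s' + s), ← AddCircle.coe_add, add_comm]
  rw [hs', hs, map_smul, J.rot_rot _ _ hu, smul_smul]

theorem dir_self (hp : ∃ j : ℤ, (2 : ℝ) = j * p) (hv : v ∈ ξ.plane y) (h0 : v ≠ 0) :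
    J.dir v v p = 0 := by
  rw [J.dir_eq hp hv h0 one_pos (s := 0) (by simp), AddCircle.coe_zero]

theorem exists_one : ∃ j : ℤ, (2 : ℝ) = j * 1 := ⟨2, by norm_num⟩

theorem exists_two : ∃ j : ℤ, (2 : ℝ) = j * 2 := ⟨1, by norm_num⟩

theorem span_eq_iff_dir (hv : v ∈ ξ.plane y) (h0 : v ≠ 0) (hw : w ∈ ξ.plane y) (hw0 : w ≠ 0)
    {s : ℝ} : Submodule.span ℝ {w} = Submodule.span ℝ {J.rot y s v} ↔
      J.dir v w 1 = (s : AddCircle (1 : ℝ)) := by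
  obtain ⟨r, t, hr, ht⟩ := J.exists_rot hv h0 hw hw0
  rw [J.dir_eq exists_one hv h0 hr ht, ht, Submodule.span_singleton_smul_eq (IsUnit.mk0 _ hr.ne'),
    J.span_rot_eq_iff t s hv h0, AddCircle.coe_eq_coe_iff_exists]
  simp

theorem dir_congr_span (hv : v ∈ ξ.plane y) (h0 : v ≠ 0) (hw : w ∈ ξ.plane y) (hw0 : w ≠ 0)
    (hw' : w' ∈ ξ.plane y) (hw0' : w' ≠ 0)
    (h : Submodule.span ℝ {w} = Submodule.span ℝ {w'}) : J.dir v w 1 = J.dir v w' 1 := by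
  obtain ⟨r, t, hr, ht⟩ := J.exists_rot hv h0 hw' hw0'
  rw [J.dir_eq exists_one hv h0 hr ht, ← J.span_eq_iff_dir hv h0 hw hw0, h,
    J.span_eq_iff_dir hv h0 hw' hw0', J.dir_eq exists_one hv h0 hr ht]

theorem sameRay_iff_dir (hv : v ∈ ξ.plane y) (h0 : v ≠ 0) (hw : w ∈ ξ.plane y) (hw0 : w ≠ 0)
    {s : ℝ} : SameRay ℝ w (J.rot y s v) ↔ J.dir v w 2 = (s : AddCircle (2 : ℝ)) := by
  obtain ⟨r, t, hr, ht⟩ := J.exists_rot hv h0 hw hw0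
  rw [J.dir_eq exists_two hv h0 hr ht, ht,
    AddCircle.coe_eq_coe_iff_exists]
  have h1 : SameRay ℝ (r • J.rot y t v) (J.rot y s v) ↔ SameRay ℝ (J.rot y t v) (J.rot y s v) := by
    refine ⟨fun h => ?_, fun h => h.pos_smul_left hr⟩
    have := h.pos_smul_left (inv_pos.2 hr)
    rwa [smul_smul, inv_mul_cancel₀ hr.ne', one_smul] at this
  rw [h1, J.sameRay_rot_iff t s hv h0]
  simp [mul_comm]

/-- The angle of a continuous field of directions is continuous. -/
theorem continuousWithinAt_dir {G : Type*} [NormedAddCommGroup G] [InnerProductSpace ℝ G]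
    {e : M → G} (he : IsImmersed e) (hp : ∃ j : ℤ, (2 : ℝ) = j * p)
    {a : (y : M) → TangentSpace (𝓡 3) y} {U : Set M} (ha : ξ.IsSectionOver a U)
    {P : Type*} [TopologicalSpace P] {g : P → M} {w : (x : P) → TangentSpace (𝓡 3) (g x)}
    {S : Set P} {x₀ : P} (hx₀ : x₀ ∈ S) (hg : ContinuousWithinAt g S x₀) (hgU : g x₀ ∈ U)
    (hw : ContinuousWithinAt (fun x => mvfderiv (𝓡 3) e (g x) (w x)) S x₀)
    (hmem : ∀ x ∈ S, w x ∈ ξ.plane (g x)) (hne : w x₀ ≠ 0) :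
    ContinuousWithinAt (fun x => J.dir (a (g x)) (w x) p) S x₀ := by
  set α : P → G := fun x => mvfderiv (𝓡 3) e (g x) (a (g x)) with hα
  set β : P → G := fun x => mvfderiv (𝓡 3) e (g x) (J.ext (g x) (a (g x))) with hβ
  set Ω : P → G := fun x => mvfderiv (𝓡 3) e (g x) (w x) with hΩ
  have hαc : ContinuousWithinAt α S x₀ :=
    (OrientedCircleBundle.contMDiffAt_immersed he ha.isOpen ha.smooth
      hgU).continuousAt.comp_continuousWithinAt hg
  have hβc : ContinuousWithinAt β S x₀ :=
    (OrientedCircleBundle.contMDiffAt_immersed he ha.isOpen (J.smooth_ext ha)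
      hgU).continuousAt.comp_continuousWithinAt hg
  have hli : ∀ x, g x ∈ U → LinearIndependent ℝ ![α x, β x] := fun x hx =>
    he.linearIndependent (J.frame_linearIndependent ha hx)
  set z : P → ℂ := fun x => (frameCoeff (α x) (β x) (Ω x) : ℂ) +
    (frameCoeff (β x) (α x) (Ω x) : ℂ) * Complex.I with hz
  have hzc : ContinuousWithinAt z S x₀ := by
    have h1 : ContinuousWithinAt (fun x => frameCoeff (α x) (β x) (Ω x)) S x₀ :=
      ContinuousAt.comp_continuousWithinAt (f := fun x => (α x, β x, Ω x))
        (contDiffAt_frameCoeff (w := Ω x₀) (hli x₀ hgU)).continuousAt (hαc.prodMk (hβc.prodMk hw))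
    have h2 : ContinuousWithinAt (fun x => frameCoeff (β x) (α x) (Ω x)) S x₀ :=
      ContinuousAt.comp_continuousWithinAt (f := fun x => (β x, α x, Ω x))
        (contDiffAt_frameCoeff (w := Ω x₀)
          ((LinearIndependent.pair_symm_iff).1 (hli x₀ hgU))).continuousAt
        (hβc.prodMk (hαc.prodMk hw))
    exact (Complex.continuous_ofReal.continuousAt.comp_continuousWithinAt h1).add
      ((Complex.continuous_ofReal.continuousAt.comp_continuousWithinAt h2).mul
        continuousWithinAt_const)
  have hwz : ∀ x ∈ S, g x ∈ U → w x = J.mul (g x) (z x) (a (g x)) := by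
    intro x hx hxU
    obtain ⟨c, hc⟩ := J.exists_mul (ha.mem _ hxU) (ha.ne_zero _ hxU) (hmem x hx)
    have h2 : Ω x = c.re • α x + c.im • β x := by
      simp only [hΩ]
      rw [hc, J.mul_apply, map_add, map_smul, map_smul]
    have h3 : z x = c := by
      simp only [hz]
      rw [h2, frameCoeff_left (hli x hxU), frameCoeff_right (hli x hxU), Complex.re_add_im]
    rw [h3, hc]
  have hz0 : z x₀ ≠ 0 := by
    intro h0
    have := hwz x₀ hx₀ hgU
    rw [h0, J.mul_apply, Complex.zero_re, Complex.zero_im, zero_smul, zero_smul, add_zero] at this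
    exact hne this
  have hev : ∀ᶠ x in 𝓝[S] x₀, J.dir (a (g x)) (w x) p =
      ((angleNear (z x₀) (z x) : ℝ) : AddCircle p) := by
    filter_upwards [hzc.eventually_ne hz0, hg.preimage_mem_nhdsWithin (ha.isOpen.mem_nhds hgU),
      self_mem_nhdsWithin] with x h1 h2 h3
    refine J.dir_eq hp (ha.mem _ h2) (ha.ne_zero _ h2) (norm_pos_iff.2 h1) ?_
    rw [hwz x h3 h2, ComplexStructure.rot, ← J.mul_real_mul, ← eq_norm_mul_cisPi_angleNear hz0]
  have hcont : ContinuousWithinAt (fun x => ((angleNear (z x₀) (z x) : ℝ) : AddCircle p)) S x₀ := by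
    refine (AddCircle.continuous_mk' p).continuousAt.comp_continuousWithinAt ?_
    refine ContinuousAt.comp_continuousWithinAt
      (contDiffAt_angleNear (u₀ := z x₀) (u := z x₀) ?_).continuousAt hzc
    rw [div_self hz0]; exact Complex.one_mem_slitPlane
  exact hcont.congr_of_eventuallyEq hev (hev.self_of_nhdsWithin hx₀)

/-- A continuous determination of the angle between two sections is smooth. -/
theorem contMDiffOn_of_sameRay {a a' : (y : M) → TangentSpace (𝓡 3) y} {U V : Set M} [T2Space M]
    [CompactSpace M] (ha : ξ.IsSectionOver a U) (ha' : ξ.IsSectionOver a' U) (hV : V ⊆ U)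
    {α : M → ℝ} (hα : ContinuousOn α V)
    (h : ∀ y ∈ V, SameRay ℝ (a y) (J.rot y (2 * α y) (a' y))) :
    ContMDiffOn (𝓡 3) 𝓘(ℝ, ℝ) ∞ α V := by
  obtain ⟨n, e, he⟩ := exists_isImmersed M
  intro y₀ hy₀
  set A : M → EuclideanSpace ℝ (Fin n) := fun y => mvfderiv (𝓡 3) e y (a' y) with hA
  set C : M → EuclideanSpace ℝ (Fin n) := fun y => mvfderiv (𝓡 3) e y (J.ext y (a' y)) with hC
  set W : M → EuclideanSpace ℝ (Fin n) := fun y => mvfderiv (𝓡 3) e y (a y) with hW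
  have hli : ∀ y ∈ U, LinearIndependent ℝ ![A y, C y] := fun y hy =>
    he.linearIndependent (J.frame_linearIndependent ha' hy)
  set u : M → ℂ := fun y => (frameCoeff (A y) (C y) (W y) : ℂ) +
    (frameCoeff (C y) (A y) (W y) : ℂ) * Complex.I with hu
  have hus : ContMDiffWithinAt (𝓡 3) 𝓘(ℝ, ℂ) ∞ u V y₀ := by
    have hAs := (OrientedCircleBundle.contMDiffAt_immersed he ha'.isOpen ha'.smooth
      (hV hy₀)).contMDiffWithinAt (s := V)
    have hCs := (OrientedCircleBundle.contMDiffAt_immersed he ha'.isOpen (J.smooth_ext ha')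
      (hV hy₀)).contMDiffWithinAt (s := V)
    have hWs := (OrientedCircleBundle.contMDiffAt_immersed he ha.isOpen ha.smooth
      (hV hy₀)).contMDiffWithinAt (s := V)
    have h1 := ContMDiffWithinAt.frameCoeff hAs hCs hWs (hli y₀ (hV hy₀))
    have h2 := ContMDiffWithinAt.frameCoeff hCs hAs hWs
      ((LinearIndependent.pair_symm_iff).1 (hli y₀ (hV hy₀)))
    have h3 : ContDiff ℝ ∞ (fun x : ℝ × ℝ => (x.1 : ℂ) + (x.2 : ℂ) * Complex.I) :=
      (Complex.ofRealCLM.contDiff.comp contDiff_fst).add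
        ((Complex.ofRealCLM.contDiff.comp contDiff_snd).mul contDiff_const)
    exact h3.contMDiff.contMDiffAt.comp_contMDiffWithinAt y₀ (h1.prodMk_space h2)
  have hex : ∀ y ∈ V, ∃ r : ℝ, 0 < r ∧ u y = r * cisPi (2 * α y) := by
    intro y hy
    have hm := ha'.mem y (hV hy)
    have hn := ha'.ne_zero y (hV hy)
    obtain ⟨r, hr, hrr⟩ := (h y hy).symm.exists_pos_left (J.rot_ne_zero _ hm hn)
      (ha.ne_zero y (hV hy))
    refine ⟨r, hr, ?_⟩
    have h2 : W y = (r * cisPi (2 * α y)).re • A y + (r * cisPi (2 * α y)).im • C y := by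
      simp only [hW]
      rw [← hrr, ComplexStructure.rot, ← J.mul_real_mul, J.mul_apply, map_add, map_smul, map_smul]
    simp only [hu]
    rw [h2, frameCoeff_left (hli y (hV hy)), frameCoeff_right (hli y (hV hy)), Complex.re_add_im]
  refine ContMDiffWithinAt.of_angle hus ?_ (hα y₀ hy₀) hy₀
    (eventually_nhdsWithin_of_forall hex)
  obtain ⟨r, hr, h1⟩ := hex y₀ hy₀
  rw [h1]
  exact _root_.mul_ne_zero (Complex.ofReal_ne_zero.2 hr.ne') (cisPi_ne_zero _)

end ComplexStructure

end OrientedContactStructure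

/-! ### Lifting circle valued maps, covers and partitions of unity -/

section IntegerValued

variable {Z : Type*} [TopologicalSpace Z]

theorem eventually_eq_of_continuousWithinAt_int {f : Z → ℝ} {S : Set Z} {z₀ : Z} {p : ℝ}
    (hp : 0 < p) (hf : ContinuousWithinAt f S z₀) (hz₀ : z₀ ∈ S)
    (hint : ∀ z ∈ S, ∃ k : ℤ, f z = k * p) : ∀ᶠ z in 𝓝[S] z₀, f z = f z₀ := by
  have h1 : ∀ᶠ z in 𝓝[S] z₀, |f z - f z₀| < p := by
    have := (hf.sub (continuousWithinAt_const (b := f z₀))).abs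
    refine this.eventually_lt continuousWithinAt_const ?_
    simpa using hp
  filter_upwards [h1, self_mem_nhdsWithin] with z h2 h3
  obtain ⟨k, hk⟩ := hint z h3
  obtain ⟨k₀, hk₀⟩ := hint z₀ hz₀
  rw [hk, hk₀, ← sub_mul, abs_mul, abs_of_pos hp] at h2
  have h4 : |((k - k₀ : ℤ) : ℝ)| < 1 := by
    push_cast
    by_contra! h
    nlinarith
  have h5 : k - k₀ = 0 := Int.abs_lt_one_iff.1 (by exact_mod_cast h4)
  rw [hk, hk₀, sub_eq_zero.1 h5]

theorem eq_of_continuousOn_int {f : Z → ℝ} {S : Set Z} (hS : IsPreconnected S) {p : ℝ}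
    (hp : 0 < p) (hf : ContinuousOn f S) (hint : ∀ z ∈ S, ∃ k : ℤ, f z = k * p) {z z' : Z}
    (hz : z ∈ S) (hz' : z' ∈ S) : f z = f z' := by
  have := hS.image f hf
  by_contra hne
  obtain ⟨k, hk⟩ := hint z hz
  obtain ⟨k', hk'⟩ := hint z' hz'
  -- halfway between consecutive multiples of `p` there is a value that is not a multiple of `p`
  have key : ∀ {k k' : ℤ} {z z' : Z}, z ∈ S → z' ∈ S → f z = k * p → f z' = k' * p → k < k' →
      False := by
    intro k k' z z' hz hz' hk hk' hlt
    have hlt' : (k : ℝ) + 1 ≤ k' := by exact_mod_cast hlt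
    have hm : ((k : ℝ) + 1 / 2) * p ∈ f '' S := by
      refine (this.ordConnected).out (mem_image_of_mem f hz) (mem_image_of_mem f hz') ⟨?_, ?_⟩
      · rw [hk]; nlinarith
      · rw [hk']; nlinarith
    obtain ⟨x, hx, hxe⟩ := hm
    obtain ⟨j, hj⟩ := hint x hx
    rw [hj] at hxe
    have h1 := mul_right_cancel₀ hp.ne' hxe
    have h2 : (2 * j : ℤ) = 2 * k + 1 := by
      have : (2 * j : ℝ) = 2 * k + 1 := by linarith
      exact_mod_cast this
    omega
  rcases lt_trichotomy k k' with h | h | h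
  · exact key hz hz' hk hk' h
  · exact hne (by rw [hk, hk', h])
  · exact key hz' hz hk' hk h

end IntegerValued

section Lifts

theorem exists_lift_of_contractible {A : Type*} [TopologicalSpace A] [ContractibleSpace A]
    [LocallyPathConnectedSpace A] {p : ℝ} (f : C(A, AddCircle p)) :
    ∃ F : C(A, ℝ), ∀ a, (F a : AddCircle p) = f a := by
  obtain ⟨a₀⟩ : Nonempty A := inferInstance
  obtain ⟨e₀, he₀⟩ := QuotientAddGroup.mk_surjective (f a₀)
  obtain ⟨F, ⟨-, hF⟩, -⟩ := (AddCircle.isCoveringMap_coe p).existsUnique_continuousMap_lifts f a₀ e₀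
    he₀
  exact ⟨F, fun a => congrFun hF a⟩

/-- Circle valued maps on `N × ℝ` lift to real valued maps. -/
def HasLifts {M : Type*} [TopologicalSpace M] (N : Set M) : Prop :=
  ∀ (p : ℝ) (f : M × ℝ → AddCircle p), ContinuousOn f (N ×ˢ univ) →
    ∃ F : M × ℝ → ℝ, ContinuousOn F (N ×ˢ univ) ∧
      ∀ y ∈ N, ∀ t, (F (y, t) : AddCircle p) = f (y, t)

theorem hasLifts_of_contractible {M : Type*} [TopologicalSpace M] {N : Set M} [ContractibleSpace N]
    [LocallyPathConnectedSpace N] : HasLifts N := by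
  intro p f hf
  classical
  let f' : C(N × ℝ, AddCircle p) := ⟨fun x => f (x.1, x.2), by
    refine hf.comp_continuous (by fun_prop) fun x => ⟨x.1.2, mem_univ _⟩⟩
  obtain ⟨F, hF⟩ := exists_lift_of_contractible f'
  refine ⟨fun x => if h : x.1 ∈ N then F (⟨x.1, h⟩, x.2) else 0, ?_, fun y hy t => ?_⟩
  · rw [continuousOn_iff_continuous_domRestrict]
    have : (N ×ˢ univ).domRestrict (fun x : M × ℝ => if h : x.1 ∈ N then F (⟨x.1, h⟩, x.2) else 0) =
        fun x : (N ×ˢ (univ : Set ℝ) : Set (M × ℝ)) => F (⟨x.1.1, x.2.1⟩, x.1.2) := by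
      funext x
      simp only [domRestrict_apply]
      rw [dif_pos x.2.1]
    rw [this]
    fun_prop
  · simp only
    rw [dif_pos hy, hF]
    rfl

variable {M : Type*} [TopologicalSpace M] [ChartedSpace (EuclideanSpace ℝ (Fin 3)) M]

theorem exists_hasLifts_subset {W : Set M} {x : M} (hW : W ∈ 𝓝 x) :
    ∃ N : Set M, IsOpen N ∧ x ∈ N ∧ N ⊆ W ∧ HasLifts N := by
  have : LocallyPathConnectedSpace M :=
    ChartedSpace.locallyPathConnectedSpace (EuclideanSpace ℝ (Fin 3)) M
  set φ := chartAt (EuclideanSpace ℝ (Fin 3)) x with hφ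
  have hx : x ∈ φ.source := mem_chart_source _ x
  have h1 : φ.target ∩ φ.symm ⁻¹' W ∈ 𝓝 (φ x) := by
    refine inter_mem (φ.open_target.mem_nhds (φ.map_source hx)) ?_
    refine (φ.symm.continuousAt (φ.map_source hx)).preimage_mem_nhds ?_
    rwa [φ.left_inv hx]
  obtain ⟨ε, hε, hb⟩ := Metric.mem_nhds_iff.1 h1
  set N := φ.symm '' Metric.ball (φ x) ε with hN
  have hopen : IsOpen N := φ.symm.isOpen_image_of_subset_source Metric.isOpen_ball
    fun z hz => (hb hz).1
  have hcon : ContractibleSpace (Metric.ball (φ x) ε) :=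
    (convex_ball _ _).contractibleSpace ⟨_, Metric.mem_ball_self hε⟩
  have hN' : ContractibleSpace N :=
    ((φ.symm.homeomorphOfImageSubsetSource (s := Metric.ball (φ x) ε) (t := N)
      (fun z hz => (hb hz).1) rfl).symm).contractibleSpace
  have : LocallyPathConnectedSpace N := hopen.locallyPathConnectedSpace
  refine ⟨N, hopen, ⟨φ x, Metric.mem_ball_self hε, φ.left_inv hx⟩, ?_, hasLifts_of_contractible⟩
  rintro _ ⟨z, hz, rfl⟩
  exact (hb hz).2

/-- Covers of a closed manifold for which overlaps are contained in sets over which circle valued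
maps lift: the sets `U x` are small compared with the `N x`, and these with the `V x`. -/
theorem exists_good_cover [T2Space M] [CompactSpace M] (P : Set M → Prop)
    (hP : ∀ x, ∃ V, IsOpen V ∧ x ∈ V ∧ P V) :
    ∃ U N V : M → Set M, IsPointedCover U ∧ ∀ x, U x ⊆ N x ∧ IsOpen (N x) ∧ HasLifts (N x) ∧
      IsOpen (V x) ∧ P (V x) ∧ ∀ x', (U x ∩ U x').Nonempty → N x ⊆ V x' := by
  have hM : TopologicalSpace.MetrizableSpace M := Manifold.metrizableSpace (𝓡 3) M
  let _ : MetricSpace M := TopologicalSpace.metrizableSpaceMetric M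
  choose V₀ hV₀ hxV₀ hPV₀ using hP
  obtain ⟨δ, hδ, hδV⟩ := lebesgue_number_lemma_of_metric (s := (univ : Set M)) isCompact_univ hV₀
    fun x _ => mem_iUnion.2 ⟨x, hxV₀ x⟩
  choose i hi using fun x => hδV x (mem_univ x)
  choose N₀ hN₀ hxN₀ hN₀b hN₀l using fun x : M =>
    exists_hasLifts_subset (Metric.ball_mem_nhds x (by positivity : 0 < δ / 4))
  obtain ⟨ε, hε, hεN⟩ := lebesgue_number_lemma_of_metric (s := (univ : Set M)) isCompact_univ hN₀
    fun x _ => mem_iUnion.2 ⟨x, hxN₀ x⟩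
  choose j hj using fun x => hεN x (mem_univ x)
  refine ⟨fun x => Metric.ball x (min ε (δ / 4)), fun x => N₀ (j x), fun x => V₀ (i x),
    fun x => ⟨Metric.isOpen_ball, Metric.mem_ball_self (by positivity)⟩, fun x =>
    ⟨(Metric.ball_subset_ball (min_le_left _ _)).trans (hj x), hN₀ _, hN₀l _, hV₀ _, hPV₀ _, ?_⟩⟩
  rintro x' ⟨z, hz, hz'⟩ w hw
  refine hi x' ?_
  have h1 : dist w (j x) < δ / 4 := hN₀b _ hw
  have h2 : dist x (j x) < δ / 4 := hN₀b _ (hj x (Metric.mem_ball_self hε))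
  have h3 : dist z x < δ / 4 := lt_of_lt_of_le hz (min_le_right _ _)
  have h4 : dist z x' < δ / 4 := lt_of_lt_of_le hz' (min_le_right _ _)
  rw [Metric.mem_ball]
  calc dist w x' ≤ dist w (j x) + dist x (j x) + dist z x + dist z x' := by
        have := dist_triangle w (j x) x'
        have := dist_triangle (j x) x x'
        have := dist_triangle x z x'
        rw [dist_comm (j x) x] at *
        rw [dist_comm x z] at *
        linarith
    _ < δ := by linarith

theorem exists_hasLifts_cover {U : M → Set M} (hU : IsPointedCover U) :
    ∃ N : M → Set M, IsPointedCover N ∧ ∀ x, N x ⊆ U x ∧ HasLifts (N x) := by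
  choose N h1 h2 h3 h4 using fun x => exists_hasLifts_subset ((hU x).1.mem_nhds (hU x).2)
  exact ⟨N, fun x => ⟨h1 x, h2 x⟩, fun x => ⟨h3 x, h4 x⟩⟩

end Lifts

section Partitions

variable {M : Type*} [TopologicalSpace M] [ChartedSpace (EuclideanSpace ℝ (Fin 3)) M]
  [IsManifold (𝓡 3) ∞ M] [T2Space M] [CompactSpace M]

theorem exists_partition {U : M → Set M} (hU : IsPointedCover U) :
    ∃ (s : Finset M) (ρ : M → M → ℝ), (∀ x, ContMDiff (𝓡 3) 𝓘(ℝ, ℝ) ∞ (ρ x)) ∧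
      (∀ x y, 0 ≤ ρ x y) ∧ (∀ y, ∑ x ∈ s, ρ x y = 1) ∧ ∀ x ∈ s, tsupport (ρ x) ⊆ U x := by
  classical
  obtain ⟨s, hs⟩ := isCompact_univ.elim_finite_subcover U (fun x => (hU x).1)
    fun x _ => mem_iUnion.2 ⟨x, (hU x).2⟩
  obtain ⟨f, hf⟩ := SmoothPartitionOfUnity.exists_isSubordinate (𝓡 3) isClosed_univ
    (fun x : s => U x) (fun x => (hU x).1) (fun y hy => by
      obtain ⟨x, hx, hxy⟩ := mem_iUnion₂.1 (hs hy)
      exact mem_iUnion.2 ⟨⟨x, hx⟩, hxy⟩)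
  refine ⟨s, fun x => if h : x ∈ s then f ⟨x, h⟩ else fun _ => 0, fun x => ?_, fun x y => ?_,
    fun y => ?_, fun x hx => ?_⟩
  · by_cases h : x ∈ s
    · simp only [h, dite_true]; exact (f ⟨x, h⟩).contMDiff
    · simp only [h, dite_false]; exact contMDiff_const
  · by_cases h : x ∈ s
    · simp only [h, dite_true]; exact f.nonneg _ _
    · simp [h]
  · have h1 := f.sum_eq_one (mem_univ y)
    rw [finsum_eq_sum_of_fintype] at h1
    rw [← Finset.sum_coe_sort, ← h1]
    refine Finset.sum_congr rfl fun x _ => ?_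
    simp
  · simp only [hx, dite_true]
    exact hf ⟨x, hx⟩

end Partitions

/-! ### Čech cocycles from local lifts -/

section CechCalculus

variable {M : Type*} [TopologicalSpace M]

theorem cechD_zero_apply (b : (Fin 1 → M) → M → ℤ) (i : Fin 2 → M) (y : M) :
    cechD M 0 b i y = b ![i 1] y - b ![i 0] y := by
  have h0 : i ∘ (0 : Fin 2).succAbove = ![i 1] := by ext k; fin_cases k; rfl
  have h1 : i ∘ (1 : Fin 2).succAbove = ![i 0] := by ext k; fin_cases k; rfl
  change ∑ k : Fin 2, (-1) ^ (k : ℕ) * b (i ∘ k.succAbove) y = _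
  rw [Fin.sum_univ_two, h0, h1]
  simp [sub_eq_add_neg]

theorem cechD_one_apply (b : (Fin 2 → M) → M → ℤ) (i : Fin 3 → M) (y : M) :
    cechD M 1 b i y = b ![i 1, i 2] y - b ![i 0, i 2] y + b ![i 0, i 1] y := by
  have h0 : i ∘ (0 : Fin 3).succAbove = ![i 1, i 2] := by ext k; fin_cases k <;> rfl
  have h1 : i ∘ (1 : Fin 3).succAbove = ![i 0, i 2] := by ext k; fin_cases k <;> rfl
  have h2 : i ∘ (2 : Fin 3).succAbove = ![i 0, i 1] := by ext k; fin_cases k <;> rfl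
  change ∑ k : Fin 3, (-1) ^ (k : ℕ) * b (i ∘ k.succAbove) y = _
  rw [Fin.sum_univ_three, h0, h1, h2]
  simp
  ring

theorem cechD_two_apply (b : (Fin 3 → M) → M → ℤ) (i : Fin 4 → M) (y : M) :
    cechD M 2 b i y = b ![i 1, i 2, i 3] y - b ![i 0, i 2, i 3] y + b ![i 0, i 1, i 3] y -
      b ![i 0, i 1, i 2] y := by
  have h0 : i ∘ (0 : Fin 4).succAbove = ![i 1, i 2, i 3] := by ext k; fin_cases k <;> rfl
  have h1 : i ∘ (1 : Fin 4).succAbove = ![i 0, i 2, i 3] := by ext k; fin_cases k <;> rfl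
  have h2 : i ∘ (2 : Fin 4).succAbove = ![i 0, i 1, i 3] := by ext k; fin_cases k <;> rfl
  have h3 : i ∘ (3 : Fin 4).succAbove = ![i 0, i 1, i 2] := by ext k; fin_cases k <;> rfl
  change ∑ k : Fin 4, (-1) ^ (k : ℕ) * b (i ∘ k.succAbove) y = _
  rw [Fin.sum_univ_four, h0, h1, h2, h3]
  simp
  ring

theorem cech_mk_eq_iff {p : ℕ} (c c' : cechCocycles M (p + 1)) :
    (QuotientAddGroup.mk c : CechH M (p + 1)) = QuotientAddGroup.mk c' ↔
      ∃ V : M → Set M, IsPointedCover V ∧ ∃ b : (Fin (p + 1) → M) → M → ℤ,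
        (∀ i, ∀ y ∈ ⋂ k, V (i k), ∀ᶠ z in 𝓝 y, b i z = b i y) ∧
        ∀ i, ∀ y ∈ ⋂ k, V (i k), c'.1 i y - c.1 i y = cechD M p b i y := by
  rw [QuotientAddGroup.eq, AddSubgroup.mem_addSubgroupOf]
  change -c.1 + c'.1 ∈ (cechCochains M p).map (cechD M p) ⊔ cechNull M (p + 1) ↔ _
  rw [AddSubgroup.mem_sup]
  constructor
  · rintro ⟨_, ⟨b, ⟨V, hV, hb⟩, rfl⟩, n, ⟨W, hW, hn⟩, h⟩
    refine ⟨_, hV.inter hW, b, fun i y hy => hb i y ?_, fun i y hy => ?_⟩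
    · rw [iInter_inter_distrib] at hy; exact hy.1
    · rw [iInter_inter_distrib] at hy
      have h1 := congrFun (congrFun h i) y
      have h2 := hn i y hy.2
      simp only [Pi.add_apply, Pi.neg_apply, h2] at h1
      linarith
  · rintro ⟨V, hV, b, hb, h⟩
    refine ⟨_, ⟨b, ⟨V, hV, hb⟩, rfl⟩, -c.1 + c'.1 - cechD M p b, ⟨V, hV, fun i y hy => ?_⟩, ?_⟩
    · have := h i y hy
      simp only [Pi.add_apply, Pi.neg_apply, Pi.sub_apply]
      linarith
    · abel

theorem mem_iInter_two {V : M → Set M} {i : Fin 2 → M} {y : M} :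
    y ∈ ⋂ k, V (i k) ↔ y ∈ V (i 0) ∧ y ∈ V (i 1) := by
  rw [mem_iInter, Fin.forall_fin_two]

theorem mem_iInter_three {V : M → Set M} {i : Fin 3 → M} {y : M} :
    y ∈ ⋂ k, V (i k) ↔ y ∈ V (i 0) ∧ y ∈ V (i 1) ∧ y ∈ V (i 2) := by
  rw [mem_iInter]
  exact ⟨fun h => ⟨h 0, h 1, h 2⟩, fun h k => by fin_cases k <;> simp [h]⟩

theorem mem_iInter_four {V : M → Set M} {i : Fin 4 → M} {y : M} :
    y ∈ ⋂ k, V (i k) ↔ y ∈ V (i 0) ∧ y ∈ V (i 1) ∧ y ∈ V (i 2) ∧ y ∈ V (i 3) := by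
  rw [mem_iInter]
  exact ⟨fun h => ⟨h 0, h 1, h 2, h 3⟩, fun h k => by fin_cases k <;> simp [h]⟩

/-- A Čech 1-cocycle, given as a function of two indices. -/
theorem exists_cocycle_one {U : M → Set M} (hU : IsPointedCover U) (b : M → M → M → ℤ)
    (hb : ∀ x x', ∀ y ∈ U x ∩ U x', ∀ᶠ z in 𝓝 y, b x x' z = b x x' y)
    (h : ∀ x₀ x₁ x₂, ∀ y ∈ U x₀ ∩ U x₁ ∩ U x₂, b x₀ x₁ y + b x₁ x₂ y = b x₀ x₂ y) :
    ∃ c : cechCocycles M 1, ∀ i y, c.1 i y = b (i 0) (i 1) y := by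
  refine ⟨⟨fun i y => b (i 0) (i 1) y, ⟨U, hU, fun i y hy => ?_⟩, ⟨U, hU, fun i y hy => ?_⟩⟩,
    fun _ _ => rfl⟩
  · exact hb _ _ y (mem_iInter_two.1 hy)
  · rw [mem_iInter_three] at hy
    rw [cechD_one_apply]
    have := h (i 0) (i 1) (i 2) y ⟨⟨hy.1, hy.2.1⟩, hy.2.2⟩
    simp only [Matrix.cons_val_zero, Matrix.cons_val_one]
    linarith

/-- A Čech 2-cocycle, given as a function of three indices. -/
theorem exists_cocycle_two {U : M → Set M} (hU : IsPointedCover U) (b : M → M → M → M → ℤ)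
    (hb : ∀ x₀ x₁ x₂, ∀ y ∈ U x₀ ∩ U x₁ ∩ U x₂, ∀ᶠ z in 𝓝 y, b x₀ x₁ x₂ z = b x₀ x₁ x₂ y)
    (h : ∀ x₀ x₁ x₂ x₃, ∀ y ∈ U x₀ ∩ U x₁ ∩ U x₂ ∩ U x₃,
      b x₁ x₂ x₃ y + b x₀ x₁ x₃ y = b x₀ x₂ x₃ y + b x₀ x₁ x₂ y) :
    ∃ c : cechCocycles M 2, ∀ i y, c.1 i y = b (i 0) (i 1) (i 2) y := by
  refine ⟨⟨fun i y => b (i 0) (i 1) (i 2) y, ⟨U, hU, fun i y hy => ?_⟩,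
    ⟨U, hU, fun i y hy => ?_⟩⟩, fun _ _ => rfl⟩
  · rw [mem_iInter_three] at hy
    exact hb _ _ _ y ⟨⟨hy.1, hy.2.1⟩, hy.2.2⟩
  · rw [mem_iInter_four] at hy
    rw [cechD_two_apply]
    have := h (i 0) (i 1) (i 2) (i 3) y ⟨⟨⟨hy.1, hy.2.1⟩, hy.2.2.1⟩, hy.2.2.2⟩
    simp only [Matrix.cons_val_zero, Matrix.cons_val_one, Matrix.cons_val]
    linarith

/-- An equation between multiples of classes in degree two, in terms of a 1-cochain. -/
theorem smul_mk_eq_smul_mk_iff (c d : cechCocycles M 2) (n m : ℤ) :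
    n • (QuotientAddGroup.mk c : CechH M 2) = m • QuotientAddGroup.mk d ↔
      ∃ V : M → Set M, IsPointedCover V ∧ ∃ b : M → M → M → ℤ,
        (∀ x x', ∀ y ∈ V x ∩ V x', ∀ᶠ z in 𝓝 y, b x x' z = b x x' y) ∧
        ∀ i : Fin 3 → M, ∀ y ∈ ⋂ k, V (i k), n * c.1 i y - m * d.1 i y =
          b (i 0) (i 1) y + b (i 1) (i 2) y - b (i 0) (i 2) y := by
  rw [eq_comm, ← QuotientAddGroup.mk_zsmul, ← QuotientAddGroup.mk_zsmul, cech_mk_eq_iff]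
  refine exists_congr fun V => and_congr_right fun hV => ⟨?_, ?_⟩
  · rintro ⟨b, hb, h⟩
    refine ⟨fun x x' => b ![x, x'], fun x x' y hy => hb _ y (mem_iInter_two.2 hy), fun i y hy => ?_⟩
    have := h i y hy
    rw [cechD_one_apply] at this
    simp only [AddSubgroup.coe_zsmul, Pi.smul_apply, smul_eq_mul] at this
    linarith
  · rintro ⟨b, hb, h⟩
    refine ⟨fun i => b (i 0) (i 1), fun i y hy => hb _ _ y (mem_iInter_two.1 hy), fun i y hy => ?_⟩
    have := h i y hy
    rw [cechD_one_apply]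
    simp only [AddSubgroup.coe_zsmul, Pi.smul_apply, smul_eq_mul, Matrix.cons_val_zero,
      Matrix.cons_val_one]
    linarith

end CechCalculus

section LiftClasses

variable {M Z : Type*} [TopologicalSpace M] [TopologicalSpace Z]

/-- The properties of a circle bundle that make integer valued functions on its total space descend
to the base. -/
structure IsConnectedFibration (π : Z → M) : Prop where
  continuous : Continuous π
  isOpenMap : IsOpenMap π
  surjective : Function.Surjective π
  fiber : ∀ y, IsPreconnected (π ⁻¹' {y})

theorem IsConnectedFibration.id : IsConnectedFibration (id : M → M) :=
  ⟨continuous_id, IsOpenMap.id, Function.surjective_id, fun _ => isPreconnected_singleton⟩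

/-- Functions on the total space with values in `ℤ * p` are constant on the fibres, and hence
functions on the base. -/
theorem IsConnectedFibration.exists_descend {π : Z → M} (hπ : IsConnectedFibration π) {U : Set M}
    (hU : IsOpen U) {f : Z → ℝ} {p : ℝ} (hp : 0 < p) (hf : ContinuousOn f (π ⁻¹' U))
    (hint : ∀ z ∈ π ⁻¹' U, ∃ k : ℤ, f z = k * p) :
    ∃ b : M → ℤ, (∀ z ∈ π ⁻¹' U, f z = b (π z) * p) ∧ ∀ y ∈ U, ∀ᶠ y' in 𝓝 y, b y' = b y := by
  choose σ hσ using hπ.surjective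
  have hσU : ∀ y ∈ U, σ y ∈ π ⁻¹' U := fun y hy => by rw [mem_preimage, hσ]; exact hy
  choose! k hk using hint
  have hfb : ∀ z ∈ π ⁻¹' U, f z = k (σ (π z)) * p := by
    intro z hz
    rw [← hk _ (hσU _ hz)]
    refine eq_of_continuousOn_int (hπ.fiber (π z)) hp (hf.mono ?_) ?_ rfl (hσ _)
    · rintro w hw
      rw [mem_preimage, show π w = π z from hw]; exact hz
    · rintro w hw
      refine ⟨k w, hk w ?_⟩
      rw [mem_preimage, show π w = π z from hw]; exact hz
  refine ⟨fun y => k (σ y), hfb, fun y hy => ?_⟩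
  have h1 : ∀ᶠ z in 𝓝 (σ y), f z = f (σ y) ∧ z ∈ π ⁻¹' U := by
    have hopen := (hU.preimage hπ.continuous)
    have := eventually_eq_of_continuousWithinAt_int hp (hf _ (hσU y hy)) (hσU y hy)
      fun z hz => ⟨k z, hk z hz⟩
    rw [hopen.nhdsWithin_eq (hσU y hy)] at this
    exact this.and (hopen.mem_nhds (hσU y hy))
  have h2 := hπ.isOpenMap.image_mem_nhds h1
  rw [hσ] at h2
  filter_upwards [h2] with y' hy'
  obtain ⟨z, ⟨hz1, hz2⟩, rfl⟩ := hy'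
  have h3 : (k (σ (π z)) : ℝ) * p = k (σ y) * p := by
    rw [← hfb z hz2, hz1, hfb _ (hσU y hy), hσ]
  exact_mod_cast mul_right_cancel₀ hp.ne' h3

/-- The obstruction class of `F : Z → S¹ = ℝ/ℤ` to lifting to `ℝ`, for a map `F` that lifts locally
over the base of a fibration. -/
def IsLiftClass (π : Z → M) (F : Z → UnitAddCircle) (α : CechH M 1) : Prop :=
  ∃ c : cechCocycles M 1, (QuotientAddGroup.mk c : CechH M 1) = α ∧
    ∃ U : M → Set M, IsPointedCover U ∧ ∃ h : M → Z → ℝ,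
      (∀ x, ContinuousOn (h x) (π ⁻¹' U x)) ∧
      (∀ x, ∀ z ∈ π ⁻¹' U x, (h x z : UnitAddCircle) = F z) ∧
      ∀ (i : Fin 2 → M) (z : Z), π z ∈ U (i 0) → π z ∈ U (i 1) →
        (c.1 i (π z) : ℝ) = h (i 1) z - h (i 0) z

variable {π : Z → M} {F F' : Z → UnitAddCircle} {α β : CechH M 1}

theorem exists_int_sub_eq {a b : ℝ} (h : (a : UnitAddCircle) = (b : UnitAddCircle)) :
    ∃ k : ℤ, b - a = k * (1 : ℝ) := by
  obtain ⟨k, hk⟩ := AddCircle.coe_eq_coe_iff_exists.1 h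
  exact ⟨k, by rw [hk]; ring⟩

theorem exists_isLiftClass (hπ : IsConnectedFibration π) {U : M → Set M} (hU : IsPointedCover U)
    {h : M → Z → ℝ} (hc : ∀ x, ContinuousOn (h x) (π ⁻¹' U x))
    (hF : ∀ x, ∀ z ∈ π ⁻¹' U x, (h x z : UnitAddCircle) = F z) : ∃ α, IsLiftClass π F α := by
  have := fun x x' => hπ.exists_descend ((hU x).1.inter (hU x').1) (f := fun z => h x' z - h x z)
    one_pos (((hc x').mono fun z hz => hz.2).sub ((hc x).mono fun z hz => hz.1))
    fun z hz => exists_int_sub_eq ((hF x z hz.1).trans (hF x' z hz.2).symm)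
  choose b hb hbl using this
  obtain ⟨c, hcb⟩ := exists_cocycle_one hU b hbl fun x₀ x₁ x₂ y hy => by
    obtain ⟨z, rfl⟩ := hπ.surjective y
    have h1 := hb x₀ x₁ z ⟨hy.1.1, hy.1.2⟩
    have h2 := hb x₁ x₂ z ⟨hy.1.2, hy.2⟩
    have h3 := hb x₀ x₂ z ⟨hy.1.1, hy.2⟩
    have : (b x₀ x₁ (π z) : ℝ) + b x₁ x₂ (π z) = b x₀ x₂ (π z) := by linarith
    exact_mod_cast this
  refine ⟨_, c, rfl, U, hU, h, hc, hF, fun i z h0 h1 => ?_⟩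
  rw [hcb, hb _ _ z ⟨h0, h1⟩, mul_one]

theorem IsLiftClass.unique (hπ : IsConnectedFibration π) (hα : IsLiftClass π F α)
    (hβ : IsLiftClass π F β) : α = β := by
  obtain ⟨c, rfl, U, hU, h, hc, hF, hch⟩ := hα
  obtain ⟨c', rfl, U', hU', h', hc', hF', hch'⟩ := hβ
  have := fun x => hπ.exists_descend ((hU x).1.inter (hU' x).1) (f := fun z => h' x z - h x z)
    one_pos (((hc' x).mono fun z hz => hz.2).sub ((hc x).mono fun z hz => hz.1))
    fun z hz => exists_int_sub_eq ((hF x z hz.1).trans (hF' x z hz.2).symm)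
  choose b hb hbl using this
  rw [cech_mk_eq_iff]
  refine ⟨_, hU.inter hU', fun i => b (i 0), fun i y hy => hbl _ y (mem_iInter.1 hy 0),
    fun i y hy => ?_⟩
  replace hy := (mem_iInter_two (V := fun x => U x ∩ U' x)).1 hy
  obtain ⟨z, rfl⟩ := hπ.surjective y
  rw [cechD_zero_apply]
  have h1 := hb (i 0) z hy.1
  have h2 := hb (i 1) z hy.2
  have h3 := hch i z hy.1.1 hy.2.1
  have h4 := hch' i z hy.1.2 hy.2.2
  have : (c'.1 i (π z) : ℝ) - c.1 i (π z) = b (i 1) (π z) - b (i 0) (π z) := by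
    rw [h3, h4]; linarith
  exact_mod_cast this

theorem IsLiftClass.add (hα : IsLiftClass π F α) (hβ : IsLiftClass π F' β) :
    IsLiftClass π (fun z => F z + F' z) (α + β) := by
  obtain ⟨c, rfl, U, hU, h, hc, hF, hch⟩ := hα
  obtain ⟨c', rfl, U', hU', h', hc', hF', hch'⟩ := hβ
  refine ⟨c + c', rfl, _, hU.inter hU', fun x z => h x z + h' x z,
    fun x => ((hc x).mono fun z hz => hz.1).add ((hc' x).mono fun z hz => hz.2),
    fun x z hz => ?_, fun i z h0 h1 => ?_⟩
  · rw [AddCircle.coe_add, hF x z hz.1, hF' x z hz.2]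
  · have h3 := hch i z h0.1 h1.1
    have h4 := hch' i z h0.2 h1.2
    simp only [AddSubgroup.coe_add, Pi.add_apply, Int.cast_add]
    rw [h3, h4]; ring

theorem isLiftClass_zero {h : Z → ℝ} (hc : Continuous h)
    (hF : ∀ z, (h z : UnitAddCircle) = F z) : IsLiftClass π F 0 :=
  ⟨0, rfl, _, isPointedCover_univ, fun _ => h, fun _ => hc.continuousOn, fun _ z _ => hF z,
    fun i z _ _ => by simp⟩

theorem IsLiftClass.exists_lift (hπ : IsConnectedFibration π) (hα : IsLiftClass π F 0) :
    ∃ h : Z → ℝ, Continuous h ∧ ∀ z, (h z : UnitAddCircle) = F z := by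
  obtain ⟨c, hc0, U, hU, h, hc, hF, hch⟩ := hα
  have h0 : (QuotientAddGroup.mk (0 : cechCocycles M 1) : CechH M 1) = QuotientAddGroup.mk c :=
    hc0.symm
  rw [cech_mk_eq_iff] at h0
  obtain ⟨V, hV, b, hb, hbc⟩ := h0
  have key : ∀ x z, π z ∈ U x ∩ V x → h (π z) z - b ![π z] (π z) = h x z - b ![x] (π z) := by
    intro x z hz
    have h1 := hbc ![x, π z] (π z) (mem_iInter_two.2 ⟨hz.2, (hV _).2⟩)
    have h2 := hch ![x, π z] z hz.1 (hU _).2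
    rw [cechD_zero_apply] at h1
    simp only [Matrix.cons_val_zero, Matrix.cons_val_one, ZeroMemClass.coe_zero, Pi.zero_apply,
      sub_zero] at h1 h2
    rw [h1] at h2
    push_cast at h2
    linarith
  refine ⟨fun z => h (π z) z - b ![π z] (π z), continuous_iff_continuousAt.2 fun z₀ => ?_,
    fun z => ?_⟩
  · set x := π z₀ with hx
    have hmem : ∀ᶠ z in 𝓝 z₀, π z ∈ U x ∩ V x := hπ.continuous.continuousAt.preimage_mem_nhds
      (((hU x).1.inter (hV x).1).mem_nhds ⟨(hU x).2, (hV x).2⟩)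
    have hbx : ∀ᶠ z in 𝓝 z₀, b ![x] (π z) = b ![x] x :=
      hπ.continuous.continuousAt.eventually (hb ![x] x (mem_iInter.2 fun k => by
        fin_cases k; exact (hV x).2))
    have hcx : ContinuousAt (fun z => h x z - b ![x] x) z₀ :=
      ((hc x z₀ (hU x).2).continuousAt (((hU x).1.preimage hπ.continuous).mem_nhds (hU x).2)).sub
        continuousAt_const
    refine hcx.congr ?_
    filter_upwards [hmem, hbx] with z h1 h2
    rw [key x z h1, h2]
  · have h1 : ((h (π z) z : ℝ) : UnitAddCircle) = F z := hF _ z (hU _).2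
    rw [← h1, AddCircle.coe_eq_coe_iff_exists]
    exact ⟨b ![π z] (π z), by ring⟩

/-- If the differences of the local lifts are even, the class is divisible by two. -/
theorem IsLiftClass.exists_two_smul (hπ : IsConnectedFibration π) (hα : IsLiftClass π F α)
    {U : M → Set M} (hU : IsPointedCover U)
    {h : M → Z → ℝ} (hc : ∀ x, ContinuousOn (h x) (π ⁻¹' U x))
    (hF : ∀ x, ∀ z ∈ π ⁻¹' U x, (h x z : UnitAddCircle) = F z)
    (h2 : ∀ x x', ∀ z, π z ∈ U x → π z ∈ U x' → ∃ k : ℤ, h x' z = h x z + 2 * k) :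
    ∃ β : CechH M 1, α = (2 : ℤ) • β := by
  set F' : Z → UnitAddCircle := fun z => ((h (π z) z / 2 : ℝ) : UnitAddCircle) with hF'
  obtain ⟨β, hβ⟩ := exists_isLiftClass (F := F') hπ hU (h := fun x z => h x z / 2)
    (fun x => (hc x).div_const 2) fun x z hz => by
      obtain ⟨k, hk⟩ := h2 x (π z) z hz (hU _).2
      rw [hF', AddCircle.coe_eq_coe_iff_exists]
      exact ⟨k, by rw [hk]; ring⟩
  refine ⟨β, hα.unique hπ ?_⟩
  have h3 : F = fun z => F' z + F' z := by
    funext z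
    rw [← hF (π z) z (hU _).2, hF', ← AddCircle.coe_add, add_halves]
  rw [h3, two_zsmul]
  exact hβ.add hβ

end LiftClasses

/-! ### Fibre coordinates and direction fields -/

namespace OrientedCircleBundle

section Fibration

variable {M : Type*} [TopologicalSpace M] [ChartedSpace (EuclideanSpace ℝ (Fin 3)) M]
  {Q : Type*} [TopologicalSpace Q] [ChartedSpace (EuclideanSpace ℝ (Fin 4)) Q]

theorem isConnectedFibration (B : OrientedCircleBundle Q M) : IsConnectedFibration B.proj where
  continuous := B.continuous_proj
  isOpenMap := by
    refine IsOpenMap.of_nhds_le fun q O hO => ?_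
    rw [Filter.mem_map] at hO
    obtain ⟨U, hU, hq, E, hE⟩ := B.locallyTrivial (B.proj q)
    obtain ⟨t, ht⟩ := hE.exists_eq hq
    have hc : ContinuousAt (fun y => E y t) (B.proj q) :=
      ContinuousAt.comp (f := fun y => (y, t)) (g := fun p : M × ℝ => E p.1 p.2)
        (hE.contMDiffAt hU hq t).continuousAt (by fun_prop)
    have h1 : ∀ᶠ y in 𝓝 (B.proj q), E y t ∈ B.proj ⁻¹' O :=
      hc.preimage_mem_nhds (by rw [ht]; exact hO)
    filter_upwards [h1, hU.mem_nhds hq] with y h2 h3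
    rw [mem_preimage, hE.proj_apply h3] at h2
    exact h2
  surjective y := by
    obtain ⟨U, hU, hy, E, hE⟩ := B.locallyTrivial y
    exact ⟨E y 0, hE.proj_apply hy 0⟩
  fiber y := by
    obtain ⟨U, hU, hy, E, hE⟩ := B.locallyTrivial y
    rw [← hE.range_eq y hy]
    exact isPreconnected_range (hE.contMDiff_fiber hy).continuous

end Fibration

variable {M : Type*} [TopologicalSpace M] [ChartedSpace (EuclideanSpace ℝ (Fin 3)) M]
  {Q : Type*} [TopologicalSpace Q] [ChartedSpace (EuclideanSpace ℝ (Fin 4)) Q]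
  [IsManifold (𝓡 3) ∞ M] [IsManifold (𝓡 4) ∞ Q]
  {B : OrientedCircleBundle Q M} {ξ : OrientedContactStructure M} {J : ξ.ComplexStructure}

theorem continuousAt_of_fiberCoord {U : Set M} {E : M → ℝ → Q}
    (hE : IsTrivialization B.proj B.pos U E) (hU : IsOpen U) {κ : Q → AddCircle (1 : ℝ)}
    (hκ : ∀ y ∈ U, ∀ t : ℝ, κ (E y t) = (t : AddCircle (1 : ℝ))) {q : Q} (hq : B.proj q ∈ U) :
    ContinuousAt κ q := by
  obtain ⟨t, ht⟩ := hE.exists_eq hq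
  obtain ⟨O, τ, hO, hqO, hOU, hτ, -, hEτ, -⟩ := hE.exists_coordinate hU hq t
  rw [ht] at hqO
  have h1 : ContinuousAt (fun q => ((τ q : ℝ) : AddCircle (1 : ℝ))) q :=
    (AddCircle.continuous_mk' 1).continuousAt.comp
      ((hτ q hqO).continuousWithinAt.continuousAt (hO.mem_nhds hqO))
  refine h1.congr ?_
  filter_upwards [hO.mem_nhds hqO] with q' hq'
  rw [← hκ _ (hOU hq') (τ q'), hEτ q' hq']

/-- Over sets with the lifting property, changes of trivialization lift to real valued maps. -/
theorem exists_transition {U U' N : Set M} {E E' : M → ℝ → Q}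
    (hE : IsTrivialization B.proj B.pos U E)
    (hE' : IsTrivialization B.proj B.pos U' E') (hU' : IsOpen U') (hN : HasLifts N)
    (hNU : N ⊆ U) (hNU' : N ⊆ U') : ∃ G : M × ℝ → ℝ, ContinuousOn G (N ×ˢ univ) ∧
      ∀ y ∈ N, ∀ t, E y t = E' y (G (y, t)) := by
  set κ : Q → AddCircle (1 : ℝ) := fun q =>
    ((Classical.epsilon fun t : ℝ => E' (B.proj q) t = q : ℝ) : AddCircle (1 : ℝ)) with hκ
  have hκE : ∀ y ∈ U', ∀ t : ℝ, κ (E' y t) = (t : AddCircle (1 : ℝ)) := by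
    intro y hy t
    have h1 : E' (B.proj (E' y t)) (Classical.epsilon fun s : ℝ =>
        E' (B.proj (E' y t)) s = E' y t) = E' y t :=
      Classical.epsilon_spec (p := fun s : ℝ => E' (B.proj (E' y t)) s = E' y t)
        ⟨t, by rw [hE'.proj_apply hy]⟩
    rw [hκ, eq_comm, AddCircle.coe_eq_coe_iff_exists]
    generalize Classical.epsilon (fun s : ℝ => E' (B.proj (E' y t)) s = E' y t) = s at h1 ⊢
    rw [hE'.proj_apply hy] at h1
    obtain ⟨k, hk⟩ := (hE'.eq_iff y hy _ _).1 h1.symm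
    exact ⟨k, by rw [hk, mul_one]⟩
  obtain ⟨G, hG, hGκ⟩ := hN 1 (fun x => κ (E x.1 x.2)) (fun x hx => by
    have hp : B.proj (E x.1 x.2) ∈ U' := by rw [hE.proj_apply (hNU hx.1)]; exact hNU' hx.1
    exact ContinuousAt.comp_continuousWithinAt (f := fun x : M × ℝ => E x.1 x.2)
      (continuousAt_of_fiberCoord hE' hU' hκE hp)
      ((hE.continuousOn x ⟨hNU hx.1, mem_univ _⟩).mono (prod_mono hNU subset_rfl)))
  refine ⟨G, hG, fun y hy t => ?_⟩
  have hp : B.proj (E y t) = y := hE.proj_apply (hNU hy) t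
  obtain ⟨s, hs⟩ := hE'.exists_eq (q := E y t) (by rw [hp]; exact hNU' hy)
  rw [hp] at hs
  have h1 := hGκ y hy t
  simp only at h1
  rw [← hs, hκE y (hNU' hy), AddCircle.coe_eq_coe_iff_exists] at h1
  obtain ⟨k, hk⟩ := h1
  rw [← hs, hE'.eq_iff y (hNU' hy)]
  exact ⟨-k, by rw [hk]; push_cast; ring⟩

/-- A field of directions in the contact planes, parametrized by the total space, with continuous
angles up to multiples of `p`: it is a field of lines for `p = 1` and of rays for `p = 2`. -/
structure IsDirectionField (B : OrientedCircleBundle Q M) (J : ξ.ComplexStructure) (p : ℝ)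
    (w : (q : Q) → TangentSpace (𝓡 3) (B.proj q)) : Prop where
  mem : ∀ q, w q ∈ ξ.plane (B.proj q)
  ne_zero : ∀ q, w q ≠ 0
  continuousAt : ∀ (U : Set M) (a : (y : M) → TangentSpace (𝓡 3) y), ξ.IsSectionOver a U →
    ∀ q, B.proj q ∈ U → ContinuousAt (fun q => J.dir (a (B.proj q)) (w q) p) q

variable {p : ℝ} {w w' : (q : Q) → TangentSpace (𝓡 3) (B.proj q)} {U N : Set M}
  {a : (y : M) → TangentSpace (𝓡 3) y} {E : M → ℝ → Q}

theorem IsDirectionField.exists_angle (hw : B.IsDirectionField J p w)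
    (hE : IsTrivialization B.proj B.pos U E) (ha : ξ.IsSectionOver a U) (hN : HasLifts N)
    (hNU : N ⊆ U) : ∃ θ : M × ℝ → ℝ, ContinuousOn θ (N ×ˢ univ) ∧ ∀ y ∈ N, ∀ t,
      J.dir (a (B.proj (E y t))) (w (E y t)) p = (θ (y, t) : AddCircle p) := by
  obtain ⟨θ, h1, h2⟩ := hN p (fun x => J.dir (a (B.proj (E x.1 x.2))) (w (E x.1 x.2)) p)
    (fun x hx => by
      have hp : B.proj (E x.1 x.2) ∈ U := by rw [hE.proj_apply (hNU hx.1)]; exact hNU hx.1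
      exact ContinuousAt.comp_continuousWithinAt (f := fun x : M × ℝ => E x.1 x.2)
        (hw.continuousAt U a ha _ hp)
        ((hE.continuousOn x ⟨hNU hx.1, mem_univ _⟩).mono (prod_mono hNU subset_rfl)))
  exact ⟨θ, h1, fun y hy t => (h2 y hy t).symm⟩

theorem _root_.OrientedContactStructure.ComplexStructure.dir_one_of_dir
    (hp : ∃ j : ℤ, (2 : ℝ) = j * p) (hp' : ∃ m : ℤ, p = m) {y : M}
    {v w : TangentSpace (𝓡 3) y} (hv : v ∈ ξ.plane y) (hv0 : v ≠ 0) (hw : w ∈ ξ.plane y)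
    (hw0 : w ≠ 0) {s : ℝ} (h : J.dir v w p = (s : AddCircle p)) :
    J.dir v w 1 = (s : AddCircle (1 : ℝ)) := by
  obtain ⟨r, k, hr, hk⟩ := (J.dir_eq_iff hp hv hv0 hw hw0).1 h
  obtain ⟨m, rfl⟩ := hp'
  rw [J.dir_eq_iff OrientedContactStructure.ComplexStructure.exists_one hv hv0 hw hw0]
  exact ⟨r, k * m, hr, by rw [hk]; push_cast; rw [mul_one]⟩

theorem continuous_slice {θ : M × ℝ → ℝ} (hθ : ContinuousOn θ (N ×ˢ univ)) {y : M} (hy : y ∈ N) :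
    Continuous fun t => θ (y, t) :=
  hθ.comp_continuous (by fun_prop) fun _ => ⟨hy, mem_univ _⟩

theorem eq_add_of_angles {f g : ℝ → ℝ} (hf : Continuous f) (hg : Continuous g) {p : ℝ} (hp : 0 < p)
    (h : ∀ t, (f t : AddCircle p) = (g t : AddCircle p)) : ∃ k : ℤ, ∀ t, g t = f t + k * p := by
  choose k hk using fun t => AddCircle.coe_eq_coe_iff_exists.1 (h t)
  refine ⟨k 0, fun t => ?_⟩
  have := eq_of_continuousOn_int (f := fun t => g t - f t) (S := univ) isPreconnected_univ hp
    (hg.sub hf).continuousOn (fun t _ => ⟨k t, by rw [hk t]; ring⟩) (mem_univ t) (mem_univ 0)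
  linarith [hk 0]

namespace VerticalEngel

variable {𝒟 : B.VerticalEngel} {n : ℤ}

/-- The angle of the development map along a fibre increases by the twisting number. -/
theorem HasTwisting.exists_angle (h : 𝒟.HasTwisting ξ n) (J : ξ.ComplexStructure)
    (hU : IsOpen U) (hE : IsTrivialization B.proj B.pos U E) (ha : ∀ y ∈ U, a y ∈ ξ.plane y)
    (ha0 : ∀ y ∈ U, a y ≠ 0) {y : M} (hy : y ∈ U) : ∃ θ : ℝ → ℝ, Continuous θ ∧
      (∀ t, θ (t + 1) = θ t + n) ∧ ∀ t, B.image 𝒟.D (E y t) = Submodule.span ℝ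
        {J.rot (B.proj (E y t)) (θ t) (a (B.proj (E y t)))} := by
  classical
  choose A C hAC using ξ.exists_positivePair
  set a' : (y : M) → TangentSpace (𝓡 3) y := fun y => if y ∈ U then a y else A y with ha'
  set b' : (y : M) → TangentSpace (𝓡 3) y := fun y =>
    if y ∈ U then J.ext y (a y) else C y with hb'
  obtain ⟨θ, h1, h2, h3⟩ := h a' b' (fun y => by
    by_cases hy : y ∈ U
    · simp only [ha', hb', if_pos hy]
      exact J.isPositivePair (ha y hy) (ha0 y hy)
    · simp only [ha', hb', if_neg hy]
      exact hAC y) U E hU hE y hy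
  refine ⟨θ, h1, h2, fun t => ?_⟩
  have hmem : B.proj (E y t) ∈ U := by rw [hE.proj_apply hy]; exact hy
  rw [h3 t, J.rot_apply]
  simp only [ha', hb', if_pos hmem]

theorem HasTwisting.add_one (h : 𝒟.HasTwisting ξ n) (hp : ∃ j : ℤ, (2 : ℝ) = j * p)
    (hp' : ∃ m : ℤ, p = m) (hwm : ∀ q, w q ∈ ξ.plane (B.proj q)) (hw0 : ∀ q, w q ≠ 0)
    (hw𝒟 : ∀ q, B.image 𝒟.D q = Submodule.span ℝ {w q})
    (hU : IsOpen U) (hE : IsTrivialization B.proj B.pos U E) (ha : ∀ y ∈ U, a y ∈ ξ.plane y)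
    (ha0 : ∀ y ∈ U, a y ≠ 0) {y : M} (hy : y ∈ U) {θ : ℝ → ℝ} (hθ : Continuous θ)
    (hθw : ∀ t, J.dir (a (B.proj (E y t))) (w (E y t)) p = (θ t : AddCircle p)) (t : ℝ) :
    θ (t + 1) = θ t + n := by
  obtain ⟨θ', h1, h2, h3⟩ := h.exists_angle J hU hE ha ha0 hy
  have hmem : ∀ t, B.proj (E y t) ∈ U := fun t => by rw [hE.proj_apply hy]; exact hy
  obtain ⟨k, hk⟩ := eq_add_of_angles (p := 1) h1 hθ one_pos fun t => by
    rw [← J.dir_one_of_dir hp hp' (ha _ (hmem t)) (ha0 _ (hmem t)) (hwm _) (hw0 _) (hθw t),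
      eq_comm, ← J.span_eq_iff_dir (ha _ (hmem t)) (ha0 _ (hmem t)) (hwm _) (hw0 _), ← hw𝒟, h3]
  rw [hk, hk, h2]; ring

/-- The twisting number can be read off from one trivialization around each fibre. -/
theorem hasTwisting_of_angles (hwm : ∀ q, w q ∈ ξ.plane (B.proj q)) (hw0 : ∀ q, w q ≠ 0)
    (hw𝒟 : ∀ q, B.image 𝒟.D q = Submodule.span ℝ {w q})
    (h : ∀ y, ∃ (U : Set M) (E : M → ℝ → Q) (a : (y : M) → TangentSpace (𝓡 3) y) (θ : ℝ → ℝ),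
      IsOpen U ∧ y ∈ U ∧ IsTrivialization B.proj B.pos U E ∧ (∀ y ∈ U, a y ∈ ξ.plane y) ∧
      (∀ y ∈ U, a y ≠ 0) ∧ Continuous θ ∧ (∀ t, θ (t + 1) = θ t + n) ∧
      ∀ t, J.dir (a (B.proj (E y t))) (w (E y t)) 1 = (θ t : AddCircle (1 : ℝ))) :
    𝒟.HasTwisting ξ n := by
  intro a' b' hab U' E' hU' hE' y hy'
  obtain ⟨U, E, a, θ, hU, hy, hE, ha, ha0, hθ, hθn, hθw⟩ := h y
  obtain ⟨N, hN, hyN, hNU, hNl⟩ := exists_hasLifts_subset ((hU.inter hU').mem_nhds ⟨hy, hy'⟩)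
  obtain ⟨G, hG, hGE⟩ := exists_transition hE' hE hU hNl (fun z hz => (hNU hz).2)
    (fun z hz => (hNU hz).1)
  have hg := continuous_slice hG hyN
  have hg1 := hE'.transition_add_one hE hU hy' hy hg (hGE y hyN)
  -- the angle from `a'` to `a`, and the coordinates of `b'`, at each point of the base
  have hex : ∀ y ∈ U, ∃ s r : ℝ, 0 < r ∧ a y = r • J.rot y s (a' y) := fun y hy => by
    obtain ⟨r, s, hr, h⟩ := J.exists_rot (hab y).mem_left ((hab y).linearIndependent.ne_zero 0)
      (ha y hy) (ha0 y hy)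
    exact ⟨s, r, hr, h⟩
  choose! s r hr hs using hex
  have hex2 : ∀ y, ∃ x z : ℝ, 0 < z ∧ b' y = x • a' y + z • J.ext y (a' y) := fun y => by
    have hJ := J.isPositivePair (hab y).mem_left ((hab y).linearIndependent.ne_zero 0)
    obtain ⟨x, z, hxz⟩ := hJ.exists_coeffs (hab y).mem_right
    refine ⟨x, z, ?_, hxz⟩
    have h1 := hab y
    have h2 : a' y = (1 : ℝ) • a' y + (0 : ℝ) • J.ext y (a' y) := by simp
    rw [hxz] at h1
    nth_rewrite 1 [h2] at h1
    rw [hJ.iff_det_pos] at h1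
    linarith
  choose x z hz hb' using hex2
  have hproj : ∀ t, B.proj (E' y t) = y := fun t => hE'.proj_apply hy' t
  refine ⟨fun t => shear (-(x y / z y)) (1 / z y) (s y + θ (G (y, t))), ?_, fun t => ?_,
    fun t => ?_⟩
  · rw [continuous_iff_continuousAt]
    intro t
    rw [← continuousWithinAt_univ]
    exact continuousWithinAt_shear continuousWithinAt_const continuousWithinAt_const
      (one_div_pos.2 (hz y)) ((continuous_const.add (hθ.comp hg)).continuousWithinAt)
  · simp only
    rw [hg1, hθn, ← add_assoc, shear_add_int]
  · set q := E' y t with hq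
    have hqy : B.proj q = y := hproj t
    have hqU : B.proj q ∈ U := by rw [hqy]; exact hy
    have hqE : E y (G (y, t)) = q := (hGE y hyN t).symm
    have hm := (hab (B.proj q)).mem_left
    have hm0 : a' (B.proj q) ≠ 0 := (hab (B.proj q)).linearIndependent.ne_zero 0
    have h1 : J.dir (a (B.proj q)) (w q) 1 = (θ (G (y, t)) : AddCircle (1 : ℝ)) := by
      have := hθw (G (y, t))
      rwa [hqE] at this
    have h2 : J.dir (a' (B.proj q)) (w q) 1 = ((s y + θ (G (y, t)) : ℝ) : AddCircle (1 : ℝ)) := by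
      rw [← J.dir_add OrientedContactStructure.ComplexStructure.exists_one hm hm0
        (ha _ hqU) (ha0 _ hqU) (hwm q) (hw0 q), h1, AddCircle.coe_add]
      congr 1
      rw [J.dir_eq OrientedContactStructure.ComplexStructure.exists_one hm hm0
        (hr _ hqU) (hs _ hqU), hqy]
    rw [hw𝒟, (J.span_eq_iff_dir hm hm0 (hwm q) (hw0 q)).2 h2]
    obtain ⟨ρ, hρ, hρs⟩ := shear_polar (-(x y / z y)) (one_div_pos.2 (hz y))
      (s y + θ (G (y, t)))
    set φ := shear (-(x y / z y)) (1 / z y) (s y + θ (G (y, t))) with hφ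
    set ψ := s y + θ (G (y, t)) with hψ
    have hre := congrArg Complex.re hρs
    have him := congrArg Complex.im hρs
    simp only [Complex.re_ofReal_mul, Complex.im_ofReal_mul, cisPi_re, cisPi_im] at hre him
    have hzy : z y ≠ 0 := (hz y).ne'
    have hbq : b' (B.proj q) = x y • a' (B.proj q) + z y • J.ext (B.proj q) (a' (B.proj q)) := by
      have := hb' (B.proj q)
      rwa [show x (B.proj q) = x y from congrArg x hqy,
        show z (B.proj q) = z y from congrArg z hqy] at this
    have hfin : J.rot (B.proj q) ψ (a' (B.proj q)) = ρ • (Real.cos (Real.pi * φ) • a' (B.proj q) +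
        Real.sin (Real.pi * φ) • b' (B.proj q)) := by
      rw [smul_add, smul_smul, smul_smul, ← hre, ← him, hbq, J.rot_apply]
      have h3 : Real.cos (Real.pi * ψ) = (Real.cos (Real.pi * ψ) +
          -(x y / z y) * Real.sin (Real.pi * ψ)) + 1 / z y * Real.sin (Real.pi * ψ) * x y := by
        field_simp; ring
      have h4 : Real.sin (Real.pi * ψ) = 1 / z y * Real.sin (Real.pi * ψ) * z y := by
        field_simp
      rw [smul_add, smul_smul, smul_smul, ← h4, ← add_assoc, ← add_smul, ← h3]
    rw [hfin]
    exact Submodule.span_singleton_smul_eq (IsUnit.mk0 _ hρ.ne') _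

variable [T2Space M] [CompactSpace M]

/-- A nonzero vector spanning the value of the development map. -/
def vec (𝒟 : B.VerticalEngel) (q : Q) : TangentSpace (𝓡 3) (B.proj q) :=
  Classical.epsilon fun v => v ≠ 0 ∧ B.image 𝒟.D q = Submodule.span ℝ {v}

theorem vec_spec (h : 𝒟.Induces ξ) (q : Q) :
    𝒟.vec q ≠ 0 ∧ B.image 𝒟.D q = Submodule.span ℝ {𝒟.vec q} := by
  refine Classical.epsilon_spec (p := fun v => v ≠ 0 ∧ B.image 𝒟.D q = Submodule.span ℝ {v}) ?_
  obtain ⟨O, X, -, hq, -, hX⟩ := exists_section_generating h q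
  exact ⟨_, hX q hq⟩

theorem mem_plane_of_span (h : 𝒟.Induces ξ) {q : Q} {v : TangentSpace (𝓡 3) (B.proj q)}
    (hv : B.image 𝒟.D q = Submodule.span ℝ {v}) : v ∈ ξ.plane (B.proj q) :=
  image_le h q (hv ▸ Submodule.mem_span_singleton_self v)

theorem isDirectionField_vec (h : 𝒟.Induces ξ) (J : ξ.ComplexStructure) :
    B.IsDirectionField J 1 𝒟.vec where
  mem q := mem_plane_of_span h (vec_spec h q).2
  ne_zero q := (vec_spec h q).1
  continuousAt U a ha q hq := by
    obtain ⟨O, θ, hqO, hOU, hθ⟩ := exists_twistAngle h J ha hq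
    have h1 : ContinuousAt (fun q => ((θ q : ℝ) : AddCircle (1 : ℝ))) q :=
      (AddCircle.continuous_mk' 1).continuousAt.comp
        ((hθ.smooth q hqO).continuousWithinAt.continuousAt (hθ.isOpen.mem_nhds hqO))
    refine h1.congr ?_
    filter_upwards [hθ.isOpen.mem_nhds hqO] with q' hq'
    rw [eq_comm, ← J.span_eq_iff_dir (ha.mem _ (hOU hq')) (ha.ne_zero _ (hOU hq'))
      (mem_plane_of_span h (vec_spec h q').2) (vec_spec h q').1, ← (vec_spec h q').2,
      hθ.eq_span q' hq']

/-- The angle of the development map moves along the fibres in the direction given by the sign of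
the twisting number. -/
theorem mul_deriv_pos (h : 𝒟.Induces ξ) (hn : 𝒟.HasTwisting ξ n) (ha : ξ.IsSectionOver a U)
    {O : Set Q} (hOU : O ⊆ B.proj ⁻¹' U) {θ : Q → ℝ}
    (hθ : B.IsTwistAngle J (B.image 𝒟.D) a O θ) {q : Q} (hq : q ∈ O) {v : TangentSpace (𝓡 4) q}
    (hv : v ∈ B.pos q) : 0 < n * mvfderiv (𝓡 4) θ q v := by
  obtain ⟨V, hV, hyV, E, hE⟩ := B.locallyTrivial (B.proj q)
  have hyU : B.proj q ∈ U := hOU hq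
  obtain ⟨y, hy⟩ : ∃ y, B.proj q = y := ⟨_, rfl⟩
  rw [hy] at hyU hyV
  have hUV : IsOpen (U ∩ V) := ha.isOpen.inter hV
  have hE' := hE.mono (inter_subset_right : U ∩ V ⊆ V)
  have hyUV : y ∈ U ∩ V := ⟨hyU, hyV⟩
  obtain ⟨ψ, hψ, hψn, hψs⟩ := hn.exists_angle J hUV hE' (fun y hy => ha.mem y hy.1)
    (fun y hy => ha.ne_zero y hy.1) hyUV
  have hmem : ∀ t, B.proj (E y t) ∈ U := fun t => by rw [hE'.proj_apply hyUV]; exact hyU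
  -- any local smooth angle differs from `ψ` by a constant along the fibre
  have key : ∀ {O : Set Q} {θ : Q → ℝ}, O ⊆ B.proj ⁻¹' U →
      B.IsTwistAngle J (B.image 𝒟.D) a O θ → ∀ t, E y t ∈ O → HasDerivAt ψ (mvfderiv (𝓡 4) θ (E y t)
        (mfderiv 𝓘(ℝ, ℝ) (𝓡 4) (E y) t (1 : ℝ) : TangentSpace (𝓡 4) (E y t))) t := by
    intro O θ hOU hθ t ht
    have hd := hE'.hasDerivAt_comp hyUV (t := t) (f := θ)
      (((hθ.smooth _ ht).contMDiffAt (hθ.isOpen.mem_nhds ht)).mdifferentiableAt (by simp))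
    set S : Set ℝ := E y ⁻¹' O with hS
    have hSo : IsOpen S := hθ.isOpen.preimage (hE'.contMDiff_fiber hyUV).continuous
    have hev := eventually_eq_of_continuousWithinAt_int (f := fun s => ψ s - θ (E y s)) (S := S)
      one_pos (hψ.continuousWithinAt.sub hd.continuousAt.continuousWithinAt) ht fun s hs => by
        have h1 := hψs s
        rw [hθ.eq_span _ hs, J.span_rot_eq_iff _ _ (ha.mem _ (hmem s))
          (ha.ne_zero _ (hmem s))] at h1
        obtain ⟨k, hk⟩ := h1
        exact ⟨k, by rw [hk]; ring⟩
    rw [hSo.nhdsWithin_eq ht] at hev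
    refine (hd.add_const (ψ t - θ (E y t))).congr_of_eventuallyEq ?_
    filter_upwards [hev] with s hs
    linarith
  obtain ⟨t₀, ht₀⟩ := hE'.exists_eq (q := q) (by rw [hy]; exact hyUV)
  rw [hy] at ht₀
  have hvel : ∀ t, ∃ d : ℝ, HasDerivAt ψ d t ∧ d ≠ 0 := by
    intro t
    obtain ⟨O', θ', h1, h2, h3⟩ := exists_twistAngle h J ha (hmem t)
    exact ⟨_, key h2 h3 t h1, h3.deriv_ne _ h1 _ (hE'.velocity_mem hyUV t)⟩
  choose d hd hd0 using hvel
  have hpos : 0 < n * d t₀ := by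
    have h1 : ψ 1 = ψ 0 + n := by simpa using hψn 0
    rcases hasDerivWithinAt_forall_lt_or_forall_gt_of_forall_ne (s := univ) convex_univ
      (f := ψ) (f' := d) (m := 0) (fun t _ => (hd t).hasDerivWithinAt) (fun t _ => hd0 t) with h2 | h2
    · have hanti : StrictAnti ψ := strictAnti_of_deriv_neg fun t => by
        rw [(hd t).deriv]; exact h2 t (mem_univ t)
      have h3 := hanti (zero_lt_one (α := ℝ))
      exact mul_pos_of_neg_of_neg (by linarith) (h2 t₀ (mem_univ _))
    · have hmono : StrictMono ψ := strictMono_of_deriv_pos fun t => by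
        rw [(hd t).deriv]; exact h2 t (mem_univ t)
      have h3 := hmono (zero_lt_one (α := ℝ))
      exact mul_pos (by linarith) (h2 t₀ (mem_univ _))
  subst ht₀
  have hdt := (key hOU hθ t₀ hq).unique (hd t₀)
  obtain ⟨r, hr, hrv⟩ := hE'.eq_smul_velocity hyUV hv
  rw [hrv, map_smul, smul_eq_mul]
  have : mvfderiv (𝓡 4) θ (E y t₀) (mfderiv 𝓘(ℝ, ℝ) (𝓡 4) (E y) t₀ (1 : ℝ)) = d t₀ := hdt
  rw [this, mul_left_comm]
  exact mul_pos hr hpos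

end VerticalEngel

end OrientedCircleBundle

/-! ### Isotopies and lifts of the angle between development maps -/

namespace OrientedCircleBundle

open OrientedContactStructure.ComplexStructure (exists_one exists_two)

variable {M : Type*} [TopologicalSpace M] [ChartedSpace (EuclideanSpace ℝ (Fin 3)) M]
  {Q : Type*} [TopologicalSpace Q] [ChartedSpace (EuclideanSpace ℝ (Fin 4)) Q]
  [IsManifold (𝓡 3) ∞ M] [IsManifold (𝓡 4) ∞ Q]
  {B : OrientedCircleBundle Q M} {ξ : OrientedContactStructure M} {J : ξ.ComplexStructure}
  {a : (y : M) → TangentSpace (𝓡 3) y} {U : Set M} {n : ℤ}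

theorem IsTwistAngle.mono {ℓ : (q : Q) → Submodule ℝ (TangentSpace (𝓡 3) (B.proj q))} {O O' : Set Q}
    {θ : Q → ℝ} (h : B.IsTwistAngle J ℓ a O θ) (hO' : IsOpen O') (hOO : O' ⊆ O) :
    B.IsTwistAngle J ℓ a O' θ :=
  ⟨hO', h.smooth.mono hOO, fun q hq => h.eq_span q (hOO hq), fun q hq => h.deriv_ne q (hOO hq)⟩

theorem IsTwistAngle.dir_eq {ℓ : (q : Q) → Submodule ℝ (TangentSpace (𝓡 3) (B.proj q))} {O : Set Q}
    {θ : Q → ℝ} (h : B.IsTwistAngle J ℓ a O θ) (ha : ξ.IsSectionOver a U) (hOU : O ⊆ B.proj ⁻¹' U)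
    {q : Q} (hq : q ∈ O) {w : TangentSpace (𝓡 3) (B.proj q)} (hw : w ∈ ξ.plane (B.proj q))
    (hw0 : w ≠ 0) (hℓ : ℓ q = Submodule.span ℝ {w}) :
    J.dir (a (B.proj q)) w 1 = (θ q : AddCircle (1 : ℝ)) := by
  rw [← J.span_eq_iff_dir (ha.mem _ (hOU hq)) (ha.ne_zero _ (hOU hq)) hw hw0, ← hℓ,
    h.eq_span q hq]

theorem mvfderiv_add_apply {f g : Q → ℝ} {q : Q} (hf : MDifferentiableAt (𝓡 4) 𝓘(ℝ, ℝ) f q)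
    (hg : MDifferentiableAt (𝓡 4) 𝓘(ℝ, ℝ) g q) (v : TangentSpace (𝓡 4) q) :
    mvfderiv (𝓡 4) (fun q => f q + g q) q v = mvfderiv (𝓡 4) f q v + mvfderiv (𝓡 4) g q v :=
  congrArg (fun A => A v) (mvfderiv_fun_add hf hg)

namespace VerticalEngel

variable [T2Space M] [CompactSpace M] {𝒟 𝒟' : B.VerticalEngel}

theorem vec_mem (h : 𝒟.Induces ξ) (q : Q) : 𝒟.vec q ∈ ξ.plane (B.proj q) :=
  mem_plane_of_span h (vec_spec h q).2

theorem vec_ne_zero (h : 𝒟.Induces ξ) (q : Q) : 𝒟.vec q ≠ 0 := (vec_spec h q).1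

/-- Local angles of two development maps whose difference is a given lift of the angle between
them. -/
theorem exists_twistAngle_pair (h : 𝒟.Induces ξ) (h' : 𝒟'.Induces ξ) {f : Q → ℝ} {V : Set M}
    (hV : IsOpen V) (hf : ContinuousOn f (B.proj ⁻¹' V))
    (hfd : ∀ q ∈ B.proj ⁻¹' V, J.dir (𝒟.vec q) (𝒟'.vec q) 1 = (f q : AddCircle (1 : ℝ)))
    (ha : ξ.IsSectionOver a U) {q₀ : Q} (hq₀ : B.proj q₀ ∈ U) (hqV : B.proj q₀ ∈ V) :
    ∃ (O : Set Q) (θ θ' : Q → ℝ), q₀ ∈ O ∧ O ⊆ B.proj ⁻¹' (U ∩ V) ∧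
      B.IsTwistAngle J (B.image 𝒟.D) a O θ ∧ B.IsTwistAngle J (B.image 𝒟'.D) a O θ' ∧
      ∀ q ∈ O, f q = θ' q - θ q := by
  obtain ⟨O₀, θ, hq, hOU, hθ⟩ := exists_twistAngle h J ha hq₀
  obtain ⟨O₁, θ', hq', hOU', hθ'⟩ := exists_twistAngle h' J ha hq₀
  set S : Set Q := O₀ ∩ O₁ ∩ B.proj ⁻¹' V with hS
  have hSo : IsOpen S := (hθ.isOpen.inter hθ'.isOpen).inter (hV.preimage B.continuous_proj)
  have hqS : q₀ ∈ S := ⟨⟨hq, hq'⟩, hqV⟩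
  have hint : ∀ q ∈ S, ∃ k : ℤ, θ' q - θ q - f q = k * (1 : ℝ) := by
    intro q hq
    have h1 := hθ.dir_eq ha hOU hq.1.1 (vec_mem h q) (vec_ne_zero h q) (vec_spec h q).2
    have h2 := hθ'.dir_eq ha hOU' hq.1.2 (vec_mem h' q) (vec_ne_zero h' q) (vec_spec h' q).2
    have hqU := hOU hq.1.1
    have h3 := J.dir_add exists_one (ha.mem _ hqU) (ha.ne_zero _ hqU) (vec_mem h q)
      (vec_ne_zero h q) (vec_mem h' q) (vec_ne_zero h' q)
    rw [h1, h2, hfd q hq.2, ← AddCircle.coe_add] at h3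
    obtain ⟨k, hk⟩ := exists_int_sub_eq h3
    exact ⟨k, by rw [← hk]; ring⟩
  have hcont : ContinuousWithinAt (fun q => θ' q - θ q - f q) S q₀ :=
    (((hθ'.smooth q₀ hq').continuousWithinAt.mono fun q hq => hq.1.2).sub
      ((hθ.smooth q₀ hq).continuousWithinAt.mono fun q hq => hq.1.1)).sub
      ((hf q₀ hqV).mono fun q hq => hq.2)
  have hev := eventually_eq_of_continuousWithinAt_int one_pos hcont hqS hint
  rw [hSo.nhdsWithin_eq hqS] at hev
  obtain ⟨O, hOe, hO, hqO⟩ := eventually_nhds_iff.1 (hev.and (hSo.mem_nhds hqS))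
  obtain ⟨k, hk⟩ := hint q₀ hqS
  have hθO := hθ'.mono hO fun q hq => (hOe q hq).2.1.2
  refine ⟨O, θ, fun q => θ' q + (-k : ℝ), hqO, fun q hq => ⟨hOU (hOe q hq).2.1.1, (hOe q hq).2.2⟩,
    hθ.mono hO fun q hq => (hOe q hq).2.1.1, ⟨hO, hθO.smooth.add contMDiffOn_const, fun q hq => ?_,
    fun q hq v hv => ?_⟩, fun q hq => ?_⟩
  · have hqU := hOU (hOe q hq).2.1.1
    rw [hθO.eq_span q hq, J.span_rot_eq_iff _ _ (ha.mem _ hqU) (ha.ne_zero _ hqU)]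
    exact ⟨-k, by push_cast; rfl⟩
  · rw [mvfderiv_add_apply (((hθO.smooth q hq).contMDiffAt (hO.mem_nhds hq)).mdifferentiableAt
      (by simp)) mdifferentiableAt_const]
    rw [mvfderiv_const]
    simpa using hθO.deriv_ne q hq v hv
  · have := (hOe q hq).1
    rw [hk] at this
    simp only at this ⊢
    linarith

/-- The twisting number does not change if the angle between the development maps lifts locally
over the base. -/
theorem HasTwisting.of_lifts (hn : 𝒟.HasTwisting ξ n) (h : 𝒟.Induces ξ) (h' : 𝒟'.Induces ξ)
    (J : ξ.ComplexStructure)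
    (hl : ∀ y, ∃ (V : Set M) (f : Q → ℝ), IsOpen V ∧ y ∈ V ∧ ContinuousOn f (B.proj ⁻¹' V) ∧
      ∀ q ∈ B.proj ⁻¹' V, J.dir (𝒟.vec q) (𝒟'.vec q) 1 = (f q : AddCircle (1 : ℝ))) :
    𝒟'.HasTwisting ξ n := by
  refine hasTwisting_of_angles (J := J) (w := 𝒟'.vec) (vec_mem h') (vec_ne_zero h')
    (fun q => (vec_spec h' q).2) fun y => ?_
  obtain ⟨V, f, hV, hyV, hf, hfd⟩ := hl y
  obtain ⟨U₁, hU₁, hy₁, E, hE⟩ := B.locallyTrivial y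
  obtain ⟨U₂, a, hy₂, ha⟩ := ξ.exists_isSectionOver y
  have hUo : IsOpen (U₁ ∩ U₂) := hU₁.inter ha.isOpen
  have hE' := hE.mono (inter_subset_left : U₁ ∩ U₂ ⊆ U₁)
  have ham : ∀ y ∈ U₁ ∩ U₂, a y ∈ ξ.plane y := fun y hy => ha.mem y hy.2
  have ha0 : ∀ y ∈ U₁ ∩ U₂, a y ≠ 0 := fun y hy => ha.ne_zero y hy.2
  have hy : y ∈ U₁ ∩ U₂ := ⟨hy₁, hy₂⟩
  obtain ⟨θ, hθ, hθ1, hθs⟩ := hn.exists_angle J hUo hE' ham ha0 hy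
  have hp : ∀ t, B.proj (E y t) = y := fun t => hE'.proj_apply hy t
  refine ⟨_, E, a, fun t => θ t + f (E y t), hUo, hy, hE', ham, ha0, ?_, fun t => ?_, fun t => ?_⟩
  · refine hθ.add (hf.comp_continuous (hE'.contMDiff_fiber hy).continuous fun t => ?_)
    rw [mem_preimage, hp]; exact hyV
  · have := hE'.periodic hy t 1
    rw [Int.cast_one] at this
    simp only [this, hθ1]
    ring
  · have hpU : B.proj (E y t) ∈ U₁ ∩ U₂ := by rw [hp]; exact hy
    rw [← J.dir_add exists_one (ham _ hpU) (ha0 _ hpU) (vec_mem h _) (vec_ne_zero h _)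
      (vec_mem h' _) (vec_ne_zero h' _), hfd _ (by rw [mem_preimage, hp]; exact hyV),
      AddCircle.coe_add, (J.span_eq_iff_dir (ham _ hpU) (ha0 _ hpU) (vec_mem h _)
      (vec_ne_zero h _)).1 ((vec_spec h _).2.symm.trans (hθs t))]

/-- The angle between the development maps of two Engel structures lifts to the real numbers. -/
def AngleLifts (J : ξ.ComplexStructure) (𝒟 𝒟' : B.VerticalEngel) : Prop :=
  ∃ f : Q → ℝ, Continuous f ∧ ∀ q, (f q : AddCircle (1 : ℝ)) = J.dir (𝒟.vec q) (𝒟'.vec q) 1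

/-- The isotopy rotates the first development map by `s * f`, for a lift `f` of the angle between the
two.  Its angles interpolate linearly between those of the given development maps, which move along
the fibres in the same direction. -/
theorem isotopic_of_angleLifts (h : 𝒟.Induces ξ) (h' : 𝒟'.Induces ξ)
    (hn : 𝒟.HasTwisting ξ n) (hn' : 𝒟'.HasTwisting ξ n) (hl : AngleLifts J 𝒟 𝒟') :
    Isotopic 𝒟 𝒟' := by
  obtain ⟨f, hf, hfd⟩ := hl
  set ℓ : ℝ → (q : Q) → Submodule ℝ (TangentSpace (𝓡 3) (B.proj q)) := fun s q =>
    Submodule.span ℝ {J.rot (B.proj q) (s * f q) (𝒟.vec q)} with hℓ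
  have hpair : ∀ q₀ : Q, ∃ (U : Set M) (a : (y : M) → TangentSpace (𝓡 3) y) (O : Set Q)
      (θ θ' : Q → ℝ), ξ.IsSectionOver a U ∧ q₀ ∈ O ∧ O ⊆ B.proj ⁻¹' U ∧
      B.IsTwistAngle J (B.image 𝒟.D) a O θ ∧ B.IsTwistAngle J (B.image 𝒟'.D) a O θ' ∧
      ∀ q ∈ O, f q = θ' q - θ q := by
    intro q₀
    obtain ⟨U, a, hU, ha⟩ := ξ.exists_isSectionOver (B.proj q₀)
    obtain ⟨O, θ, θ', h1, h2, h3, h4, h5⟩ := exists_twistAngle_pair (J := J) h h'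
      (V := univ) isOpen_univ hf.continuousOn (fun q _ => (hfd q).symm) ha hU (mem_univ _)
    exact ⟨U, a, O, θ, θ', ha, h1, h2.trans (preimage_mono inter_subset_left), h3, h4, h5⟩
  have hspan : ∀ {U : Set M} {a : (y : M) → TangentSpace (𝓡 3) y} {O : Set Q}
      {θ θ' : Q → ℝ}, ξ.IsSectionOver a U → O ⊆ B.proj ⁻¹' U →
      B.IsTwistAngle J (B.image 𝒟.D) a O θ → (∀ q ∈ O, f q = θ' q - θ q) → ∀ (s : ℝ), ∀ q ∈ O,
      ℓ s q = Submodule.span ℝ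
        {J.rot (B.proj q) (θ q + s * (θ' q - θ q)) (a (B.proj q))} := by
    intro U a O θ θ' ha hOU hθ hff s q hq
    have hqU := hOU hq
    have hr := J.rot_mem (s * f q) (vec_mem h q)
    have hr0 := J.rot_ne_zero (s * f q) (vec_mem h q) (vec_ne_zero h q)
    rw [hℓ]
    simp only
    rw [J.span_eq_iff_dir (ha.mem _ hqU) (ha.ne_zero _ hqU) hr hr0,
      ← J.dir_add exists_one (ha.mem _ hqU) (ha.ne_zero _ hqU) (vec_mem h q) (vec_ne_zero h q)
      hr hr0, hθ.dir_eq ha hOU hq (vec_mem h q) (vec_ne_zero h q) (vec_spec h q).2,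
      J.dir_eq exists_one (vec_mem h q) (vec_ne_zero h q) one_pos (one_smul _ _).symm,
      AddCircle.coe_add, hff q hq]
  have htw : ∀ s ∈ Icc (0 : ℝ) 1, B.IsTwisting J (ℓ s) := by
    intro s hs q₀
    obtain ⟨U, a, O, θ, θ', ha, hq₀, hOU, hθ, hθ', hff⟩ := hpair q₀
    refine ⟨U, a, O, fun q => (1 - s) * θ q + s * θ' q, ha, hq₀, hOU, hθ.isOpen, ?_,
      fun q hq => ?_, fun q hq v hv => ?_⟩
    · have hc : ∀ c : ℝ, ContMDiffOn (𝓡 4) 𝓘(ℝ, ℝ) ∞ (fun _ : Q => c) O :=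
        fun c => contMDiffOn_const
      exact ((hc (1 - s)).smul hθ.smooth).add ((hc s).smul hθ'.smooth)
    · rw [hspan ha hOU hθ hff s q hq]
      congr 4
      ring
    · have hd := ((hθ.smooth q hq).contMDiffAt (hθ.isOpen.mem_nhds hq)).mdifferentiableAt
        (n := ∞) (by simp)
      have hd' := ((hθ'.smooth q hq).contMDiffAt (hθ.isOpen.mem_nhds hq)).mdifferentiableAt
        (n := ∞) (by simp)
      have e1 := mvfderiv_real_comp hd ((hasDerivAt_id (θ q)).const_mul (1 - s)) v
      have e2 := mvfderiv_real_comp hd' ((hasDerivAt_id (θ' q)).const_mul s) v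
      rw [mvfderiv_add_apply (f := fun q => (1 - s) * θ q) (g := fun q => s * θ' q)
        (mdifferentiableAt_const.smul hd) (mdifferentiableAt_const.smul hd')]
      simp only [id] at e1 e2
      rw [e1, e2]
      have p1 := mul_deriv_pos h hn ha hOU hθ hq hv
      have p2 := mul_deriv_pos h' hn' ha hOU hθ' hq hv
      intro h0
      have h3 : (n : ℝ) * (mvfderiv (𝓡 4) θ q v * ((1 - s) * 1) +
        mvfderiv (𝓡 4) θ' q v * (s * 1)) = 0 := by rw [h0, mul_zero]
      have h4 : 0 ≤ (1 - s) * (n * mvfderiv (𝓡 4) θ q v) := mul_nonneg (by linarith [hs.2]) p1.le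
      have h5 : 0 ≤ s * (n * mvfderiv (𝓡 4) θ' q v) := mul_nonneg hs.1 p2.le
      rcases hs.1.eq_or_lt with h6 | h6
      · rw [← h6] at h3
        linarith
      · have := mul_pos h6 p2
        linarith
  -- `VerticalEngel`s are required for all real parameters, so clamp the parameter to `[0, 1]`
  have hcl : ∀ t : ℝ, max 0 (min 1 t) ∈ Icc (0 : ℝ) 1 := fun t =>
    ⟨le_max_left _ _, max_le zero_le_one (min_le_left _ _)⟩
  have hcl' : ∀ t ∈ Icc (0 : ℝ) 1, max 0 (min 1 t) = t := fun t ht => by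
    rw [min_eq_right ht.2, max_eq_right ht.1]
  refine ⟨fun t => VerticalEngel.ofTwisting (htw _ (hcl t)), ?_, ?_, ?_, ?_⟩
  · refine ext_image (induces_ofTwisting _) h ?_
    rw [image_ofTwisting]
    funext q
    rw [hcl' 0 (by simp), hℓ, (vec_spec h q).2]
    simp
  · refine ext_image (induces_ofTwisting _) h' ?_
    rw [image_ofTwisting]
    funext q
    rw [hcl' 1 (by simp), hℓ, (vec_spec h' q).2]
    simp only [one_mul]
    rw [eq_comm, J.span_eq_iff_dir (vec_mem h q) (vec_ne_zero h q) (vec_mem h' q)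
      (vec_ne_zero h' q), hfd]
  · intro t₀ ht₀ q₀
    obtain ⟨N, e, he⟩ := exists_isImmersed M
    obtain ⟨U, a, O, θ, θ', ha, hq₀, hOU, hθ, hθ', hff⟩ := hpair q₀
    obtain ⟨O₁, lift, hO₁, hq₁, hl1, hl2, hl3, hl4⟩ := exists_lift (B := B) he q₀
    set W : Set (ℝ × Q) := univ ×ˢ (O ∩ O₁) with hW
    have hsnd : ∀ p ∈ W, ContMDiffWithinAt (𝓘(ℝ, ℝ).prod (𝓡 4)) (𝓡 4) ∞
      (Prod.snd : ℝ × Q → Q) W p := fun p _ => contMDiff_snd.contMDiffAt.contMDiffWithinAt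
    have hfst : ∀ p ∈ W, ContMDiffWithinAt (𝓘(ℝ, ℝ).prod (𝓡 4)) 𝓘(ℝ, ℝ) ∞
      (Prod.fst : ℝ × Q → ℝ) W p := fun p _ => contMDiff_fst.contMDiffAt.contMDiffWithinAt
    refine ⟨W, isOpen_univ.prod (hθ.isOpen.inter hO₁), ⟨mem_univ _, hq₀, hq₁⟩,
      fun _ q => lift q 0 1, fun t q => lift q (mvfderiv (𝓡 3) e (B.proj q)
        (J.rot (B.proj q) (θ q + t * (θ' q - θ q)) (a (B.proj q)))) 0, fun p hp => ?_,
      fun p hp => ?_, fun p hp hpI => ?_⟩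
    · exact hl4 (g := Prod.snd) (u := fun _ => 0) (s := fun _ => 1) hp.2.2 (hsnd p hp)
        contMDiffWithinAt_const contMDiffWithinAt_const
    · have c1 := ((hθ.smooth p.2 hp.2.1).contMDiffAt
        (hθ.isOpen.mem_nhds hp.2.1)).comp_contMDiffWithinAt p (hsnd p hp)
      have c2 := ((hθ'.smooth p.2 hp.2.1).contMDiffAt
        (hθ.isOpen.mem_nhds hp.2.1)).comp_contMDiffWithinAt p (hsnd p hp)
      exact hl4 (g := Prod.snd) (s := fun _ => 0) hp.2.2 (hsnd p hp)
        (contMDiffWithinAt_rotated he ha (hsnd p hp) (hOU hp.2.1)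
          (c1.add ((hfst p hp).smul (c2.sub c1)))) contMDiffWithinAt_const
    · have hqU := hOU hp.2.1
      have hY := hl1 p.2 hp.2.2 (J.rot (B.proj p.2) (θ p.2 + p.1 * (θ' p.2 - θ p.2))
        (a (B.proj p.2))) 0
      refine liftField_eq_span (hl2 p.2 hp.2.2) ?_ ?_
      · rw [hY]
        exact J.rot_ne_zero _ (ha.mem _ hqU) (ha.ne_zero _ hqU)
      · rw [hY, hcl' p.1 hpI, hspan ha hOU hθ hff p.1 p.2 hp.2.1]
  · intro t _ q
    rw [induces_ofTwisting (htw _ (hcl t)) q, h q]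

theorem AngleLifts.refl (h : 𝒟.Induces ξ) : AngleLifts J 𝒟 𝒟 :=
  ⟨fun _ => 0, continuous_const, fun q => by
    rw [J.dir_self exists_one (vec_mem h q) (vec_ne_zero h q), AddCircle.coe_zero]⟩

theorem AngleLifts.symm (h : 𝒟.Induces ξ) (h' : 𝒟'.Induces ξ) (hl : AngleLifts J 𝒟 𝒟') :
    AngleLifts J 𝒟' 𝒟 := by
  obtain ⟨f, hf, hfd⟩ := hl
  refine ⟨fun q => -f q, hf.neg, fun q => ?_⟩
  have := J.dir_add exists_one (vec_mem h q) (vec_ne_zero h q) (vec_mem h' q) (vec_ne_zero h' q)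
    (vec_mem h q) (vec_ne_zero h q)
  rw [J.dir_self exists_one (vec_mem h q) (vec_ne_zero h q), ← hfd] at this
  rw [AddCircle.coe_neg]
  exact (eq_neg_of_add_eq_zero_right this).symm

theorem AngleLifts.trans {𝒟'' : B.VerticalEngel} (h : 𝒟.Induces ξ) (h' : 𝒟'.Induces ξ)
    (h'' : 𝒟''.Induces ξ) (hl : AngleLifts J 𝒟 𝒟') (hl' : AngleLifts J 𝒟' 𝒟'') :
    AngleLifts J 𝒟 𝒟'' := by
  obtain ⟨f, hf, hfd⟩ := hl
  obtain ⟨f', hf', hfd'⟩ := hl'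
  refine ⟨fun q => f q + f' q, hf.add hf', fun q => ?_⟩
  rw [AddCircle.coe_add, hfd, hfd', J.dir_add exists_one (vec_mem h q) (vec_ne_zero h q)
    (vec_mem h' q) (vec_ne_zero h' q) (vec_mem h'' q) (vec_ne_zero h'' q)]

theorem induces_iff_of_isotopic (h : Isotopic 𝒟 𝒟') : 𝒟.Induces ξ ↔ 𝒟'.Induces ξ := by
  obtain ⟨𝒟t, -, rfl, -, h1⟩ := h
  exact forall_congr' fun q => by rw [h1 1 (by simp) q]

/-- Along an isotopy, the angle of the development maps lifts to the real numbers. -/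
theorem angleLifts_of_isotopic (hi : Isotopic 𝒟 𝒟') (h : 𝒟.Induces ξ) (J : ξ.ComplexStructure) :
    AngleLifts J 𝒟 𝒟' := by
  obtain ⟨𝒟t, h0, rfl, hs, himg⟩ := hi
  have hind : ∀ t ∈ Icc (0 : ℝ) 1, (𝒟t t).Induces ξ := fun t ht q => by rw [himg t ht q, h q]
  obtain ⟨N, e, he⟩ := exists_isImmersed M
  set F : ℝ × Q → AddCircle (1 : ℝ) := fun p => J.dir (𝒟.vec p.2) ((𝒟t p.1).vec p.2) 1 with hF
  have hFc : ContinuousOn F (Icc 0 1 ×ˢ univ) := by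
    rintro ⟨t₀, q₀⟩ ⟨ht₀, -⟩
    obtain ⟨W, hW, hmW, X, Y, hX, hY, hXY⟩ := hs t₀ ht₀ q₀
    have himage : ∀ p ∈ W, p.1 ∈ Icc (0 : ℝ) 1 → B.image (𝒟t p.1).D p.2 =
        Submodule.span ℝ {B.dproj p.2 (X p.1 p.2), B.dproj p.2 (Y p.1 p.2)} := by
      intro p hp hpI
      rw [image, (hXY p hp hpI).2, Submodule.map_span, image_pair]
      rfl
    -- one of the two fields has nonzero projection
    have key : ∀ X : ℝ → (q : Q) → TangentSpace (𝓡 4) q,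
        ContMDiffOn (𝓘(ℝ, ℝ).prod (𝓡 4)) (𝓡 4).tangent ∞
          (fun p : ℝ × Q => (⟨p.2, X p.1 p.2⟩ : TangentBundle (𝓡 4) Q)) W →
        (∀ p ∈ W, p.1 ∈ Icc (0 : ℝ) 1 → B.dproj p.2 (X p.1 p.2) ∈ B.image (𝒟t p.1).D p.2) →
        B.dproj q₀ (X t₀ q₀) ≠ 0 → ContinuousWithinAt F (Icc 0 1 ×ˢ univ) (t₀, q₀) := by
      intro X hX hXm hX0
      set S : Set (ℝ × Q) := W ∩ Icc 0 1 ×ˢ univ with hS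
      have hmS : (t₀, q₀) ∈ S := ⟨hmW, ht₀, mem_univ _⟩
      obtain ⟨U, a, hU, ha⟩ := ξ.exists_isSectionOver (B.proj q₀)
      have hproj : ContinuousWithinAt (fun p : ℝ × Q => B.proj p.2) S (t₀, q₀) :=
        (B.continuous_proj.comp continuous_snd).continuousWithinAt
      have hΩ : ContinuousWithinAt (fun p : ℝ × Q => mvfderiv (𝓡 3) e (B.proj p.2)
          (B.dproj p.2 (X p.1 p.2))) S (t₀, q₀) := by
        have h1 := (ContMDiffAt.mvfderiv_apply_field isOpen_univ
          ((he.smooth.comp B.contMDiff_proj).contMDiffOn) (g := fun p : ℝ × Q => p.2)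
          (v := fun p => X p.1 p.2) (mem_univ _) (hX (t₀, q₀) hmW)).continuousWithinAt
        refine (h1.mono inter_subset_left).congr_of_eventuallyEq (Eventually.of_forall fun p => ?_)
          ?_
        · exact (mvfderiv_immersion_comp he B.contMDiff_proj p.2 (X p.1 p.2)).symm
        · exact (mvfderiv_immersion_comp he B.contMDiff_proj q₀ (X t₀ q₀)).symm
      have hd := J.continuousWithinAt_dir he exists_one ha hmS hproj hU hΩ
        (fun p hp => image_le (hind p.1 hp.2.1) p.2 (hXm p hp.1 hp.2.1)) hX0
      have hd0 := ((isDirectionField_vec h J).continuousAt U a ha q₀ hU).comp_continuousWithinAt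
        (s := S) (x := (t₀, q₀)) (f := Prod.snd) continuous_snd.continuousWithinAt
      have hFS : ContinuousWithinAt F S (t₀, q₀) := by
        have hne : ∀ᶠ p in 𝓝[S] (t₀, q₀), B.dproj p.2 (X p.1 p.2) ≠ 0 := by
          have h2 : mvfderiv (𝓡 3) e (B.proj q₀) (B.dproj q₀ (X t₀ q₀)) ≠ 0 :=
            (map_ne_zero_iff (mvfderiv (𝓡 3) e (B.proj q₀)) (he.injective _)).2 hX0
          filter_upwards [hΩ.eventually_ne h2] with p hp hp0
          exact hp (by rw [hp0, map_zero])
        have hev : ∀ᶠ p in 𝓝[S] (t₀, q₀), F p = J.dir (a (B.proj p.2)) (B.dproj p.2 (X p.1 p.2)) 1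
            - J.dir (a (B.proj p.2)) (𝒟.vec p.2) 1 := by
          filter_upwards [hne, hproj.preimage_mem_nhdsWithin (ha.isOpen.mem_nhds hU),
            self_mem_nhdsWithin] with p hp hpU hpS
          have hi := hind p.1 hpS.2.1
          have hXp := hXm p hpS.1 hpS.2.1
          have hXpl := image_le hi p.2 hXp
          have hsp : Submodule.span ℝ {(𝒟t p.1).vec p.2} =
              Submodule.span ℝ {B.dproj p.2 (X p.1 p.2)} := by
            rw [← (vec_spec hi p.2).2, eq_comm]
            refine Submodule.eq_of_le_of_finrank_eq ?_ ?_
            · rw [Submodule.span_singleton_le_iff_mem]; exact hXp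
            · rw [finrank_span_singleton hp, finrank_image hi]
          rw [eq_sub_iff_add_eq, add_comm, hF, J.dir_add exists_one (ha.mem _ hpU)
            (ha.ne_zero _ hpU) (vec_mem h _) (vec_ne_zero h _) (vec_mem hi _) (vec_ne_zero hi _)]
          exact J.dir_congr_span (ha.mem _ hpU) (ha.ne_zero _ hpU) (vec_mem hi _)
            (vec_ne_zero hi _) hXpl hp hsp
        exact (hd.sub hd0).congr_of_eventuallyEq hev (hev.self_of_nhdsWithin hmS)
      rwa [hS, inter_comm, continuousWithinAt_inter' (mem_nhdsWithin_of_mem_nhds (hW.mem_nhds hmW))] at hFS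
    by_cases hX0 : B.dproj q₀ (X t₀ q₀) = 0
    · refine key Y hY (fun p hp hpI => ?_) fun hY0 => ?_
      · rw [himage p hp hpI]; exact Submodule.subset_span (by simp)
      · have h1 := himage (t₀, q₀) hmW ht₀
        simp only [hX0, hY0, Set.pair_eq_singleton, Submodule.span_zero_singleton] at h1
        have h2 := finrank_image (hind t₀ ht₀) q₀
        rw [h1, finrank_bot] at h2
        exact zero_ne_one h2
    · refine key X hX (fun p hp hpI => ?_) hX0
      rw [himage p hp hpI]; exact Submodule.subset_span (by simp)
  let H : C(unitInterval × Q, AddCircle (1 : ℝ)) := ⟨fun x => F (x.1, x.2),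
    hFc.comp_continuous (by fun_prop) fun x => ⟨x.1.2, mem_univ _⟩⟩
  have hH0 : ∀ q, H (0, q) = QuotientAddGroup.mk ((0 : C(Q, ℝ)) q) := by
    intro q
    change J.dir (𝒟.vec q) ((𝒟t 0).vec q) 1 = _
    rw [h0, J.dir_self exists_one (vec_mem h q) (vec_ne_zero h q)]
    rfl
  refine ⟨fun q => (AddCircle.isCoveringMap_coe (1 : ℝ)).liftHomotopy H 0 hH0 (1, q),
    by fun_prop, fun q => ?_⟩
  exact congrFun ((AddCircle.isCoveringMap_coe (1 : ℝ)).liftHomotopy_lifts H 0 hH0) (1, q)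

theorem HasTwisting.of_angleLifts (hn : 𝒟.HasTwisting ξ n) (h : 𝒟.Induces ξ) (h' : 𝒟'.Induces ξ)
    (hl : AngleLifts J 𝒟 𝒟') : 𝒟'.HasTwisting ξ n := by
  obtain ⟨f, hf, hfd⟩ := hl
  exact hn.of_lifts h h' J fun y =>
    ⟨univ, f, isOpen_univ, mem_univ _, hf.continuousOn, fun q _ => (hfd q).symm⟩

/-- The induced contact structure and the twisting number are constant on isotopy classes, and the
angle between isotopic development maps lifts. -/
theorem of_isotopyClass_eq (J : ξ.ComplexStructure) (hc : 𝒟.isotopyClass = 𝒟'.isotopyClass) :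
    (𝒟.Induces ξ ↔ 𝒟'.Induces ξ) ∧ (𝒟.Induces ξ → AngleLifts J 𝒟 𝒟') := by
  have hg := Quot.eqvGen_exact hc
  induction hg with
  | rel x y h => exact ⟨induces_iff_of_isotopic h, fun hx => angleLifts_of_isotopic h hx J⟩
  | refl x => exact ⟨Iff.rfl, fun hx => .refl hx⟩
  | symm x y _ ih =>
    have ih := ih (Quot.eqvGen_sound ‹_›)
    exact ⟨ih.1.symm, fun hy => (ih.2 (ih.1.2 hy)).symm (ih.1.2 hy) hy⟩
  | trans x y z _ _ ih ih' =>
    have ih := ih (Quot.eqvGen_sound ‹_›)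
    have ih' := ih' (Quot.eqvGen_sound ‹_›)
    exact ⟨ih.1.trans ih'.1, fun hx => (ih.2 hx).trans hx (ih.1.1 hx) (ih'.1.1 (ih.1.1 hx))
      (ih'.2 (ih.1.1 hx))⟩

end VerticalEngel

end OrientedCircleBundle

/-! ### Difference classes -/

namespace OrientedCircleBundle

open OrientedContactStructure.ComplexStructure (exists_one exists_two)

variable {M : Type*} [TopologicalSpace M] [ChartedSpace (EuclideanSpace ℝ (Fin 3)) M]
  {Q : Type*} [TopologicalSpace Q] [ChartedSpace (EuclideanSpace ℝ (Fin 4)) Q]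
  [IsManifold (𝓡 3) ∞ M] [IsManifold (𝓡 4) ∞ Q]
  {B : OrientedCircleBundle Q M} {ξ : OrientedContactStructure M} {J : ξ.ComplexStructure}
  {n : ℤ} {p : ℝ}

theorem _root_.OrientedContactStructure.ComplexStructure.dir_congr {y : M}
    {v v' w w' : TangentSpace (𝓡 3) y} (hv : v ∈ ξ.plane y) (hv0 : v ≠ 0) (hv' : v' ∈ ξ.plane y)
    (hv0' : v' ≠ 0) (hw : w ∈ ξ.plane y) (hw0 : w ≠ 0) (hw' : w' ∈ ξ.plane y) (hw0' : w' ≠ 0)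
    (h : Submodule.span ℝ {v} = Submodule.span ℝ {v'})
    (h' : Submodule.span ℝ {w} = Submodule.span ℝ {w'}) : J.dir v w 1 = J.dir v' w' 1 := by
  have h1 := J.dir_add exists_one hv hv0 hv' hv0' hw' hw0'
  rw [← J.dir_congr_span hv hv0 hv hv0 hv' hv0' h, J.dir_self exists_one hv hv0, zero_add] at h1
  rw [h1, J.dir_congr_span hv hv0 hw hw0 hw' hw0' h']

namespace VerticalEngel

variable [T2Space M] [CompactSpace M] {𝒟 𝒟' : B.VerticalEngel}
  {w w' : (q : Q) → TangentSpace (𝓡 3) (B.proj q)}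

/-- Between development maps of the same twisting number, the angle lifts locally over the base. -/
theorem exists_local_lifts (hp : ∃ j : ℤ, (2 : ℝ) = j * p) (hp' : ∃ m : ℤ, p = m)
    (hw : B.IsDirectionField J p w) (hw' : B.IsDirectionField J p w')
    (hw𝒟 : ∀ q, B.image 𝒟.D q = Submodule.span ℝ {w q})
    (hw𝒟' : ∀ q, B.image 𝒟'.D q = Submodule.span ℝ {w' q})
    (hn : 𝒟.HasTwisting ξ n) (hn' : 𝒟'.HasTwisting ξ n) :
    ∃ (U : M → Set M) (f : M → Q → ℝ), IsPointedCover U ∧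
      (∀ x, ContinuousOn (f x) (B.proj ⁻¹' U x)) ∧
      ∀ x, ∀ q ∈ B.proj ⁻¹' U x, (f x q : AddCircle p) = J.dir (w q) (w' q) p := by
  have key : ∀ x, ∃ (N : Set M) (f : Q → ℝ), IsOpen N ∧ x ∈ N ∧ ContinuousOn f (B.proj ⁻¹' N) ∧
      ∀ q ∈ B.proj ⁻¹' N, (f q : AddCircle p) = J.dir (w q) (w' q) p := by
    intro x
    obtain ⟨U₁, hU₁, hx₁, E, hE⟩ := B.locallyTrivial x
    obtain ⟨U₂, a, hx₂, ha⟩ := ξ.exists_isSectionOver x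
    have hUo := hU₁.inter ha.isOpen
    obtain ⟨N, hN, hxN, hNU, hNl⟩ := exists_hasLifts_subset (hUo.mem_nhds ⟨hx₁, hx₂⟩)
    have hE' := hE.mono (hNU.trans inter_subset_left)
    have ha' := ha.mono hN (hNU.trans inter_subset_right)
    obtain ⟨θ, hθ, hθw⟩ := hw.exists_angle hE' ha' hNl subset_rfl
    obtain ⟨θ', hθ', hθw'⟩ := hw'.exists_angle hE' ha' hNl subset_rfl
    have hper : ∀ y ∈ N, ∀ t, ∀ k : ℤ, θ' (y, t + k) - θ (y, t + k) = θ' (y, t) - θ (y, t) := by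
      intro y hy t k
      have h1 : Function.Periodic (fun t => θ' (y, t) - θ (y, t)) 1 := fun t => by
        have e1 := hn.add_one hp hp' hw.mem hw.ne_zero hw𝒟 hN hE' ha'.mem ha'.ne_zero hy
          (continuous_slice hθ hy) (hθw y hy) t
        have e2 := hn'.add_one hp hp' hw'.mem hw'.ne_zero hw𝒟' hN hE' ha'.mem ha'.ne_zero hy
          (continuous_slice hθ' hy) (hθw' y hy) t
        simp only
        rw [e1, e2]; ring
      have h2 := h1.int_mul k t
      rwa [mul_one] at h2
    set τ : Q → ℝ := fun q => Classical.epsilon fun t => E (B.proj q) t = q with hτ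
    have hτE : ∀ q, B.proj q ∈ N → E (B.proj q) (τ q) = q := fun q hq =>
      Classical.epsilon_spec (hE'.exists_eq hq)
    set f : Q → ℝ := fun q => θ' (B.proj q, τ q) - θ (B.proj q, τ q) with hf
    have hfE : ∀ y ∈ N, ∀ t, f (E y t) = θ' (y, t) - θ (y, t) := by
      intro y hy t
      have h1 : B.proj (E y t) = y := hE'.proj_apply hy t
      have h2 := hτE (E y t) (by rw [h1]; exact hy)
      rw [hf]
      simp only
      rw [h1] at h2 ⊢
      obtain ⟨k, hk⟩ := (hE'.eq_iff y hy _ _).1 h2.symm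
      rw [hk, hper y hy]
    refine ⟨N, f, hN, hxN, hE'.continuousOn_of_comp B.continuous_proj hN ?_, fun q hq => ?_⟩
    · exact (hθ'.sub hθ).congr fun x hx => hfE x.1 hx.1 x.2
    · have h1 := hθw _ hq (τ q)
      have h2 := hθw' _ hq (τ q)
      rw [hτE q hq] at h1 h2
      rw [hf]
      simp only
      rw [AddCircle.coe_sub, ← h1, ← h2, sub_eq_iff_eq_add', J.dir_add hp (ha'.mem _ hq)
        (ha'.ne_zero _ hq) (hw.mem q) (hw.ne_zero q) (hw'.mem q) (hw'.ne_zero q)]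
  choose U f h1 h2 h3 h4 using key
  exact ⟨U, f, fun x => ⟨h1 x, h2 x⟩, h3, h4⟩

/-- `α` is the obstruction to lifting the angle from `φ_D` to `φ_D'`. -/
def IsDifferenceClass (J : ξ.ComplexStructure) (𝒟 𝒟' : B.VerticalEngel) (α : CechH M 1) : Prop :=
  IsLiftClass B.proj (fun q => J.dir (𝒟.vec q) (𝒟'.vec q) 1) α

theorem exists_isDifferenceClass (J : ξ.ComplexStructure) (h : 𝒟.Induces ξ) (h' : 𝒟'.Induces ξ)
    (hn : 𝒟.HasTwisting ξ n) (hn' : 𝒟'.HasTwisting ξ n) : ∃ α, IsDifferenceClass J 𝒟 𝒟' α := by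
  obtain ⟨U, f, hU, hf, hfd⟩ := exists_local_lifts exists_one ⟨1, by simp⟩
    (isDirectionField_vec h J) (isDirectionField_vec h' J) (fun q => (vec_spec h q).2)
    (fun q => (vec_spec h' q).2) hn hn'
  exact exists_isLiftClass B.isConnectedFibration hU hf hfd

theorem IsDifferenceClass.add {𝒟'' : B.VerticalEngel} {α β : CechH M 1} (h : 𝒟.Induces ξ)
    (h' : 𝒟'.Induces ξ) (h'' : 𝒟''.Induces ξ) (hα : IsDifferenceClass J 𝒟 𝒟' α)
    (hβ : IsDifferenceClass J 𝒟' 𝒟'' β) : IsDifferenceClass J 𝒟 𝒟'' (α + β) := by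
  have h1 := IsLiftClass.add hα hβ
  rw [IsDifferenceClass]
  have h2 : (fun q => J.dir (𝒟.vec q) (𝒟''.vec q) 1) = fun q => J.dir (𝒟.vec q) (𝒟'.vec q) 1 +
      J.dir (𝒟'.vec q) (𝒟''.vec q) 1 := funext fun q => (J.dir_add exists_one (vec_mem h q)
    (vec_ne_zero h q) (vec_mem h' q) (vec_ne_zero h' q) (vec_mem h'' q) (vec_ne_zero h'' q)).symm
  rw [h2]
  exact h1

theorem IsDifferenceClass.unique {α β : CechH M 1} (hα : IsDifferenceClass J 𝒟 𝒟' α)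
    (hβ : IsDifferenceClass J 𝒟 𝒟' β) : α = β :=
  IsLiftClass.unique B.isConnectedFibration hα hβ

/-- The difference class vanishes exactly between isotopic Engel structures. -/
theorem isDifferenceClass_zero_iff (h : 𝒟.Induces ξ) (h' : 𝒟'.Induces ξ)
    (hn : 𝒟.HasTwisting ξ n) (hn' : 𝒟'.HasTwisting ξ n) :
    IsDifferenceClass J 𝒟 𝒟' 0 ↔ 𝒟.isotopyClass = 𝒟'.isotopyClass := by
  constructor
  · intro h0
    obtain ⟨f, hf, hfd⟩ := IsLiftClass.exists_lift B.isConnectedFibration h0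
    exact Quot.sound (isotopic_of_angleLifts h h' hn hn' ⟨f, hf, hfd⟩)
  · intro hc
    obtain ⟨f, hf, hfd⟩ := (of_isotopyClass_eq J hc).2 h
    exact isLiftClass_zero hf hfd

/-- Between fields of rays the difference class is even. -/
theorem IsDifferenceClass.exists_two_smul {α : CechH M 1} (hα : IsDifferenceClass J 𝒟 𝒟' α)
    (h : 𝒟.Induces ξ) (h' : 𝒟'.Induces ξ)
    (hw : B.IsDirectionField J 2 w) (hw' : B.IsDirectionField J 2 w')
    (hw𝒟 : ∀ q, B.image 𝒟.D q = Submodule.span ℝ {w q})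
    (hw𝒟' : ∀ q, B.image 𝒟'.D q = Submodule.span ℝ {w' q})
    (hn : 𝒟.HasTwisting ξ n) (hn' : 𝒟'.HasTwisting ξ n) : ∃ β : CechH M 1, α = (2 : ℤ) • β := by
  obtain ⟨U, f, hU, hf, hfd⟩ := exists_local_lifts exists_two ⟨2, by simp⟩ hw hw' hw𝒟 hw𝒟' hn hn'
  refine IsLiftClass.exists_two_smul B.isConnectedFibration hα hU hf (fun x q hq => ?_)
    fun x x' q hq hq' => ?_
  · rw [← J.dir_one_of_dir exists_two ⟨2, by simp⟩ (hw.mem q) (hw.ne_zero q) (hw'.mem q)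
      (hw'.ne_zero q) (hfd x q hq).symm]
    exact J.dir_congr (hw.mem q) (hw.ne_zero q) (vec_mem h q) (vec_ne_zero h q) (hw'.mem q)
      (hw'.ne_zero q) (vec_mem h' q) (vec_ne_zero h' q) ((hw𝒟 q).symm.trans (vec_spec h q).2)
      ((hw𝒟' q).symm.trans (vec_spec h' q).2)
  · obtain ⟨k, hk⟩ := AddCircle.coe_eq_coe_iff_exists.1
      ((hfd x q hq).trans (hfd x' q hq').symm)
    exact ⟨k, by rw [hk]; ring⟩

end VerticalEngel

/-! ### Rotating development maps by cohomology classes -/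

theorem contMDiffAt_mul_of_eventually_zero {E : Type*} [NormedAddCommGroup E] [NormedSpace ℝ E]
    {H : Type*} [TopologicalSpace H] {I : ModelWithCorners ℝ E H} {X : Type*} [TopologicalSpace X]
    [ChartedSpace H X] {ρ g : X → ℝ} {x : X} (hρ : ContMDiffAt I 𝓘(ℝ, ℝ) ∞ ρ x)
    (h : ContMDiffAt I 𝓘(ℝ, ℝ) ∞ g x ∨ ∀ᶠ z in 𝓝 x, ρ z = 0) :
    ContMDiffAt I 𝓘(ℝ, ℝ) ∞ (fun z => ρ z * g z) x := by
  rcases h with h | h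
  · exact hρ.smul h
  · refine (contMDiffAt_const (c := (0 : ℝ))).congr_of_eventuallyEq ?_
    filter_upwards [h] with z hz
    rw [hz, zero_mul]

theorem eventually_eq_zero_of_tsupport {X : Type*} [TopologicalSpace X] {ρ : X → ℝ} {U : Set X}
    (h : tsupport ρ ⊆ U) {x : X} (hx : x ∉ U) : ∀ᶠ z in 𝓝 x, ρ z = 0 :=
  notMem_tsupport_iff_eventuallyEq.1 fun h' => hx (h h')

variable [T2Space M] [CompactSpace M]

/-- A multiple of a Čech 1-cocycle is the coboundary of a cochain of smooth functions. -/
theorem exists_smooth_cobounding (c : cechCocycles M 1) (m : ℝ) :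
    ∃ (U : M → Set M) (f : M → M → ℝ), IsPointedCover U ∧
      (∀ x, ContMDiffOn (𝓡 3) 𝓘(ℝ, ℝ) ∞ (f x) (U x)) ∧
      ∀ (i : Fin 2 → M), ∀ y, y ∈ U (i 0) → y ∈ U (i 1) →
        f (i 1) y - f (i 0) y = m * c.1 i y := by
  obtain ⟨⟨U₁, hU₁, hc₁⟩, ⟨U₂, hU₂, hc₂⟩⟩ := c.2
  have hU := hU₁.inter hU₂
  obtain ⟨s, ρ, hρ, hρ0, hρ1, hρs⟩ := exists_partition hU
  refine ⟨_, fun x y => ∑ x' ∈ s, ρ x' y * (m * c.1 ![x', x] y), hU, fun x y hy => ?_,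
    fun i y hy hy' => ?_⟩
  · refine ContMDiffAt.contMDiffWithinAt ?_
    refine contMDiffAt_finsetSum fun x' hx' => ?_
    refine contMDiffAt_mul_of_eventually_zero (hρ x' y) ?_
    by_cases hy' : y ∈ U₁ x' ∩ U₂ x'
    · left
      refine (contMDiffAt_const (c := m * (c.1 ![x', x] y : ℝ))).congr_of_eventuallyEq ?_
      filter_upwards [hc₁ ![x', x] y (mem_iInter_two.2 ⟨hy'.1, hy.1⟩)] with z hz
      rw [hz]
    · exact Or.inr (eventually_eq_zero_of_tsupport (hρs x' hx') hy')
  · simp only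
    rw [← Finset.sum_sub_distrib]
    have : ∀ x' ∈ s, ρ x' y * (m * c.1 ![x', i 1] y) - ρ x' y * (m * c.1 ![x', i 0] y) =
        ρ x' y * (m * c.1 i y) := by
      intro x' hx'
      by_cases hyx : y ∈ U₁ x' ∩ U₂ x'
      · have h1 := hc₂ ![x', i 0, i 1] y (mem_iInter_three.2 ⟨hyx.2, hy.2, hy'.2⟩)
        rw [cechD_one_apply] at h1
        have h2 : ![i 0, i 1] = i := by ext k; fin_cases k <;> rfl
        simp only [Matrix.cons_val_zero, Matrix.cons_val_one, Matrix.cons_val, h2] at h1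
        have h3 : (c.1 i y : ℝ) = c.1 ![x', i 1] y - c.1 ![x', i 0] y := by
          have : c.1 i y = c.1 ![x', i 1] y - c.1 ![x', i 0] y := by linarith
          exact_mod_cast this
        rw [h3]; ring
      · rw [(eventually_eq_zero_of_tsupport (hρs x' hx') hyx).self_of_nhds]; ring
    rw [Finset.sum_congr rfl this, ← Finset.sum_mul, hρ1, one_mul]

namespace VerticalEngel

variable {𝒟 𝒟' : B.VerticalEngel} {w w' : (q : Q) → TangentSpace (𝓡 3) (B.proj q)}

/-- Development maps, or fields of rays spanning their values, can be rotated so as to realize any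
difference class. -/
theorem exists_isDifferenceClass_eq {m : ℤ} (hp : ∃ j : ℤ, (2 : ℝ) = j * p) (hm : p = m)
    (h : 𝒟.Induces ξ) (hn : 𝒟.HasTwisting ξ n) (hw : B.IsDirectionField J p w)
    (hw𝒟 : ∀ q, B.image 𝒟.D q = Submodule.span ℝ {w q}) (β : CechH M 1) :
    ∃ (𝒟' : B.VerticalEngel) (w' : (q : Q) → TangentSpace (𝓡 3) (B.proj q)),
      𝒟'.Induces ξ ∧ 𝒟'.HasTwisting ξ n ∧ B.IsDirectionField J p w' ∧
      (∀ q, B.image 𝒟'.D q = Submodule.span ℝ {w' q}) ∧ IsDifferenceClass J 𝒟 𝒟' (m • β) := by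
  have hp' : ∃ m : ℤ, p = m := ⟨m, hm⟩
  obtain ⟨c, rfl⟩ := QuotientAddGroup.mk_surjective β
  obtain ⟨U, f, hU, hf, hfc⟩ := exists_smooth_cobounding c m
  set w' : (q : Q) → TangentSpace (𝓡 3) (B.proj q) := fun q =>
    J.rot (B.proj q) (f (B.proj q) (B.proj q)) (w q) with hw'
  have hmem : ∀ q, w' q ∈ ξ.plane (B.proj q) := fun q => J.rot_mem _ (hw.mem q)
  have hne : ∀ q, w' q ≠ 0 := fun q => J.rot_ne_zero _ (hw.mem q) (hw.ne_zero q)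
  have hdir : ∀ x, ∀ q ∈ B.proj ⁻¹' U x,
      J.dir (w q) (w' q) p = (f x (B.proj q) : AddCircle p) := by
    intro x q hq
    rw [J.dir_eq hp (hw.mem q) (hw.ne_zero q) one_pos (one_smul _ _).symm, eq_comm,
      AddCircle.coe_eq_coe_iff_exists]
    refine ⟨c.1 ![x, B.proj q] (B.proj q), ?_⟩
    have := hfc ![x, B.proj q] (B.proj q) hq (hU _).2
    simp only [Matrix.cons_val_zero, Matrix.cons_val_one] at this
    rw [hm]
    linarith
  have hdir1 : ∀ x, ∀ q ∈ B.proj ⁻¹' U x,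
      J.dir (w q) (w' q) 1 = (f x (B.proj q) : AddCircle (1 : ℝ)) := fun x q hq =>
    J.dir_one_of_dir hp hp' (hw.mem q) (hw.ne_zero q) (hmem q) (hne q) (hdir x q hq)
  have hfs : ∀ x, ContMDiffOn (𝓡 4) 𝓘(ℝ, ℝ) ∞ (fun q => f x (B.proj q)) (B.proj ⁻¹' U x) :=
    fun x => (hf x).comp B.contMDiff_proj.contMDiffOn subset_rfl
  have hdf : B.IsDirectionField J p w' := by
    refine ⟨hmem, hne, fun V a ha q hq => ?_⟩
    set x := B.proj q with hx
    have hUo : IsOpen (B.proj ⁻¹' (U x ∩ V)) := ((hU x).1.inter ha.isOpen).preimage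
      B.continuous_proj
    have hqU : q ∈ B.proj ⁻¹' (U x ∩ V) := ⟨(hU x).2, hq⟩
    have h1 : ContinuousAt (fun q => ((f x (B.proj q) : ℝ) : AddCircle p)) q :=
      (AddCircle.continuous_mk' p).continuousAt.comp ((hfs x q (hU x).2).continuousWithinAt.continuousAt
        (((hU x).1.preimage B.continuous_proj).mem_nhds (hU x).2))
    refine ((hw.continuousAt V a ha q hq).add h1).congr ?_
    filter_upwards [hUo.mem_nhds hqU] with q' hq'
    simp only [Pi.add_apply]
    rw [← hdir x q' hq'.1, J.dir_add hp (ha.mem _ hq'.2) (ha.ne_zero _ hq'.2) (hw.mem q')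
      (hw.ne_zero q') (hmem q') (hne q')]
  have htw : B.IsTwisting J (fun q => Submodule.span ℝ {w' q}) := by
    intro q₀
    obtain ⟨V, a, hV, ha⟩ := ξ.exists_isSectionOver (B.proj q₀)
    obtain ⟨O, θ, hq₀, hOV, hθ⟩ := exists_twistAngle h J ha hV
    set x := B.proj q₀ with hx
    have hO : IsOpen (O ∩ B.proj ⁻¹' U x) := hθ.isOpen.inter ((hU x).1.preimage B.continuous_proj)
    have hfq : ∀ q ∈ O ∩ B.proj ⁻¹' U x, ContMDiffAt (𝓡 3) 𝓘(ℝ, ℝ) ∞ (f x) (B.proj q) :=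
      fun q hq => (hf x _ hq.2).contMDiffAt ((hU x).1.mem_nhds hq.2)
    refine ⟨V, a, O ∩ B.proj ⁻¹' U x, fun q => θ q + f x (B.proj q), ha, ⟨hq₀, (hU x).2⟩,
      inter_subset_left.trans hOV, hO, ?_, fun q hq => ?_, fun q hq v hv => ?_⟩
    · exact (hθ.smooth.mono inter_subset_left).add ((hfs x).mono inter_subset_right)
    · have hqV := hOV hq.1
      rw [J.span_eq_iff_dir (ha.mem _ hqV) (ha.ne_zero _ hqV) (hmem q) (hne q),
        ← J.dir_add exists_one (ha.mem _ hqV) (ha.ne_zero _ hqV) (hw.mem q) (hw.ne_zero q) (hmem q)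
        (hne q), hdir1 x q hq.2, AddCircle.coe_add,
        hθ.dir_eq ha hOV hq.1 (hw.mem q) (hw.ne_zero q) (hw𝒟 q)]
    · have hd := ((hθ.smooth q hq.1).contMDiffAt (hθ.isOpen.mem_nhds hq.1)).mdifferentiableAt
        (n := ∞) (by simp)
      have hd' := (hfq q hq).mdifferentiableAt (n := ∞) (by simp)
      rw [mvfderiv_add_apply (g := fun q => f x (B.proj q)) hd
        (hd'.comp q (B.mdifferentiableAt_proj q)),
        mvfderiv_comp_proj hd' B.contMDiff_proj]
      change _ + mvfderiv (𝓡 3) (f x) (B.proj q) (B.dproj q v) ≠ 0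
      rw [B.dproj_of_mem_pos hv, map_zero, add_zero]
      exact hθ.deriv_ne q hq.1 v hv
  have hind := induces_ofTwisting htw
  have himg : ∀ q, B.image (ofTwisting htw).D q = Submodule.span ℝ {w' q} := fun q =>
    congrFun (image_ofTwisting htw) q
  have hvec : ∀ q, J.dir (𝒟.vec q) ((ofTwisting htw).vec q) 1 = J.dir (w q) (w' q) 1 := fun q =>
    J.dir_congr (vec_mem h q) (vec_ne_zero h q) (hw.mem q) (hw.ne_zero q) (vec_mem hind q)
      (vec_ne_zero hind q) (hmem q) (hne q) ((vec_spec h q).2.symm.trans (hw𝒟 q))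
      ((vec_spec hind q).2.symm.trans (himg q))
  refine ⟨_, w', hind, hn.of_lifts h hind J fun y => ⟨U y, fun q => f y (B.proj q), (hU y).1,
    (hU y).2, (hfs y).continuousOn, fun q hq => by rw [hvec, hdir1 y q hq]⟩, hdf, himg,
    m • c, rfl, U, hU, fun x q => f x (B.proj q), fun x => (hfs x).continuousOn,
    fun x q hq => ((hvec q).trans (hdir1 x q hq)).symm, fun i q h0 h1 => ?_⟩
  simp only [AddSubgroup.coe_zsmul, Pi.smul_apply, smul_eq_mul, Int.cast_mul]
  rw [hfc i _ h0 h1]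

end VerticalEngel

end OrientedCircleBundle

/-! ### Circle valued functions and the choice of the complex structure -/

section CircleClasses

variable {M Z : Type*} [TopologicalSpace M] [TopologicalSpace Z]

theorem isCircleClass_iff {f : C(M, UnitAddCircle)} {α : CechH M 1} :
    IsCircleClass f α ↔ IsLiftClass id f α := by
  refine exists_congr fun c => and_congr_right fun _ => exists_congr fun U =>
    and_congr_right fun _ => exists_congr fun h => and_congr_right fun _ => and_congr_right fun _ =>
    forall_congr' fun i => ⟨fun H y h0 h1 => H y (mem_iInter_two.2 ⟨h0, h1⟩), fun H y hy => ?_⟩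
  rw [mem_iInter_two] at hy
  exact H y hy.1 hy.2

theorem IsLiftClass.comp {F : M → UnitAddCircle} {α : CechH M 1} (h : IsLiftClass id F α)
    {π : Z → M} (hπ : Continuous π) : IsLiftClass π (fun z => F (π z)) α := by
  obtain ⟨c, hc, U, hU, f, hf, hF, hfc⟩ := h
  exact ⟨c, hc, U, hU, fun x z => f x (π z),
    fun x => (hf x).comp hπ.continuousOn fun z hz => hz, fun x z hz => hF x _ hz,
    fun i z h0 h1 => hfc i (π z) h0 h1⟩

variable [ChartedSpace (EuclideanSpace ℝ (Fin 3)) M]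

theorem isCircleClass_circleClass (f : C(M, UnitAddCircle)) : IsCircleClass f (circleClass f) := by
  refine Classical.epsilon_spec (p := IsCircleClass f) ?_
  obtain ⟨N, hN, hNl⟩ := exists_hasLifts_cover (M := M) isPointedCover_univ
  have hl := fun x => (hNl x).2 1 (fun p => f p.1) (f.continuous.comp continuous_fst).continuousOn
  choose F hF hFf using hl
  obtain ⟨α, hα⟩ := exists_isLiftClass IsConnectedFibration.id (F := f) hN
    (h := fun x y => F x (y, 0))
    (fun x => (hF x).comp (by fun_prop) fun y hy => ⟨hy, mem_univ _⟩) fun x y hy => hFf x y hy 0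
  exact ⟨α, isCircleClass_iff.2 hα⟩

end CircleClasses

namespace OrientedContactStructure.ComplexStructure

variable {M : Type*} [TopologicalSpace M] [ChartedSpace (EuclideanSpace ℝ (Fin 3)) M]
  [IsManifold (𝓡 3) ∞ M] {ξ : OrientedContactStructure M} (J J' : ξ.ComplexStructure)

/-- Two compatible complex structures rotate in the same direction. -/
theorem exists_ext_eq {y : M} {v : TangentSpace (𝓡 3) y} (hv : v ∈ ξ.plane y) (h0 : v ≠ 0) :
    ∃ x z : ℝ, 0 < z ∧ J'.ext y v = x • v + z • J.ext y v := by
  have hJ := J.isPositivePair hv h0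
  obtain ⟨x, z, hxz⟩ := hJ.exists_coeffs (J'.ext_mem hv)
  refine ⟨x, z, ?_, hxz⟩
  have h1 := J'.isPositivePair hv h0
  have h2 : v = (1 : ℝ) • v + (0 : ℝ) • J.ext y v := by simp
  rw [hxz] at h1
  nth_rewrite 1 [h2] at h1
  rw [hJ.iff_det_pos] at h1
  linarith

variable {J J'}

theorem dir_eq_shear {y : M} {v w : TangentSpace (𝓡 3) y} (hv : v ∈ ξ.plane y) (h0 : v ≠ 0)
    (hw : w ∈ ξ.plane y) (hw0 : w ≠ 0) {x z : ℝ} (hz : 0 < z)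
    (hJ : J'.ext y v = x • v + z • J.ext y v) {s : ℝ}
    (h : J'.dir v w 1 = (s : AddCircle (1 : ℝ))) :
    J.dir v w 1 = (shear x z s : AddCircle (1 : ℝ)) := by
  obtain ⟨r, k, hr, hk⟩ := (J'.dir_eq_iff exists_one hv h0 hw hw0).1 h
  obtain ⟨ρ, hρ, hρs⟩ := shear_polar x hz (s + k)
  have hrot : J'.rot y (s + k) v = ρ • J.rot y (shear x z (s + k)) v := by
    change _ = ρ • J.mul y (cisPi (shear x z (s + k))) v
    rw [← J.mul_real_mul, ← hρs, J.mul_apply, J'.rot_apply, hJ]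
    simp only
    module
  rw [_root_.mul_one, hrot, smul_smul] at hk
  rw [J.dir_eq exists_one hv h0 (mul_pos hr hρ) hk, shear_add_int,
    eq_comm, AddCircle.coe_eq_coe_iff_exists]
  exact ⟨k, by rw [_root_.mul_one]⟩

theorem ext_isSectionOver {a : (y : M) → TangentSpace (𝓡 3) y} {U : Set M}
    (ha : ξ.IsSectionOver a U) : ξ.IsSectionOver (fun y => J.ext y (a y)) U where
  isOpen := ha.isOpen
  smooth := J.smooth_ext ha
  mem y hy := J.ext_mem (ha.mem y hy)
  ne_zero y hy := (J.isPositivePair (ha.mem y hy) (ha.ne_zero y hy)).linearIndependent.ne_zero 1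

end OrientedContactStructure.ComplexStructure

namespace OrientedCircleBundle.VerticalEngel

open OrientedContactStructure.ComplexStructure (exists_one exists_two ext_isSectionOver dir_eq_shear)

variable {M : Type*} [TopologicalSpace M] [ChartedSpace (EuclideanSpace ℝ (Fin 3)) M]
  {Q : Type*} [TopologicalSpace Q] [ChartedSpace (EuclideanSpace ℝ (Fin 4)) Q]
  [IsManifold (𝓡 3) ∞ M] [IsManifold (𝓡 4) ∞ Q] [T2Space M] [CompactSpace M]
  {B : OrientedCircleBundle Q M} {ξ : OrientedContactStructure M} {J J' : ξ.ComplexStructure}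
  {n : ℤ} {𝒟 𝒟' : B.VerticalEngel} {α : CechH M 1}

theorem continuousAt_ext_coeffs (h : 𝒟.Induces ξ) {x z : Q → ℝ}
    (hxz : ∀ q, J'.ext (B.proj q) (𝒟.vec q) = x q • 𝒟.vec q + z q • J.ext (B.proj q) (𝒟.vec q))
    (q₀ : Q) : ContinuousAt x q₀ ∧ ContinuousAt z q₀ := by
  obtain ⟨N, e, he⟩ := exists_isImmersed M
  obtain ⟨U, a, hU, ha⟩ := ξ.exists_isSectionOver (B.proj q₀)
  obtain ⟨O, θ, hq₀, hOU, hθ⟩ := exists_twistAngle h J ha hU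
  have hθc : ContinuousAt θ q₀ :=
    (hθ.smooth q₀ hq₀).continuousWithinAt.continuousAt (hθ.isOpen.mem_nhds hq₀)
  have hsec : ∀ {b : (y : M) → TangentSpace (𝓡 3) y}, ξ.IsSectionOver b U →
      ContinuousAt (fun q => mvfderiv (𝓡 3) e (B.proj q) (b (B.proj q))) q₀ := fun hb =>
    ContinuousAt.comp (g := fun y => mvfderiv (𝓡 3) e y _)
      (contMDiffAt_immersed he hb.isOpen hb.smooth hU).continuousAt B.continuous_proj.continuousAt
  set v : (q : Q) → TangentSpace (𝓡 3) (B.proj q) := fun q =>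
    J.rot (B.proj q) (θ q) (a (B.proj q)) with hv
  have hcos : ContinuousAt (fun q => Real.cos (Real.pi * θ q)) q₀ :=
    Real.continuous_cos.continuousAt.comp (continuousAt_const.mul hθc)
  have hsin : ContinuousAt (fun q => Real.sin (Real.pi * θ q)) q₀ :=
    Real.continuous_sin.continuousAt.comp (continuousAt_const.mul hθc)
  have hα : ContinuousAt (fun q => mvfderiv (𝓡 3) e (B.proj q) (v q)) q₀ := by
    have h1 : ∀ q, mvfderiv (𝓡 3) e (B.proj q) (v q) = _ := fun q => B.rotated_eq θ q
    exact ((hcos.smul (hsec ha)).add (hsin.smul (hsec (ext_isSectionOver (J := J) ha)))).congr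
      (Eventually.of_forall fun q => (h1 q).symm)
  have hext : ∀ K : ξ.ComplexStructure,
      ContinuousAt (fun q => mvfderiv (𝓡 3) e (B.proj q) (K.ext (B.proj q) (v q))) q₀ := by
    intro K
    have h1 : ∀ q, mvfderiv (𝓡 3) e (B.proj q) (K.ext (B.proj q) (v q)) =
        Real.cos (Real.pi * θ q) • mvfderiv (𝓡 3) e (B.proj q) (K.ext (B.proj q) (a (B.proj q))) +
        Real.sin (Real.pi * θ q) • mvfderiv (𝓡 3) e (B.proj q)
          (K.ext (B.proj q) (J.ext (B.proj q) (a (B.proj q)))) := fun q => by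
      simp only [hv]
      rw [J.rot_apply, map_add, map_smul, map_smul, map_add, map_smul, map_smul]
    exact ((hcos.smul (hsec (ext_isSectionOver (J := K) ha))).add
      (hsin.smul (hsec (ext_isSectionOver (J := K) (ext_isSectionOver (J := J) ha))))).congr
      (Eventually.of_forall fun q => (h1 q).symm)
  have hvm : ∀ q ∈ O, v q ∈ ξ.plane (B.proj q) := fun q hq => J.rot_mem _ (ha.mem _ (hOU hq))
  have hv0 : ∀ q ∈ O, v q ≠ 0 := fun q hq =>
    J.rot_ne_zero _ (ha.mem _ (hOU hq)) (ha.ne_zero _ (hOU hq))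
  have hli : ∀ q ∈ O, LinearIndependent ℝ ![mvfderiv (𝓡 3) e (B.proj q) (v q),
      mvfderiv (𝓡 3) e (B.proj q) (J.ext (B.proj q) (v q))] := fun q hq =>
    he.linearIndependent (J.isPositivePair (hvm q hq) (hv0 q hq)).linearIndependent
  have hco : ∀ q ∈ O, mvfderiv (𝓡 3) e (B.proj q) (J'.ext (B.proj q) (v q)) =
      x q • mvfderiv (𝓡 3) e (B.proj q) (v q) +
      z q • mvfderiv (𝓡 3) e (B.proj q) (J.ext (B.proj q) (v q)) := by
    intro q hq
    have h1 : v q ∈ Submodule.span ℝ {𝒟.vec q} := by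
      rw [← (vec_spec h q).2, hθ.eq_span q hq]
      exact Submodule.mem_span_singleton_self _
    obtain ⟨c, hc⟩ := Submodule.mem_span_singleton.1 h1
    have h2 : J'.ext (B.proj q) (v q) = x q • v q + z q • J.ext (B.proj q) (v q) := by
      rw [← hc, map_smul, map_smul, hxz]
      module
    rw [h2, map_add, map_smul, map_smul]
  constructor
  · have h1 : ContinuousAt (fun q => frameCoeff (mvfderiv (𝓡 3) e (B.proj q) (v q))
        (mvfderiv (𝓡 3) e (B.proj q) (J.ext (B.proj q) (v q)))
        (mvfderiv (𝓡 3) e (B.proj q) (J'.ext (B.proj q) (v q)))) q₀ :=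
      ContinuousAt.comp (f := fun q => (mvfderiv (𝓡 3) e (B.proj q) (v q),
        mvfderiv (𝓡 3) e (B.proj q) (J.ext (B.proj q) (v q)),
        mvfderiv (𝓡 3) e (B.proj q) (J'.ext (B.proj q) (v q))))
        (contDiffAt_frameCoeff (hli q₀ hq₀)).continuousAt (hα.prodMk ((hext J).prodMk (hext J')))
    refine h1.congr ?_
    filter_upwards [hθ.isOpen.mem_nhds hq₀] with q hq
    rw [hco q hq, frameCoeff_left (hli q hq)]
  · have h1 : ContinuousAt (fun q => frameCoeff
        (mvfderiv (𝓡 3) e (B.proj q) (J.ext (B.proj q) (v q)))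
        (mvfderiv (𝓡 3) e (B.proj q) (v q))
        (mvfderiv (𝓡 3) e (B.proj q) (J'.ext (B.proj q) (v q)))) q₀ :=
      ContinuousAt.comp (f := fun q => (mvfderiv (𝓡 3) e (B.proj q) (J.ext (B.proj q) (v q)),
        mvfderiv (𝓡 3) e (B.proj q) (v q),
        mvfderiv (𝓡 3) e (B.proj q) (J'.ext (B.proj q) (v q))))
        (contDiffAt_frameCoeff ((LinearIndependent.pair_symm_iff).1 (hli q₀ hq₀))).continuousAt
        ((hext J).prodMk (hα.prodMk (hext J')))
    refine h1.congr ?_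
    filter_upwards [hθ.isOpen.mem_nhds hq₀] with q hq
    rw [hco q hq, frameCoeff_right (hli q hq)]

/-- The difference class does not depend on the complex structure. -/
theorem IsDifferenceClass.of_complexStructure (h : 𝒟.Induces ξ) (h' : 𝒟'.Induces ξ)
    (hα : IsDifferenceClass J' 𝒟 𝒟' α) : IsDifferenceClass J 𝒟 𝒟' α := by
  obtain ⟨c, hc, U, hU, f, hf, hF, hfc⟩ := hα
  choose x z hz hxz using fun q => J.exists_ext_eq J' (vec_mem h q) (vec_ne_zero h q)
  refine ⟨c, hc, U, hU, fun y q => shear (x q) (z q) (f y q), fun y q hq => ?_, fun y q hq => ?_,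
    fun i q h0 h1 => ?_⟩
  · obtain ⟨hx, hz'⟩ := continuousAt_ext_coeffs h hxz q
    exact continuousWithinAt_shear hx.continuousWithinAt hz'.continuousWithinAt (hz q) (hf y q hq)
  · exact (dir_eq_shear (vec_mem h q) (vec_ne_zero h q) (vec_mem h' q) (vec_ne_zero h' q) (hz q)
      (hxz q) (hF y q hq).symm).symm
  · have h2 : f (i 1) q = f (i 0) q + (c.1 i (B.proj q) : ℤ) := by rw [hfc i q h0 h1]; ring
    simp only
    rw [h2, shear_add_int]
    ring

/-- Rotating the development map by `f : M → S¹` changes it by the class of `f`. -/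
theorem isDifferenceClass_of_isRotationOf {f : C(M, UnitAddCircle)} (h : 𝒟.Induces ξ)
    (h' : 𝒟'.Induces ξ) (hf : 𝒟.IsRotationOf J f 𝒟') :
    IsDifferenceClass J 𝒟 𝒟' (circleClass f) := by
  have h1 := (isCircleClass_iff.1 (isCircleClass_circleClass f)).comp B.continuous_proj
  have h2 : (fun q => J.dir (𝒟.vec q) (𝒟'.vec q) 1) = fun q => f (B.proj q) := by
    funext q
    obtain ⟨s, hs⟩ := QuotientAddGroup.mk_surjective (f (B.proj q))
    have h3 := hf q s hs ⟨𝒟.vec q, vec_mem h q⟩ (by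
      rw [(vec_spec h q).2]; exact Submodule.mem_span_singleton_self _)
    have h4 : ((Real.cos (Real.pi * s) • (⟨𝒟.vec q, vec_mem h q⟩ : ξ.plane (B.proj q)) +
        Real.sin (Real.pi * s) • J.J (B.proj q) ⟨𝒟.vec q, vec_mem h q⟩ : ξ.plane (B.proj q)) :
        TangentSpace (𝓡 3) (B.proj q)) = J.rot (B.proj q) s (𝒟.vec q) := by
      rw [J.rot_apply]
      exact congrArg (fun u => Real.cos (Real.pi * s) • 𝒟.vec q + Real.sin (Real.pi * s) • u)
        (J.ext_coe (y := B.proj q) ⟨𝒟.vec q, vec_mem h q⟩).symm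
    rw [h4] at h3
    refine Eq.trans ?_ hs
    refine (J.span_eq_iff_dir (vec_mem h q) (vec_ne_zero h q) (vec_mem h' q)
      (vec_ne_zero h' q)).1 ?_
    rw [← (vec_spec h' q).2, eq_comm]
    refine Submodule.eq_of_le_of_finrank_eq ?_ ?_
    · rw [Submodule.span_singleton_le_iff_mem]; exact h3
    · rw [finrank_span_singleton (J.rot_ne_zero _ (vec_mem h q) (vec_ne_zero h q)),
        finrank_image h']
  rw [IsDifferenceClass, h2]
  exact h1

end OrientedCircleBundle.VerticalEngel

/-! ### The torsor of isotopy classes -/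

/-- A difference function with the formal properties of a torsor comes from an action. -/
theorem exists_addAction_of_difference {A S : Type*} [AddCommGroup A] {δ : S → S → A}
    (hadd : ∀ x y z, δ x y + δ y z = δ x z) (h0 : ∀ x y, δ x y = 0 → x = y)
    (hs : ∀ x β, ∃ y, δ x y = β) :
    ∃ _act : AddAction A S, ∀ (α : A) (x y : S), α +ᵥ x = y ↔ δ x y = α := by
  have hself : ∀ x, δ x x = 0 := fun x => by simpa using hadd x x x
  have hinj : ∀ {x y z}, δ x y = δ x z → y = z := fun {x y z} h => by
    refine h0 y z ?_
    have := hadd x y z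
    rw [h] at this
    simpa using this
  choose v hv using hs
  refine ⟨{ vadd := fun α x => v x α
            zero_vadd := fun x => hinj ((hv x 0).trans (hself x).symm)
            add_vadd := fun α β x => hinj (x := x) ?_ }, fun α x y => ⟨?_, fun h => ?_⟩⟩
  · change δ x (v x (α + β)) = δ x (v (v x β) α)
    rw [hv, ← hadd x (v x β), hv, hv, add_comm]
  · rintro rfl
    exact hv x α
  · exact hinj ((hv x α).trans h.symm)

namespace OrientedCircleBundle

variable {M : Type*} [TopologicalSpace M] [ChartedSpace (EuclideanSpace ℝ (Fin 3)) M]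
  {Q : Type*} [TopologicalSpace Q] [ChartedSpace (EuclideanSpace ℝ (Fin 4)) Q]
  [IsManifold (𝓡 3) ∞ M] [IsManifold (𝓡 4) ∞ Q] [T2Space M] [CompactSpace M]
  (B : OrientedCircleBundle Q M) (ξ : OrientedContactStructure M) (n : ℤ)

open VerticalEngel in
/-- The action of `H¹(M; ℤ)` on isotopy classes through difference classes. -/
theorem exists_addAction : ∃ _act : AddAction (CechH M 1) (B.EngSet ξ n),
    ∀ (J : ξ.ComplexStructure) (α : CechH M 1) (𝒟 𝒟' : B.VerticalEngel) (x x' : B.EngSet ξ n),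
      (x : B.Eng) = 𝒟.isotopyClass → (x' : B.Eng) = 𝒟'.isotopyClass →
      (α +ᵥ x = x' ↔ IsDifferenceClass J 𝒟 𝒟' α) := by
  obtain ⟨J₀⟩ := ξ.nonempty_complexStructure
  choose r hr hrI hrT using fun x : B.EngSet ξ n => x.2
  choose δ hδ using fun x y => exists_isDifferenceClass J₀ (hrI x) (hrI y) (hrT x) (hrT y)
  obtain ⟨act, hact⟩ := exists_addAction_of_difference (δ := δ)
    (fun x y z => ((hδ x y).add (hrI x) (hrI y) (hrI z) (hδ y z)).unique (hδ x z))
    (fun x y h0 => by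
      have h1 := hδ x y
      rw [h0, isDifferenceClass_zero_iff (hrI x) (hrI y) (hrT x) (hrT y), hr, hr] at h1
      exact Subtype.ext h1)
    (fun x β => by
      obtain ⟨𝒟', w', h1, h2, -, -, h3⟩ := exists_isDifferenceClass_eq (p := 1) (m := 1)
        OrientedContactStructure.ComplexStructure.exists_one (by simp) (hrI x) (hrT x)
        (isDirectionField_vec (hrI x) J₀) (fun q => (vec_spec (hrI x) q).2) β
      rw [one_smul] at h3
      refine ⟨⟨𝒟'.isotopyClass, 𝒟', rfl, h1, h2⟩, ?_⟩
      set y : B.EngSet ξ n := ⟨𝒟'.isotopyClass, 𝒟', rfl, h1, h2⟩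
      have h4 := (isDifferenceClass_zero_iff (J := J₀) h1 (hrI y) h2 (hrT y)).2 (hr y).symm
      have h5 := h3.add (hrI x) h1 (hrI y) h4
      rw [add_zero] at h5
      exact (hδ x y).unique h5)
  refine ⟨act, fun J α 𝒟 𝒟' x x' hx hx' => ?_⟩
  have e := of_isotopyClass_eq J₀ ((hr x).trans hx)
  have e' := of_isotopyClass_eq J₀ ((hr x').trans hx')
  have hI := e.1.1 (hrI x)
  have hI' := e'.1.1 (hrI x')
  have hT := (hrT x).of_angleLifts (hrI x) hI (e.2 (hrI x))
  have hT' := (hrT x').of_angleLifts (hrI x') hI' (e'.2 (hrI x'))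
  have h1 : IsDifferenceClass J₀ (r x) 𝒟 0 :=
    (isDifferenceClass_zero_iff (hrI x) hI (hrT x) hT).2 ((hr x).trans hx)
  have h1' : IsDifferenceClass J₀ 𝒟 (r x) 0 :=
    (isDifferenceClass_zero_iff hI (hrI x) hT (hrT x)).2 ((hr x).trans hx).symm
  have h2 : IsDifferenceClass J₀ (r x') 𝒟' 0 :=
    (isDifferenceClass_zero_iff (hrI x') hI' (hrT x') hT').2 ((hr x').trans hx')
  have h2' : IsDifferenceClass J₀ 𝒟' (r x') 0 :=
    (isDifferenceClass_zero_iff hI' (hrI x') hT' (hrT x')).2 ((hr x').trans hx').symm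
  rw [hact]
  constructor
  · rintro rfl
    have h3 := h1'.add hI (hrI x) hI' ((hδ x x').add (hrI x) (hrI x') hI' h2)
    rw [zero_add, add_zero] at h3
    exact h3.of_complexStructure hI hI'
  · intro h3
    have h4 := h1.add (hrI x) hI (hrI x')
      ((h3.of_complexStructure (J := J₀) hI hI').add hI hI' (hrI x') h2')
    rw [zero_add, add_zero] at h4
    exact (hδ x x').unique h4

end OrientedCircleBundle

/-! ### Existence of Euler classes -/

section LiftingCocycles

variable {M : Type*} [TopologicalSpace M]

theorem isConnectedFibration_fst : IsConnectedFibration (Prod.fst : M × ℝ → M) where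
  continuous := continuous_fst
  isOpenMap := isOpenMap_fst
  surjective y := ⟨(y, 0), rfl⟩
  fiber y := by
    have : Prod.fst ⁻¹' {y} = range (fun t : ℝ => (y, t)) := by
      ext ⟨x, t⟩
      simp [eq_comm]
    rw [this]
    exact isPreconnected_range (by fun_prop)

/-- Changes of parametrization that are compatible up to integer translations have a lifting
cocycle. -/
theorem exists_isLiftingCocycle {P : M → Type*} {R : ∀ y, P y → P y → Prop} {U : M → Set M}
    (hU : IsPointedCover U) {E : M → (y : M) → ℝ → P y} {G : M → M → M × ℝ → ℝ}
    (hG : ∀ x x', ContinuousOn (G x x') ((U x ∩ U x') ×ˢ univ))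
    (hR : ∀ x x', ∀ y ∈ U x ∩ U x', ∀ t, R y (E x y t) (E x' y (G x x' (y, t))))
    (hadd : ∀ x x', ∀ y ∈ U x ∩ U x', ∀ (t : ℝ) (k : ℤ), G x x' (y, t + k) = G x x' (y, t) + k)
    (hdev : ∀ x₀ x₁ x₂, ∀ y ∈ U x₀ ∩ U x₁ ∩ U x₂, ∀ t, ∃ k : ℤ,
      G x₁ x₂ (y, G x₀ x₁ (y, t)) = G x₀ x₂ (y, t) + k) :
    ∃ c : cechCocycles M 2, IsLiftingCocycle R U E c.1 := by
  have := fun x₀ x₁ x₂ => isConnectedFibration_fst.exists_descend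
    (((hU x₀).1.inter (hU x₁).1).inter (hU x₂).1) (p := 1)
    (f := fun z : M × ℝ => G x₁ x₂ (z.1, G x₀ x₁ z) - G x₀ x₂ z) one_pos (by
      refine ContinuousOn.sub ((hG x₁ x₂).comp (continuousOn_fst.prodMk ((hG x₀ x₁).mono ?_)) ?_)
        ((hG x₀ x₂).mono ?_)
      · exact fun z hz => ⟨hz.1, mem_univ _⟩
      · exact fun z hz => ⟨⟨hz.1.2, hz.2⟩, mem_univ _⟩
      · exact fun z hz => ⟨⟨hz.1.1, hz.2⟩, mem_univ _⟩) fun z hz => by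
      obtain ⟨k, hk⟩ := hdev x₀ x₁ x₂ z.1 hz z.2
      exact ⟨k, by rw [hk]; ring⟩
  choose c hc hcl using this
  have hc' : ∀ x₀ x₁ x₂, ∀ y ∈ U x₀ ∩ U x₁ ∩ U x₂, ∀ t,
      G x₁ x₂ (y, G x₀ x₁ (y, t)) = G x₀ x₂ (y, t) + c x₀ x₁ x₂ y := by
    intro x₀ x₁ x₂ y hy t
    have := hc x₀ x₁ x₂ (y, t) hy
    simp only [mul_one] at this
    linarith
  obtain ⟨d, hd⟩ := exists_cocycle_two hU c hcl fun x₀ x₁ x₂ x₃ y hy => by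
    obtain ⟨⟨⟨h0, h1⟩, h2⟩, h3⟩ := hy
    have e1 := hc' x₁ x₂ x₃ y ⟨⟨h1, h2⟩, h3⟩ (G x₀ x₁ (y, 0))
    have e2 := hc' x₀ x₁ x₃ y ⟨⟨h0, h1⟩, h3⟩ 0
    have e3 := hc' x₀ x₂ x₃ y ⟨⟨h0, h2⟩, h3⟩ 0
    rw [hc' x₀ x₁ x₂ y ⟨⟨h0, h1⟩, h2⟩ 0, hadd x₂ x₃ y ⟨h2, h3⟩] at e1
    have : (c x₁ x₂ x₃ y : ℝ) + c x₀ x₁ x₃ y = c x₀ x₂ x₃ y + c x₀ x₁ x₂ y := by linarith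
    exact_mod_cast this
  refine ⟨d, fun x x' y t => G x x' (y, t), hG, hR, fun i y hy t => ?_⟩
  rw [mem_iInter_three] at hy
  rw [hd]
  exact hc' _ _ _ y ⟨⟨hy.1, hy.2.1⟩, hy.2.2⟩ t

end LiftingCocycles

namespace OrientedContactStructure.ComplexStructure

variable {M : Type*} [TopologicalSpace M] [ChartedSpace (EuclideanSpace ℝ (Fin 3)) M]
  [IsManifold (𝓡 3) ∞ M] [T2Space M] [CompactSpace M]

theorem continuousAt_dir_of_sections {ξ : OrientedContactStructure M} (J : ξ.ComplexStructure)
    {p : ℝ} (hp : ∃ j : ℤ, (2 : ℝ) = j * p) {a b : (y : M) → TangentSpace (𝓡 3) y} {U V : Set M}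
    (ha : ξ.IsSectionOver a U) (hb : ξ.IsSectionOver b V) {y : M} (hy : y ∈ U) (hy' : y ∈ V) :
    ContinuousAt (fun y => J.dir (a y) (b y) p) y := by
  obtain ⟨m, e, he⟩ := exists_isImmersed M
  exact (J.continuousWithinAt_dir he hp ha (S := V) (g := id) (w := fun y => b y) hy'
    continuousWithinAt_id hy ((OrientedCircleBundle.contMDiffAt_immersed he hb.isOpen hb.smooth
    hy').continuousAt.continuousWithinAt) hb.mem (hb.ne_zero y hy')).continuousAt
    (hb.isOpen.mem_nhds hy')

end OrientedContactStructure.ComplexStructure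

section Existence

variable {M : Type*} [TopologicalSpace M] [ChartedSpace (EuclideanSpace ℝ (Fin 3)) M]
  [IsManifold (𝓡 3) ∞ M] [T2Space M] [CompactSpace M]
  {Q : Type*} [TopologicalSpace Q] [ChartedSpace (EuclideanSpace ℝ (Fin 4)) Q]
  [IsManifold (𝓡 4) ∞ Q]

theorem OrientedCircleBundle.isEulerClass_eulerClass (B : OrientedCircleBundle Q M) :
    B.IsEulerClass B.eulerClass := by
  refine Classical.epsilon_spec (p := B.IsEulerClass) ?_
  obtain ⟨U, N, V, hU, h⟩ := exists_good_cover (M := M)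
    (fun V => ∃ E, IsTrivialization B.proj B.pos V E) fun x => by
      obtain ⟨V, h1, h2, h3⟩ := B.locallyTrivial x
      exact ⟨V, h1, h2, h3⟩
  choose hUN hN hNl hV hE hNV using h
  choose E hE using hE
  have hself : ∀ x, N x ⊆ V x := fun x => hNV x x ⟨x, (hU x).2, (hU x).2⟩
  have hG : ∀ x x', ∃ G : M × ℝ → ℝ, (U x ∩ U x').Nonempty →
      ContinuousOn G (N x ×ˢ univ) ∧ ∀ y ∈ N x, ∀ t, E x y t = E x' y (G (y, t)) := by
    intro x x'
    by_cases hne : (U x ∩ U x').Nonempty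
    · obtain ⟨G, hG⟩ := OrientedCircleBundle.exists_transition (hE x) (hE x') (hV x') (hNl x)
        (hself x) (hNV x x' hne)
      exact ⟨G, fun _ => hG⟩
    · exact ⟨fun _ => 0, fun h => absurd h hne⟩
  choose G hG using hG
  have hGc : ∀ x x', ContinuousOn (G x x') ((U x ∩ U x') ×ˢ univ) := by
    rintro x x' ⟨y, t⟩ ⟨hy, -⟩
    exact ((hG x x' ⟨y, hy⟩).1 _ ⟨hUN x hy.1, mem_univ _⟩).mono
      (prod_mono (inter_subset_left.trans (hUN x)) subset_rfl)
  have hGE : ∀ x x', ∀ y ∈ U x ∩ U x', ∀ t, E x y t = E x' y (G x x' (y, t)) :=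
    fun x x' y hy t => (hG x x' ⟨y, hy⟩).2 y (hUN x hy.1) t
  have hUV : ∀ x, U x ⊆ V x := fun x => (hUN x).trans (hself x)
  obtain ⟨c, hc⟩ := exists_isLiftingCocycle (P := fun _ : M => Q) (R := fun _ q q' => q = q')
    hU hGc hGE
    (fun x x' y hy t k => (hE x).transition_add_int (hE x') (hV x') (hUV x hy.1) (hUV x' hy.2)
      (OrientedCircleBundle.continuous_slice (hGc x x') hy) (hGE x x' y hy) t k)
    fun x₀ x₁ x₂ y hy t => by
      obtain ⟨⟨h0, h1⟩, h2⟩ := hy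
      have e : E x₂ y (G x₀ x₂ (y, t)) = E x₂ y (G x₁ x₂ (y, G x₀ x₁ (y, t))) := by
        rw [← hGE x₁ x₂ y ⟨h1, h2⟩, ← hGE x₀ x₁ y ⟨h0, h1⟩, ← hGE x₀ x₂ y ⟨h0, h2⟩]
      exact ((hE x₂).eq_iff y (hUV x₂ h2) _ _).1 e
  exact ⟨_, c, rfl, U, hU, E, fun x => (hE x).mono (hUV x), hc⟩

open OrientedContactStructure.ComplexStructure in
theorem OrientedContactStructure.isEulerClass_eulerClass (ξ : OrientedContactStructure M) :
    ξ.IsEulerClass ξ.eulerClass := by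
  refine Classical.epsilon_spec (p := ξ.IsEulerClass) ?_
  obtain ⟨J⟩ := ξ.nonempty_complexStructure
  obtain ⟨U, N, V, hU, h⟩ := exists_good_cover (M := M)
    (fun V => ∃ a, ξ.IsSectionOver a V) fun x => by
      obtain ⟨V, a, h1, h2⟩ := ξ.exists_isSectionOver x
      exact ⟨V, h2.isOpen, h1, a, h2⟩
  choose hUN hN hNl hV ha hNV using h
  choose a ha using ha
  have hself : ∀ x, N x ⊆ V x := fun x => hNV x x ⟨x, (hU x).2, (hU x).2⟩
  have hUV : ∀ x, U x ⊆ V x := fun x => (hUN x).trans (hself x)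
  have hα : ∀ x x', ∃ α : M → ℝ, (U x ∩ U x').Nonempty →
      ContinuousOn α (N x) ∧ ∀ y ∈ N x, J.dir (a x' y) (a x y) 2 = (2 * α y : ℝ) := by
    intro x x'
    by_cases hne : (U x ∩ U x').Nonempty
    · obtain ⟨F, hF, hFd⟩ := hNl x 2 (fun p => J.dir (a x' p.1) (a x p.1) 2) (by
        rintro ⟨y, t⟩ ⟨hy, -⟩
        exact ((J.continuousAt_dir_of_sections exists_two (ha x') (ha x) (hNV x x' hne hy)
          (hself x hy)).comp (f := Prod.fst) continuousAt_fst).continuousWithinAt)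
      refine ⟨fun y => F (y, 0) / 2, fun _ => ⟨(hF.comp (by fun_prop)
        fun y hy => ⟨hy, mem_univ _⟩).div_const 2, fun y hy => ?_⟩⟩
      rw [mul_div_cancel₀ _ two_ne_zero, hFd y hy 0]
    · exact ⟨fun _ => 0, fun h => absurd h hne⟩
  choose α hα using hα
  have hαc : ∀ x x', ContinuousOn (α x x') (U x ∩ U x') := fun x x' y hy =>
    ((hα x x' ⟨y, hy⟩).1 _ (hUN x hy.1)).mono (inter_subset_left.trans (hUN x))
  have hαd : ∀ x x', ∀ y ∈ U x ∩ U x', J.dir (a x' y) (a x y) 2 = (2 * α x x' y : ℝ) :=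
    fun x x' y hy => (hα x x' ⟨y, hy⟩).2 y (hUN x hy.1)
  have hm : ∀ x, ∀ y ∈ U x, a x y ∈ ξ.plane y := fun x y hy => (ha x).mem y (hUV x hy)
  have h0 : ∀ x, ∀ y ∈ U x, a x y ≠ 0 := fun x y hy => (ha x).ne_zero y (hUV x hy)
  have hrot : ∀ x y t, Real.cos (2 * Real.pi * t) • a x y + Real.sin (2 * Real.pi * t) •
      J.ext y (a x y) = J.rot y (2 * t) (a x y) := fun x y t => by
    rw [J.rot_apply, show Real.pi * (2 * t) = 2 * Real.pi * t by ring]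
  obtain ⟨c, hc⟩ := exists_isLiftingCocycle (P := fun y : M => TangentSpace (𝓡 3) y)
    (R := fun _ v w => SameRay ℝ v w) hU (E := fun x y t => Real.cos (2 * Real.pi * t) • a x y +
      Real.sin (2 * Real.pi * t) • J.ext y (a x y)) (G := fun x x' z => z.2 + α x x' z.1)
    (fun x x' => continuousOn_snd.add ((hαc x x').comp continuousOn_fst fun z hz => hz.1))
    (fun x x' y hy t => by
      rw [hrot, hrot]
      have hrm := J.rot_mem (2 * t) (hm x y hy.1)
      have hr0 := J.rot_ne_zero (2 * t) (hm x y hy.1) (h0 x y hy.1)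
      rw [J.sameRay_iff_dir (hm x' y hy.2) (h0 x' y hy.2) hrm hr0,
        ← J.dir_add exists_two (hm x' y hy.2) (h0 x' y hy.2) (hm x y hy.1) (h0 x y hy.1) hrm hr0,
        hαd x x' y hy, J.dir_eq exists_two (hm x y hy.1) (h0 x y hy.1) one_pos
        (one_smul _ _).symm, ← AddCircle.coe_add]
      congr 1
      ring)
    (fun x x' y hy t k => by simp only; ring)
    (fun x₀ x₁ x₂ y hy t => by
      obtain ⟨⟨hy0, hy1⟩, hy2⟩ := hy
      have := J.dir_add exists_two (hm x₂ y hy2) (h0 x₂ y hy2) (hm x₁ y hy1) (h0 x₁ y hy1)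
        (hm x₀ y hy0) (h0 x₀ y hy0)
      rw [hαd x₁ x₂ y ⟨hy1, hy2⟩, hαd x₀ x₁ y ⟨hy0, hy1⟩, hαd x₀ x₂ y ⟨hy0, hy2⟩,
        ← AddCircle.coe_add, eq_comm, AddCircle.coe_eq_coe_iff_exists] at this
      obtain ⟨k, hk⟩ := this
      exact ⟨k, by simp only; linarith⟩)
  refine ⟨_, c, rfl, U, hU, a, fun x y => J.ext y (a x y), fun x => ⟨(ha x).smooth.mono (hUV x),
    (J.smooth_ext (ha x)).mono (hUV x), fun y hy => ?_⟩, hc⟩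
  exact J.isPositivePair (hm x y hy) (h0 x y hy)

end Existence

/-! ### Cocycles computing the Euler classes -/

namespace OrientedContactStructure

open ComplexStructure (exists_two)

variable {M : Type*} [TopologicalSpace M] [ChartedSpace (EuclideanSpace ℝ (Fin 3)) M]
  [IsManifold (𝓡 3) ∞ M] [T2Space M] [CompactSpace M]

theorem ComplexStructure.continuousOn_coeffs {ξ : OrientedContactStructure M}
    (J : ξ.ComplexStructure) {a b : (y : M) → TangentSpace (𝓡 3) y} {U : Set M}
    (ha : ξ.IsSectionOver a U) (hb : SmoothFieldOn (𝓡 3) b U) {x z : M → ℝ}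
    (h : ∀ y ∈ U, b y = x y • a y + z y • J.ext y (a y)) :
    ContinuousOn x U ∧ ContinuousOn z U := by
  obtain ⟨m, e, he⟩ := exists_isImmersed M
  have hA : ContinuousOn (fun y => mvfderiv (𝓡 3) e y (a y)) U := fun y hy =>
    (OrientedCircleBundle.contMDiffAt_immersed he ha.isOpen ha.smooth hy).continuousAt.continuousWithinAt
  have hC : ContinuousOn (fun y => mvfderiv (𝓡 3) e y (J.ext y (a y))) U := fun y hy =>
    (OrientedCircleBundle.contMDiffAt_immersed he ha.isOpen (J.smooth_ext ha)
      hy).continuousAt.continuousWithinAt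
  have hB : ContinuousOn (fun y => mvfderiv (𝓡 3) e y (b y)) U := fun y hy =>
    (OrientedCircleBundle.contMDiffAt_immersed he ha.isOpen hb hy).continuousAt.continuousWithinAt
  have hli : ∀ y ∈ U, LinearIndependent ℝ ![mvfderiv (𝓡 3) e y (a y),
      mvfderiv (𝓡 3) e y (J.ext y (a y))] := fun y hy =>
    he.linearIndependent (J.frame_linearIndependent ha hy)
  have hco : ∀ y ∈ U, mvfderiv (𝓡 3) e y (b y) = x y • mvfderiv (𝓡 3) e y (a y) +
      z y • mvfderiv (𝓡 3) e y (J.ext y (a y)) := fun y hy => by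
    rw [h y hy, map_add, map_smul, map_smul]
  constructor
  · have h1 : ContinuousOn (fun y => frameCoeff (mvfderiv (𝓡 3) e y (a y))
        (mvfderiv (𝓡 3) e y (J.ext y (a y))) (mvfderiv (𝓡 3) e y (b y))) U := fun y hy =>
      ContinuousAt.comp_continuousWithinAt (f := fun y => (mvfderiv (𝓡 3) e y (a y),
        mvfderiv (𝓡 3) e y (J.ext y (a y)), mvfderiv (𝓡 3) e y (b y)))
        (contDiffAt_frameCoeff (hli y hy)).continuousAt (hA.prodMk (hC.prodMk hB) y hy)
    exact h1.congr fun y hy => by simp only; rw [hco y hy, frameCoeff_left (hli y hy)]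
  · have h1 : ContinuousOn (fun y => frameCoeff (mvfderiv (𝓡 3) e y (J.ext y (a y)))
        (mvfderiv (𝓡 3) e y (a y)) (mvfderiv (𝓡 3) e y (b y))) U := fun y hy =>
      ContinuousAt.comp_continuousWithinAt (f := fun y => (mvfderiv (𝓡 3) e y (J.ext y (a y)),
        mvfderiv (𝓡 3) e y (a y), mvfderiv (𝓡 3) e y (b y)))
        (contDiffAt_frameCoeff ((LinearIndependent.pair_symm_iff).1 (hli y hy))).continuousAt
        (hC.prodMk (hA.prodMk hB) y hy)
    exact h1.congr fun y hy => by simp only; rw [hco y hy, frameCoeff_right (hli y hy)]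

/-- The Euler class of a contact structure in terms of the angles between local sections. -/
theorem exists_angle_cocycle (ξ : OrientedContactStructure M) (J : ξ.ComplexStructure) :
    ∃ (d : cechCocycles M 2) (U : M → Set M) (a : M → (y : M) → TangentSpace (𝓡 3) y)
      (α : M → M → M → ℝ), (QuotientAddGroup.mk d : CechH M 2) = ξ.eulerClass ∧
      IsPointedCover U ∧ (∀ x, ξ.IsSectionOver (a x) (U x)) ∧
      (∀ x x', ContinuousOn (α x x') (U x ∩ U x')) ∧
      (∀ x x', ∀ y ∈ U x ∩ U x', SameRay ℝ (a x y) (J.rot y (2 * α x x' y) (a x' y))) ∧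
      ∀ (i : Fin 3 → M) (y : M), y ∈ U (i 0) → y ∈ U (i 1) → y ∈ U (i 2) →
        α (i 0) (i 1) y + α (i 1) (i 2) y = α (i 0) (i 2) y + d.1 i y := by
  obtain ⟨d, hd, U, hU, a, b, hab, G, hG, hGR, hGd⟩ := ξ.isEulerClass_eulerClass
  have ha : ∀ x, ξ.IsSectionOver (a x) (U x) := fun x => ⟨(hU x).1, (hab x).1,
    fun y hy => ((hab x).2.2 y hy).mem_left,
    fun y hy => ((hab x).2.2 y hy).linearIndependent.ne_zero 0⟩
  have hex : ∀ x, ∀ y, ∃ u v : ℝ, y ∈ U x →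
      0 < v ∧ b x y = u • a x y + v • J.ext y (a x y) := by
    intro x y
    by_cases hy : y ∈ U x
    · have hJ := J.isPositivePair ((ha x).mem y hy) ((ha x).ne_zero y hy)
      have h1 := (hab x).2.2 y hy
      obtain ⟨u, v, huv⟩ := hJ.exists_coeffs h1.mem_right
      refine ⟨u, v, fun _ => ⟨?_, huv⟩⟩
      have h2 : a x y = (1 : ℝ) • a x y + (0 : ℝ) • J.ext y (a x y) := by simp
      rw [huv] at h1
      nth_rewrite 1 [h2] at h1
      rw [hJ.iff_det_pos] at h1
      linarith
    · exact ⟨0, 0, fun h => absurd h hy⟩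
  choose u v huv using hex
  have hcont := fun x => J.continuousOn_coeffs (ha x) (hab x).2.1 fun y hy => (huv x y hy).2
  -- the angle of the `t`-th ray in the frame `(a x, b x)`, as a multiple of a full turn
  set K : M → M → ℝ → ℝ := fun x y t => shear (u x y) (v x y) (2 * t) / 2 with hK
  have hKadd : ∀ x y t (k : ℤ), K x y (t + k) = K x y t + k := by
    intro x y t k
    have h1 := shear_add_int (u x y) (v x y) (2 * t) (2 * k)
    simp only [hK]
    rw [show 2 * (t + (k : ℝ)) = 2 * t + ((2 * k : ℤ) : ℝ) by push_cast; ring, h1]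
    push_cast; ring
  have hK0 : ∀ x y, K x y 0 = 0 := fun x y => by simp [hK]
  have hKc : ∀ x, ContinuousOn (fun z : M × ℝ => K x z.1 z.2) (U x ×ˢ univ) := by
    intro x z hz
    refine ContinuousWithinAt.div_const (continuousWithinAt_shear
      (((hcont x).1 z.1 hz.1).comp continuousWithinAt_fst fun z hz => hz.1)
      (((hcont x).2 z.1 hz.1).comp continuousWithinAt_fst fun z hz => hz.1)
      (huv x z.1 hz.1).1 (by fun_prop)) 2
  have hKr : ∀ x, ∀ y ∈ U x, ∀ t, ∃ ρ : ℝ, 0 < ρ ∧ Real.cos (2 * Real.pi * t) • a x y +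
      Real.sin (2 * Real.pi * t) • b x y = ρ • J.rot y (2 * K x y t) (a x y) := by
    intro x y hy t
    obtain ⟨ρ, hρ, h⟩ := shear_polar (u x y) (huv x y hy).1 (2 * t)
    refine ⟨ρ, hρ, ?_⟩
    change _ = ρ • J.mul y (cisPi (2 * K x y t)) (a x y)
    simp only [hK]
    rw [mul_div_cancel₀ _ two_ne_zero, ← J.mul_real_mul, ← h, J.mul_apply, (huv x y hy).2,
      show Real.pi * (2 * t) = 2 * Real.pi * t by ring]
    module
  have hdir : ∀ x x', ∀ y ∈ U x ∩ U x', ∀ t, SameRay ℝ (J.rot y (2 * K x y t) (a x y))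
      (J.rot y (2 * K x' y (G x x' y t)) (a x' y)) := by
    intro x x' y hy t
    obtain ⟨ρ, hρ, h⟩ := hKr x y hy.1 t
    obtain ⟨ρ', hρ', h'⟩ := hKr x' y hy.2 (G x x' y t)
    have h1 := hGR x x' y hy t
    simp only at h1
    rw [h, h'] at h1
    have h2 := (h1.pos_smul_left (inv_pos.2 hρ)).pos_smul_right (inv_pos.2 hρ')
    rwa [smul_smul, smul_smul, inv_mul_cancel₀ hρ.ne', inv_mul_cancel₀ hρ'.ne', one_smul,
      one_smul] at h2
  set α : M → M → M → ℝ := fun x x' y => K x' y (G x x' y 0) with hα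
  have hαr : ∀ x x', ∀ y ∈ U x ∩ U x', SameRay ℝ (a x y) (J.rot y (2 * α x x' y) (a x' y)) := by
    intro x x' y hy
    have := hdir x x' y hy 0
    rwa [hK0, mul_zero, J.rot_zero] at this
  have hGs : ∀ x x', ∀ y ∈ U x ∩ U x', Continuous fun t => G x x' y t := fun x x' y hy =>
    (hG x x').comp_continuous (f := fun t => (y, t)) (by fun_prop) fun t => ⟨hy, mem_univ _⟩
  have hKs : ∀ x, ∀ y ∈ U x, Continuous fun t => K x y t := fun x y hy =>
    (hKc x).comp_continuous (f := fun t => (y, t)) (by fun_prop) fun t => ⟨hy, mem_univ _⟩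
  have hKG : ∀ x x', ∀ y ∈ U x ∩ U x', ∀ t, K x' y (G x x' y t) = K x y t + α x x' y := by
    intro x x' y hy t
    have hint : ∀ t ∈ (univ : Set ℝ), ∃ k : ℤ,
        K x' y (G x x' y t) - K x y t - α x x' y = k * (1 : ℝ) := by
      intro t _
      have m' := (ha x').mem y hy.2
      have n' := (ha x').ne_zero y hy.2
      have m := (ha x).mem y hy.1
      have n := (ha x).ne_zero y hy.1
      have h1 := (J.sameRay_iff_dir m' n' (J.rot_mem _ m) (J.rot_ne_zero _ m n)).1
        (hdir x x' y hy t)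
      rw [← J.dir_add exists_two m' n' m n (J.rot_mem _ m) (J.rot_ne_zero _ m n),
        (J.sameRay_iff_dir m' n' m n).1 (hαr x x' y hy), J.dir_eq exists_two m n one_pos
        (one_smul _ _).symm, ← AddCircle.coe_add, AddCircle.coe_eq_coe_iff_exists] at h1
      obtain ⟨k, hk⟩ := h1
      exact ⟨k, by linarith⟩
    have := eq_of_continuousOn_int
      (f := fun t => K x' y (G x x' y t) - K x y t - K x' y (G x x' y 0)) isPreconnected_univ one_pos
      (((((hKs x' y hy.2).comp (hGs x x' y hy)).sub (hKs x y hy.1)).sub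
        continuous_const).continuousOn) hint (mem_univ t) (mem_univ 0)
    rw [hK0] at this
    simp only [hα]
    linarith
  refine ⟨d, U, a, α, hd, hU, ha, fun x x' => ?_, hαr, fun i y h0 h1 h2 => ?_⟩
  · have h1 : ContinuousOn (fun y => (y, G x x' y 0)) (U x ∩ U x') :=
      continuousOn_id.prodMk ((hG x x').comp (f := fun y => (y, (0 : ℝ))) (by fun_prop)
        fun y hy => ⟨hy, mem_univ _⟩)
    exact (hKc x').comp h1 fun y hy => ⟨hy.2, mem_univ _⟩
  · have e := hGd i y (mem_iInter_three.2 ⟨h0, h1, h2⟩) 0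
    have e1 := congrArg (K (i 2) y) e
    rw [hKG _ _ y ⟨h1, h2⟩, hKG _ _ y ⟨h0, h1⟩, hKadd, hKG _ _ y ⟨h0, h2⟩] at e1
    linarith

end OrientedContactStructure

/-! ### Development maps and Euler classes -/

namespace OrientedCircleBundle

open OrientedContactStructure.ComplexStructure (exists_one exists_two)

variable {M : Type*} [TopologicalSpace M] [ChartedSpace (EuclideanSpace ℝ (Fin 3)) M]
  {Q : Type*} [TopologicalSpace Q] [ChartedSpace (EuclideanSpace ℝ (Fin 4)) Q]
  [IsManifold (𝓡 3) ∞ M] [IsManifold (𝓡 4) ∞ Q] [T2Space M] [CompactSpace M]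
  {B : OrientedCircleBundle Q M} {ξ : OrientedContactStructure M} {J : ξ.ComplexStructure}
  {n : ℤ} {p : ℝ}

/-- Trivializations `E` of the circle bundle with lifted transition functions `G`, and sections `a`
of the contact structure with angles `2 * α` (in units of `π`) between them, over one cover; the
failures `c` and `d` of `G` and `α` to be cocycles represent the Euler classes. -/
structure EulerData (B : OrientedCircleBundle Q M) (J : ξ.ComplexStructure) where
  /-- the cover -/
  cover : M → Set M
  pointed : IsPointedCover cover
  /-- the trivializations of the circle bundle -/
  E : M → M → ℝ → Q
  triv : ∀ x, IsTrivialization B.proj B.pos (cover x) (E x)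
  /-- the lifted transition functions -/
  G : M → M → M → ℝ → ℝ
  continuousOn_G : ∀ x x',
    ContinuousOn (fun z : M × ℝ => G x x' z.1 z.2) ((cover x ∩ cover x') ×ˢ univ)
  E_eq : ∀ x x', ∀ y ∈ cover x ∩ cover x', ∀ t, E x y t = E x' y (G x x' y t)
  /-- a cocycle for the Euler class of the circle bundle -/
  c : cechCocycles M 2
  mk_c : (QuotientAddGroup.mk c : CechH M 2) = B.eulerClass
  G_comp : ∀ (i : Fin 3 → M) (y : M), y ∈ cover (i 0) → y ∈ cover (i 1) → y ∈ cover (i 2) →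
    ∀ t, G (i 1) (i 2) y (G (i 0) (i 1) y t) = G (i 0) (i 2) y t + c.1 i y
  /-- the sections of the contact structure -/
  a : M → (y : M) → TangentSpace (𝓡 3) y
  isSection : ∀ x, ξ.IsSectionOver (a x) (cover x)
  /-- the angles between the sections, in full turns -/
  α : M → M → M → ℝ
  continuousOn_α : ∀ x x', ContinuousOn (α x x') (cover x ∩ cover x')
  sameRay : ∀ x x', ∀ y ∈ cover x ∩ cover x',
    SameRay ℝ (a x y) (J.rot y (2 * α x x' y) (a x' y))
  /-- a cocycle for the Euler class of the contact structure -/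
  d : cechCocycles M 2
  mk_d : (QuotientAddGroup.mk d : CechH M 2) = ξ.eulerClass
  α_comp : ∀ (i : Fin 3 → M) (y : M), y ∈ cover (i 0) → y ∈ cover (i 1) → y ∈ cover (i 2) →
    α (i 0) (i 1) y + α (i 1) (i 2) y = α (i 0) (i 2) y + d.1 i y

theorem nonempty_eulerData (B : OrientedCircleBundle Q M) (J : ξ.ComplexStructure) :
    Nonempty (EulerData B J) := by
  obtain ⟨c, hc, U, hU, E, hE, G, hG, hGE, hGc⟩ := B.isEulerClass_eulerClass
  obtain ⟨d, U', a, α, hd, hU', ha, hα, hαr, hαd⟩ := ξ.exists_angle_cocycle J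
  exact ⟨{ cover := fun x => U x ∩ U' x
           pointed := hU.inter hU'
           E := E
           triv := fun x => (hE x).mono inter_subset_left
           G := G
           continuousOn_G := fun x x' => (hG x x').mono
             (prod_mono (inter_subset_inter inter_subset_left inter_subset_left) subset_rfl)
           E_eq := fun x x' y hy t => hGE x x' y ⟨hy.1.1, hy.2.1⟩ t
           c := c
           mk_c := hc
           G_comp := fun i y h0 h1 h2 t => hGc i y (mem_iInter_three.2 ⟨h0.1, h1.1, h2.1⟩) t
           a := a
           isSection := fun x => (ha x).mono ((hU x).1.inter (hU' x).1) inter_subset_right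
           α := α
           continuousOn_α := fun x x' => (hα x x').mono
             (inter_subset_inter inter_subset_right inter_subset_right)
           sameRay := fun x x' y hy => hαr x x' y ⟨hy.1.2, hy.2.2⟩
           d := d
           mk_d := hd
           α_comp := fun i y h0 h1 h2 => hαd i y h0.2 h1.2 h2.2 }⟩

namespace EulerData

variable (D : EulerData B J)

theorem dir_a (hp : ∃ j : ℤ, (2 : ℝ) = j * p) {x x' y : M} (hy : y ∈ D.cover x)
    (hy' : y ∈ D.cover x') : J.dir (D.a x' y) (D.a x y) p = (2 * D.α x x' y : ℝ) := by
  have hm := (D.isSection x').mem y hy'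
  have h0 := (D.isSection x').ne_zero y hy'
  obtain ⟨r, hr, h⟩ := (D.sameRay x x' y ⟨hy, hy'⟩).symm.exists_pos_left
    (J.rot_ne_zero _ hm h0) ((D.isSection x).ne_zero y hy)
  exact J.dir_eq hp hm h0 hr h.symm

theorem continuous_G {x x' y : M} (hy : y ∈ D.cover x) (hy' : y ∈ D.cover x') :
    Continuous (D.G x x' y) :=
  continuous_slice (θ := fun z : M × ℝ => D.G x x' z.1 z.2) (D.continuousOn_G x x') ⟨hy, hy'⟩

theorem G_add_int {x x' y : M} (hy : y ∈ D.cover x) (hy' : y ∈ D.cover x') (t : ℝ) (k : ℤ) :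
    D.G x x' y (t + k) = D.G x x' y t + k :=
  (D.triv x).transition_add_int (D.triv x') (D.pointed x').1 hy hy' (D.continuous_G hy hy')
    (D.E_eq x x' y ⟨hy, hy'⟩) t k

/-- `b` is a 1-cochain whose coboundary multiplied by `p` is the difference of `n` times the cocycle
of the circle bundle and two times the cocycle of the contact structure. -/
def IsCobounding (n : ℤ) (p : ℤ) : Prop :=
  ∃ V : M → Set M, IsPointedCover V ∧ ∃ b : M → M → M → ℤ,
    (∀ x x', ∀ y ∈ V x ∩ V x', ∀ᶠ z in 𝓝 y, b x x' z = b x x' y) ∧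
    ∀ i : Fin 3 → M, ∀ y ∈ ⋂ k, V (i k), n * D.c.1 i y - 2 * D.d.1 i y =
      p * (b (i 0) (i 1) y + b (i 1) (i 2) y - b (i 0) (i 2) y)

theorem isCobounding_one_iff :
    D.IsCobounding n 1 ↔ n • B.eulerClass = (2 : ℤ) • ξ.eulerClass := by
  rw [← D.mk_c, ← D.mk_d, smul_mk_eq_smul_mk_iff]
  simp only [IsCobounding, one_mul]

theorem isCobounding_two_iff {m : ℤ} :
    D.IsCobounding (2 * m) 2 ↔ m • B.eulerClass = ξ.eulerClass := by
  rw [← D.mk_c, ← D.mk_d, ← one_smul ℤ (QuotientAddGroup.mk D.d : CechH M 2),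
    smul_mk_eq_smul_mk_iff]
  refine exists_congr fun V => and_congr_right fun _ => exists_congr fun b =>
    and_congr_right fun _ => forall_congr' fun i => forall₂_congr fun y _ => ?_
  constructor <;> intro h <;> linarith

section Necessity

variable {𝒟 : B.VerticalEngel} {w : (q : Q) → TangentSpace (𝓡 3) (B.proj q)}

/-- The angles of a development map in the trivializations of the bundles provide a bounding
cochain. -/
theorem isCobounding_of_isDirectionField {p : ℤ} (hp0 : 0 < p) (hp : ∃ j : ℤ, (2 : ℝ) = j * (p : ℝ))
    (hw : B.IsDirectionField J p w) (hw𝒟 : ∀ q, B.image 𝒟.D q = Submodule.span ℝ {w q})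
    (hn : 𝒟.HasTwisting ξ n) : D.IsCobounding n p := by
  have hp0' : (0 : ℝ) < p := by exact_mod_cast hp0
  obtain ⟨N, hN, hNl⟩ := exists_hasLifts_cover D.pointed
  have hNc : ∀ x, N x ⊆ D.cover x := fun x => (hNl x).1
  have hΘ := fun x => hw.exists_angle (D.triv x) (D.isSection x) (hNl x).2 (hNc x)
  choose Θ hΘc hΘw using hΘ
  have hadd : ∀ x, ∀ y ∈ N x, ∀ t (k : ℤ), Θ x (y, t + k) = Θ x (y, t) + n * k := by
    intro x y hy t k
    have h1 : Function.Periodic (fun t => Θ x (y, t) - n * t) 1 := fun t => by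
      have := hn.add_one hp ⟨p, rfl⟩ hw.mem hw.ne_zero hw𝒟 (D.pointed x).1 (D.triv x)
        (D.isSection x).mem (D.isSection x).ne_zero (hNc x hy) (continuous_slice (hΘc x) hy)
        (hΘw x y hy) t
      simp only
      rw [this]; ring
    have h2 := h1.int_mul k t
    simp only [mul_one] at h2
    linarith
  have := fun x x' => isConnectedFibration_fst.exists_descend ((hN x).1.inter (hN x').1)
    (f := fun z : M × ℝ => Θ x' (z.1, D.G x x' z.1 z.2) - Θ x z - 2 * D.α x x' z.1) hp0' (by
      refine (ContinuousOn.sub ((hΘc x').comp (continuousOn_fst.prodMk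
        ((D.continuousOn_G x x').mono ?_)) ?_) ((hΘc x).mono ?_)).sub
        (continuousOn_const.mul ((D.continuousOn_α x x').comp continuousOn_fst ?_))
      · exact fun z hz => ⟨⟨hNc x hz.1, hNc x' hz.2⟩, mem_univ _⟩
      · exact fun z hz => ⟨hz.2, mem_univ _⟩
      · exact fun z hz => ⟨hz.1, mem_univ _⟩
      · exact fun z hz => ⟨hNc x hz.1, hNc x' hz.2⟩) (by
      rintro ⟨y, t⟩ ⟨hy, hy'⟩
      have e := D.E_eq x x' y ⟨hNc x hy, hNc x' hy'⟩ t
      have h1 := hΘw x y hy t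
      have h2 := hΘw x' y hy' (D.G x x' y t)
      rw [← e] at h2
      have hq : B.proj (D.E x y t) = y := (D.triv x).proj_apply (hNc x hy) t
      have hqx : B.proj (D.E x y t) ∈ D.cover x := by rw [hq]; exact hNc x hy
      have hqx' : B.proj (D.E x y t) ∈ D.cover x' := by rw [hq]; exact hNc x' hy'
      have h3 := J.dir_add hp ((D.isSection x').mem _ hqx') ((D.isSection x').ne_zero _ hqx')
        ((D.isSection x).mem _ hqx) ((D.isSection x).ne_zero _ hqx) (hw.mem (D.E x y t))
        (hw.ne_zero _)
      have hα : D.α x x' (B.proj (D.E x y t)) = D.α x x' y := by rw [hq]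
      rw [h1, h2, D.dir_a hp hqx hqx', hα, ← AddCircle.coe_add,
        AddCircle.coe_eq_coe_iff_exists] at h3
      obtain ⟨k, hk⟩ := h3
      exact ⟨k, by simp only; linarith⟩)
  choose b hb hbl using this
  have hb' : ∀ x x' y t, y ∈ N x → y ∈ N x' →
      Θ x' (y, D.G x x' y t) = Θ x (y, t) + 2 * D.α x x' y + b x x' y * p := by
    intro x x' y t h h'
    have := hb x x' (y, t) ⟨h, h'⟩
    simp only at this
    linarith
  refine ⟨N, hN, b, hbl, fun i y hy => ?_⟩
  obtain ⟨h0, h1, h2⟩ := mem_iInter_three.1 hy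
  have e1 := hb' (i 1) (i 2) y (D.G (i 0) (i 1) y 0) h1 h2
  rw [hb' (i 0) (i 1) y 0 h0 h1, D.G_comp i y (hNc _ h0) (hNc _ h1) (hNc _ h2),
    hadd (i 2) y h2, hb' (i 0) (i 2) y 0 h0 h2] at e1
  have e2 := D.α_comp i y (hNc _ h0) (hNc _ h1) (hNc _ h2)
  have : (n * D.c.1 i y - 2 * D.d.1 i y : ℝ) =
      p * (b (i 0) (i 1) y + b (i 1) (i 2) y - b (i 0) (i 2) y) := by linarith
  exact_mod_cast this

end Necessity

end EulerData

/-- The twisting number of a field of rays is even. -/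
theorem exists_eq_mul_of_isDirectionField [Nonempty M] {𝒟 : B.VerticalEngel}
    {w : (q : Q) → TangentSpace (𝓡 3) (B.proj q)}
    {p : ℤ} (hp : ∃ j : ℤ, (2 : ℝ) = j * (p : ℝ)) (hw : B.IsDirectionField J p w)
    (hw𝒟 : ∀ q, B.image 𝒟.D q = Submodule.span ℝ {w q}) (hn : 𝒟.HasTwisting ξ n) :
    ∃ m : ℤ, n = p * m := by
  obtain ⟨y⟩ : Nonempty M := inferInstance
  obtain ⟨U₁, hU₁, hy₁, E, hE⟩ := B.locallyTrivial y
  obtain ⟨U₂, a, hy₂, ha⟩ := ξ.exists_isSectionOver y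
  obtain ⟨N, hN, hyN, hNU, hNl⟩ := exists_hasLifts_subset
    ((hU₁.inter ha.isOpen).mem_nhds ⟨hy₁, hy₂⟩)
  have hE' := hE.mono (hNU.trans inter_subset_left)
  have ha' := ha.mono hN (hNU.trans inter_subset_right)
  obtain ⟨θ, hθ, hθw⟩ := hw.exists_angle hE' ha' hNl subset_rfl
  have h1 := hn.add_one hp ⟨p, rfl⟩ hw.mem hw.ne_zero hw𝒟 hN hE' ha'.mem ha'.ne_zero hyN
    (continuous_slice hθ hyN) (hθw y hyN) 0
  have h2 := hθw y hyN (0 + 1)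
  have h3 := hE'.periodic hyN 0 1
  rw [Int.cast_one] at h3
  rw [h3, hθw y hyN 0, h1, AddCircle.coe_eq_coe_iff_exists] at h2
  obtain ⟨k, hk⟩ := h2
  refine ⟨k, ?_⟩
  have : (n : ℝ) = p * k := by linarith
  exact_mod_cast this

end OrientedCircleBundle

/-! ### Gluing angles along the fibres -/

section Coordinate

variable {M : Type*} [TopologicalSpace M] [ChartedSpace (EuclideanSpace ℝ (Fin 3)) M]
  {Q : Type*} [TopologicalSpace Q] [ChartedSpace (EuclideanSpace ℝ (Fin 4)) Q]

/-- Continuous fibre coordinates of a trivialization that agree at a point agree near it. -/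
theorem IsTrivialization.eventually_eq_coordinate {π : Q → M}
    {pos : (q : Q) → Set (TangentSpace (𝓡 4) q)} {U : Set M} {E : M → ℝ → Q}
    (h : IsTrivialization π pos U E) {O : Set Q} {τ : Q → ℝ} (hO : IsOpen O) (hOU : O ⊆ π ⁻¹' U)
    (hτ : ContinuousOn τ O) (hτE : ∀ q ∈ O, E (π q) (τ q) = q) {Z : Type*} [TopologicalSpace Z]
    {f : Z → Q} {g : Z → ℝ} {z₀ : Z} (hf : ContinuousAt f z₀) (hg : ContinuousAt g z₀)
    (hz₀ : f z₀ ∈ O) (hfg : ∀ᶠ z in 𝓝 z₀, E (π (f z)) (g z) = f z) (h0 : g z₀ = τ (f z₀)) :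
    ∀ᶠ z in 𝓝 z₀, g z = τ (f z) := by
  have hτ' : ContinuousAt τ (f z₀) := hτ.continuousAt (hO.mem_nhds hz₀)
  set S : Set Z := {z | f z ∈ O ∧ E (π (f z)) (g z) = f z} with hS
  have hSn : S ∈ 𝓝 z₀ := by
    filter_upwards [hf (hO.mem_nhds hz₀), hfg] with z h1 h2 using ⟨h1, h2⟩
  have := eventually_eq_of_continuousWithinAt_int (f := fun z => g z - τ (f z)) (S := S)
    one_pos (hg.sub (hτ'.comp hf)).continuousWithinAt (mem_of_mem_nhds hSn) (by
      rintro z ⟨hz, hz'⟩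
      obtain ⟨k, hk⟩ := (h.eq_iff _ (hOU hz) (τ (f z)) (g z)).1 ((hτE _ hz).trans hz'.symm)
      exact ⟨k, by linarith⟩)
  rw [nhdsWithin_eq_nhds.2 hSn] at this
  filter_upwards [this] with z hz
  simp only [h0, sub_self] at hz
  linarith

end Coordinate

namespace OrientedCircleBundle

open OrientedContactStructure.ComplexStructure (exists_one exists_two)

variable {M : Type*} [TopologicalSpace M] [ChartedSpace (EuclideanSpace ℝ (Fin 3)) M]
  {Q : Type*} [TopologicalSpace Q] [ChartedSpace (EuclideanSpace ℝ (Fin 4)) Q]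
  [IsManifold (𝓡 3) ∞ M] [IsManifold (𝓡 4) ∞ Q] [T2Space M] [CompactSpace M]
  {B : OrientedCircleBundle Q M} {ξ : OrientedContactStructure M} {J : ξ.ComplexStructure}
  {n p : ℤ}

namespace EulerData

variable (D : EulerData B J)

theorem contMDiffAt_G {x x' : M} {O : Set Q} {τ : Q → ℝ} (hO : IsOpen O)
    (hOU : O ⊆ B.proj ⁻¹' D.cover x) (hτ : ContMDiffOn (𝓡 4) 𝓘(ℝ, ℝ) ∞ τ O)
    (hτE : ∀ q ∈ O, D.E x (B.proj q) (τ q) = q) {q₀ : Q} (hq₀ : q₀ ∈ O)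
    (hq₀' : B.proj q₀ ∈ D.cover x') :
    ContMDiffAt (𝓡 4) 𝓘(ℝ, ℝ) ∞ (fun q => D.G x x' (B.proj q) (τ q)) q₀ := by
  have hy := hOU hq₀
  have hE : ∀ q ∈ O, B.proj q ∈ D.cover x' →
      D.E x' (B.proj q) (D.G x x' (B.proj q) (τ q)) = q := fun q hq hq' => by
    rw [← D.E_eq x x' _ ⟨hOU hq, hq'⟩, hτE q hq]
  obtain ⟨O', τ', hO', hqO', hO'U, hτ', hτ'0, hτ'E, -⟩ :=
    (D.triv x').exists_coordinate (D.pointed x').1 hq₀' (D.G x x' (B.proj q₀) (τ q₀))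
  rw [hE q₀ hq₀ hq₀'] at hqO' hτ'0
  have hev : ∀ᶠ q in 𝓝 q₀, D.G x x' (B.proj q) (τ q) = τ' q := by
    refine (D.triv x').eventually_eq_coordinate hO' hO'U hτ'.continuousOn hτ'E continuousAt_id ?_
      hqO' ?_ hτ'0.symm
    · have h1 : ContinuousAt (fun z : M × ℝ => D.G x x' z.1 z.2) (B.proj q₀, τ q₀) :=
        (D.continuousOn_G x x').continuousAt
          ((((D.pointed x).1.inter (D.pointed x').1).prod isOpen_univ).mem_nhds
            ⟨⟨hy, hq₀'⟩, mem_univ _⟩)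
      exact ContinuousAt.comp (f := fun q => (B.proj q, τ q)) h1
        (B.continuous_proj.continuousAt.prodMk (hτ.continuousOn.continuousAt (hO.mem_nhds hq₀)))
    · filter_upwards [hO.mem_nhds hq₀,
        ((D.pointed x').1.preimage B.continuous_proj).mem_nhds hq₀'] with q h1 h2
      exact hE q h1 h2
  exact ((hτ' q₀ hqO').contMDiffAt (hO'.mem_nhds hqO')).congr_of_eventuallyEq hev

theorem exists_hasDerivAt_G {x x' y : M} (hy : y ∈ D.cover x) (hy' : y ∈ D.cover x') (t : ℝ) :
    ∃ r : ℝ, 0 < r ∧ HasDerivAt (D.G x x' y) r t := by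
  obtain ⟨O', τ', hO', hqO', hO'U, hτ', hτ'0, hτ'E, hτ'd⟩ :=
    (D.triv x').exists_coordinate (D.pointed x').1 hy' (D.G x x' y t)
  rw [← D.E_eq x x' y ⟨hy, hy'⟩] at hqO' hτ'0
  refine ⟨_, hτ'd _ hqO' _ ((D.triv x).velocity_mem hy t), ?_⟩
  refine ((D.triv x).hasDerivAt_comp hy (((hτ' _ hqO').contMDiffAt
    (hO'.mem_nhds hqO')).mdifferentiableAt (by simp))).congr_of_eventuallyEq ?_
  refine (D.triv x').eventually_eq_coordinate hO' hO'U hτ'.continuousOn hτ'E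
    ((D.triv x).contMDiff_fiber hy).continuous.continuousAt
    (D.continuous_G hy hy').continuousAt hqO' (Eventually.of_forall fun s => ?_) hτ'0.symm
  rw [(D.triv x).proj_apply hy, ← D.E_eq x x' y ⟨hy, hy'⟩]

/-- A bounding cochain `b` as in `IsCobounding`, with a partition of unity subordinate to its
cover. -/
structure Gluing (n p : ℤ) where
  /-- the cover of the bounding cochain -/
  V : M → Set M
  pointed : IsPointedCover V
  /-- the bounding cochain -/
  b : M → M → M → ℤ
  eventually_eq : ∀ x x', ∀ y ∈ V x ∩ V x', ∀ᶠ z in 𝓝 y, b x x' z = b x x' y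
  cobounding : ∀ i : Fin 3 → M, ∀ y ∈ ⋂ k, V (i k), n * D.c.1 i y - 2 * D.d.1 i y =
    p * (b (i 0) (i 1) y + b (i 1) (i 2) y - b (i 0) (i 2) y)
  /-- the indices of the partition of unity -/
  s : Finset M
  /-- the partition of unity -/
  ρ : M → M → ℝ
  contMDiff_ρ : ∀ x, ContMDiff (𝓡 3) 𝓘(ℝ, ℝ) ∞ (ρ x)
  nonneg : ∀ x y, 0 ≤ ρ x y
  sum_eq_one : ∀ y, ∑ x ∈ s, ρ x y = 1
  tsupport_subset : ∀ x ∈ s, tsupport (ρ x) ⊆ D.cover x ∩ V x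

variable {D}

theorem IsCobounding.nonempty_gluing (h : D.IsCobounding n p) : Nonempty (D.Gluing n p) := by
  obtain ⟨V, hV, b, hb, hc⟩ := h
  obtain ⟨s, ρ, h1, h2, h3, h4⟩ := exists_partition (D.pointed.inter hV)
  exact ⟨⟨V, hV, b, hb, hc, s, ρ, h1, h2, h3, h4⟩⟩

namespace Gluing

variable (P : D.Gluing n p) {x x' y : M}

/-- Convex combination of the angles that grow at constant speed `n` in one of the trivializations,
all expressed in the coordinates indexed by `x₀`; the summand of index `x` is corrected by a multiple
of `p`, which does not affect the direction, in order that the summands transform alike. -/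
def angle (x₀ y : M) (t : ℝ) : ℝ :=
  ∑ x ∈ P.s, P.ρ x y * (n * D.G x₀ x y t - 2 * D.α x₀ x y - p * P.b x₀ x y)

/-- The cover on which the angles are defined. -/
def W (x : M) : Set M := D.cover x ∩ P.V x

theorem isPointedCover_W : IsPointedCover P.W := D.pointed.inter P.pointed

theorem ρ_eq_zero (hx : x ∈ P.s) (hy : y ∉ P.W x) : P.ρ x y = 0 :=
  (eventually_eq_zero_of_tsupport (P.tsupport_subset x hx) hy).self_of_nhds

/-- In other coordinates the glued angle changes by the angle between the two sections, up to a
multiple of `p`: the bounding cochain compensates for the failure of `G` and `α` to be cocycles. -/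
theorem angle_change {x₀ x₁ : M} (h0 : y ∈ P.W x₀) (h1 : y ∈ P.W x₁) (t : ℝ) :
    P.angle x₁ y (D.G x₀ x₁ y t) = P.angle x₀ y t + 2 * D.α x₀ x₁ y + p * P.b x₀ x₁ y := by
  have key : ∀ x ∈ P.s,
      P.ρ x y * (n * D.G x₁ x y (D.G x₀ x₁ y t) - 2 * D.α x₁ x y - p * P.b x₁ x y) =
      P.ρ x y * (n * D.G x₀ x y t - 2 * D.α x₀ x y - p * P.b x₀ x y) +
        P.ρ x y * (2 * D.α x₀ x₁ y + p * P.b x₀ x₁ y) := by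
    intro x hx
    by_cases hy : y ∈ P.W x
    · have e1 := D.G_comp ![x₀, x₁, x] y h0.1 h1.1 hy.1 t
      have e2 := D.α_comp ![x₀, x₁, x] y h0.1 h1.1 hy.1
      have e3 := P.cobounding ![x₀, x₁, x] y (mem_iInter_three.2 ⟨h0.2, h1.2, hy.2⟩)
      simp only [Matrix.cons_val_zero, Matrix.cons_val_one, Matrix.cons_val] at e1 e2 e3
      have e4 : (n * D.c.1 ![x₀, x₁, x] y - 2 * D.d.1 ![x₀, x₁, x] y : ℝ) =
        p * (P.b x₀ x₁ y + P.b x₁ x y - P.b x₀ x y) := by exact_mod_cast e3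
      rw [e1, ← mul_add]
      congr 1
      linear_combination -2 * e2 + e4
    · rw [P.ρ_eq_zero hx hy]; ring
  rw [angle, angle, Finset.sum_congr rfl key, Finset.sum_add_distrib, ← Finset.sum_mul,
    P.sum_eq_one]
  ring

theorem angle_add_int {x₀ : M} (h0 : y ∈ P.W x₀) (t : ℝ) (k : ℤ) :
    P.angle x₀ y (t + k) = P.angle x₀ y t + n * k := by
  have key : ∀ x ∈ P.s,
      P.ρ x y * (n * D.G x₀ x y (t + k) - 2 * D.α x₀ x y - p * P.b x₀ x y) =
      P.ρ x y * (n * D.G x₀ x y t - 2 * D.α x₀ x y - p * P.b x₀ x y) + P.ρ x y * (n * k) := by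
    intro x hx
    by_cases hy : y ∈ P.W x
    · rw [D.G_add_int h0.1 hy.1]; ring
    · rw [P.ρ_eq_zero hx hy]; ring
  rw [angle, angle, Finset.sum_congr rfl key, Finset.sum_add_distrib, ← Finset.sum_mul,
    P.sum_eq_one, one_mul]

/-- The glued angle is strictly monotone along the fibres, because convex combinations of positive
speeds are positive. -/
theorem exists_hasDerivAt_angle {x₀ : M} (h0 : y ∈ P.W x₀) (t : ℝ) :
    ∃ r : ℝ, 0 < r ∧ HasDerivAt (P.angle x₀ y) (n * r) t := by
  have : ∀ x, ∃ r : ℝ, 0 < r ∧ (y ∈ P.W x → HasDerivAt (D.G x₀ x y) r t) := by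
    intro x
    by_cases hy : y ∈ P.W x
    · obtain ⟨r, hr, h⟩ := D.exists_hasDerivAt_G h0.1 hy.1 t
      exact ⟨r, hr, fun _ => h⟩
    · exact ⟨1, one_pos, fun h => absurd h hy⟩
  choose r hr hd using this
  refine ⟨∑ x ∈ P.s, P.ρ x y * r x, ?_, ?_⟩
  · have h1 : ∃ x ∈ P.s, 0 < P.ρ x y := by
      by_contra! h
      have := P.sum_eq_one y
      linarith [Finset.sum_nonpos h]
    obtain ⟨x, hx, hxy⟩ := h1
    exact Finset.sum_pos' (fun x _ => mul_nonneg (P.nonneg x y) (hr x).le)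
      ⟨x, hx, mul_pos hxy (hr x)⟩
  · rw [Finset.mul_sum]
    refine HasDerivAt.fun_sum fun x hx => ?_
    by_cases hy : y ∈ P.W x
    · have := ((((hd x hy).const_mul (n : ℝ)).sub_const (2 * D.α x₀ x y)).sub_const
        (p * P.b x₀ x y : ℝ)).const_mul (P.ρ x y)
      exact this.congr_deriv (by ring)
    · simp only [P.ρ_eq_zero hx hy, zero_mul, mul_zero]
      exact hasDerivAt_const t (0 : ℝ)

theorem contMDiffAt_angle {O : Set Q} {τ : Q → ℝ} (hO : IsOpen O)
    (hOU : O ⊆ B.proj ⁻¹' P.W x) (hτ : ContMDiffOn (𝓡 4) 𝓘(ℝ, ℝ) ∞ τ O)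
    (hτE : ∀ q ∈ O, D.E x (B.proj q) (τ q) = q) {q₀ : Q} (hq₀ : q₀ ∈ O) :
    ContMDiffAt (𝓡 4) 𝓘(ℝ, ℝ) ∞ (fun q => P.angle x (B.proj q) (τ q)) q₀ := by
  have hx := hOU hq₀
  refine contMDiffAt_finsetSum fun x' hx' => ?_
  refine contMDiffAt_mul_of_eventually_zero
    ((P.contMDiff_ρ x').contMDiffAt.comp q₀ B.contMDiff_proj.contMDiffAt) ?_
  by_cases hy : B.proj q₀ ∈ P.W x'
  · left
    have hU := (D.pointed x).1.inter (D.pointed x').1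
    have hα := (J.contMDiffOn_of_sameRay ((D.isSection x).mono hU inter_subset_left)
      ((D.isSection x').mono hU inter_subset_right) subset_rfl (D.continuousOn_α x x')
      (D.sameRay x x')).contMDiffAt (hU.mem_nhds ⟨hx.1, hy.1⟩)
    have hα' : ContMDiffAt (𝓡 4) 𝓘(ℝ, ℝ) ∞ (fun q => 2 * D.α x x' (B.proj q)) q₀ :=
      contMDiffAt_const.mul (hα.comp q₀ B.contMDiff_proj.contMDiffAt)
    have hG : ContMDiffAt (𝓡 4) 𝓘(ℝ, ℝ) ∞ (fun q => n * D.G x x' (B.proj q) (τ q)) q₀ :=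
      contMDiffAt_const.mul
        (D.contMDiffAt_G hO (fun q hq => (hOU hq).1) hτ hτE hq₀ hy.1)
    have hb : ContMDiffAt (𝓡 4) 𝓘(ℝ, ℝ) ∞ (fun q => (p * P.b x x' (B.proj q) : ℝ)) q₀ := by
      refine (contMDiffAt_const (c := (p * P.b x x' (B.proj q₀) : ℝ))).congr_of_eventuallyEq ?_
      filter_upwards [B.continuous_proj.continuousAt.eventually
        (P.eventually_eq x x' _ ⟨hx.2, hy.2⟩)] with q hq
      rw [hq]
    exact (hG.sub hα').sub hb
  · exact Or.inr (B.continuous_proj.continuousAt.eventually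
      (eventually_eq_zero_of_tsupport (P.tsupport_subset x' hx') hy))

/-- The directions with the glued angles. -/
theorem exists_direction (hp : ∃ j : ℤ, (2 : ℝ) = j * (p : ℝ)) {m : ℤ} (hm : n = p * m) :
    ∃ w : (q : Q) → TangentSpace (𝓡 3) (B.proj q), (∀ q, w q ∈ ξ.plane (B.proj q)) ∧
      (∀ q, w q ≠ 0) ∧ ∀ x q t, B.proj q ∈ P.W x → D.E x (B.proj q) t = q →
        J.dir (D.a x (B.proj q)) (w q) p = (P.angle x (B.proj q) t : AddCircle (p : ℝ)) := by
  choose T hT using fun q : Q => (D.triv (B.proj q)).exists_eq (D.pointed (B.proj q)).2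
  have ha := fun y : M => (D.isSection y).mem y (D.pointed y).2
  have ha0 := fun y : M => (D.isSection y).ne_zero y (D.pointed y).2
  refine ⟨fun q => J.rot (B.proj q) (P.angle (B.proj q) (B.proj q) (T q))
    (D.a (B.proj q) (B.proj q)), fun q => J.rot_mem _ (ha _),
    fun q => J.rot_ne_zero _ (ha _) (ha0 _), fun x q t hx hq => ?_⟩
  set y := B.proj q with hy
  have hyy : y ∈ P.W y := (P.isPointedCover_W y).2
  have h1 := J.dir_add hp (ha y) (ha0 y) ((D.isSection x).mem y hx.1)
    ((D.isSection x).ne_zero y hx.1) (J.rot_mem (P.angle y y (T q)) (ha y))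
    (J.rot_ne_zero (P.angle y y (T q)) (ha y) (ha0 y))
  rw [D.dir_a hp hx.1 hyy.1, J.dir_eq hp (ha y) (ha0 y) one_pos (one_smul _ _).symm] at h1
  obtain ⟨k, hk⟩ := ((D.triv y).eq_iff y hyy.1 (T q) (D.G x y y t)).1 (by
    rw [← D.E_eq x y y ⟨hx.1, hyy.1⟩, hq]; exact hT q)
  have h2 := P.angle_change hx hyy t
  rw [hk, P.angle_add_int hyy] at h2
  have hm' : (n : ℝ) = p * m := by exact_mod_cast hm
  have h3 : P.angle y y (T q) = 2 * D.α x y y + (P.angle x y t + (P.b x y y - m * k : ℤ) * p) := by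
    push_cast
    rw [hm'] at h2
    linear_combination h2
  have h4 := add_left_cancel (h1.trans ((congrArg _ h3).trans (AddCircle.coe_add _ _ _)))
  refine h4.trans (Eq.symm ?_)
  rw [AddCircle.coe_eq_coe_iff_exists]
  exact ⟨_, rfl⟩

end Gluing

/-- A bounding cochain gives rise to a development map. -/
theorem IsCobounding.exists_verticalEngel (h : D.IsCobounding n p)
    (hp : ∃ j : ℤ, (2 : ℝ) = j * (p : ℝ)) {m : ℤ} (hm : n = p * m) (hn : n ≠ 0) :
    ∃ (𝒟 : B.VerticalEngel) (w : (q : Q) → TangentSpace (𝓡 3) (B.proj q)),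
      𝒟.Induces ξ ∧ 𝒟.HasTwisting ξ n ∧ B.IsDirectionField J p w ∧
      ∀ q, B.image 𝒟.D q = Submodule.span ℝ {w q} := by
  obtain ⟨P⟩ := h.nonempty_gluing
  obtain ⟨w, hmem, hne, hdir⟩ := P.exists_direction hp hm
  have hdir1 : ∀ x q t, B.proj q ∈ P.W x → D.E x (B.proj q) t = q →
      J.dir (D.a x (B.proj q)) (w q) 1 = (P.angle x (B.proj q) t : AddCircle (1 : ℝ)) :=
    fun x q t hx hq => J.dir_one_of_dir hp ⟨p, rfl⟩ ((D.isSection x).mem _ hx.1)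
      ((D.isSection x).ne_zero _ hx.1) (hmem q) (hne q) (hdir x q t hx hq)
  have hcoord : ∀ q₀ : Q, ∃ (O : Set Q) (τ : Q → ℝ), IsOpen O ∧ q₀ ∈ O ∧
      O ⊆ B.proj ⁻¹' P.W (B.proj q₀) ∧ ContMDiffOn (𝓡 4) 𝓘(ℝ, ℝ) ∞ τ O ∧
      (∀ q ∈ O, D.E (B.proj q₀) (B.proj q) (τ q) = q) ∧
      ∀ q ∈ O, ∀ v ∈ B.pos q, 0 < mvfderiv (𝓡 4) τ q v := by
    intro q₀
    have hW := P.isPointedCover_W (B.proj q₀)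
    have hE := (D.triv (B.proj q₀)).mono (inter_subset_left : P.W (B.proj q₀) ⊆ _)
    obtain ⟨t₀, ht₀⟩ := hE.exists_eq hW.2
    obtain ⟨O, τ, hO, hqO, hOU, hτ, -, hτE, hτd⟩ := hE.exists_coordinate hW.1 hW.2 t₀
    exact ⟨O, τ, hO, ht₀ ▸ hqO, hOU, hτ, hτE, hτd⟩
  have hdf : B.IsDirectionField J p w := by
    refine ⟨hmem, hne, fun V a ha q₀ hq₀ => ?_⟩
    obtain ⟨O, τ, hO, hqO, hOW, hτ, hτE, -⟩ := hcoord q₀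
    set x := B.proj q₀ with hx
    have h1 : ContinuousAt (fun q => J.dir (a (B.proj q)) (D.a x (B.proj q)) p) q₀ :=
      ContinuousAt.comp (g := fun y => J.dir (a y) (D.a x y) p)
        (J.continuousAt_dir_of_sections hp ha (D.isSection x) hq₀ (D.pointed x).2)
        B.continuous_proj.continuousAt
    have h2 : ContinuousAt (fun q => (P.angle x (B.proj q) (τ q) : AddCircle (p : ℝ))) q₀ :=
      (AddCircle.continuous_mk' (p : ℝ)).continuousAt.comp
        (P.contMDiffAt_angle hO hOW hτ hτE hqO).continuousAt
    refine (h1.add h2).congr ?_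
    filter_upwards [hO.mem_nhds hqO, (ha.isOpen.preimage B.continuous_proj).mem_nhds hq₀]
      with q hq hqV
    have hqx := (hOW hq).1
    simp only [Pi.add_apply]
    rw [← hdir x q (τ q) (hOW hq) (hτE q hq), J.dir_add hp (ha.mem _ hqV) (ha.ne_zero _ hqV)
      ((D.isSection x).mem _ hqx) ((D.isSection x).ne_zero _ hqx) (hmem q) (hne q)]
  have htw : B.IsTwisting J (fun q => Submodule.span ℝ {w q}) := by
    intro q₀
    obtain ⟨O, τ, hO, hqO, hOW, hτ, hτE, hτd⟩ := hcoord q₀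
    set x := B.proj q₀ with hx
    have hs : ∀ q ∈ O, ContMDiffAt (𝓡 4) 𝓘(ℝ, ℝ) ∞ (fun q => P.angle x (B.proj q) (τ q)) q :=
      fun q hq => P.contMDiffAt_angle hO hOW hτ hτE hq
    have hWx : ∀ q ∈ O, B.proj q ∈ D.cover x := fun q hq => (hOW hq).1
    refine ⟨D.cover x, D.a x, O, fun q => P.angle x (B.proj q) (τ q), D.isSection x, hqO, hWx, hO,
      fun q hq => (hs q hq).contMDiffWithinAt, fun q hq => ?_, fun q hq v hv => ?_⟩
    · rw [J.span_eq_iff_dir ((D.isSection x).mem _ (hWx q hq))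
        ((D.isSection x).ne_zero _ (hWx q hq)) (hmem q) (hne q)]
      exact hdir1 x q (τ q) (hOW hq) (hτE q hq)
    · -- compute the derivative along the fibre through `q`
      obtain ⟨y, t, hyt, rfl⟩ : ∃ y t, y = B.proj q ∧ D.E x y t = q := ⟨_, τ q, rfl, hτE q hq⟩
      have hy : y ∈ D.cover x := hyt ▸ hWx _ hq
      have hyW : y ∈ P.W x := hyt ▸ hOW hq
      obtain ⟨r, hr, rfl⟩ := (D.triv x).eq_smul_velocity hy hv
      obtain ⟨r', hr', hd⟩ := P.exists_hasDerivAt_angle hyW (τ (D.E x y t))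
      have h1 := (D.triv x).hasDerivAt_comp hy ((hs _ hq).mdifferentiableAt (by simp))
      have h2 := (D.triv x).hasDerivAt_comp hy
        (((hτ _ hq).contMDiffAt (hO.mem_nhds hq)).mdifferentiableAt (n := ∞) (by simp))
      simp only [(D.triv x).proj_apply hy] at h1
      have h3 := h1.unique (HasDerivAt.comp (h₂ := P.angle x y) t hd h2)
      have h4 := hτd _ hq _ ((D.triv x).velocity_mem hy t)
      rw [map_smul, h3]
      have hn' : (n : ℝ) ≠ 0 := by exact_mod_cast hn
      exact smul_ne_zero hr.ne' (mul_ne_zero (mul_ne_zero hn' hr'.ne') h4.ne')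
  have himg : ∀ q, B.image (VerticalEngel.ofTwisting htw).D q = Submodule.span ℝ {w q} := fun q =>
    congrFun (VerticalEngel.image_ofTwisting htw) q
  refine ⟨_, w, VerticalEngel.induces_ofTwisting htw, ?_, hdf, himg⟩
  refine VerticalEngel.hasTwisting_of_angles (J := J) hmem hne himg fun y => ?_
  have hy := P.isPointedCover_W y
  refine ⟨P.W y, D.E y, D.a y, P.angle y y, hy.1, hy.2, (D.triv y).mono inter_subset_left,
    fun z hz => (D.isSection y).mem z hz.1, fun z hz => (D.isSection y).ne_zero z hz.1,
    ?_, fun t => ?_, fun t => ?_⟩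
  · refine continuous_iff_continuousAt.2 fun t => ?_
    obtain ⟨r, -, h⟩ := P.exists_hasDerivAt_angle hy.2 t
    exact h.continuousAt
  · simpa using P.angle_add_int hy.2 t 1
  · have hq : B.proj (D.E y y t) = y := (D.triv y).proj_apply hy.2.1 t
    have := hdir1 y (D.E y y t) t (by rw [hq]; exact hy.2) (by rw [hq])
    rw [this, hq]

end EulerData

end OrientedCircleBundle

/-! ### Orientability -/

section PositivePairs

theorem IsPositivePair.or_neg {T : Type*} [AddCommGroup T] [Module ℝ T] {S : Submodule ℝ T}
    {o : Orientation ℝ S (Fin 2)} {v w t l : T} (h : IsPositivePair o v w) (ht : t ∈ S) (hl : l ∈ S)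
    (hli : LinearIndependent ℝ ![t, l]) : IsPositivePair o t l ∨ IsPositivePair o t (-l) := by
  obtain ⟨p, q, rfl⟩ := h.exists_coeffs ht
  obtain ⟨r, s, rfl⟩ := h.exists_coeffs hl
  have hne : p * s - q * r ≠ 0 := by
    intro h0
    rw [LinearIndependent.pair_iff] at hli
    have e1 := hli s (-q) (by
      have : s • (p • v + q • w) + -q • (r • v + s • w) = (p * s - q * r) • v := by module
      rw [this, h0, zero_smul])
    have e2 := hli r (-p) (by
      have : r • (p • v + q • w) + -p • (r • v + s • w) = -(p * s - q * r) • w := by module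
      rw [this, h0, neg_zero, zero_smul])
    have e3 := hli 1 0 (by rw [neg_eq_zero.1 e1.2, neg_eq_zero.1 e2.2]; simp)
    exact one_ne_zero e3.1
  have e : -(r • v + s • w) = (-r) • v + (-s) • w := by module
  rw [e, h.iff_det_pos, h.iff_det_pos]
  rcases lt_or_gt_of_ne hne with h | h
  · exact Or.inr (by linarith)
  · exact Or.inl h

/-- Smooth frames that are positive at a point are positive near it. -/
theorem IsOrientationOf.eventually_isPositivePair {Q : Type*} [TopologicalSpace Q]
    [ChartedSpace (EuclideanSpace ℝ (Fin 4)) Q] [IsManifold (𝓡 4) ∞ Q]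
    {D : TangentDistribution (𝓡 4) Q} {o : ∀ q, Orientation ℝ (D q) (Fin 2)}
    (ho : IsOrientationOf (𝓡 4) D o) {T L : (q : Q) → TangentSpace (𝓡 4) q} {O : Set Q}
    (hO : IsOpen O) (hT : IsSectionOn (𝓡 4) D T O) (hL : IsSectionOn (𝓡 4) D L O) {q₀ : Q}
    (hq₀ : q₀ ∈ O) (h : IsPositivePair (o q₀) (T q₀) (L q₀)) :
    ∀ᶠ q in 𝓝 q₀, IsPositivePair (o q) (T q) (L q) := by
  obtain ⟨U, hU, hqU, V, W, hV, hW, hVW⟩ := ho q₀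
  set φ := extChartAt (𝓡 4) q₀ with hφ
  have hφo : IsOpen φ.source := isOpen_extChartAt_source q₀
  have hqφ : q₀ ∈ φ.source := mem_extChartAt_source q₀
  set A : (q : Q) → TangentSpace (𝓡 4) q →L[ℝ] EuclideanSpace ℝ (Fin 4) := fun q =>
    mvfderiv (𝓡 4) φ q with hA
  have hcont : ∀ {X : (q : Q) → TangentSpace (𝓡 4) q} {S : Set Q}, IsOpen S → q₀ ∈ S →
      SmoothFieldOn (𝓡 4) X S →
      ContMDiffAt (𝓡 4) 𝓘(ℝ, EuclideanSpace ℝ (Fin 4)) ∞ (fun q => A q (X q)) q₀ :=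
    fun {X S} hS hq hX => (ContMDiffAt.mvfderiv_apply_field hφo
      (contMDiffOn_extChartAt (I := 𝓡 4) (x := q₀) |>.mono (by rw [hφ, extChartAt_source])) hqφ
      (hX q₀ hq)).contMDiffAt (hS.mem_nhds hq)
  have hinj : ∀ q ∈ φ.source, Function.Injective (A q) := fun q hq =>
    (isInvertible_mfderiv_extChartAt hq).injective
  have hli : ∀ q ∈ φ.source ∩ U, LinearIndependent ℝ ![A q (V q), A q (W q)] := by
    rintro q ⟨hq, hqU⟩
    have h1 := (hVW q hqU).linearIndependent
    rw [LinearIndependent.pair_iff] at h1 ⊢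
    intro s t hst
    exact h1 s t (hinj q hq (by rw [map_add, map_smul, map_smul, hst, map_zero]))
  -- the determinant of the coefficients of `(T, L)` with respect to `(V, W)`
  set δ : Q → ℝ := fun q =>
    frameCoeff (A q (V q)) (A q (W q)) (A q (T q)) * frameCoeff (A q (W q)) (A q (V q)) (A q (L q)) -
    frameCoeff (A q (W q)) (A q (V q)) (A q (T q)) * frameCoeff (A q (V q)) (A q (W q)) (A q (L q))
    with hδ
  have hδiff : ∀ q ∈ φ.source ∩ U ∩ O, IsPositivePair (o q) (T q) (L q) ↔ 0 < δ q := by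
    rintro q ⟨hq, hqO⟩
    obtain ⟨a, b, hab⟩ := (hVW q hq.2).exists_coeffs (hT.2 q hqO)
    obtain ⟨c, d, hcd⟩ := (hVW q hq.2).exists_coeffs (hL.2 q hqO)
    have hTA : A q (T q) = a • A q (V q) + b • A q (W q) := by rw [hab, map_add, map_smul, map_smul]
    have hLA : A q (L q) = c • A q (V q) + d • A q (W q) := by rw [hcd, map_add, map_smul, map_smul]
    simp only [hδ, hTA, hLA]
    rw [hab, hcd, (hVW q hq.2).iff_det_pos, frameCoeff_left (hli q hq), frameCoeff_left (hli q hq), frameCoeff_right (hli q hq),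
      frameCoeff_right (hli q hq)]
  have hδc : ContinuousAt δ q₀ := by
    have hl := hli q₀ ⟨hqφ, hqU⟩
    have hl' := LinearIndependent.pair_symm_iff.1 hl
    have cV := (hcont hU hqU hV).contMDiffWithinAt (s := univ)
    have cW := (hcont hU hqU hW).contMDiffWithinAt (s := univ)
    have cT := (hcont hO hq₀ hT.1).contMDiffWithinAt (s := univ)
    have cL := (hcont hO hq₀ hL.1).contMDiffWithinAt (s := univ)
    rw [← continuousWithinAt_univ]
    exact ((cV.frameCoeff cW cT hl).continuousWithinAt.mul
      (cW.frameCoeff cV cL hl').continuousWithinAt).sub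
      ((cW.frameCoeff cV cT hl').continuousWithinAt.mul
      (cV.frameCoeff cW cL hl).continuousWithinAt)
  filter_upwards [hδc.eventually_const_lt ((hδiff q₀ ⟨⟨hqφ, hqU⟩, hq₀⟩).1 h), hφo.mem_nhds hqφ,
    hU.mem_nhds hqU, hO.mem_nhds hq₀] with q h1 h2 h3 h4
  exact (hδiff q ⟨⟨h2, h3⟩, h4⟩).2 h1

end PositivePairs

namespace OrientedCircleBundle

open OrientedContactStructure.ComplexStructure (exists_one exists_two)

variable {M : Type*} [TopologicalSpace M] [ChartedSpace (EuclideanSpace ℝ (Fin 3)) M]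
  {Q : Type*} [TopologicalSpace Q] [ChartedSpace (EuclideanSpace ℝ (Fin 4)) Q]
  [IsManifold (𝓡 3) ∞ M] [IsManifold (𝓡 4) ∞ Q] [T2Space M] [CompactSpace M]
  {B : OrientedCircleBundle Q M} {ξ : OrientedContactStructure M} {J : ξ.ComplexStructure}
  {U : Set M} {a : (y : M) → TangentSpace (𝓡 3) y}
  {𝒟 : B.VerticalEngel} {w : (q : Q) → TangentSpace (𝓡 3) (B.proj q)}

theorem IsTwistAngle.add_int {ℓ : (q : Q) → Submodule ℝ (TangentSpace (𝓡 3) (B.proj q))} {O : Set Q}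
    {θ : Q → ℝ} (h : B.IsTwistAngle J ℓ a O θ) (k : ℤ) :
    B.IsTwistAngle J ℓ a O (fun q => θ q + k) := by
  refine ⟨h.isOpen, h.smooth.add contMDiffOn_const, fun q hq => ?_, fun q hq v hv => ?_⟩
  · rw [J.rot_add_int, Submodule.span_singleton_smul_eq, h.eq_span q hq]
    exact IsUnit.mk0 _ (zpow_ne_zero _ (by norm_num))
  · have hd := ((h.smooth q hq).contMDiffAt (h.isOpen.mem_nhds hq)).mdifferentiableAt
      (n := ∞) (by simp)
    rw [mvfderiv_real_comp (φ := fun x => x + k) hd ((hasDerivAt_id _).add_const _), mul_one]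
    exact h.deriv_ne q hq v hv

namespace VerticalEngel

theorem mem_of_mem_pos (h : 𝒟.Induces ξ) {q : Q} {T : TangentSpace (𝓡 4) q} (hT : T ∈ B.pos q) :
    T ∈ 𝒟.D q := ker_le h q (B.dproj_of_mem_pos hT)

theorem mem_iff (h : 𝒟.Induces ξ) {q : Q} {v : TangentSpace (𝓡 4) q} :
    v ∈ 𝒟.D q ↔ B.dproj q v ∈ B.image 𝒟.D q := by
  rw [eq_comap h q]
  rfl

/-- Smooth local frames of an Engel structure, consisting of a positive vertical field and a lift of
the direction given by a local angle. -/
theorem exists_frame (h : 𝒟.Induces ξ) (ha : ξ.IsSectionOver a U) {O : Set Q} {θ : Q → ℝ}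
    (hOU : O ⊆ B.proj ⁻¹' U) (hθ : B.IsTwistAngle J (B.image 𝒟.D) a O θ) {q₀ : Q} (hq₀ : q₀ ∈ O) :
    ∃ (O' : Set Q) (T L : (q : Q) → TangentSpace (𝓡 4) q), IsOpen O' ∧ q₀ ∈ O' ∧ O' ⊆ O ∧
      IsSectionOn (𝓡 4) 𝒟.D T O' ∧ IsSectionOn (𝓡 4) 𝒟.D L O' ∧ ∀ q ∈ O', T q ∈ B.pos q ∧
        B.dproj q (L q) = J.rot (B.proj q) (θ q) (a (B.proj q)) := by
  obtain ⟨n, e, he⟩ := exists_isImmersed M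
  obtain ⟨O₁, lift, hO₁, hq₁, hl1, hl2, -, hl4⟩ := exists_lift (B := B) he q₀
  have hL := fun q (hq : q ∈ O₁) => hl1 q hq (J.rot (B.proj q) (θ q) (a (B.proj q))) 0
  refine ⟨O ∩ O₁, fun q => lift q 0 1, fun q => lift q (B.rotated J e a θ q) 0,
    hθ.isOpen.inter hO₁, ⟨hq₀, hq₁⟩, inter_subset_left, ⟨fun q hq =>
      hl4 (u := fun _ => 0) (s := fun _ => 1) hq.2 contMDiffWithinAt_id contMDiffWithinAt_const
        contMDiffWithinAt_const, fun q hq => mem_of_mem_pos h (hl2 q hq.2)⟩, ⟨fun q hq =>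
      hl4 (s := fun _ => 0) hq.2 contMDiffWithinAt_id
        (contMDiffWithinAt_rotated he ha contMDiffWithinAt_id (hOU hq.1)
          ((hθ.smooth q hq.1).mono inter_subset_left)) contMDiffWithinAt_const, fun q hq => ?_⟩,
    fun q hq => ⟨hl2 q hq.2, hL q hq.2⟩⟩
  rw [mem_iff h]
  refine (hL q hq.2).symm ▸ ?_
  rw [hθ.eq_span q hq.1]
  exact Submodule.mem_span_singleton_self _

/-- Completing a positive vertical vector to a positive pair amounts to choosing the ray spanned by
the projection of the second vector. -/
theorem isPositivePair_iff_of_mem_pos {q : Q} {o : Orientation ℝ (𝒟.D q) (Fin 2)}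
    {T Y T' Y' : TangentSpace (𝓡 4) q} (hp : IsPositivePair o T Y) (hT : T ∈ B.pos q)
    (hT' : T' ∈ B.pos q) (hY' : Y' ∈ 𝒟.D q) :
    IsPositivePair o T' Y' ↔ ∃ r : ℝ, 0 < r ∧ B.dproj q Y' = r • B.dproj q Y := by
  obtain ⟨c, hc, rfl⟩ := (B.pos_iff hT).1 hT'
  obtain ⟨k, d, rfl⟩ := hp.exists_coeffs hY'
  have h1 := hp.iff_det_pos (p := c) (q := 0) (r := k) (s := d)
  rw [zero_smul, add_zero, zero_mul, sub_zero] at h1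
  have h2 : B.dproj q (k • T + d • Y) = d • B.dproj q Y := by
    rw [map_add, map_smul, map_smul, B.dproj_of_mem_pos hT, smul_zero, zero_add]
  have hY : B.dproj q Y ≠ 0 := by
    intro h0
    obtain ⟨s, hs⟩ := B.exists_smul_of_vertical hT h0
    have := LinearIndependent.pair_iff.1 hp.linearIndependent s (-1) (by rw [hs]; module)
    norm_num at this
  rw [h1, h2]
  refine ⟨fun h => ⟨d, pos_of_mul_pos_right h hc.le, rfl⟩, ?_⟩
  rintro ⟨r, hr, hd⟩
  rw [show d = r from smul_left_injective ℝ hY hd]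
  exact mul_pos hc hr

/-- An orientation of an Engel structure orients the lines of the development map, the fibres being
oriented. -/
theorem Orientable.exists_isDirectionField (ho : 𝒟.Orientable) (h : 𝒟.Induces ξ)
    (J : ξ.ComplexStructure) : ∃ w : (q : Q) → TangentSpace (𝓡 3) (B.proj q),
      B.IsDirectionField J 2 w ∧ ∀ q, B.image 𝒟.D q = Submodule.span ℝ {w q} := by
  obtain ⟨o, ho⟩ := ho
  have hex : ∀ q, ∃ T Y, T ∈ B.pos q ∧ IsPositivePair (o q) T Y := by
    intro q
    obtain ⟨T, hT⟩ := B.pos_nonempty q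
    obtain ⟨Y, hY⟩ := B.dproj_surjective q (𝒟.vec q)
    obtain ⟨U, -, hqU, V, W, -, -, hVW⟩ := ho q
    have hYD : Y ∈ 𝒟.D q := by
      rw [mem_iff h, hY, (vec_spec h q).2]
      exact Submodule.mem_span_singleton_self _
    rcases (hVW q hqU).or_neg (mem_of_mem_pos h hT) hYD
      (linearIndependent_of_mem_pos hT (hY ▸ vec_ne_zero h q)) with h1 | h1
    · exact ⟨T, Y, hT, h1⟩
    · exact ⟨T, -Y, hT, h1⟩
  choose T Y hT hTY using hex
  have hYD : ∀ q, Y q ∈ 𝒟.D q := fun q => (hTY q).mem_right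
  have hYi : ∀ q, B.dproj q (Y q) ∈ B.image 𝒟.D q := fun q => (mem_iff h).1 (hYD q)
  have hY0 : ∀ q, B.dproj q (Y q) ≠ 0 := by
    intro q h0
    obtain ⟨s, hs⟩ := B.exists_smul_of_vertical (hT q) h0
    have := LinearIndependent.pair_iff.1 (hTY q).linearIndependent s (-1) (by rw [hs]; module)
    norm_num at this
  refine ⟨fun q => B.dproj q (Y q), ⟨fun q => image_le h q (hYi q), hY0, fun U a ha q₀ hq₀ => ?_⟩,
    fun q => ?_⟩
  · -- an angle whose direction is on the positive side at the given point
    obtain ⟨O, θ, hq₀O, hOU, hθ, O', T', L, hO', hqO', hOO', hT', hL, hTL, hpos⟩ :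
        ∃ (O : Set Q) (θ : Q → ℝ), q₀ ∈ O ∧ O ⊆ B.proj ⁻¹' U ∧
          B.IsTwistAngle J (B.image 𝒟.D) a O θ ∧
          ∃ (O' : Set Q) (T L : (q : Q) → TangentSpace (𝓡 4) q), IsOpen O' ∧ q₀ ∈ O' ∧ O' ⊆ O ∧
            IsSectionOn (𝓡 4) 𝒟.D T O' ∧ IsSectionOn (𝓡 4) 𝒟.D L O' ∧ (∀ q ∈ O', T q ∈ B.pos q ∧
              B.dproj q (L q) = J.rot (B.proj q) (θ q) (a (B.proj q))) ∧
            IsPositivePair (o q₀) (T q₀) (L q₀) := by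
      obtain ⟨O, θ, hq₀O, hOU, hθ⟩ := exists_twistAngle h J ha hq₀
      obtain ⟨O', T', L, hO', hqO', hOO', hT', hL, hTL⟩ := exists_frame h ha hOU hθ hq₀O
      have hL0 : B.dproj q₀ (L q₀) ≠ 0 := by
        rw [(hTL q₀ hqO').2]
        exact J.rot_ne_zero _ (ha.mem _ hq₀) (ha.ne_zero _ hq₀)
      rcases (hTY q₀).or_neg (hT'.2 q₀ hqO') (hL.2 q₀ hqO')
        (linearIndependent_of_mem_pos (hTL q₀ hqO').1 hL0) with h1 | h1
      · exact ⟨O, θ, hq₀O, hOU, hθ, O', T', L, hO', hqO', hOO', hT', hL, hTL, h1⟩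
      · have hθ' := hθ.add_int 1
        obtain ⟨O₂, T₂, L₂, hO₂, hqO₂, hOO₂, hT₂, hL₂, hTL₂⟩ := exists_frame h ha hOU hθ' hq₀O
        refine ⟨O, _, hq₀O, hOU, hθ', O₂, T₂, L₂, hO₂, hqO₂, hOO₂, hT₂, hL₂, hTL₂, ?_⟩
        rw [isPositivePair_iff_of_mem_pos h1 (hTL q₀ hqO').1 (hTL₂ q₀ hqO₂).1 (hL₂.2 q₀ hqO₂)]
        refine ⟨1, one_pos, ?_⟩
        rw [(hTL₂ q₀ hqO₂).2, J.rot_add_int, map_neg, (hTL q₀ hqO').2]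
        simp
    have h1 : ContinuousAt (fun q => ((θ q : ℝ) : AddCircle (2 : ℝ))) q₀ :=
      (AddCircle.continuous_mk' 2).continuousAt.comp
        ((hθ.smooth q₀ hq₀O).continuousWithinAt.continuousAt (hθ.isOpen.mem_nhds hq₀O))
    refine h1.congr ?_
    filter_upwards [ho.eventually_isPositivePair hO' hT' hL hqO' hpos, hO'.mem_nhds hqO']
      with q hq hqO
    obtain ⟨r, hr, hrY⟩ := (isPositivePair_iff_of_mem_pos hq (hTL q hqO).1 (hT q) (hYD q)).1 (hTY q)
    rw [(hTL q hqO).2] at hrY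
    have hqU := hOU (hOO' hqO)
    exact (J.dir_eq exists_two (ha.mem _ hqU) (ha.ne_zero _ hqU) hr hrY).symm
  · rw [(vec_spec h q).2]
    have := hYi q
    rw [(vec_spec h q).2] at this
    obtain ⟨r, hr⟩ := Submodule.mem_span_singleton.1 this
    have hr0 : r ≠ 0 := by
      rintro rfl
      exact hY0 q (by rw [← hr, zero_smul])
    change _ = Submodule.span ℝ {B.dproj q (Y q)}
    rw [← hr, Submodule.span_singleton_smul_eq (IsUnit.mk0 _ hr0)]

/-- A field of rays, together with the orientation of the fibres, orients the Engel structure. -/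
theorem orientable_of_isDirectionField (h : 𝒟.Induces ξ) (hw : B.IsDirectionField J 2 w)
    (hw𝒟 : ∀ q, B.image 𝒟.D q = Submodule.span ℝ {w q}) : 𝒟.Orientable := by
  have hex : ∀ q, ∃ (o : Orientation ℝ (𝒟.D q) (Fin 2)) (T Y : TangentSpace (𝓡 4) q),
      T ∈ B.pos q ∧ B.dproj q Y = w q ∧ IsPositivePair o T Y := by
    intro q
    obtain ⟨T, hT⟩ := B.pos_nonempty q
    obtain ⟨Y, hY⟩ := B.dproj_surjective q (w q)
    obtain ⟨hli, hsp⟩ := liftField_eq_span (ℓ := B.image 𝒟.D) hT (hY ▸ hw.ne_zero q)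
      (by rw [hY, hw𝒟 q])
    have hTD := mem_of_mem_pos h hT
    have hYD : Y ∈ 𝒟.D q := by
      rw [mem_iff h, hY, hw𝒟]
      exact Submodule.mem_span_singleton_self _
    have hli' : LinearIndependent ℝ ![(⟨T, hTD⟩ : 𝒟.D q), ⟨Y, hYD⟩] := by
      rw [LinearIndependent.pair_iff] at hli ⊢
      exact fun s t hst => hli s t (congrArg Subtype.val hst)
    have hsp' : ⊤ ≤ Submodule.span ℝ (range ![(⟨T, hTD⟩ : 𝒟.D q), ⟨Y, hYD⟩]) := by
      rintro ⟨v, hv⟩ -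
      have hv' : v ∈ liftField (B.image 𝒟.D) q := (mem_iff h).1 hv
      rw [hsp] at hv'
      obtain ⟨s, t, rfl⟩ := Submodule.mem_span_pair.1 hv'
      rw [Matrix.range_cons_cons_empty]
      exact Submodule.mem_span_pair.2 ⟨s, t, rfl⟩
    exact ⟨(Module.Basis.mk hli' hsp').orientation, T, Y, hT, hY, Module.Basis.mk hli' hsp', rfl,
      by simp, by simp⟩
  choose o T Y hT hY hTY using hex
  refine ⟨o, fun q₀ => ?_⟩
  obtain ⟨U, a, hq₀, ha⟩ := ξ.exists_isSectionOver (B.proj q₀)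
  obtain ⟨O, θ, hq₀O, hOU, hθ⟩ := exists_twistAngle h J ha hq₀
  have hd1 : ∀ q ∈ O, ∃ k : ℤ, J.dir (a (B.proj q)) (w q) 2 = ((θ q + k : ℝ) : AddCircle (2 : ℝ)) := by
    intro q hq
    have hqU := hOU hq
    obtain ⟨r, k, hr, hrk⟩ := (J.dir_eq_iff exists_one (ha.mem _ hqU) (ha.ne_zero _ hqU)
      (hw.mem q) (hw.ne_zero q)).1 (hθ.dir_eq ha hOU hq (hw.mem q) (hw.ne_zero q) (hw𝒟 q))
    rw [mul_one] at hrk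
    exact ⟨k, J.dir_eq exists_two (ha.mem _ hqU) (ha.ne_zero _ hqU) hr hrk⟩
  -- correct the angle by a half turn of the contact plane if necessary
  obtain ⟨k₀, hk₀⟩ := hd1 q₀ hq₀O
  have hθ' := hθ.add_int k₀
  have hev : ∀ᶠ q in 𝓝 q₀, q ∈ O ∧
      J.dir (a (B.proj q)) (w q) 2 = ((θ q + k₀ : ℝ) : AddCircle (2 : ℝ)) := by
    have hc : ContinuousAt (fun q => J.dir (a (B.proj q)) (w q) 2 -
        ((θ q + k₀ : ℝ) : AddCircle (2 : ℝ))) q₀ :=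
      (hw.continuousAt U a ha q₀ hq₀).sub ((AddCircle.continuous_mk' 2).continuousAt.comp
        ((hθ'.smooth q₀ hq₀O).continuousWithinAt.continuousAt (hθ.isOpen.mem_nhds hq₀O)))
    have h01 : (0 : AddCircle (2 : ℝ)) ≠ ((1 : ℝ) : AddCircle (2 : ℝ)) := by
      rw [← AddCircle.coe_zero (p := (2 : ℝ)), Ne, AddCircle.coe_eq_coe_iff_exists]
      rintro ⟨k, hk⟩
      have : (1 : ℤ) = k * 2 := by exact_mod_cast (by linarith : (1 : ℝ) = k * 2)
      omega
    have hne : ∀ᶠ q in 𝓝 q₀, J.dir (a (B.proj q)) (w q) 2 -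
        ((θ q + k₀ : ℝ) : AddCircle (2 : ℝ)) ≠ ((1 : ℝ) : AddCircle (2 : ℝ)) :=
      hc.eventually_ne (by rw [hk₀, sub_self]; exact h01)
    filter_upwards [hne, hθ.isOpen.mem_nhds hq₀O] with q hq hqO
    refine ⟨hqO, ?_⟩
    obtain ⟨k, hk⟩ := hd1 q hqO
    rw [hk, ← AddCircle.coe_sub, Ne, eq_comm, AddCircle.coe_eq_coe_iff_exists] at hq
    rw [hk, eq_comm, AddCircle.coe_eq_coe_iff_exists]
    rcases Int.even_or_odd' (k - k₀) with ⟨j, hj | hj⟩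
    · refine ⟨j, ?_⟩
      have : (k : ℝ) - k₀ = 2 * j := by exact_mod_cast hj
      linarith
    · refine absurd ⟨j, ?_⟩ hq
      have : (k : ℝ) - k₀ = 2 * j + 1 := by exact_mod_cast hj
      linarith
  obtain ⟨N, hN, hNo, hqN⟩ := eventually_nhds_iff.1 hev
  have hNU : N ⊆ B.proj ⁻¹' U := fun q hq => hOU (hN q hq).1
  obtain ⟨O', T', L, hO', hqO', hOO', hT', hL, hTL⟩ :=
    exists_frame h ha hNU (hθ'.mono hNo fun q hq => (hN q hq).1) hqN
  refine ⟨O', hO', hqO', T', L, hT'.1, hL.1, fun q hq => ?_⟩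
  have hqU := hNU (hOO' hq)
  rw [isPositivePair_iff_of_mem_pos (hTY q) (hT q) (hTL q hq).1 (hL.2 q hq), (hTL q hq).2, hY q]
  exact ((J.sameRay_iff_dir (ha.mem _ hqU) (ha.ne_zero _ hqU) (hw.mem q) (hw.ne_zero q)).2
    (hN q (hOO' hq)).2).exists_pos_left (hw.ne_zero q)
    (J.rot_ne_zero _ (ha.mem _ hqU) (ha.ne_zero _ hqU)) |>.imp fun r hr => ⟨hr.1, hr.2.symm⟩

end VerticalEngel

end OrientedCircleBundle

/-! ### Existence of isotopy classes -/

namespace OrientedCircleBundle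

open OrientedContactStructure.ComplexStructure (exists_one exists_two)

variable {M : Type*} [TopologicalSpace M] [ChartedSpace (EuclideanSpace ℝ (Fin 3)) M]
  {Q : Type*} [TopologicalSpace Q] [ChartedSpace (EuclideanSpace ℝ (Fin 4)) Q]
  [IsManifold (𝓡 3) ∞ M] [IsManifold (𝓡 4) ∞ Q] [T2Space M] [CompactSpace M]
  {B : OrientedCircleBundle Q M} {ξ : OrientedContactStructure M} {n : ℤ}

theorem engSet_nonempty_iff (hn : n ≠ 0) :
    (B.EngSet ξ n).Nonempty ↔ n • B.eulerClass = (2 : ℤ) • ξ.eulerClass := by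
  obtain ⟨J⟩ := ξ.nonempty_complexStructure
  obtain ⟨D⟩ := nonempty_eulerData B J
  have h1 : ((1 : ℤ) : ℝ) = 1 := Int.cast_one
  have hp : ∃ j : ℤ, (2 : ℝ) = j * ((1 : ℤ) : ℝ) := h1 ▸ exists_one
  rw [← D.isCobounding_one_iff]
  constructor
  · rintro ⟨_, 𝒟, -, hI, hT⟩
    have hw : B.IsDirectionField J ((1 : ℤ) : ℝ) 𝒟.vec := by
      rw [h1]; exact VerticalEngel.isDirectionField_vec hI J
    exact D.isCobounding_of_isDirectionField one_pos hp hw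
      (fun q => (VerticalEngel.vec_spec hI q).2) hT
  · intro h
    obtain ⟨𝒟, -, hI, hT, -, -⟩ := h.exists_verticalEngel hp (one_mul n).symm hn
    exact ⟨_, 𝒟, rfl, hI, hT⟩

theorem mem_engOrSet_iff (J : ξ.ComplexStructure) {c : B.Eng} :
    c ∈ B.EngOrSet ξ n ↔ ∃ (𝒟 : B.VerticalEngel) (w : (q : Q) → TangentSpace (𝓡 3) (B.proj q)),
      𝒟.isotopyClass = c ∧ 𝒟.Induces ξ ∧ 𝒟.HasTwisting ξ n ∧ B.IsDirectionField J 2 w ∧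
      ∀ q, B.image 𝒟.D q = Submodule.span ℝ {w q} := by
  constructor
  · rintro ⟨𝒟, hc, hI, hT, ho⟩
    obtain ⟨w, hw, hw𝒟⟩ := ho.exists_isDirectionField hI J
    exact ⟨𝒟, w, hc, hI, hT, hw, hw𝒟⟩
  · rintro ⟨𝒟, w, hc, hI, hT, hw, hw𝒟⟩
    exact ⟨𝒟, hc, hI, hT, VerticalEngel.orientable_of_isDirectionField hI hw hw𝒟⟩

theorem engOrSet_nonempty_iff [Nonempty M] (hn : n ≠ 0) :
    (B.EngOrSet ξ n).Nonempty ↔ ∃ m : ℤ, n = 2 * m ∧ m • B.eulerClass = ξ.eulerClass := by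
  obtain ⟨J⟩ := ξ.nonempty_complexStructure
  obtain ⟨D⟩ := nonempty_eulerData B J
  have h2 : ((2 : ℤ) : ℝ) = 2 := by norm_num
  have hp : ∃ j : ℤ, (2 : ℝ) = j * ((2 : ℤ) : ℝ) := h2 ▸ exists_two
  simp only [Set.Nonempty, mem_engOrSet_iff J]
  constructor
  · rintro ⟨_, 𝒟, w, -, hI, hT, hw, hw𝒟⟩
    rw [← h2] at hw
    obtain ⟨m, rfl⟩ := exists_eq_mul_of_isDirectionField hp hw hw𝒟 hT
    exact ⟨m, rfl, D.isCobounding_two_iff.1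
      (D.isCobounding_of_isDirectionField two_pos hp hw hw𝒟 hT)⟩
  · rintro ⟨m, rfl, hm⟩
    obtain ⟨𝒟, w, hI, hT, hw, hw𝒟⟩ :=
      (D.isCobounding_two_iff.2 hm).exists_verticalEngel hp rfl hn
    rw [h2] at hw
    exact ⟨_, 𝒟, w, rfl, hI, hT, hw, hw𝒟⟩

end OrientedCircleBundle

end

theorem theorem1p2
    {M : Type*} [TopologicalSpace M] [ChartedSpace (EuclideanSpace ℝ (Fin 3)) M]
    [IsManifold (𝓡 3) ∞ M] [T2Space M] [CompactSpace M] [Nonempty M]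
    {Q : Type*} [TopologicalSpace Q] [ChartedSpace (EuclideanSpace ℝ (Fin 4)) Q]
    [IsManifold (𝓡 4) ∞ Q] [T2Space Q]
    (B : OrientedCircleBundle Q M) (ξ : OrientedContactStructure M) (n : ℤ) (hn : n ≠ 0) :
    ((B.EngSet ξ n).Nonempty ↔ n • B.eulerClass = (2 : ℤ) • ξ.eulerClass) ∧
    ((B.EngOrSet ξ n).Nonempty ↔ ∃ m : ℤ, n = 2 * m ∧ m • B.eulerClass = ξ.eulerClass) ∧
    ((B.EngSet ξ n).Nonempty →
      ∃ _act : AddAction (CechH M 1) (B.EngSet ξ n),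
        (∀ x y : B.EngSet ξ n, ∃! α : CechH M 1, α +ᵥ x = y) ∧
        (∀ (J : ξ.ComplexStructure) (f : C(M, UnitAddCircle)) (𝒟 𝒟' : B.VerticalEngel)
          (x x' : B.EngSet ξ n), (x : B.Eng) = 𝒟.isotopyClass → (x' : B.Eng) = 𝒟'.isotopyClass →
          𝒟.IsRotationOf J f 𝒟' → circleClass f +ᵥ x = x') ∧
        ((B.EngOrSet ξ n).Nonempty →
          (∀ (β : CechH M 1) (x : B.EngSet ξ n), (x : B.Eng) ∈ B.EngOrSet ξ n →
            (((2 : ℤ) • β +ᵥ x : B.EngSet ξ n) : B.Eng) ∈ B.EngOrSet ξ n) ∧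
          ∀ x y : B.EngSet ξ n, (x : B.Eng) ∈ B.EngOrSet ξ n → (y : B.Eng) ∈ B.EngOrSet ξ n →
            ∃! α : CechH M 1, (∃ β : CechH M 1, α = (2 : ℤ) • β) ∧ α +ᵥ x = y)) := by
  refine ⟨OrientedCircleBundle.engSet_nonempty_iff hn,
    OrientedCircleBundle.engOrSet_nonempty_iff hn, fun _ => ?_⟩
  obtain ⟨act, hact⟩ := OrientedCircleBundle.exists_addAction (B := B) (ξ := ξ) (n := n)
  obtain ⟨J⟩ := ξ.nonempty_complexStructure
  have huniq : ∀ x y : B.EngSet ξ n, ∃! α : CechH M 1, α +ᵥ x = y := by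
    rintro ⟨x, 𝒟, rfl, hI, hT⟩ ⟨y, 𝒟', rfl, hI', hT'⟩
    obtain ⟨α, hα⟩ := OrientedCircleBundle.VerticalEngel.exists_isDifferenceClass J hI hI' hT hT'
    exact ⟨α, (hact J α 𝒟 𝒟' _ _ rfl rfl).2 hα, fun β hβ =>
      ((hact J β 𝒟 𝒟' _ _ rfl rfl).1 hβ).unique hα⟩
  refine ⟨act, huniq, fun J f 𝒟 𝒟' x x' hx hx' hf => ?_, fun _ =>
    ⟨fun β x hx => ?_, fun x y hx hy => ?_⟩⟩
  · -- the induced contact structure does not depend on the representative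
    obtain ⟨𝒟₁, h₁, hI₁, -⟩ := x.2
    obtain ⟨𝒟₂, h₂, hI₂, -⟩ := x'.2
    have hI : 𝒟.Induces ξ := (OrientedCircleBundle.VerticalEngel.of_isotopyClass_eq J
      (h₁.trans hx)).1.1 hI₁
    have hI' : 𝒟'.Induces ξ := (OrientedCircleBundle.VerticalEngel.of_isotopyClass_eq J
      (h₂.trans hx')).1.1 hI₂
    exact (hact J _ 𝒟 𝒟' x x' hx hx').2
      (OrientedCircleBundle.VerticalEngel.isDifferenceClass_of_isRotationOf hI hI' hf)
  · obtain ⟨𝒟, w, hc, hI, hT, hw, hw𝒟⟩ := (OrientedCircleBundle.mem_engOrSet_iff J).1 hx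
    obtain ⟨𝒟', w', hI', hT', hw', hw𝒟', hd⟩ :=
      OrientedCircleBundle.VerticalEngel.exists_isDifferenceClass_eq (m := 2)
        OrientedContactStructure.ComplexStructure.exists_two (by norm_num) hI hT hw hw𝒟 β
    have h : (2 : ℤ) • β +ᵥ x = ⟨𝒟'.isotopyClass, 𝒟', rfl, hI', hT'⟩ :=
      (hact J _ 𝒟 𝒟' _ _ hc.symm rfl).2 hd
    rw [h]
    exact (OrientedCircleBundle.mem_engOrSet_iff J).2 ⟨𝒟', w', rfl, hI', hT', hw', hw𝒟'⟩
  · obtain ⟨α, hα, hαu⟩ := huniq x y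
    refine ⟨α, ⟨?_, hα⟩, fun β hβ => hαu β hβ.2⟩
    obtain ⟨𝒟, w, hc, hI, hT, hw, hw𝒟⟩ := (OrientedCircleBundle.mem_engOrSet_iff J).1 hx
    obtain ⟨𝒟', w', hc', hI', hT', hw', hw𝒟'⟩ := (OrientedCircleBundle.mem_engOrSet_iff J).1 hy
    exact ((hact J α 𝒟 𝒟' _ _ hc.symm hc'.symm).1 hα).exists_two_smul hI hI' hw hw' hw𝒟 hw𝒟'
      hT hT'
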